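/- **Model.** An asset of value $v\sim N(p_0,\sigma_v^2)$ is traded at times $1,1_+,2$ (with $1<1_+<2$) by competitive dealers, one informed trader (IT), one high-frequency trader (HFT) with inventory aversion $\gamma\in[0,\infty]$, and noise traders with orders $u_1\sim N(0,\sigma_1^2)$, $u_{1_+}\sim N(0,\sigma_{1_+}^2)$, $u_2\sim N(0,\sigma_2^2)$, where $\sigma_v,\sigma_1,\sigma_{1_+},\sigma_2>0$. IT knows $v$ and submits orders $i_1$ (executed at time 1) and $i_2$ (executed at time 2). The HFT observes the signal $\tilde i_1=i_1+\varepsilon$, $\varepsilon\sim N(0,\sigma_\varepsilon^2)$, $\sigma_\varepsilon\ge 0$, and submits $x_1$ (time $1_+$) and $x_2$ (time 2). The order flows are $y_1=i_1+u_1$, $y_{1_+}=x_1+u_{1_+}$, $y_2=i_2+x_2+u_2$. Consider linear strategies $$p_1=p_0+\lambda_1y_1,\quad p_{1_+}=p_1+\lambda_{1_+}y_{1_+},\quad p_2=p_1+\lambda_{21}y_{1_+}+\lambda_{22}y_2,$$ $$i_1=\alpha_1(v-p_0)+z,\quad i_2=\alpha_{21}(v-E(v|y_1))+\alpha_{22}(i_1-E(i_1|y_1)),$$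 $$x_1=\beta_1(\tilde i_1-E(\tilde i_1|y_1)),\quad x_2=\beta_{21}(\tilde i_1-E(\tilde i_1|y_1))+\beta_{22}u_{1_+}+\beta_{23}x_1,$$ with $z\sim N(0,\sigma_z^2)$ and $v,u_1,u_{1_+},u_2,\varepsilon,z$ independent. Here $E(v|y_1)=p_1$ and $E(i_1|y_1)=E(\tilde i_1|y_1)=\delta y_1$ are the linear functions of $y_1$ given by the equilibrium laws; they and all reactions are kept fixed when a trader deviates. A *linear equilibrium* consists of such strategies for which 1. $p_1=E(v|y_1)$, $p_{1_+}=E(v|y_1,y_{1_+})$, $p_2=E(v|y_1,y_{1_+},y_2)$; 2. after every first order $i_1$ of IT, $i_2$ is the unique maximizer of $E((v-p_2)i_2\mid v,i_1,y_1)$; and either (mixed strategy) $\sigma_z>0$ and $E(i_1(v-p_1)+(v-p_2)i_2\mid v)$ is the same for all pure first orders $i_1=i_1(v)$, or (pure strategy) $\sigma_z=0$ and $i_1$ is the unique maximizer of this expectation among all $i_1=i_1(v)$, where $i_2$ follows IT's strategy; 3. after every first order $x_1=x_1(\tilde i_1,y_1)$ of the HFT, $x_2$ is the unique maximizer of $E((v-p_2)x_2-\gamma(x_1+x_2)^2\mid\tilde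 i_1,y_1,y_{1_+})$; and $x_1$ is the unique maximizer of $E((v-p_{1_+})x_1+(v-p_2)x_2-\gamma(x_1+x_2)^2\mid\tilde i_1,y_1)$, where $x_2$ follows the HFT's strategy. If $\gamma=\infty$, the penalty is $0$ when $x_1+x_2=0$ almost surely, and all other orders are infeasible. All orders are square-integrable measurable functions of the information on which they may depend, and maximizers are unique up to null sets. The HFT's trading directions relative to IT are the coefficients of $i_1-E(i_1|y_1)$ in her orders: $d_1=\beta_1$ in $x_1$ and $d_2=\beta_{21}+\beta_{23}\beta_1$ in $x_2$. She is a *Small-IT* if $d_1>0$ and $d_2>0$, and a *Round-Tripper* if $d_1>0$ and $d_2<0$. Put $$\theta_{1_+}=\frac{\sigma_{1_+}^2}{\sigma_1^2},\quad\theta_2=\frac{\sigma_2^2}{\sigma_1^2},\quad\theta_\varepsilon=\frac{\sigma_\varepsilon^2}{\sigma_1^2},\quad\Gamma=\frac{\gamma}{\sigma_v/\sigma_1}\in[0,\infty].$$ **Theorem.** For any $\theta_{1_+},\theta_2>0$ and $\theta_\varepsilon\ge0$ there is a critical value $\bar\Gamma\in(0,\infty)$, depending only on $(\theta_{1_+},\theta_2,\theta_\varepsilon)$,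 such that in every linear equilibrium (mixed or pure) of every market with these parameters: if $\Gamma\in[0,\bar\Gamma)$, the HFT is a Small-IT; if $\Gamma\in(\bar\Gamma,\infty]$, she is a Round-Tripper; and in the borderline case $\Gamma=\bar\Gamma$, $d_1>0$ and $d_2\le0$. -/

import Mathlib

open MeasureTheory ProbabilityTheory
open scoped ENNReal NNReal

namespace AnticipatoryTrading

/-- Exogenous parameters of the market with one informed trader (IT) and one high-frequency
trader (HFT). The suffix `1p` refers to the trading time `1₊`, strictly between times `1` and `2`.
The inventory aversion `γ` may be infinite. -/
structure Market where
  p0 : ℝ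
  σv : ℝ
  σ1 : ℝ
  σ1p : ℝ
  σ2 : ℝ
  σε : ℝ
  γ : ℝ≥0∞
  σv_pos : 0 < σv
  σ1_pos : 0 < σ1
  σ1p_pos : 0 < σ1p
  σ2_pos : 0 < σ2
  σε_nonneg : 0 ≤ σε

namespace Market

/-- Relative size of the time-`1₊` market. -/
noncomputable def θ1p (M : Market) : ℝ := M.σ1p ^ 2 / M.σ1 ^ 2

/-- Relative size of the time-`2` market. -/
noncomputable def θ2 (M : Market) : ℝ := M.σ2 ^ 2 / M.σ1 ^ 2

/-- Relative size of the signal noise. -/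
noncomputable def θε (M : Market) : ℝ := M.σε ^ 2 / M.σ1 ^ 2

/-- Dimensionless inventory aversion `γ / (σv / σ1)`, with `Γ = ∞` exactly when `γ = ∞`. -/
noncomputable def Γ (M : Market) : ℝ≥0∞ := M.γ / ENNReal.ofReal (M.σv / M.σ1)

end Market

/-- The primitive random variables: asset value `v`, noise orders `u1`, `u1p`, `u2`, noise `ε` in
the HFT's signal, and the endogenous noise `z` by which IT may randomise. -/
structure Shocks (Ω : Type*) where
  v : Ω → ℝ
  u1 : Ω → ℝ
  u1p : Ω → ℝ
  u2 : Ω → ℝ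
  ε : Ω → ℝ
  z : Ω → ℝ

/-- The primitive random variables are independent and have the prescribed normal laws
(`σz` is the standard deviation of IT's randomisation). -/
structure Shocks.IsModel {Ω : Type*} [MeasurableSpace Ω] (S : Shocks Ω) (M : Market) (σz : ℝ)
    (P : Measure Ω) : Prop where
  measurable_v : Measurable S.v
  measurable_u1 : Measurable S.u1
  measurable_u1p : Measurable S.u1p
  measurable_u2 : Measurable S.u2
  measurable_ε : Measurable S.ε
  measurable_z : Measurable S.z
  law_v : P.map S.v = gaussianReal M.p0 (M.σv ^ 2).toNNReal
  law_u1 : P.map S.u1 = gaussianReal 0 (M.σ1 ^ 2).toNNReal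
  law_u1p : P.map S.u1p = gaussianReal 0 (M.σ1p ^ 2).toNNReal
  law_u2 : P.map S.u2 = gaussianReal 0 (M.σ2 ^ 2).toNNReal
  law_ε : P.map S.ε = gaussianReal 0 (M.σε ^ 2).toNNReal
  law_z : P.map S.z = gaussianReal 0 (σz ^ 2).toNNReal
  indep : iIndepFun ![S.v, S.u1, S.u1p, S.u2, S.ε, S.z] P

/-- A strategy profile.
* `p1 y1`, `p1p y1 y1p`, `p2 y1 y1p y2`: dealers' quotes as functions of the order flows;
* `i1 v z`: IT's first order, as a function of the value and of her randomisation;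
* `i2 v i1 y1`: IT's second order;
* `x1 s y1`: HFT's first order, as a function of her signal `s` and of `y1`;
* `x2 s y1 y1p x1`: HFT's second order, which may also react to her own first order `x1`. -/
structure Profile where
  p1 : ℝ → ℝ
  p1p : ℝ → ℝ → ℝ
  p2 : ℝ → ℝ → ℝ → ℝ
  i1 : ℝ → ℝ → ℝ
  i2 : ℝ → ℝ → ℝ → ℝ
  x1 : ℝ → ℝ → ℝ
  x2 : ℝ → ℝ → ℝ → ℝ → ℝ

/-- The orders actually submitted by IT and by the HFT. -/
structure Orders (Ω : Type*) where
  i1 : Ω → ℝ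
  i2 : Ω → ℝ
  x1 : Ω → ℝ
  x2 : Ω → ℝ

section Flows

variable {Ω : Type*} (S : Shocks Ω) (o : Orders Ω)

/-- Order flow at time `1`. -/
def flow1 : Ω → ℝ := fun ω => o.i1 ω + S.u1 ω

/-- The HFT's signal about IT's first order. -/
def signal : Ω → ℝ := fun ω => o.i1 ω + S.ε ω

/-- Order flow at time `1₊`. -/
def flow1p : Ω → ℝ := fun ω => o.x1 ω + S.u1p ω

/-- Order flow at time `2`. -/
def flow2 : Ω → ℝ := fun ω => o.i2 ω + o.x2 ω + S.u2 ω

variable (p : Profile)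

/-- Transaction price at time `1`. -/
def price1 : Ω → ℝ := fun ω => p.p1 (flow1 S o ω)

/-- Transaction price at time `1₊`. -/
def price1p : Ω → ℝ := fun ω => p.p1p (flow1 S o ω) (flow1p S o ω)

/-- Transaction price at time `2`. -/
def price2 : Ω → ℝ := fun ω => p.p2 (flow1 S o ω) (flow1p S o ω) (flow2 S o ω)

/-- IT's profit from her first order. -/
def itProfit1 : Ω → ℝ := fun ω => o.i1 ω * (S.v ω - price1 S o p ω)

/-- IT's profit from her second order. -/
def itProfit2 : Ω → ℝ := fun ω => (S.v ω - price2 S o p ω) * o.i2 ω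

/-- HFT's profit from her first order. -/
def hftProfit1 : Ω → ℝ := fun ω => (S.v ω - price1p S o p ω) * o.x1 ω

/-- HFT's profit from her second order. -/
def hftProfit2 : Ω → ℝ := fun ω => (S.v ω - price2 S o p ω) * o.x2 ω

/-- HFT's inventory penalty for finite `γ`. For `γ = ∞` this expression is `0`; the penalty then
acts through the constraint `InventoryFeasible`. -/
noncomputable def penalty (M : Market) : Ω → ℝ :=
  fun ω => M.γ.toReal * (o.x1 ω + o.x2 ω) ^ 2

/-- With infinite inventory aversion any terminal inventory is infinitely penalised, so the HFT
has to close her position; with finite aversion there is no constraint. -/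
def InventoryFeasible [MeasurableSpace Ω] (M : Market) (P : Measure Ω) : Prop :=
  M.γ = ∞ → ∀ᵐ ω ∂P, o.x1 ω + o.x2 ω = 0

end Flows

namespace Profile

variable {Ω : Type*} (p : Profile) (S : Shocks Ω)

/-- Orders that result when IT submits `i1` at time `1` and everything else follows the profile. -/
def ordersIT (i1 : Ω → ℝ) : Orders Ω :=
  let y1 : Ω → ℝ := fun ω => i1 ω + S.u1 ω
  let s : Ω → ℝ := fun ω => i1 ω + S.ε ω
  let x1 : Ω → ℝ := fun ω => p.x1 (s ω) (y1 ω)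
  { i1 := i1
    i2 := fun ω => p.i2 (S.v ω) (i1 ω) (y1 ω)
    x1 := x1
    x2 := fun ω => p.x2 (s ω) (y1 ω) (x1 ω + S.u1p ω) (x1 ω) }

/-- Orders on the path of play. -/
def path : Orders Ω := p.ordersIT S (fun ω => p.i1 (S.v ω) (S.z ω))

/-- Orders that result when the HFT submits `x1` at time `1₊` and everything else, including her
second order, follows the profile. -/
def ordersHFT (x1 : Ω → ℝ) : Orders Ω :=
  { p.path S with
    x1 := x1
    x2 := fun ω => p.x2 (signal S (p.path S) ω) (flow1 S (p.path S) ω) (x1 ω + S.u1p ω) (x1 ω) }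

end Profile

/-- The σ-algebra generated by a random element. -/
abbrev info {Ω E : Type*} [MeasurableSpace E] (X : Ω → E) : MeasurableSpace Ω :=
  MeasurableSpace.comap X inferInstance

/-- An order is admissible for the information `m` if it is a square-integrable measurable function
of that information (all payoffs are quadratic in the orders). -/
def Admissible {Ω : Type*} (m : MeasurableSpace Ω) [MeasurableSpace Ω] (P : Measure Ω)
    (a : Ω → ℝ) : Prop :=
  Measurable[m] a ∧ MemLp a 2 P

/-- `a = arg max E(payoff | m)`: among all orders that are admissible for the information `m` and
satisfy `feasible`, the order `a` is the (almost surely unique) maximiser of the conditional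
expectation of the payoff. -/
def IsArgmax {Ω : Type*} (m : MeasurableSpace Ω) [MeasurableSpace Ω] (P : Measure Ω)
    (feasible : (Ω → ℝ) → Prop) (payoff : (Ω → ℝ) → Ω → ℝ) (a : Ω → ℝ) : Prop :=
  Admissible m P a ∧ feasible a ∧
    ∀ b : Ω → ℝ, Admissible m P b → feasible b →
      P[payoff b | m] ≤ᵐ[P] P[payoff a | m] ∧
        (P[payoff b | m] =ᵐ[P] P[payoff a | m] → b =ᵐ[P] a)

section Equilibrium

variable {Ω : Type*} [MeasurableSpace Ω] (p : Profile) (S : Shocks Ω) (M : Market)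
  (P : Measure Ω)

/-- Weak efficiency: dealers' quotes are the conditional expectations of the value. -/
def EfficientQuotes : Prop :=
  price1 S (p.path S) p =ᵐ[P] P[S.v | info (flow1 S (p.path S))] ∧
  price1p S (p.path S) p =ᵐ[P]
    P[S.v | info (fun ω => (flow1 S (p.path S) ω, flow1p S (p.path S) ω))] ∧
  price2 S (p.path S) p =ᵐ[P]
    P[S.v | info (fun ω =>
      (flow1 S (p.path S) ω, flow1p S (p.path S) ω, flow2 S (p.path S) ω))]

/-- IT's second order is optimal given `(v, i1, y1)`, whatever first order `i1` she submitted. -/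
def ITOptimal2 : Prop :=
  ∀ i1 : Ω → ℝ, Admissible (info (fun ω => (S.v ω, S.z ω))) P i1 →
    IsArgmax (info (fun ω => (S.v ω, i1 ω, flow1 S (p.ordersIT S i1) ω))) P
      (fun _ => True)
      (fun i2 => itProfit2 S { p.ordersIT S i1 with i2 := i2 } p)
      (p.ordersIT S i1).i2

/-- IT's total profit when she submits `i1` first and continues with her second-order strategy. -/
def itTotal (i1 : Ω → ℝ) : Ω → ℝ :=
  fun ω => itProfit1 S (p.ordersIT S i1) p ω + itProfit2 S (p.ordersIT S i1) p ω

/-- Mixed strategy: IT is indifferent between all pure first orders `i1 = i1(v)`. -/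
def ITIndifferent1 : Prop :=
  ∀ a b : Ω → ℝ, Admissible (info S.v) P a → Admissible (info S.v) P b →
    P[itTotal p S a | info S.v] =ᵐ[P] P[itTotal p S b | info S.v]

/-- Pure strategy: IT's first order (in which her randomisation is switched off) is optimal
among all `i1 = i1(v)`. -/
def ITOptimal1 : Prop :=
  IsArgmax (info S.v) P (fun _ => True) (itTotal p S) (fun ω => p.i1 (S.v ω) 0)

/-- HFT's second order is optimal given her signal, `y1` and `y1p`, whatever first order `x1` she
submitted. -/
def HFTOptimal2 : Prop :=
  ∀ x1 : Ω → ℝ,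
    Admissible (info (fun ω => (signal S (p.path S) ω, flow1 S (p.path S) ω))) P x1 →
    IsArgmax
      (info (fun ω => (signal S (p.path S) ω, flow1 S (p.path S) ω, x1 ω + S.u1p ω))) P
      (fun x2 => InventoryFeasible { p.ordersHFT S x1 with x2 := x2 } M P)
      (fun x2 ω =>
        hftProfit2 S { p.ordersHFT S x1 with x2 := x2 } p ω
          - penalty { p.ordersHFT S x1 with x2 := x2 } M ω)
      (p.ordersHFT S x1).x2

/-- HFT's first order is optimal given her signal and `y1`, when she continues with her
second-order strategy. -/
def HFTOptimal1 : Prop :=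
  IsArgmax (info (fun ω => (signal S (p.path S) ω, flow1 S (p.path S) ω))) P
    (fun x1 => InventoryFeasible (p.ordersHFT S x1) M P)
    (fun x1 ω =>
      hftProfit1 S (p.ordersHFT S x1) p ω + hftProfit2 S (p.ordersHFT S x1) p ω
        - penalty (p.ordersHFT S x1) M ω)
    (p.path S).x1

/-- The conditions common to mixed- and pure-strategy equilibria. -/
structure IsEquilibriumCore : Prop where
  quotes : EfficientQuotes p S P
  it2 : ITOptimal2 p S P
  hft2 : HFTOptimal2 p S M P
  hft1 : HFTOptimal1 p S M P

/-- Mixed-strategy equilibrium; `σz` is the standard deviation of IT's randomisation. -/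
def IsMixedEquilibrium (σz : ℝ) : Prop :=
  0 < σz ∧ IsEquilibriumCore p S M P ∧ ITIndifferent1 p S P

/-- Pure-strategy equilibrium: no randomisation, and the first order is optimal. -/
def IsPureEquilibrium (σz : ℝ) : Prop :=
  σz = 0 ∧ IsEquilibriumCore p S M P ∧ ITOptimal1 p S P

end Equilibrium

/-- Coefficients of a linear strategy profile. `δ` is the slope of `E(i1 | y1) = δ * y1` and `σz`
the standard deviation of IT's randomisation. -/
structure Coeffs where
  l1 : ℝ
  l1p : ℝ
  l21 : ℝ
  l22 : ℝ
  α1 : ℝ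
  α21 : ℝ
  α22 : ℝ
  σz : ℝ
  δ : ℝ
  β1 : ℝ
  β21 : ℝ
  β22 : ℝ
  β23 : ℝ

namespace Coeffs

/-- The linear profile with the given coefficients. In it `E(v | y1)` is the time-`1` quote
`p0 + l1 * y1`, and `E(i1 | y1)` and `E(s | y1)` are both `δ * y1`. The quantity `y1p - x1` is the
part of the time-`1₊` order flow that does not come from the HFT. -/
def profile (c : Coeffs) (M : Market) : Profile where
  p1 y1 := M.p0 + c.l1 * y1
  p1p y1 y1p := M.p0 + c.l1 * y1 + c.l1p * y1p
  p2 y1 y1p y2 := M.p0 + c.l1 * y1 + c.l21 * y1p + c.l22 * y2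
  i1 v z := c.α1 * (v - M.p0) + z
  i2 v i1 y1 := c.α21 * (v - (M.p0 + c.l1 * y1)) + c.α22 * (i1 - c.δ * y1)
  x1 s y1 := c.β1 * (s - c.δ * y1)
  x2 s y1 y1p x1 := c.β21 * (s - c.δ * y1) + c.β22 * (y1p - x1) + c.β23 * x1

/-- The coefficients form a linear equilibrium (mixed or pure) of the market `M`, the primitive
random variables being `S` under the probability measure `P`. -/
structure IsLinearEquilibrium {Ω : Type*} [MeasurableSpace Ω] (c : Coeffs) (M : Market)
    (S : Shocks Ω) (P : Measure Ω) : Prop where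
  model : S.IsModel M c.σz P
  slope : (fun ω => c.δ * flow1 S ((c.profile M).path S) ω) =ᵐ[P]
    P[((c.profile M).path S).i1 | info (flow1 S ((c.profile M).path S))]
  equilibrium : IsMixedEquilibrium (c.profile M) S M P c.σz ∨
    IsPureEquilibrium (c.profile M) S M P c.σz

/-- Trading direction of the HFT's first order: the coefficient of `i1 - E(i1 | y1)` in it. -/
def direction1 (c : Coeffs) : ℝ := c.β1

/-- Trading direction of the HFT's second order: the coefficient of `i1 - E(i1 | y1)` in it, on
the path of play. -/
def direction2 (c : Coeffs) : ℝ := c.β21 + c.β23 * c.β1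

/-- The HFT trades in the same direction as IT in both rounds. -/
def IsSmallIT (c : Coeffs) : Prop := 0 < c.direction1 ∧ 0 < c.direction2

/-- The HFT trades first in the same direction as IT and then in the opposite direction. -/
def IsRoundTripper (c : Coeffs) : Prop := 0 < c.direction1 ∧ c.direction2 < 0

end Coeffs

end AnticipatoryTrading

namespace AnticipatoryTrading

/-- A reduced equilibrium state: `x`, `η` and `C` describe the HFT's trades, `ψ` her signal
quality, and `ϑ` is the reciprocal of the discount factor `T`. -/
structure Cell (x η C ψ ϑ : ℝ) : Prop where
  x_pos : 0 < x
  η_pos : 0 < η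
  C_gt : 1 < C
  C_lt : C < 2
  ψ_ge : 1 / 2 ≤ ψ
  ψ_le : ψ ≤ 1
  eqX : 2 * (1 - x) * ϑ = (1 + x) * (1 + C * (2 - C) * (x / η - x) - (1 - η) * (C - 1))
  eqN : ψ * (ϑ - 1) = x * C / 2 + (1 - η) * (C - 1) / 2

/-- The relation between two values of `C` used to compare states: `n ^ 2 = C₂ / C₁` and `ρ` is the
ratio of inventory aversions, both replaced by `1` if `C₂ ≤ C₁`. -/
structure Ratio (C₁ C₂ n ρ : ℝ) : Prop where
  n_ge : 1 ≤ n
  n_sq : n ^ 2 ≤ 2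
  le_C : C₂ ≤ n ^ 2 * C₁
  q_le : C₁ * (2 - C₁) * n ^ 4 ≤ C₂ * (2 - C₂) * ρ
  pow_le : n ^ 6 ≤ ρ
  gain : 19 / 10 * C₂ * n * (n ^ 2 - 1) ≤ C₂ * (2 - C₂) * (ρ - n ^ 3)

theorem Ratio.of_ge {C₁ C₂ : ℝ} (h1 : 1 < C₂) (h2 : C₂ ≤ C₁) :
    Ratio C₁ C₂ 1 1 where
  n_ge := le_rfl
  n_sq := by norm_num
  le_C := by linarith
  q_le := by nlinarith
  pow_le := by norm_num
  gain := by norm_num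

theorem Ratio.of_le {C₁ C₂ n ρ : ℝ} (h1 : 1 < C₁) (h2 : C₁ ≤ C₂) (h3 : C₂ < 2) (hn : 0 ≤ n)
    (hn2 : n ^ 2 * C₁ = C₂)
    (hρ : ρ * ((2 - C₂) * (C₁ - 1)) = (2 - C₁) * (C₂ - 1)) :
    Ratio C₁ C₂ n ρ := by
  have hn1 : 1 ≤ n ^ 2 := by
    by_contra h
    nlinarith
  have hn1' : 1 ≤ n := by nlinarith
  have hz : 0 < C₁ - 1 := by linarith
  have hw : 0 < 2 - C₂ := by linarith
  have hd : 0 < (2 - C₂) * (C₁ - 1) := by positivity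
  have hρ' : ρ = (2 - C₁) * (C₂ - 1) / ((2 - C₂) * (C₁ - 1)) := by
    rw [eq_div_iff hd.ne', hρ]
  have e1 : C₂ * (2 - C₂) * ρ * (C₁ - 1) = C₂ * (2 - C₁) * (C₂ - 1) := by
    calc _ = C₂ * (ρ * ((2 - C₂) * (C₁ - 1))) := by ring
      _ = _ := by rw [hρ]; ring
  refine ⟨hn1', ?_, hn2.ge, ?_, ?_, ?_⟩
  · nlinarith
  · refine le_of_mul_le_mul_right ?_ hz
    rw [e1]
    have : n ^ 2 * (C₁ - 1) ≤ C₂ - 1 := by nlinarith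
    calc C₁ * (2 - C₁) * n ^ 4 * (C₁ - 1) = (n ^ 2 * C₁) * (2 - C₁) * (n ^ 2 * (C₁ - 1)) := by ring
      _ ≤ C₂ * (2 - C₁) * (C₂ - 1) := by
        rw [hn2]
        refine mul_le_mul_of_nonneg_left this (mul_nonneg (by linarith) (by linarith))
  · refine le_of_mul_le_mul_right ?_ hd
    rw [hρ]
    have a1 : n ^ 2 * (2 - C₂) ≤ 2 - C₁ := by
      refine le_of_mul_le_mul_right ?_ (show 0 < C₁ by linarith)
      calc n ^ 2 * (2 - C₂) * C₁ = (n ^ 2 * C₁) * (2 - C₂) := by ring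
        _ = C₂ * (2 - C₂) := by rw [hn2]
        _ ≤ (2 - C₁) * C₁ := by nlinarith
    have a2 : n ^ 4 * (C₁ - 1) ≤ C₂ - 1 := by
      have : C₁ ^ 2 * (n ^ 4 * (C₁ - 1)) = C₂ ^ 2 * (C₁ - 1) := by rw [← hn2]; ring
      refine le_of_mul_le_mul_left ?_ (show 0 < C₁ ^ 2 by positivity)
      rw [this]
      nlinarith [mul_nonneg (sub_nonneg.2 h2) (show 0 ≤ C₁ + C₂ - C₁ * C₂ by nlinarith)]
    calc n ^ 6 * ((2 - C₂) * (C₁ - 1)) = (n ^ 2 * (2 - C₂)) * (n ^ 4 * (C₁ - 1)) := by ring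
      _ ≤ _ := mul_le_mul a1 a2 (by positivity) (by linarith)
  · have hgain : 19 / 20 * (n ^ 2 + 1) * (n ^ 2 - 1) ≤ (2 - C₂) * (ρ - n ^ 2 * (n ^ 2 + 1) / 2) := by
      refine le_of_mul_le_mul_right ?_ hz
      have e2 : (2 - C₂) * (ρ - n ^ 2 * (n ^ 2 + 1) / 2) * (C₁ - 1)
          = (2 - C₁) * (C₂ - 1) - n ^ 2 * (n ^ 2 + 1) / 2 * (2 - C₂) * (C₁ - 1) := by
        linear_combination hρ
      rw [e2, ← hn2]
      obtain ⟨d, hd⟩ : ∃ d, d = n ^ 2 - 1 := ⟨_, rfl⟩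
      obtain ⟨w, hw⟩ : ∃ w, w = C₁ - 1 := ⟨_, rfl⟩
      have hd0 : 0 ≤ d := by linarith
      have hw0 : 0 ≤ w := by linarith
      rw [show n ^ 2 = 1 + d by linarith, show C₁ = 1 + w by linarith]
      have h1 : 0 ≤ 1 - 12 / 5 * w + 3 / 2 * w ^ 2 := by nlinarith [sq_nonneg (w - 4 / 5)]
      have h2 : 0 ≤ d * (1 - 12 / 5 * w + 3 / 2 * w ^ 2 + d * (w / 20 + 2 * w ^ 2)
          + d ^ 2 * w * (1 + w) / 2) := by positivity
      linarith
    have hnn : n ≤ (n ^ 2 + 1) / 2 := by linarith [sq_nonneg (n - 1)]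
    have hw0 : 0 ≤ 2 - C₂ := hw.le
    have hC2 : 0 ≤ C₂ := by linarith
    have h3 : n ^ 3 ≤ n ^ 2 * (n ^ 2 + 1) / 2 := by
      have := mul_le_mul_of_nonneg_left hnn (sq_nonneg n)
      linarith
    have h4 : 19 / 10 * n * (n ^ 2 - 1) ≤ 19 / 20 * (n ^ 2 + 1) * (n ^ 2 - 1) :=
      mul_le_mul_of_nonneg_right (by linarith) (by linarith)
    have h5 := mul_le_mul_of_nonneg_left h3 hw0
    have h6 : 19 / 10 * n * (n ^ 2 - 1) ≤ (2 - C₂) * (ρ - n ^ 3) := by linarith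
    have := mul_le_mul_of_nonneg_left h6 hC2
    linarith

end AnticipatoryTrading

namespace AnticipatoryTrading

set_option maxHeartbeats 1000000 in
theorem Cell.core_left {x₁ η₁ C₁ ψ₁ ϑ₁ x₂ C₂ c n ρ p κ : ℝ} (h₁ : Cell x₁ η₁ C₁ ψ₁ ϑ₁)
    (hC₂ : 1 < C₂) (hC₂' : C₂ < 2) (hR : Ratio C₁ C₂ n ρ) (hη : η₁ ≤ 1) (hx : x₁ < x₂)
    (hx₂ : x₂ < 1)
    (hc : 0 ≤ c) (hcC : c ≤ C₂) (hp : 1 ≤ p) (hϑ : c * x₁ ≤ p * n ^ 3 * (ϑ₁ - 1))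
    (hκ' : C₂ * (2 - C₂) * (1 + κ) * (x₂ - x₁) * (1 + x₁)
      ≤ 2 * (1 - x₁) * (1 + c * x₁ / p) - (1 + x₁)) :
    n ^ 3 * (x₂ + κ * (x₂ - x₁)) ≤ ρ * (x₁ / η₁) := by
  obtain ⟨hx0, hη0, hC1, hC1', -, -, hX, -⟩ := h₁
  obtain ⟨hn, hn2, -, hq, hρ, hg⟩ := hR
  by_contra! hlt
  set X := x₁ / η₁ with hXdef
  have hxX : x₁ ≤ X := by rw [hXdef, le_div_iff₀ hη0]; nlinarith
  have hn2' : 1 ≤ n ^ 2 := one_le_pow₀ hn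
  have hn4' : 1 ≤ n ^ 4 := one_le_pow₀ hn
  have hn3' : 0 < n ^ 3 := by positivity
  have hρ0 : 0 < ρ := lt_of_lt_of_le (by positivity) hρ
  have hp0 : 0 < p := by linarith
  have hq1 : 0 < C₁ * (2 - C₁) := mul_pos (by linarith) (by linarith)
  have hq2 : 0 < C₂ * (2 - C₂) := mul_pos (by linarith) (by linarith)
  set q₁ := C₁ * (2 - C₁)
  set q₂ := C₂ * (2 - C₂)
  set V := n ^ 3 * (x₂ + κ * (x₂ - x₁)) - ρ * x₁ with hV
  have hV0 : 0 < V := by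
    have := mul_le_mul_of_nonneg_left hxX hρ0.le
    linarith
  have hF : 2 * (1 - x₁) * ϑ₁ - (1 + x₁) ≤ (1 + x₁) * (q₁ * (X - x₁)) := by
    have : 0 ≤ (1 + x₁) * ((1 - η₁) * (C₁ - 1)) :=
      mul_nonneg (by linarith) (mul_nonneg (by linarith) (by linarith))
    linarith
  have h1 : ρ * (q₁ * (X - x₁)) < q₁ * V := by
    have : q₁ * (ρ * X) < q₁ * (n ^ 3 * (x₂ + κ * (x₂ - x₁))) := mul_lt_mul_of_pos_left hlt hq1
    rw [hV]; linarith
  have h2 : q₁ * V * n ^ 4 ≤ q₂ * ρ * V := by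
    have := mul_le_mul_of_nonneg_right hq hV0.le
    linarith
  have h3 : n ^ 4 * (q₁ * (X - x₁)) < q₂ * V := by
    refine lt_of_mul_lt_mul_left (a := ρ) ?_ hρ0.le
    have := mul_lt_mul_of_pos_right h1 (show 0 < n ^ 4 by positivity)
    linarith
  have h4 : n ^ 4 * (2 * (1 - x₁) * ϑ₁ - (1 + x₁)) < (1 + x₁) * (q₂ * V) := by
    have a := mul_le_mul_of_nonneg_left hF (show 0 ≤ n ^ 4 by positivity)
    have b := mul_lt_mul_of_pos_left h3 (show 0 < 1 + x₁ by linarith)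
    linarith
  set D := c * x₁ / p with hD
  have hD0 : 0 ≤ D := by positivity
  have hDp : D ≤ c * x₁ := div_le_self (by positivity) hp
  have hϑ' : D ≤ n ^ 3 * (ϑ₁ - 1) := by
    rw [hD, div_le_iff₀ hp0]; linarith
  have hx1 : x₁ < 1 := by linarith
  have hnV : q₂ * V = n ^ 3 * (q₂ * (1 + κ) * (x₂ - x₁)) - q₂ * (ρ - n ^ 3) * x₁ := by
    rw [hV]; ring
  have hgx := mul_le_mul_of_nonneg_right hg hx0.le
  have h5 : (1 + x₁) * (q₂ * V) ≤ n ^ 3 * (2 * (1 - x₁) * (1 + D) - (1 + x₁))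
      - (1 + x₁) * (19 / 10 * C₂ * n * (n ^ 2 - 1) * x₁) := by
    have a := mul_le_mul_of_nonneg_left hκ' (show 0 ≤ n ^ 3 by positivity)
    have b := mul_le_mul_of_nonneg_left hgx (show 0 ≤ 1 + x₁ by linarith)
    rw [hnV]
    linarith
  have hE : n * (2 * (1 - x₁) * (n ^ 3 + D) - n ^ 3 * (1 + x₁))
      ≤ n ^ 4 * (2 * (1 - x₁) * ϑ₁ - (1 + x₁)) := by
    have := mul_le_mul_of_nonneg_left hϑ' (show 0 ≤ n * (2 * (1 - x₁)) from
      mul_nonneg (by linarith) (by linarith))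
    linarith
  have h6 : n * ((n - 1) * (n ^ 2 * (1 - 3 * x₁)
      - (n + 1) * (2 * (1 - x₁) * D - 19 / 10 * (1 + x₁) * C₂ * x₁))) < 0 := by
    linarith only [hE, h4, h5]
  refine absurd h6 (not_lt.2 (mul_nonneg (by linarith) (mul_nonneg (by linarith) ?_)))
  have hDC : 2 * (1 - x₁) * D ≤ 2 * (1 - x₁) * (C₂ * x₁) :=
    mul_le_mul_of_nonneg_left (hDp.trans (mul_le_mul_of_nonneg_right hcC hx0.le)) (by linarith)
  have h7 : (n + 1) * (2 * (1 - x₁) * D - 19 / 10 * (1 + x₁) * C₂ * x₁)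
      ≤ (n + 1) * (C₂ * x₁ * (1 / 10 - 39 / 10 * x₁)) :=
    mul_le_mul_of_nonneg_left (by linarith only [hDC]) (by linarith)
  have hn15 : n ≤ 3 / 2 := by nlinarith only [hn, hn2]
  rcases le_total x₁ (1 / 3) with h13 | h13
  · rcases le_total (1 / 39) x₁ with h39 | h39
    · have a1 : (n + 1) * (C₂ * x₁ * (1 / 10 - 39 / 10 * x₁)) ≤ 0 :=
        mul_nonpos_of_nonneg_of_nonpos (by linarith)
          (mul_nonpos_of_nonneg_of_nonpos (by positivity) (by linarith))
      have a2 : 0 ≤ n ^ 2 * (1 - 3 * x₁) := mul_nonneg (by positivity) (by linarith)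
      linarith
    · have a1 : C₂ * x₁ * (1 / 10 - 39 / 10 * x₁) ≤ (2 * (1 / 39)) * (1 / 10) := by
        refine mul_le_mul ?_ (by linarith) (by linarith) (by norm_num)
        exact mul_le_mul hC₂'.le h39 hx0.le (by norm_num)
      have a2 := mul_le_mul_of_nonneg_left a1 (show 0 ≤ n + 1 by linarith)
      have a3 : 1 * (9 / 10) ≤ n ^ 2 * (1 - 3 * x₁) :=
        mul_le_mul hn2' (by linarith) (by norm_num) (by positivity)
      linarith
  · have a0 : 0 ≤ x₁ * (39 / 10 * x₁ - 1 / 10) := mul_nonneg hx0.le (by linarith)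
    have a1 : 3 * x₁ - 1 ≤ x₁ * (39 / 10 * x₁ - 1 / 10) := by
      nlinarith only [sq_nonneg (x₁ - 2 / 5)]
    have a2 : n ^ 2 * (3 * x₁ - 1) ≤ (n + 1) * (x₁ * (39 / 10 * x₁ - 1 / 10)) :=
      mul_le_mul (by nlinarith only [hn, hn15]) a1 (by linarith) (by linarith)
    have a3 : (n + 1) * (x₁ * (39 / 10 * x₁ - 1 / 10)) * 1
        ≤ (n + 1) * (x₁ * (39 / 10 * x₁ - 1 / 10)) * C₂ :=
      mul_le_mul_of_nonneg_left hC₂.le (mul_nonneg (by linarith) a0)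
    linarith

set_option maxHeartbeats 1000000 in
theorem Cell.core_right {x₁ C₁ x₂ η₂ C₂ ψ₂ ϑ₂ c n ρ p κ : ℝ} (h₂ : Cell x₂ η₂ C₂ ψ₂ ϑ₂)
    (hR : Ratio C₁ C₂ n ρ) (hη : 1 ≤ η₂) (hx₁ : 0 < x₁)
    (hx : x₁ < x₂) (hx₂ : x₂ < 1)
    (hcC : n = 1 ∨ n ^ 2 * c ≤ C₂) (hϑ : ϑ₂ - 1 ≤ c * p * n ^ 3 * x₂)
    (hp : 1 ≤ p) (hp' : 2 * p * x₂ * (1 - x₂) ≤ x₁ * (1 + x₂))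
    (hκ : 0 ≤ κ)
    (hκ' : C₂ * (2 - C₂) * (1 + κ) * (x₂ - x₁) * (1 + x₂)
      ≤ (1 + x₂) - 2 * (1 - x₂) * (1 + c * p * x₂)) :
    n ^ 3 * (x₂ + κ * (x₂ - x₁)) * (x₂ / η₂) ≤ ρ * x₁ * x₂ := by
  obtain ⟨hx0, hη0, hC2, hC2', -, -, hX, -⟩ := h₂
  obtain ⟨hn, hn2, -, hq, hρ, hg⟩ := hR
  by_contra! hlt
  set X := x₂ / η₂ with hXdef
  have hX0 : 0 < X := by positivity
  have hxX : X ≤ x₂ := by rw [hXdef, div_le_iff₀ hη0]; nlinarith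
  have hq2 : 0 < C₂ * (2 - C₂) := mul_pos (by linarith) (by linarith)
  set q₂ := C₂ * (2 - C₂)
  set L := x₂ + κ * (x₂ - x₁) with hL
  have hLx : x₂ ≤ L := by
    have := mul_nonneg hκ (sub_nonneg.2 hx.le); linarith
  have hF : (1 + x₂) - 2 * (1 - x₂) * ϑ₂ ≤ (1 + x₂) * (q₂ * (x₂ - X)) := by
    have : 0 ≤ (1 + x₂) * ((η₂ - 1) * (C₂ - 1)) :=
      mul_nonneg (by linarith) (mul_nonneg (by linarith) (by linarith))
    linarith
  have hn3' : 0 < n ^ 3 := by positivity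
  have h1 : n ^ 3 * (x₂ - X) * L < n ^ 3 * L * x₂ - ρ * x₁ * x₂ := by linarith
  have h1' : n ^ 3 * (x₂ - X) * x₂ < n ^ 3 * L * x₂ - ρ * x₁ * x₂ :=
    (mul_le_mul_of_nonneg_left hLx (mul_nonneg (by linarith) (by linarith))).trans_lt h1
  have h2 : n ^ 3 * (x₂ - X) < n ^ 3 * L - ρ * x₁ :=
    lt_of_mul_lt_mul_right (by linarith) hx0.le
  have h3 : q₂ * (n ^ 3 * L - ρ * x₁)
      = n ^ 3 * (q₂ * (1 + κ) * (x₂ - x₁)) - q₂ * (ρ - n ^ 3) * x₁ := by rw [hL]; ring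
  have hgx := mul_le_mul_of_nonneg_right hg hx₁.le
  have h4 : (1 + x₂) * (q₂ * (n ^ 3 * L - ρ * x₁))
      ≤ n ^ 3 * ((1 + x₂) - 2 * (1 - x₂) * (1 + c * p * x₂))
        - (1 + x₂) * (19 / 10 * C₂ * n * (n ^ 2 - 1) * x₁) := by
    have a := mul_le_mul_of_nonneg_left hκ' hn3'.le
    have b := mul_le_mul_of_nonneg_left hgx (show 0 ≤ 1 + x₂ by linarith)
    rw [h3]
    linarith
  have h5 : n ^ 3 * ((1 + x₂) - 2 * (1 - x₂) * ϑ₂) < (1 + x₂) * (q₂ * (n ^ 3 * L - ρ * x₁)) := by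
    have a := mul_le_mul_of_nonneg_left hF hn3'.le
    have b := mul_lt_mul_of_pos_left h2 (show 0 < (1 + x₂) * q₂ by positivity)
    linarith
  have h6 : n ^ 3 * ((1 + x₂) - 2 * (1 - x₂) * (1 + c * p * n ^ 3 * x₂))
      ≤ n ^ 3 * ((1 + x₂) - 2 * (1 - x₂) * ϑ₂) := by
    refine mul_le_mul_of_nonneg_left ?_ hn3'.le
    have := mul_le_mul_of_nonneg_left hϑ (show 0 ≤ 2 * (1 - x₂) by linarith)
    linarith
  have h7 : (1 + x₂) * (19 / 10 * C₂ * n * (n ^ 2 - 1) * x₁)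
      < n ^ 3 * (2 * (1 - x₂) * (c * p * x₂ * (n ^ 3 - 1))) := by
    linarith only [h4, h5, h6]
  have hn3 : 0 ≤ n ^ 3 - 1 := by linarith [one_le_pow₀ (n := 3) hn]
  obtain rfl | hcC := hcC
  · norm_num at h7
  have hpx : 0 ≤ n * (2 * (1 - x₂) * (p * x₂)) :=
    mul_nonneg (by linarith) (mul_nonneg (by linarith) (by positivity))
  have h8 : n ^ 2 * c * (n * (2 * (1 - x₂) * (p * x₂))) * (n ^ 3 - 1)
      ≤ C₂ * (n * (2 * (1 - x₂) * (p * x₂))) * (n ^ 3 - 1) :=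
    mul_le_mul_of_nonneg_right (mul_le_mul_of_nonneg_right hcC hpx) hn3
  have h9 : C₂ * n * (2 * p * x₂ * (1 - x₂)) * (n ^ 3 - 1) ≤ C₂ * n * (x₁ * (1 + x₂)) * (n ^ 3 - 1) :=
    mul_le_mul_of_nonneg_right (mul_le_mul_of_nonneg_left hp'
      (mul_nonneg (by linarith) (by linarith))) hn3
  have hn15 : n ≤ 14143 / 10000 := by nlinarith only [hn, hn2]
  have h10 : n ^ 3 - 1 ≤ 19 / 10 * (n ^ 2 - 1) := by
    have a : 0 ≤ 9 / 10 * n + 9 / 10 - n ^ 2 := by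
      nlinarith only [hn15, mul_nonneg (sub_nonneg.2 hn) (sub_nonneg.2 hn15)]
    linarith only [mul_nonneg (sub_nonneg.2 hn) a]
  have h11 := mul_le_mul_of_nonneg_left h10 (show 0 ≤ C₂ * n * (x₁ * (1 + x₂)) by positivity)
  linarith only [h7, h8, h9, h11]

end AnticipatoryTrading

namespace AnticipatoryTrading

/-- The parameters `x`, `C` and `c = C / (2 ψ)` of a critical state (`η = 1`). -/
structure Crit (x C c : ℝ) : Prop where
  x_gt : 207 / 500 < x
  x_lt : x < 641 / 1000
  C_gt : 1 < C
  C_lt : C < 2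
  c_le : c ≤ C
  C_le : C ≤ 2 * c
  eq : 2 * x * (1 - x) * c = 3 * x - 1

theorem Cell.lt_one_of_le {x η C ψ ϑ : ℝ} (h : Cell x η C ψ ϑ) (hη : η ≤ 1) (hϑ : 0 < ϑ) :
    x < 1 := by
  obtain ⟨hx, hη0, hC, hC', -, -, hX, -⟩ := h
  by_contra! h1
  have hle : x ≤ x / η := by rw [le_div_iff₀ hη0]; nlinarith
  have h2 : 0 ≤ C * (2 - C) * (x / η - x) :=
    mul_nonneg (mul_nonneg (by linarith) (by linarith)) (by linarith)
  have h3 : (1 - η) * (C - 1) < 1 := by nlinarith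
  have h4 : 0 < (1 + x) * (1 + C * (2 - C) * (x / η - x) - (1 - η) * (C - 1)) :=
    mul_pos (by linarith) (by linarith)
  nlinarith

theorem Cell.lt_one_of_ge {x η C ψ ϑ : ℝ} (h : Cell x η C ψ ϑ) (hη : 1 ≤ η) (hϑ : 1 ≤ ϑ) :
    x < 1 := by
  obtain ⟨hx, hη0, hC, hC', hψ, hψ', hX, hN⟩ := h
  by_contra! h1
  have hX0 : 0 < x / η := by positivity
  set e := (η - 1) * (C - 1) with he
  have he0 : 0 ≤ e := mul_nonneg (by linarith) (by linarith)
  have hq : C * (2 - C) ≤ 1 := by nlinarith [sq_nonneg (C - 1)]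
  have hq0 : 0 < C * (2 - C) := mul_pos (by linarith) (by linarith)
  have h2 : C * (2 - C) * (x / η - x) > - x := by nlinarith
  have h3 : x * C / 2 - e / 2 ≤ ϑ - 1 := by
    have : x * C / 2 - e / 2 = ψ * (ϑ - 1) := by rw [hN, he]; ring
    rw [this]; nlinarith
  have h4 : 2 * (1 - x) * ϑ > (1 + x) * (1 - x + e) := by
    rw [hX]
    exact mul_lt_mul_of_pos_left (by linarith) (by linarith)
  have h5 : (x - 1) * (1 + x * C / 2 - e / 2) ≤ (x - 1) * ϑ :=
    mul_le_mul_of_nonneg_left (by linarith) (by linarith)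
  have h6 : (x - 1) * x ≤ (x - 1) * (x * C) :=
    mul_le_mul_of_nonneg_left (by nlinarith) (by linarith)
  nlinarith [mul_nonneg he0 hx.le]

theorem Cell.crit {x C ψ ϑ : ℝ} (h : Cell x 1 C ψ ϑ) : Crit x C (C / (2 * ψ)) := by
  obtain ⟨hx, -, hC, hC', hψ, hψ', hX, hN⟩ := h
  have hψ0 : 0 < ψ := by linarith
  have hX' : 2 * (1 - x) * ϑ = 1 + x := by rw [hX]; ring
  have hN' : ψ * (ϑ - 1) = x * C / 2 := by rw [hN]; ring
  have h1 : x < 1 := by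
    by_contra! h1
    have : 1 < ϑ := by
      have : 0 < ψ * (ϑ - 1) := by rw [hN']; positivity
      linarith [pos_of_mul_pos_right this hψ0.le]
    nlinarith
  have e : ψ * (3 * x - 1) = x * (1 - x) * C := by linear_combination 2 * (1 - x) * hN' - ψ * hX'
  have h3 : 0 < 3 * x - 1 := by
    have : 0 < ψ * (3 * x - 1) := by
      rw [e]; exact mul_pos (mul_pos hx (by linarith)) (by linarith)
    exact pos_of_mul_pos_right this hψ0.le
  have h4 : 0 < x * (1 - x) := mul_pos hx (by linarith)
  have a1 : x * (1 - x) < 3 * x - 1 := by nlinarith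
  have a2 : 3 * x - 1 < 4 * (x * (1 - x)) := by nlinarith
  refine ⟨by nlinarith, by nlinarith, hC, hC', ?_, ?_, ?_⟩
  · rw [div_le_iff₀ (by positivity)]; nlinarith
  · rw [mul_div_assoc', le_div_iff₀ (by positivity)]; nlinarith
  · field_simp
    linear_combination -e

theorem Cell.crit_ϑ {x C ψ ϑ : ℝ} (h : Cell x 1 C ψ ϑ) : ϑ = 1 + C / (2 * ψ) * x := by
  have hψ0 : 0 < ψ := by linarith [h.ψ_ge]
  have := h.eqN
  field_simp
  linarith

namespace Crit

variable {x C c : ℝ}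

theorem x_pos (h : Crit x C c) : 0 < x := by linarith [h.x_gt]
theorem x_lt_one (h : Crit x C c) : x < 1 := by linarith [h.x_lt]
theorem c_gt (h : Crit x C c) : 1 / 2 < c := by linarith [h.C_gt, h.C_le]
theorem q_le (_ : Crit x C c) : C * (2 - C) ≤ 1 := by nlinarith [sq_nonneg (C - 1)]
theorem q_pos (h : Crit x C c) : 0 < C * (2 - C) :=
  mul_pos (by linarith [h.C_gt]) (by linarith [h.C_lt])
theorem q_le_of_one_le (h : Crit x C c) (hc : 1 ≤ c) : C * (2 - C) ≤ c * (2 - c) := by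
  nlinarith [h.c_le]

/-- `f(t) = 2 (1 - t) (1 + c t) / (1 + t)` equals `1` at `x`. -/
theorem factor (h : Crit x C c) (t : ℝ) :
    ((1 + t) - 2 * (1 - t) * (1 + c * t)) * x = (t - x) * (2 * c * t * x + 1) := by
  linear_combination (-t) * h.eq

theorem x_le_half (h : Crit x C c) (hc : c ≤ 1) : x ≤ 1 / 2 := by
  have h1 := h.eq
  have := mul_le_mul_of_nonneg_left hc
    (show 0 ≤ 2 * x * (1 - x) from mul_nonneg (by linarith [h.x_pos]) (by linarith [h.x_lt_one]))
  nlinarith [h.x_pos]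

theorem half_le_x (h : Crit x C c) (hc : 1 ≤ c) : 1 / 2 ≤ x := by
  have h1 := h.eq
  have := mul_le_mul_of_nonneg_left hc
    (show 0 ≤ 2 * x * (1 - x) from mul_nonneg (by linarith [h.x_pos]) (by linarith [h.x_lt_one]))
  nlinarith [h.x_pos]

theorem left_aux (h : Crit x C c) {t : ℝ} (ht : 0 ≤ t) (ht1 : t ≤ 1) :
    11 / 10 * (C * (2 - C) * (1 + c * (t + x)) * (1 + t) * x) ≤ (2 * c * t * x + 1) * (1 + c * t) := by
  have hx := h.x_gt; have hx' := h.x_lt; have hx0 := h.x_pos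
  have hc := h.c_gt
  have hq := h.q_le
  have hq0 := h.q_pos
  set q := C * (2 - C)
  have e := h.eq
  have k1 : 1 + c * x = (1 + x) / (2 * (1 - x)) := by
    rw [eq_div_iff (by linarith)]; linear_combination e
  have a0 : 11 / 10 * (q * (1 + c * x) * x) ≤ 1 := by
    rcases le_total c 1 with hc1 | hc1
    · have hx2 := h.x_le_half hc1
      have : 11 / 10 * ((1 + c * x) * x) ≤ 1 := by nlinarith
      nlinarith [show 0 ≤ (1 + c * x) * x by positivity]
    · have hx2 := h.half_le_x hc1
      have hq' := h.q_le_of_one_le hc1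
      have hc2 : c = (3 * x - 1) / (2 * x * (1 - x)) := by
        rw [eq_div_iff (by nlinarith)]; linear_combination e
      refine (mul_le_mul_of_nonneg_left (mul_le_mul_of_nonneg_right (mul_le_mul_of_nonneg_right
        hq' (by positivity)) hx0.le) (by norm_num)).trans ?_
      have : c * (2 - c) * (1 + c * x) * x
          = (1 + x - 4 * x ^ 2) * (3 * x - 1) * (1 + x) / (8 * x * (1 - x) ^ 3) := by
        rw [k1, hc2]
        have : 1 - x ≠ 0 := by linarith
        field_simp
        ring
      have hpos : 0 < 8 * x * (1 - x) ^ 3 := by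
        have : 0 < 1 - x := by linarith
        positivity
      rw [this, mul_div_assoc', div_le_one hpos]
      linarith only [sq_nonneg ((x - 553 / 1000) * x), mul_nonneg hx0.le (sq_nonneg (x - 553 / 1000)),
        sq_nonneg (x - 553 / 1000), hx2, hx']
  have a1 : 11 / 10 * (q * (c + (1 + c * x)) * x) + c * x / 10 ≤ c + 2 * c * x := by
    have hcx : 11 / 10 * x ≤ c := by
      refine le_of_mul_le_mul_left (a := 2 * x * (1 - x)) ?_ (by nlinarith)
      rw [e]
      nlinarith [mul_nonneg (sub_nonneg.2 hx.le) (sub_nonneg.2 hx'.le)]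
    have h2 : c * x * x ≤ c * x * (641 / 1000) := mul_le_mul_of_nonneg_left hx'.le (by positivity)
    have h3 : q * ((c + (1 + c * x)) * x) ≤ 1 * ((c + (1 + c * x)) * x) :=
      mul_le_mul_of_nonneg_right hq (by positivity)
    linarith [show 0 < c * x by positivity]
  have a2 : 11 / 10 * (q * c * x) ≤ 2 * c ^ 2 * x + c * x / 10 := by
    have h1 : q * (c * x) ≤ 1 * (c * x) := mul_le_mul_of_nonneg_right hq (by positivity)
    have h2 : c * x * (1 / 2) ≤ c * x * c := mul_le_mul_of_nonneg_left hc.le (by positivity)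
    linarith
  have b1 := mul_le_mul_of_nonneg_right a1 ht
  have b2 := mul_le_mul_of_nonneg_right a2 (sq_nonneg t)
  have b3 := mul_le_mul_of_nonneg_left (show t * t ≤ t * 1 from mul_le_mul_of_nonneg_left ht1 ht)
    (show 0 ≤ c * x / 10 by positivity)
  linarith

theorem right_aux_of_chord (h : Crit x C c) {f t : ℝ} (hf : 0 ≤ f) (ht : x ≤ t) (ht1 : t ≤ 1)
    (h1 : f * ((1 - x) * (x * (1 + x) + 3 * x - 1)) ≤ x * (1 + x))
    (h2 : f * (4 * x ^ 2 * (1 - x)) ≤ 1 - 2 * x + 3 * x ^ 2) :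
    f * ((1 + c * (t + x)) * (1 + t) * x) ≤ (2 * c * t * x + 1) * (1 + c * x) := by
  have hx := h.x_gt; have hx' := h.x_lt; have hx0 := h.x_pos
  have hc := h.c_gt
  have e := h.eq
  have k0 : 0 < 1 - x := by linarith
  have k2 : c = (3 * x - 1) / (2 * x * (1 - x)) := by
    rw [eq_div_iff (by positivity)]; linear_combination e
  have e1 : 0 ≤ (2 * c * x + 1) * (1 + c * x) - f * (2 * (1 + c * (1 + x)) * x) := by
    have : (2 * c * x + 1) * (1 + c * x) - f * (2 * (1 + c * (1 + x)) * x)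
        = (x * (1 + x) - f * ((1 - x) * (x * (1 + x) + 3 * x - 1))) / (1 - x) ^ 2 := by
      rw [k2]; field_simp; ring
    rw [this]
    exact div_nonneg (by linarith) (by positivity)
  have e2 : 0 ≤ (2 * c * x * x + 1) * (1 + c * x) - f * ((1 + c * (x + x)) * (1 + x) * x) := by
    have : (2 * c * x * x + 1) * (1 + c * x) - f * ((1 + c * (x + x)) * (1 + x) * x)
        = (1 + x) * (1 - 2 * x + 3 * x ^ 2 - f * (4 * x ^ 2 * (1 - x))) / (2 * (1 - x) ^ 2) := by
      rw [k2]; field_simp; ring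
    rw [this]
    exact div_nonneg (mul_nonneg (by linarith) (by linarith)) (by positivity)
  have e3 : 0 ≤ f * (c * x * ((t - x) * (1 - t))) := by
    have := mul_nonneg (sub_nonneg.2 ht) (sub_nonneg.2 ht1)
    positivity
  have f1 := mul_nonneg e1 (sub_nonneg.2 ht)
  have f2 := mul_nonneg e2 (sub_nonneg.2 ht1)
  have f3 := mul_nonneg e3 (show 0 ≤ 1 - x by linarith)
  refine le_of_mul_le_mul_right (a := 1 - x) ?_ (by linarith)
  linarith

theorem right_aux (h : Crit x C c) {t : ℝ} (ht : x ≤ t) (ht1 : t ≤ 1) :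
    (1 + c * (t + x)) * (1 + t) * x ≤ (2 * c * t * x + 1) * (1 + c * x) := by
  have hx0 := h.x_pos
  have := h.right_aux_of_chord zero_le_one ht ht1 (by nlinarith [pow_pos hx0 3, sq_nonneg (2 * x - 1)])
    (by nlinarith [h.x_gt, h.x_lt, sq_nonneg (2 * x - 1), pow_pos hx0 3])
  linarith

theorem right_aux' (h : Crit x C c) (hx : 11 / 20 ≤ x) {t : ℝ} (ht : x ≤ t) (ht1 : t ≤ 1) :
    5 / 4 * ((1 + c * (t + x)) * (1 + t) * x) ≤ (2 * c * t * x + 1) * (1 + c * x) := by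
  have hx' := sub_nonneg.2 hx
  exact h.right_aux_of_chord (by norm_num) ht ht1
    (by nlinarith [mul_nonneg hx' hx', mul_nonneg hx' (mul_nonneg hx' hx')])
    (by nlinarith [mul_nonneg hx' hx', mul_nonneg hx' (mul_nonneg hx' hx')])

end Crit

end AnticipatoryTrading

namespace AnticipatoryTrading

theorem Cell.mul_le_of_le {x η C ψ ϑ : ℝ} (h : Cell x η C ψ ϑ) (hη : η ≤ 1) :
    x * C ≤ 2 * ψ * (ϑ - 1) := by
  have := mul_nonneg (sub_nonneg.2 hη) (sub_nonneg.2 h.C_gt.le)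
  linarith [h.eqN]

theorem Cell.le_mul_of_ge {x η C ψ ϑ : ℝ} (h : Cell x η C ψ ϑ) (hη : 1 ≤ η) :
    2 * ψ * (ϑ - 1) ≤ x * C := by
  have := mul_nonneg (sub_nonneg.2 hη) (sub_nonneg.2 h.C_gt.le)
  linarith [h.eqN]

/-- `ϑ₁` is bounded below in terms of `x₁`, where `c = C₂ / (2 ψ₂)`. -/
theorem Cell.mul_le_left {x₁ η₁ C₁ ψ₁ ϑ₁ ψ₂ C₂ c n ρ P : ℝ} (h₁ : Cell x₁ η₁ C₁ ψ₁ ϑ₁)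
    (hR : Ratio C₁ C₂ n ρ) (hη : η₁ ≤ 1) (hψ₂ : 0 < ψ₂) (hP : ψ₁ ≤ ψ₂ * P)
    (hc : 2 * ψ₂ * c = C₂) : c * x₁ ≤ n ^ 2 * P * (ϑ₁ - 1) := by
  have h := h₁.mul_le_of_le hη
  have hx := h₁.x_pos
  have hψ := h₁.ψ_ge
  have hX : 0 ≤ ϑ₁ - 1 := by
    have : 0 ≤ x₁ * C₁ := mul_nonneg hx.le (by linarith [h₁.C_gt])
    nlinarith
  refine le_of_mul_le_mul_left (a := 2 * ψ₂) ?_ (by positivity)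
  calc 2 * ψ₂ * (c * x₁) = C₂ * x₁ := by rw [← hc]; ring
    _ ≤ n ^ 2 * C₁ * x₁ := mul_le_mul_of_nonneg_right hR.le_C hx.le
    _ = n ^ 2 * (x₁ * C₁) := by ring
    _ ≤ n ^ 2 * (2 * (ψ₂ * P) * (ϑ₁ - 1)) := by
      refine mul_le_mul_of_nonneg_left (h.trans ?_) (by positivity)
      exact mul_le_mul_of_nonneg_right (by linarith) hX
    _ = _ := by ring

/-- `ϑ₂` is bounded above in terms of `x₂`, where `c = C₁ / (2 ψ₁)`. -/
theorem Cell.le_mul_right {x₂ η₂ C₂ ψ₂ ϑ₂ ψ₁ C₁ c n ρ P : ℝ} (h₂ : Cell x₂ η₂ C₂ ψ₂ ϑ₂)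
    (hR : Ratio C₁ C₂ n ρ) (hη : 1 ≤ η₂) (hP : ψ₁ ≤ ψ₂ * P) (hc0 : 0 ≤ c)
    (hc : 2 * ψ₁ * c = C₁) : ϑ₂ - 1 ≤ n ^ 2 * P * c * x₂ := by
  have h := h₂.le_mul_of_ge hη
  have hx := h₂.x_pos
  have hψ := h₂.ψ_ge
  refine le_of_mul_le_mul_left (a := 2 * ψ₂) ?_ (by positivity)
  calc 2 * ψ₂ * (ϑ₂ - 1) ≤ x₂ * C₂ := h
    _ ≤ x₂ * (n ^ 2 * C₁) := mul_le_mul_of_nonneg_left hR.le_C hx.le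
    _ = x₂ * n ^ 2 * (2 * c) * ψ₁ := by rw [← hc]; ring
    _ ≤ x₂ * n ^ 2 * (2 * c) * (ψ₂ * P) := mul_le_mul_of_nonneg_left hP (by positivity)
    _ = _ := by ring

/-- The ratio of the values of `ψ (ϑ - 1) / x`. -/
theorem Cell.nu_le {x₁ η₁ C₁ ψ₁ ϑ₁ x₂ η₂ C₂ ψ₂ ϑ₂ n ρ : ℝ} (h₁ : Cell x₁ η₁ C₁ ψ₁ ϑ₁)
    (h₂ : Cell x₂ η₂ C₂ ψ₂ ϑ₂) (hR : Ratio C₁ C₂ n ρ) (hη₁ : η₁ ≤ 1) (hη₂ : 1 ≤ η₂) :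
    ψ₂ * (ϑ₂ - 1) * x₁ ≤ n ^ 2 * (ψ₁ * (ϑ₁ - 1) * x₂) := by
  have a := h₁.mul_le_of_le hη₁
  have b := h₂.le_mul_of_ge hη₂
  have hx₁ := h₁.x_pos
  have hx₂ := h₂.x_pos
  have c := mul_le_mul_of_nonneg_right b hx₁.le
  have d := mul_le_mul_of_nonneg_left (mul_le_mul_of_nonneg_right a hx₂.le) (sq_nonneg n)
  have e := mul_le_mul_of_nonneg_right hR.le_C (mul_pos hx₁ hx₂).le
  linarith

theorem Cell.c_spec {x η C ψ ϑ : ℝ} (h : Cell x η C ψ ϑ) : 2 * ψ * (C / (2 * ψ)) = C := by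
  have := h.ψ_ge
  field_simp

theorem Crit.two_mul_lt {x C c : ℝ} (h : Crit x C c) {t : ℝ} (ht : 0 ≤ t) :
    2 * t * (1 - t) ≤ x * (1 + t) := by
  nlinarith [mul_nonneg ht (sub_nonneg.2 h.x_gt.le), h.x_gt, sq_nonneg (t - 2 / 5)]

theorem Cell.mul_le_cube {x₁ η₁ C₁ ψ₁ ϑ₁ ψ₂ C₂ c n ρ : ℝ} (h₁ : Cell x₁ η₁ C₁ ψ₁ ϑ₁)
    (hR : Ratio C₁ C₂ n ρ) (hη : η₁ ≤ 1) (hψ₂ : 0 < ψ₂) (hψ : ψ₁ ≤ ψ₂)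
    (hc : 2 * ψ₂ * c = C₂) (hc0 : 0 < c) : c * x₁ ≤ 1 * n ^ 3 * (ϑ₁ - 1) := by
  have hx1 := h₁.x_pos
  have hX := h₁.mul_le_left hR hη hψ₂ (P := 1) (by linarith) hc
  have hn := hR.n_ge
  have hX1 : 0 ≤ ϑ₁ - 1 := by
    have : 0 < n ^ 2 * 1 := by positivity
    exact nonneg_of_mul_nonneg_right ((mul_pos hc0 hx1).le.trans hX) this
  refine hX.trans (mul_le_mul_of_nonneg_right ?_ hX1)
  have := pow_le_pow_right₀ hn (show 2 ≤ 3 by norm_num)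
  linarith

theorem Cell.le_mul_cube {x₂ η₂ C₂ ψ₂ ϑ₂ ψ₁ C₁ c n ρ : ℝ} (h₂ : Cell x₂ η₂ C₂ ψ₂ ϑ₂)
    (hR : Ratio C₁ C₂ n ρ) (hη : 1 ≤ η₂) (hψ : ψ₁ ≤ ψ₂) (hc0 : 0 < c)
    (hc : 2 * ψ₁ * c = C₁) : ϑ₂ - 1 ≤ c * 1 * n ^ 3 * x₂ := by
  have hX := h₂.le_mul_right hR hη (P := 1) (by linarith) hc0.le hc
  have := pow_le_pow_right₀ hR.n_ge (show 2 ≤ 3 by norm_num)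
  have := mul_le_mul_of_nonneg_right this (mul_pos hc0 h₂.x_pos).le
  linarith

/-- The comparison of `x₁ / η₁` and `x₂` if `η₂ = 1` and `x₁ < x₂`. -/
theorem Cell.psi_left {x₁ η₁ C₁ ψ₁ ϑ₁ x₂ C₂ ψ₂ ϑ₂ c n ρ : ℝ} (h₁ : Cell x₁ η₁ C₁ ψ₁ ϑ₁)
    (h₂ : Cell x₂ 1 C₂ ψ₂ ϑ₂) (hcr : Crit x₂ C₂ c) (hR : Ratio C₁ C₂ n ρ)
    (hη : η₁ ≤ 1) (hX3 : c * x₁ ≤ 1 * n ^ 3 * (ϑ₁ - 1)) (hx : x₁ < x₂) :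
    n ^ 3 * (x₂ * (1 + c * x₂ + (x₂ - x₁) / (10 * x₂) * (1 + c * (x₁ + x₂))))
      ≤ ρ * (x₁ / η₁) * (1 + c * x₁) := by
  have hx1 := h₁.x_pos
  have hx2 := h₂.x_pos
  have hc0 : 0 < c := by linarith [hcr.c_gt]
  have hd : 0 < x₂ - x₁ := sub_pos.2 hx
  have hd1 : 0 < 1 + c * x₁ := by positivity
  set κ := 11 / 10 * (1 + c * (x₁ + x₂)) / (1 + c * x₁) - 1 with hκ
  have key := h₁.core_left h₂.C_gt h₂.C_lt hR hη hx hcr.x_lt_one hc0.le hcr.c_le le_rfl hX3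
    (κ := κ) (by
      have a := hcr.left_aux hx1.le (by linarith [hcr.x_lt_one])
      have f := hcr.factor x₁
      have e1 : 1 + κ = 11 / 10 * (1 + c * (x₁ + x₂)) / (1 + c * x₁) := by rw [hκ]; ring
      rw [e1, div_one]
      have f' : 2 * (1 - x₁) * (1 + c * x₁) - (1 + x₁)
          = (x₂ - x₁) * (2 * c * x₁ * x₂ + 1) / x₂ := by
        rw [eq_div_iff hx2.ne']; linear_combination -f
      rw [f', le_div_iff₀ hx2, show C₂ * (2 - C₂) * (11 / 10 * (1 + c * (x₁ + x₂)) / (1 + c * x₁))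
        * (x₂ - x₁) * (1 + x₁) * x₂ = (x₂ - x₁) * (11 / 10 * (C₂ * (2 - C₂) * (1 + c * (x₁ + x₂))
        * (1 + x₁) * x₂)) / (1 + c * x₁) by ring, div_le_iff₀ hd1]
      calc _ ≤ (x₂ - x₁) * ((2 * c * x₁ * x₂ + 1) * (1 + c * x₁)) :=
            mul_le_mul_of_nonneg_left a hd.le
        _ = _ := by ring)
  have := mul_le_mul_of_nonneg_right key hd1.le
  refine le_trans (le_of_eq ?_) this
  rw [hκ]
  field_simp
  ring

/-- The comparison of `x₁` and `x₂ / η₂` if `η₁ = 1` and `x₁ < x₂`. -/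
theorem Cell.psi_right_of_factor {x₁ C₁ ψ₁ ϑ₁ x₂ η₂ C₂ ψ₂ ϑ₂ c n ρ f : ℝ} (h₁ : Cell x₁ 1 C₁ ψ₁ ϑ₁)
    (h₂ : Cell x₂ η₂ C₂ ψ₂ ϑ₂) (hcr : Crit x₁ C₁ c) (hR : Ratio C₁ C₂ n ρ)
    (hn : n = 1 ∨ n ^ 2 * C₁ = C₂) (hη : 1 ≤ η₂) (hX3 : ϑ₂ - 1 ≤ c * 1 * n ^ 3 * x₂)
    (hx : x₁ < x₂) (hx₂ : x₂ < 1)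
    (hf : 1 ≤ f)
    (haux : f * ((1 + c * (x₂ + x₁)) * (1 + x₂) * x₁) ≤ (2 * c * x₂ * x₁ + 1) * (1 + c * x₁)) :
    n ^ 3 * (x₂ / η₂ * (1 + c * x₂ + (f - 1) * (x₂ - x₁) / x₂ * (1 + c * (x₁ + x₂))))
      ≤ ρ * x₁ * (1 + c * x₁) := by
  have hx1 := h₁.x_pos
  have hx2 := h₂.x_pos
  have hη0 := h₂.η_pos
  have hc0 : 0 < c := by linarith [hcr.c_gt]
  have hd : 0 < x₂ - x₁ := sub_pos.2 hx
  have hd1 : 0 < 1 + c * x₁ := by positivity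
  set κ := f * (1 + c * (x₁ + x₂)) / (1 + c * x₁) - 1 with hκ
  have e1 : 1 + κ = f * (1 + c * (x₁ + x₂)) / (1 + c * x₁) := by rw [hκ]; ring
  have hκ0 : 0 ≤ κ := by
    rw [hκ, sub_nonneg, one_le_div hd1]
    have : 1 * (1 + c * (x₁ + x₂)) ≤ f * (1 + c * (x₁ + x₂)) :=
      mul_le_mul_of_nonneg_right hf (by positivity)
    nlinarith [mul_pos hc0 hx2]
  have key := h₂.core_right hR hη hx1 hx hx₂ (c := c) (p := 1) (κ := κ)
    (hn.imp id fun h => by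
      rw [← h]; exact mul_le_mul_of_nonneg_left hcr.c_le (by positivity)) hX3 le_rfl
    (by have := hcr.two_mul_lt hx2.le; linarith) hκ0 (by
      have fa := hcr.factor x₂
      have f' : (1 + x₂) - 2 * (1 - x₂) * (1 + c * 1 * x₂)
          = (x₂ - x₁) * (2 * c * x₂ * x₁ + 1) / x₁ := by
        rw [eq_div_iff hx1.ne']; linear_combination fa
      rw [f', le_div_iff₀ hx1, e1]
      have hq : C₂ * (2 - C₂) ≤ 1 := by nlinarith [sq_nonneg (C₂ - 1)]
      have hB : 0 ≤ f * (1 + c * (x₁ + x₂)) / (1 + c * x₁) * (x₂ - x₁) * (1 + x₂) * x₁ := by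
        have := hd.le
        positivity
      have hB' : f * (1 + c * (x₁ + x₂)) / (1 + c * x₁) * (x₂ - x₁) * (1 + x₂) * x₁
          ≤ (x₂ - x₁) * (2 * c * x₂ * x₁ + 1) := by
        rw [show f * (1 + c * (x₁ + x₂)) / (1 + c * x₁) * (x₂ - x₁) * (1 + x₂) * x₁
          = (x₂ - x₁) * (f * ((1 + c * (x₂ + x₁)) * (1 + x₂) * x₁)) / (1 + c * x₁) by ring,
          div_le_iff₀ hd1]
        calc _ ≤ (x₂ - x₁) * ((2 * c * x₂ * x₁ + 1) * (1 + c * x₁)) :=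
              mul_le_mul_of_nonneg_left haux hd.le
          _ = _ := by ring
      have := mul_le_mul_of_nonneg_right hq hB
      linarith)
  have := mul_le_mul_of_nonneg_right key hd1.le
  refine le_of_mul_le_mul_right (a := x₂) ?_ hx2
  calc n ^ 3 * (x₂ / η₂ * (1 + c * x₂ + (f - 1) * (x₂ - x₁) / x₂ * (1 + c * (x₁ + x₂)))) * x₂
      = n ^ 3 * (x₂ + κ * (x₂ - x₁)) * (x₂ / η₂) * (1 + c * x₁) := by
        rw [hκ]; field_simp; ring
    _ ≤ _ := this
    _ = _ := by ring

theorem Cell.psi_right {x₁ C₁ ψ₁ ϑ₁ x₂ η₂ C₂ ψ₂ ϑ₂ c n ρ : ℝ} (h₁ : Cell x₁ 1 C₁ ψ₁ ϑ₁)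
    (h₂ : Cell x₂ η₂ C₂ ψ₂ ϑ₂) (hcr : Crit x₁ C₁ c) (hR : Ratio C₁ C₂ n ρ)
    (hn : n = 1 ∨ n ^ 2 * C₁ = C₂) (hη : 1 ≤ η₂) (hX3 : ϑ₂ - 1 ≤ c * 1 * n ^ 3 * x₂)
    (hx : x₁ < x₂) (hx₂ : x₂ < 1) :
    n ^ 3 * (x₂ / η₂ * (1 + c * x₂)) ≤ ρ * x₁ * (1 + c * x₁) := by
  have := h₁.psi_right_of_factor h₂ hcr hR hn hη hX3 hx hx₂ le_rfl (by
    have := hcr.right_aux hx.le hx₂.le; linarith)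
  simpa using this

end AnticipatoryTrading

namespace AnticipatoryTrading

theorem Cell.lt_third {x η C ψ ϑ : ℝ} (h : Cell x η C ψ ϑ) (hη : 1 ≤ η) (hϑ : 0 < ϑ)
    (hϑ' : ϑ ≤ 1) : x < 1 / 3 ∧ 1 + 2 * x ≤ η := by
  obtain ⟨hx, hη0, hC, hC', hψ, hψ', hX, hN⟩ := h
  have h0 : 0 < x / η := by positivity
  have h1 : x * C ≤ (η - 1) * (C - 1) := by
    have : 0 ≤ ψ * (1 - ϑ) := mul_nonneg (by linarith) (by linarith)
    linarith
  have hq0 : 0 < C * (2 - C) := mul_pos (by linarith) (by linarith)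
  have h2 : (1 + x) * (1 + x * (C * (C - 1))) < 2 * (1 - x) * ϑ := by
    rw [hX]
    refine mul_lt_mul_of_pos_left ?_ (by linarith)
    have := mul_pos hq0 h0
    linarith
  have h3 : 0 < x * (C * (C - 1)) := mul_pos hx (mul_pos (by linarith) (by linarith))
  have h4 : (1 + x) * 1 < (1 + x) * (1 + x * (C * (C - 1))) :=
    mul_lt_mul_of_pos_left (by linarith) (by linarith)
  have h5 : 0 < 1 - x := by
    have : 0 < (1 - x) * (2 * ϑ) := by linarith
    exact pos_of_mul_pos_left this (by linarith)
  have h6 := mul_le_mul_of_nonneg_left hϑ' h5.le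
  refine ⟨by linarith, ?_⟩
  by_contra! hc
  have : (η - 1) * (C - 1) ≤ 2 * x * (C - 1) :=
    mul_le_mul_of_nonneg_right (by linarith) (by linarith)
  nlinarith

theorem Cell.lt_one_of_ge' {x η C ψ ϑ : ℝ} (h : Cell x η C ψ ϑ) (hη : 1 ≤ η) (hϑ : 0 < ϑ) :
    x < 1 := by
  rcases le_total ϑ 1 with h1 | h1
  · linarith [(h.lt_third hη hϑ h1).1]
  · exact h.lt_one_of_ge hη h1

/-- Two states, one of which is critical. -/
structure CellPair (x₁ η₁ C₁ ψ₁ ϑ₁ x₂ η₂ C₂ ψ₂ ϑ₂ n ρ : ℝ) : Prop where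
  left : Cell x₁ η₁ C₁ ψ₁ ϑ₁
  right : Cell x₂ η₂ C₂ ψ₂ ϑ₂
  ratio : Ratio C₁ C₂ n ρ
  n_eq : n = 1 ∨ n ^ 2 * C₁ = C₂
  le_one : η₁ ≤ 1
  one_le : 1 ≤ η₂
  crit : η₂ = 1 ∨ η₁ = 1
  ϑ_pos : 0 < ϑ₂

namespace CellPair

variable {x₁ η₁ C₁ ψ₁ ϑ₁ x₂ η₂ C₂ ψ₂ ϑ₂ n ρ : ℝ}

theorem one_lt_left (h : CellPair x₁ η₁ C₁ ψ₁ ϑ₁ x₂ η₂ C₂ ψ₂ ϑ₂ n ρ) : 1 < ϑ₁ := by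
  have h1 := h.left.mul_le_of_le h.le_one
  have h2 : 0 < x₁ * C₁ := mul_pos h.left.x_pos (by linarith [h.left.C_gt])
  have h3 : 0 < 2 * ψ₁ := by linarith [h.left.ψ_ge]
  linarith [pos_of_mul_pos_right (h2.trans_le h1) h3.le]

theorem lt_one_left (h : CellPair x₁ η₁ C₁ ψ₁ ϑ₁ x₂ η₂ C₂ ψ₂ ϑ₂ n ρ) : x₁ < 1 :=
  h.left.lt_one_of_le h.le_one (by linarith [h.one_lt_left])

theorem lt_one_right (h : CellPair x₁ η₁ C₁ ψ₁ ϑ₁ x₂ η₂ C₂ ψ₂ ϑ₂ n ρ) : x₂ < 1 :=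
  h.right.lt_one_of_ge' h.one_le h.ϑ_pos

theorem le_hat_left (h : CellPair x₁ η₁ C₁ ψ₁ ϑ₁ x₂ η₂ C₂ ψ₂ ϑ₂ n ρ) : x₁ ≤ x₁ / η₁ := by
  rw [le_div_iff₀ h.left.η_pos]
  exact mul_le_of_le_one_right h.left.x_pos.le h.le_one

theorem hat_right_le (h : CellPair x₁ η₁ C₁ ψ₁ ϑ₁ x₂ η₂ C₂ ψ₂ ϑ₂ n ρ) : x₂ / η₂ ≤ x₂ :=
  div_le_self h.right.x_pos.le h.one_le

theorem ρ_ge (h : CellPair x₁ η₁ C₁ ψ₁ ϑ₁ x₂ η₂ C₂ ψ₂ ϑ₂ n ρ) : n ≤ ρ ∧ n ^ 2 ≤ ρ ∧ n ^ 3 ≤ ρ :=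
  have h1 := h.ratio.n_ge
  ⟨(le_self_pow₀ h1 (by norm_num)).trans h.ratio.pow_le,
    (pow_le_pow_right₀ h1 (by norm_num)).trans h.ratio.pow_le,
    (pow_le_pow_right₀ h1 (by norm_num)).trans h.ratio.pow_le⟩

theorem ρ_pos (h : CellPair x₁ η₁ C₁ ψ₁ ϑ₁ x₂ η₂ C₂ ψ₂ ϑ₂ n ρ) : 0 < ρ := by
  linarith [h.ρ_ge.1, h.ratio.n_ge]

/-- If `x₁ < x₂`, and the information is better or the discount smaller in the first state. -/
theorem psi (h : CellPair x₁ η₁ C₁ ψ₁ ϑ₁ x₂ η₂ C₂ ψ₂ ϑ₂ n ρ) (hψ : ψ₁ ≤ ψ₂ ∨ ϑ₂ ≤ ϑ₁)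
    (hx : x₁ < x₂) : ∃ c, 0 < c ∧ n ^ 3 * (x₂ / η₂ * (1 + c * x₂)) ≤ ρ * (x₁ / η₁) * (1 + c * x₁) ∧
      (ψ₁ ≤ ψ₂ → 1 + c * x₁ ≤ n ^ 2 * ϑ₁ ∧ ϑ₂ ≤ n ^ 2 * (1 + c * x₂) ∧
        (1 + c * x₁ = ϑ₁ ∨ 1 + c * x₂ = ϑ₂)) := by
  obtain ⟨h₁, h₂, hR, hn, hη₁, hη₂, hcr, hϑ⟩ := id h
  have hn1 := hR.n_ge
  have hn2 : 1 ≤ n ^ 2 := one_le_pow₀ hn1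
  have hn3 : 1 ≤ n ^ 3 := one_le_pow₀ hn1
  have hx1 := h₁.x_pos
  have hx2 := h₂.x_pos
  have hϑ1 := h.one_lt_left
  have hx2' := h.lt_one_right
  rcases hcr with rfl | rfl
  · have hcr := h₂.crit
    have e := h₂.crit_ϑ
    have es := h₂.c_spec
    set c := C₂ / (2 * ψ₂)
    have hc0 : 0 < c := by linarith [hcr.c_gt]
    have hψ₂ : 0 < ψ₂ := by linarith [h₂.ψ_ge]
    have hX3 : c * x₁ ≤ 1 * n ^ 3 * (ϑ₁ - 1) := by
      rcases hψ with hψ | hψ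
      · exact h₁.mul_le_cube hR hη₁ hψ₂ hψ es hc0
      · have a := mul_lt_mul_of_pos_left hx hc0
        have b := mul_le_mul_of_nonneg_right hn3 (show 0 ≤ ϑ₁ - 1 by linarith)
        linarith
    have key := h₁.psi_left h₂ hcr hR hη₁ hX3 hx
    refine ⟨c, hc0, ?_, fun hψ => ⟨?_, ?_, Or.inr e.symm⟩⟩
    · rw [div_one]
      refine le_trans ?_ key
      have hd : 0 ≤ (x₂ - x₁) / (10 * x₂) * (1 + c * (x₁ + x₂)) :=
        mul_nonneg (div_nonneg (by linarith) (by linarith)) (by positivity)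
      refine mul_le_mul_of_nonneg_left (mul_le_mul_of_nonneg_left (by linarith) hx2.le) (by linarith)
    · have := h₁.mul_le_left hR hη₁ hψ₂ (P := 1) (by linarith) es
      linarith
    · rw [← e]; nlinarith
  · have hcr := h₁.crit
    have e := h₁.crit_ϑ
    have es := h₁.c_spec
    set c := C₁ / (2 * ψ₁)
    have hc0 : 0 < c := by linarith [hcr.c_gt]
    have hX3 : ϑ₂ - 1 ≤ c * 1 * n ^ 3 * x₂ := by
      rcases hψ with hψ | hψ
      · exact h₂.le_mul_cube hR hη₂ hψ hc0 es
      · have a := mul_lt_mul_of_pos_left hx hc0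
        have b := mul_le_mul_of_nonneg_right hn3 (mul_pos hc0 hx2).le
        linarith
    refine ⟨c, hc0, ?_, fun hψ => ⟨?_, ?_, Or.inl e.symm⟩⟩
    · rw [div_one]; exact h₁.psi_right h₂ hcr hR hn hη₂ hX3 hx hx2'
    · rw [← e]; nlinarith
    · have := h₂.le_mul_right hR hη₂ (P := 1) (by linarith) hc0.le es
      linarith

theorem hat_lt (h : CellPair x₁ η₁ C₁ ψ₁ ϑ₁ x₂ η₂ C₂ ψ₂ ϑ₂ n ρ) (hψ : ψ₁ ≤ ψ₂ ∨ ϑ₂ ≤ ϑ₁)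
    (hx : x₁ < x₂) : n ^ 3 * (x₂ / η₂) < ρ * (x₁ / η₁) := by
  obtain ⟨c, hc, h1, -⟩ := h.psi hψ hx
  have hx1 := h.left.x_pos
  have hη := h.left.η_pos
  have hρ := h.ρ_pos
  refine lt_of_mul_lt_mul_right (a := 1 + c * x₂) ?_ (by nlinarith)
  have : ρ * (x₁ / η₁) * (1 + c * x₁) < ρ * (x₁ / η₁) * (1 + c * x₂) :=
    mul_lt_mul_of_pos_left (by nlinarith) (by positivity)
  linarith

/-- The case of better information in the second state. -/
theorem hat_mul_le (h : CellPair x₁ η₁ C₁ ψ₁ ϑ₁ x₂ η₂ C₂ ψ₂ ϑ₂ n ρ) (hψ : ψ₁ ≤ ψ₂) :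
    n * (x₂ / η₂ * ϑ₂) ≤ ρ * (x₁ / η₁ * ϑ₁) ∧ n * (x₂ / η₂) ≤ ρ * (x₁ / η₁) := by
  obtain ⟨h₁, h₂, hR, hn, hη₁, hη₂, hcr, hϑ⟩ := id h
  have hx1 := h₁.x_pos
  have hx2 := h₂.x_pos
  have hη1 := h₁.η_pos
  have hη2 := h₂.η_pos
  have hn1 := hR.n_ge
  have hρ0 := h.ρ_pos
  have hn0 : 0 < n := by linarith
  have hX2 : 0 < x₂ / η₂ := by positivity
  have hX1 : 0 < x₁ / η₁ := by positivity
  have hϑ1 := h.one_lt_left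
  rcases lt_or_ge x₁ x₂ with hx | hx
  · obtain ⟨c, hc, k1, k2⟩ := h.psi (Or.inl hψ) hx
    obtain ⟨k2, k3, k4⟩ := k2 hψ
    have hh := h.hat_lt (Or.inl hψ) hx
    refine ⟨?_, le_trans (mul_le_mul_of_nonneg_right (le_self_pow₀ hn1 (by norm_num)) hX2.le) hh.le⟩
    rcases k4 with k4 | k4
    · have a := mul_le_mul_of_nonneg_left k3 (show 0 ≤ n * (x₂ / η₂) by positivity)
      rw [k4] at k1
      linarith
    · rw [k4] at k1
      have a := mul_le_mul_of_nonneg_left k2 (show 0 ≤ ρ * (x₁ / η₁) by positivity)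
      have b : n ^ 2 * (n * (x₂ / η₂ * ϑ₂)) ≤ n ^ 2 * (ρ * (x₁ / η₁ * ϑ₁)) := by linarith
      exact le_of_mul_le_mul_left b (by positivity)
  · have a : x₂ / η₂ ≤ x₁ / η₁ := h.hat_right_le.trans (hx.trans h.le_hat_left)
    obtain ⟨r1, r2, r3⟩ := h.ρ_ge
    have b : ϑ₂ ≤ n ^ 2 * ϑ₁ := by
      have nu := h₁.nu_le h₂ hR hη₁ hη₂
      have hψ0 := h₁.ψ_ge
      have hnn : 1 ≤ n ^ 2 := one_le_pow₀ hn1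
      rcases le_total ϑ₂ 1 with c | c
      · nlinarith
      · have s1 : ψ₁ * (ϑ₂ - 1) * x₁ ≤ ψ₂ * (ϑ₂ - 1) * x₁ :=
          mul_le_mul_of_nonneg_right (mul_le_mul_of_nonneg_right hψ (by linarith)) hx1.le
        have s2 : n ^ 2 * (ψ₁ * (ϑ₁ - 1) * x₂) ≤ n ^ 2 * (ψ₁ * (ϑ₁ - 1) * x₁) :=
          mul_le_mul_of_nonneg_left (mul_le_mul_of_nonneg_left hx
            (mul_nonneg (by linarith) (by linarith))) (by positivity)
        have s3 : ψ₁ * x₁ * (ϑ₂ - 1) ≤ ψ₁ * x₁ * (n ^ 2 * (ϑ₁ - 1)) := by linarith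
        have := le_of_mul_le_mul_left s3 (mul_pos (by linarith) hx1)
        linarith
    constructor
    · calc n * (x₂ / η₂ * ϑ₂) ≤ n * (x₁ / η₁ * (n ^ 2 * ϑ₁)) := by gcongr
        _ = n ^ 3 * (x₁ / η₁ * ϑ₁) := by ring
        _ ≤ ρ * (x₁ / η₁ * ϑ₁) := by
          refine mul_le_mul_of_nonneg_right r3 (mul_pos hX1 (by linarith)).le
    · calc n * (x₂ / η₂) ≤ ρ * (x₁ / η₁) := mul_le_mul r1 a hX2.le (by linarith)

/-- The ratio of the values of `x ϑ ψ (ϑ - 1) / η ^ 2`. -/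
theorem weight_le (h : CellPair x₁ η₁ C₁ ψ₁ ϑ₁ x₂ η₂ C₂ ψ₂ ϑ₂ n ρ) (hψ : ψ₁ ≤ ψ₂) :
    x₂ / η₂ ^ 2 * ϑ₂ * (ψ₂ * (ϑ₂ - 1)) ≤ ρ ^ 2 * (x₁ / η₁ ^ 2 * ϑ₁ * (ψ₁ * (ϑ₁ - 1))) := by
  obtain ⟨h₁, h₂, hR, hn, hη₁, hη₂, hcr, hϑ⟩ := id h
  obtain ⟨k1, k2⟩ := h.hat_mul_le hψ
  have hx1 := h₁.x_pos
  have hx2 := h₂.x_pos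
  have hη1 := h₁.η_pos
  have hη2 := h₂.η_pos
  have hn0 : 0 < n := by linarith [hR.n_ge]
  have hρ0 := h.ρ_pos
  have nu := h₁.nu_le h₂ hR hη₁ hη₂
  have hϑ1 := h.one_lt_left
  have hψ0 := h₁.ψ_ge
  have hk : n ^ 2 * (x₂ ^ 2 / η₂ ^ 2 * ϑ₂) ≤ ρ ^ 2 * (x₁ ^ 2 / η₁ ^ 2 * ϑ₁) := by
    have := mul_le_mul k1 k2 (by positivity) (by positivity)
    calc _ = n * (x₂ / η₂ * ϑ₂) * (n * (x₂ / η₂)) := by ring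
      _ ≤ _ := this
      _ = _ := by ring
  have hN : 0 ≤ ψ₁ * (ϑ₁ - 1) := mul_nonneg (by linarith) (by linarith)
  refine le_of_mul_le_mul_right (a := x₁ * x₂) ?_ (by positivity)
  calc x₂ / η₂ ^ 2 * ϑ₂ * (ψ₂ * (ϑ₂ - 1)) * (x₁ * x₂)
      = x₂ ^ 2 / η₂ ^ 2 * ϑ₂ * (ψ₂ * (ϑ₂ - 1) * x₁) := by ring
    _ ≤ x₂ ^ 2 / η₂ ^ 2 * ϑ₂ * (n ^ 2 * (ψ₁ * (ϑ₁ - 1) * x₂)) :=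
        mul_le_mul_of_nonneg_left nu (by positivity)
    _ = n ^ 2 * (x₂ ^ 2 / η₂ ^ 2 * ϑ₂) * ((ψ₁ * (ϑ₁ - 1)) * x₂) := by ring
    _ ≤ ρ ^ 2 * (x₁ ^ 2 / η₁ ^ 2 * ϑ₁) * ((ψ₁ * (ϑ₁ - 1)) * x₂) :=
        mul_le_mul_of_nonneg_right hk (by positivity)
    _ = _ := by ring

end CellPair

end AnticipatoryTrading

namespace AnticipatoryTrading

/-- The polynomial `ϑ² - (1 - a²) (ϑ - 1)²` in `X = ϑ - 1`. -/
def quad (a X : ℝ) : ℝ := 1 + 2 * X + a ^ 2 * X ^ 2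

theorem quad_ge {a X : ℝ} : 1 + 2 * X ≤ quad a X := by
  unfold quad; nlinarith [sq_nonneg (a * X)]

theorem quad_le_quad {a X Y : ℝ} (ha : a ^ 2 ≤ 1) (hX : -1 ≤ X) (h : X ≤ Y) :
    quad a X ≤ quad a Y := by
  unfold quad
  have : 0 ≤ (Y - X) * (2 + a ^ 2 * (X + Y)) := by
    refine mul_nonneg (by linarith) ?_
    have := mul_le_mul_of_nonneg_left (show -2 ≤ X + Y by linarith) (sq_nonneg a)
    linarith
  linarith

theorem quad_scale {a X Y e n : ℝ} (hn : 1 ≤ n) (hX : 0 ≤ X) (h : X ≤ n ^ 2 * Y) (he : e ≤ 1) :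
    quad a X - e ≤ n ^ 4 * (quad a Y - e) := by
  have h2 : 1 ≤ n ^ 2 := one_le_pow₀ hn
  have h4 : n ^ 2 ≤ n ^ 4 := pow_le_pow_right₀ hn (by norm_num)
  have hY : 0 ≤ Y := by
    have : 0 < n ^ 2 := by positivity
    exact nonneg_of_mul_nonneg_right (hX.trans h) this
  unfold quad
  have a1 : X ^ 2 ≤ (n ^ 2 * Y) ^ 2 := pow_le_pow_left₀ hX h 2
  have a2 := mul_le_mul_of_nonneg_left a1 (sq_nonneg a)
  have a3 := mul_le_mul_of_nonneg_right h4 hY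
  have a4 : 0 ≤ (n ^ 4 - 1) * (1 - e) := mul_nonneg (by linarith) (by linarith)
  linarith

theorem quad_cross {a c e x₁ x₂ : ℝ} (ha : a ^ 2 ≤ 1) (hc : 0 < c) (he : e ≤ 1)
    (h1 : 0 < x₁) (hx : x₁ < x₂) (h2 : x₂ < 1) :
    x₁ * (1 + c * x₁) ^ 2 * (quad a (c * x₂) - e * x₂)
      ≤ x₂ * (1 + c * x₂) ^ 2 * (quad a (c * x₁) - e * x₁) := by
  have hp : 0 < c * x₁ := by positivity
  have hq : 0 < c * x₂ := mul_pos hc (by linarith)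
  have key : 0 ≤ (1 + c * x₁) ^ 2 * (1 + c * x₂) ^ 2
      - (1 - a ^ 2) * ((c * x₁) * (c * x₂)) * (c * x₁ * (c * x₂) - 1)
      - e * (x₁ * (c * x₂)) * (2 + c * x₁ + c * x₂) := by
    have e1 : e * (x₁ * (c * x₂)) * (2 + c * x₁ + c * x₂) ≤ c * x₂ * (2 + c * x₁ + c * x₂) := by
      refine mul_le_mul_of_nonneg_right ?_ (by linarith)
      have b1 : x₁ * (c * x₂) ≤ 1 * (c * x₂) := mul_le_mul_of_nonneg_right (by linarith) hq.le
      have b2 : e * (x₁ * (c * x₂)) ≤ 1 * (x₁ * (c * x₂)) :=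
        mul_le_mul_of_nonneg_right he (by positivity)
      linarith
    generalize c * x₁ = p at *
    generalize c * x₂ = q at *
    have e2 : (1 - a ^ 2) * (p * q) * (p * q - 1) ≤ (p * q) * (p * q) := by
      have s0 : 0 ≤ p * q := by positivity
      have : 0 ≤ (1 - a ^ 2) * (p * q) := mul_nonneg (by linarith) s0
      have : 0 ≤ a ^ 2 * (p * q * (p * q)) := by positivity
      linarith
    have e3 : 0 ≤ (1 + p) ^ 2 * (1 + q) ^ 2 - p * q * (p * q) - q * (2 + p + q) := by
      have : (1 + p) ^ 2 * (1 + q) ^ 2 - p * q * (p * q) - q * (2 + p + q)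
        = 1 + 2 * p + p ^ 2 + 3 * p * q + 2 * p ^ 2 * q + 2 * p * q ^ 2 := by ring
      rw [this]; positivity
    linarith
  have := mul_nonneg (sub_nonneg.2 hx.le) key
  unfold quad
  linarith

/-- The factor in `quad_cross` may be dropped in favour of small gains. -/
theorem quad_gain {a c e f x₁ x₂ : ℝ} (hx : x₁ < x₂)
    (hf : 0 ≤ 1 - a ^ 2 * (c * x₁ * (c * x₂)) + 2 * f * (quad a (c * x₁) - e * x₁)) :
    x₁ * (quad a (c * x₂) - e * x₂)
      ≤ (x₂ + 2 * f * (x₂ - x₁)) * (quad a (c * x₁) - e * x₁) := by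
  have := mul_nonneg (sub_nonneg.2 hx.le) hf
  unfold quad at *
  linarith

theorem Crit.mul_x_lt {x C c : ℝ} (h : Crit x C c) : c * x < 129 / 100 := by
  have := h.eq
  have h1 := h.x_lt
  have h2 : 0 < 2 * (1 - x) := by linarith
  have : 2 * (1 - x) * (c * x) < 2 * (1 - x) * (129 / 100) := by linarith
  exact lt_of_mul_lt_mul_left this h2.le

namespace CellPair

variable {x₁ η₁ C₁ ψ₁ ϑ₁ x₂ η₂ C₂ ψ₂ ϑ₂ n ρ : ℝ}

/-- Comparison of the variance terms. -/
theorem quad_le (h : CellPair x₁ η₁ C₁ ψ₁ ϑ₁ x₂ η₂ C₂ ψ₂ ϑ₂ n ρ) (hψ : ψ₁ ≤ ψ₂) {a e : ℝ}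
    (ha : a ^ 2 ≤ 1) (he : e ≤ 1) (hq : 0 ≤ quad a (ϑ₂ - 1) - e * x₂) :
    n * (x₂ / η₂ ^ 2 * (quad a (ϑ₂ - 1) - e * x₂))
      ≤ ρ ^ 2 * (x₁ / η₁ ^ 2 * (quad a (ϑ₁ - 1) - e * x₁)) := by
  obtain ⟨h₁, h₂, hR, hn, hη₁, hη₂, hcr, hϑ⟩ := id h
  have hx1 := h₁.x_pos
  have hx2 := h₂.x_pos
  have hη1 := h₁.η_pos
  have hη2 := h₂.η_pos
  have hn1 := hR.n_ge
  have hn0 : 0 < n := by linarith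
  have hρ0 := h.ρ_pos
  have hϑ1 := h.one_lt_left
  have hx1' := h.lt_one_left
  have hx2' := h.lt_one_right
  have hex : ∀ x : ℝ, 0 < x → x < 1 → e * x ≤ 1 := fun x h0 h1 => by nlinarith
  have hn4 : 1 ≤ n ^ 4 := one_le_pow₀ hn1
  rcases lt_or_ge x₁ x₂ with hx | hx
  · obtain ⟨c, hc, k1, k2⟩ := h.psi (Or.inl hψ) hx
    obtain ⟨k2, k3, k4⟩ := k2 hψ
    have cr := quad_cross ha hc he hx1 hx hx2'
    set β₁ := quad a (c * x₁) - e * x₁ with hβ₁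
    set β₂ := quad a (c * x₂) - e * x₂ with hβ₂
    set b₁ := quad a (ϑ₁ - 1) - e * x₁
    set b₂ := quad a (ϑ₂ - 1) - e * x₂
    have hβ1 : 0 < β₁ := by
      have := quad_ge (a := a) (X := c * x₁)
      have := hex x₁ hx1 hx1'
      have : 0 < c * x₁ := by positivity
      linarith
    have hb : b₂ * β₁ ≤ n ^ 4 * (b₁ * β₂) := by
      rcases k4 with k4 | k4
      · have e1 : b₁ = β₁ := by simp only [b₁, β₁]; congr 2; linarith
        rw [e1]
        have : b₂ ≤ n ^ 4 * β₂ := by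
          rcases le_total 1 ϑ₂ with hh | hh
          · refine quad_scale hn1 (by linarith) ?_ (hex x₂ hx2 hx2')
            have := h₂.le_mul_right hR hη₂ (P := 1) (ψ₁ := ψ₁) (c := C₁ / (2 * ψ₁)) (by linarith)
              (div_nonneg (by linarith [h₁.C_gt]) (by linarith [h₁.ψ_ge])) h₁.c_spec
            have hc' : c * x₁ = C₁ / (2 * ψ₁) * x₁ ∨ η₂ = 1 := by
              rcases hcr with rfl | rfl
              · exact Or.inr rfl
              · left; have := h₁.crit_ϑ; linarith
            rcases hc' with hc' | rfl
            · have : c = C₁ / (2 * ψ₁) := mul_right_cancel₀ hx1.ne' hc'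
              rw [this]; linarith
            · have : ϑ₂ ≤ n ^ 2 * (1 + c * x₂) := k3
              have nu := h₁.nu_le h₂ hR hη₁ hη₂
              have hψ0 := h₁.ψ_ge
              have e2 : ϑ₁ - 1 = c * x₁ := by linarith
              rw [e2] at nu
              have s1 : ψ₁ * (ϑ₂ - 1) * x₁ ≤ ψ₂ * (ϑ₂ - 1) * x₁ :=
                mul_le_mul_of_nonneg_right (mul_le_mul_of_nonneg_right hψ (by linarith)) hx1.le
              have s3 : ψ₁ * x₁ * (ϑ₂ - 1) ≤ ψ₁ * x₁ * (n ^ 2 * (c * x₂)) := by linarith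
              exact le_of_mul_le_mul_left s3 (mul_pos (by linarith) hx1)
          · have m1 : quad a (ϑ₂ - 1) ≤ quad a (c * x₂) :=
              quad_le_quad ha (by linarith) (by linarith [mul_pos hc hx2])
            have m2 : b₂ ≤ β₂ := by simp only [b₂, β₂]; linarith
            have m3 : 1 * β₂ ≤ n ^ 4 * β₂ := mul_le_mul_of_nonneg_right hn4 (hq.trans m2)
            linarith
        have := mul_le_mul_of_nonneg_right this hβ1.le
        linarith
      · have e1 : b₂ = β₂ := by simp only [b₂, β₂]; congr 2; linarith
        rw [e1]
        have : β₁ ≤ n ^ 4 * b₁ := by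
          refine quad_scale hn1 (by positivity) ?_ (hex x₁ hx1 hx1')
          have nu := h₁.nu_le h₂ hR hη₁ hη₂
          have hψ0 := h₁.ψ_ge
          have e2 : ϑ₂ - 1 = c * x₂ := by linarith
          rw [e2] at nu
          have hψ2 : 0 < ψ₂ := by linarith
          have s1 : ψ₁ * (ϑ₁ - 1) * x₂ ≤ ψ₂ * (ϑ₁ - 1) * x₂ :=
            mul_le_mul_of_nonneg_right (mul_le_mul_of_nonneg_right hψ (by linarith)) hx2.le
          have s2 := mul_le_mul_of_nonneg_left s1 (sq_nonneg n)
          have s3 : ψ₂ * x₂ * (c * x₁) ≤ ψ₂ * x₂ * (n ^ 2 * (ϑ₁ - 1)) := by linarith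
          exact le_of_mul_le_mul_left s3 (mul_pos hψ2 hx2)
        have := mul_le_mul_of_nonneg_left this (e1 ▸ hq)
        linarith
    have hβ2 : 0 ≤ b₁ * β₂ := by
      have : 0 ≤ n ^ 4 * (b₁ * β₂) := (mul_nonneg hq hβ1.le).trans hb
      exact nonneg_of_mul_nonneg_right this (by positivity)
    have hb1 : 0 ≤ b₁ := by
      have := quad_ge (a := a) (X := ϑ₁ - 1)
      have := hex x₁ hx1 hx1'
      simp only [b₁]; linarith
    -- square of the comparison
    have k1' := mul_le_mul k1 k1 (by positivity) (by positivity)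
    have hw : n ^ 2 ≤ n ^ 2 := le_rfl
    set X₂ := x₂ / η₂ with hX₂
    set X₁ := x₁ / η₁ with hX₁
    have hX2 : 0 < X₂ := by positivity
    have hX1 : 0 < X₁ := by positivity
    have g1 : n ^ 6 * (X₂ ^ 2 * (1 + c * x₂) ^ 2) ≤ ρ ^ 2 * (X₁ ^ 2 * (1 + c * x₁) ^ 2) := by
      linarith
    have g2 : n ^ 6 * (X₂ ^ 2 * (1 + c * x₂) ^ 2) * (b₂ * β₁ * x₁ * x₂)
        ≤ ρ ^ 2 * (X₁ ^ 2 * (1 + c * x₁) ^ 2) * (n ^ 4 * (b₁ * β₂) * x₁ * x₂) := by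
      refine mul_le_mul g1 ?_ ?_ (by positivity)
      · have := mul_le_mul_of_nonneg_right hb (mul_pos hx1 hx2).le
        linarith
      · have : 0 ≤ b₂ * β₁ := mul_nonneg hq hβ1.le
        positivity
    have g3 : ρ ^ 2 * X₁ ^ 2 * n ^ 4 * b₁ * x₂ * (x₁ * (1 + c * x₁) ^ 2 * β₂)
        ≤ ρ ^ 2 * X₁ ^ 2 * n ^ 4 * b₁ * x₂ * (x₂ * (1 + c * x₂) ^ 2 * β₁) :=
      mul_le_mul_of_nonneg_left cr (by positivity)
    have g4 : (n ^ 4 * (1 + c * x₂) ^ 2 * β₁ * x₂) * (n ^ 2 * X₂ ^ 2 * b₂ * x₁)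
        ≤ (n ^ 4 * (1 + c * x₂) ^ 2 * β₁ * x₂) * (ρ ^ 2 * X₁ ^ 2 * b₁ * x₂) := by
      linarith
    have g5 := le_of_mul_le_mul_left g4 (by positivity)
    refine le_of_mul_le_mul_right (a := x₁ * x₂) ?_ (by positivity)
    have g6 : n * (X₂ ^ 2 * b₂ * x₁) ≤ n ^ 2 * (X₂ ^ 2 * b₂ * x₁) :=
      mul_le_mul_of_nonneg_right (le_self_pow₀ hn1 (by norm_num)) (by positivity)
    calc n * (x₂ / η₂ ^ 2 * b₂) * (x₁ * x₂) = n * (X₂ ^ 2 * b₂ * x₁) := by rw [hX₂]; ring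
      _ ≤ ρ ^ 2 * X₁ ^ 2 * b₁ * x₂ := by linarith
      _ = _ := by rw [hX₁]; ring
  · -- `x₂ ≤ x₁`
    have nu := h₁.nu_le h₂ hR hη₁ hη₂
    have hψ2 : 0 < ψ₂ := by linarith [h₂.ψ_ge]
    have key : n ^ 4 * (x₂ * (quad a (ϑ₂ - 1) - e * x₂))
        ≤ ρ ^ 2 * (x₁ * (quad a (ϑ₁ - 1) - e * x₁)) := by
      have hr : n ^ 8 ≤ ρ ^ 2 := by
        have := pow_le_pow_left₀ (by positivity) hR.pow_le 2
        refine le_trans ?_ this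
        rw [← pow_mul]
        exact pow_le_pow_right₀ hn1 (by norm_num)
      have hb1 : 0 ≤ quad a (ϑ₁ - 1) - e * x₁ := by
        have := quad_ge (a := a) (X := ϑ₁ - 1)
        have := hex x₁ hx1 hx1'
        linarith
      have m : x₂ * (quad a (ϑ₂ - 1) - e * x₂)
          ≤ n ^ 4 * (x₁ * (quad a (ϑ₁ - 1) - e * x₁)) := by
        -- compare at `X = (ϑ₁ - 1) x₂ / x₁`
        have hY0 : 0 ≤ (ϑ₁ - 1) := by linarith
        have hY : x₂ * (ϑ₁ - 1) ≤ x₁ * (ϑ₁ - 1) := mul_le_mul_of_nonneg_right hx hY0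
        have hbase : quad a (ϑ₂ - 1) - e * x₂ ≤ n ^ 4 * (quad a ((ϑ₁ - 1) * x₂ / x₁) - e * x₂) := by
          rcases le_total 1 ϑ₂ with hh | hh
          · refine quad_scale hn1 (by linarith) ?_ (hex x₂ hx2 hx2')
            have s1 : ψ₂ * (ϑ₂ - 1) * x₁ ≤ n ^ 2 * (ψ₂ * (ϑ₁ - 1) * x₂) :=
              nu.trans (mul_le_mul_of_nonneg_left (mul_le_mul_of_nonneg_right
                (mul_le_mul_of_nonneg_right hψ hY0) hx2.le) (by positivity))
            rw [mul_div_assoc', le_div_iff₀ hx1]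
            have s3 : ψ₂ * ((ϑ₂ - 1) * x₁) ≤ ψ₂ * (n ^ 2 * ((ϑ₁ - 1) * x₂)) := by linarith
            exact le_of_mul_le_mul_left s3 hψ2
          · have m1 : quad a (ϑ₂ - 1) ≤ quad a ((ϑ₁ - 1) * x₂ / x₁) :=
              quad_le_quad ha (by linarith)
                ((show ϑ₂ - 1 ≤ 0 by linarith).trans (by positivity))
            have m3 : 1 * (quad a ((ϑ₁ - 1) * x₂ / x₁) - e * x₂)
                ≤ n ^ 4 * (quad a ((ϑ₁ - 1) * x₂ / x₁) - e * x₂) :=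
              mul_le_mul_of_nonneg_right hn4 (by linarith)
            linarith
        have hmono : x₂ * (quad a ((ϑ₁ - 1) * x₂ / x₁) - e * x₂)
            ≤ x₁ * (quad a (ϑ₁ - 1) - e * x₁) := by
          set l := (ϑ₁ - 1) / x₁ with hl
          have hl1 : ϑ₁ - 1 = l * x₁ := by rw [hl]; field_simp
          have hl0 : 1 / 2 ≤ l := by
            rw [hl, le_div_iff₀ hx1]
            have := h₁.mul_le_of_le hη₁
            have : ψ₁ * (ϑ₁ - 1) ≤ 1 * (ϑ₁ - 1) := mul_le_mul_of_nonneg_right h₁.ψ_le hY0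
            nlinarith [h₁.C_gt]
          rw [show (ϑ₁ - 1) * x₂ / x₁ = l * x₂ by rw [hl]; ring, hl1]
          unfold quad
          have s1 : 0 ≤ (x₁ - x₂) * (1 + (2 * l - e) * (x₁ + x₂)) :=
            mul_nonneg (by linarith) (by
              have : 0 ≤ (2 * l - e) * (x₁ + x₂) := mul_nonneg (by linarith) (by linarith)
              linarith)
          have s2 : 0 ≤ (x₁ - x₂) * (a ^ 2 * l ^ 2 * (x₁ ^ 2 + x₁ * x₂ + x₂ ^ 2)) :=
            mul_nonneg (by linarith) (by positivity)
          linarith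
        have := mul_le_mul_of_nonneg_left hbase hx2.le
        have := mul_le_mul_of_nonneg_left hmono (show 0 ≤ n ^ 4 by positivity)
        linarith
      have m2 := mul_le_mul_of_nonneg_left m (show 0 ≤ n ^ 4 by positivity)
      have m3 : n ^ 8 * (x₁ * (quad a (ϑ₁ - 1) - e * x₁))
          ≤ ρ ^ 2 * (x₁ * (quad a (ϑ₁ - 1) - e * x₁)) :=
        mul_le_mul_of_nonneg_right hr (mul_nonneg hx1.le hb1)
      linarith
    have f1 : x₂ / η₂ ^ 2 * (quad a (ϑ₂ - 1) - e * x₂) ≤ x₂ * (quad a (ϑ₂ - 1) - e * x₂) :=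
      mul_le_mul_of_nonneg_right (div_le_self hx2.le (one_le_pow₀ hη₂)) hq
    have f2 : x₁ * (quad a (ϑ₁ - 1) - e * x₁) ≤ x₁ / η₁ ^ 2 * (quad a (ϑ₁ - 1) - e * x₁) := by
      refine mul_le_mul_of_nonneg_right ?_ ?_
      · rw [le_div_iff₀ (by positivity)]
        exact mul_le_of_le_one_right hx1.le (pow_le_one₀ hη1.le hη₁)
      · have := quad_ge (a := a) (X := ϑ₁ - 1)
        have := hex x₁ hx1 hx1'
        linarith
    have f3 := mul_le_mul_of_nonneg_left f2 (sq_nonneg ρ)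
    have f4 := mul_le_mul_of_nonneg_left f1 hn0.le
    have f5 : n * (x₂ * (quad a (ϑ₂ - 1) - e * x₂)) ≤ n ^ 4 * (x₂ * (quad a (ϑ₂ - 1) - e * x₂)) :=
      mul_le_mul_of_nonneg_right (le_self_pow₀ hn1 (by norm_num)) (mul_nonneg hx2.le hq)
    linarith

end CellPair

end AnticipatoryTrading

namespace AnticipatoryTrading

theorem gain_left_aux {A p q d : ℝ} (hA : A ≤ 1) (hp : 0 < p) (hpq : p < q) (hq : q < 129 / 100)
    (hd : d ≤ 641 / 1000) : 0 ≤ 1 - A * (p * q) + 2 * (1 / 10) * (1 + 2 * p + A * p ^ 2 - d) := by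
  have a1 : A * (p * (q - p / 5)) ≤ 1 * (p * (q - p / 5)) :=
    mul_le_mul_of_nonneg_right hA (mul_nonneg hp.le (by linarith))
  have a2 : p * (q - p / 5) ≤ p * (129 / 100 - p / 5) :=
    mul_le_mul_of_nonneg_left (by linarith) hp.le
  linarith only [a1, a2, hd, sq_nonneg (p - 89 / 40)]

theorem gain_right_aux {A p q d : ℝ} (hA : A ≤ 1) (hp : 0 < p) (hpq : p < q) (hq : q ≤ 2)
    (hd : d ≤ 641 / 1000) : 0 ≤ 1 - A * (p * q) + 2 * (1 / 4) * (1 + 2 * p + A * p ^ 2 - d) := by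
  have a1 : A * (p * (q - p / 2)) ≤ 1 * (p * (q - p / 2)) :=
    mul_le_mul_of_nonneg_right hA (mul_nonneg hp.le (by linarith))
  have a2 : p * (q - p / 2) ≤ p * (2 - p / 2) :=
    mul_le_mul_of_nonneg_left (by linarith) hp.le
  linarith only [a1, a2, hd, sq_nonneg (p - 1)]

/-- Below `11 / 20` the slope of a critical state is small. -/
theorem Crit.sq_mul_le {x C c : ℝ} (h : Crit x C c) (hx : x < 11 / 20) : c * x * c ≤ 1 := by
  have e1 := h.eq
  have h0 := h.x_gt
  have hc0 := h.c_gt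
  have hp : c * x ≤ 73 / 100 := by nlinarith
  have hc : c ≤ 132 / 100 := by
    by_contra! hc
    have : 132 / 100 * (2 * x * (1 - x)) < c * (2 * x * (1 - x)) :=
      mul_lt_mul_of_pos_right hc (by nlinarith)
    linarith [mul_pos (sub_pos.2 h0) (sub_pos.2 hx)]
  have := mul_le_mul hp hc (by linarith) (by norm_num)
  linarith

namespace CellPair

variable {x₁ η₁ C₁ ψ₁ ϑ₁ x₂ η₂ C₂ ψ₂ ϑ₂ n ρ : ℝ}

set_option maxHeartbeats 1000000 in
/-- Comparison of the variance terms, weighted by `ϑ²`, if `ϑ₁ < ϑ₂`. -/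
theorem quad_mul_le (h : CellPair x₁ η₁ C₁ ψ₁ ϑ₁ x₂ η₂ C₂ ψ₂ ϑ₂ 1 1) (hψ : ψ₁ ≤ ψ₂)
    (hϑ : ϑ₁ < ϑ₂) {a e : ℝ} (ha : a ^ 2 ≤ 1) (he : e ≤ 1) :
    x₂ / η₂ ^ 2 * (ϑ₂ ^ 2 * (quad a (ϑ₂ - 1) - e * x₂))
      ≤ x₁ / η₁ ^ 2 * (ϑ₁ ^ 2 * (quad a (ϑ₁ - 1) - e * x₁)) := by
  obtain ⟨h₁, h₂, hR, hn, hη₁, hη₂, hcr, hϑ0⟩ := id h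
  have hx1 := h₁.x_pos
  have hx2 := h₂.x_pos
  have hη1 := h₁.η_pos
  have hη2 := h₂.η_pos
  have hϑ1 := h.one_lt_left
  have hx1' := h.lt_one_left
  have hx2' := h.lt_one_right
  have hψ1 := h₁.ψ_ge
  have hψ2 := h₂.ψ_ge
  have nu := h₁.nu_le h₂ hR hη₁ hη₂
  have hx : x₁ < x₂ := by
    by_contra! hx
    have s1 : ψ₂ * (ϑ₁ - 1) * x₁ < ψ₂ * (ϑ₂ - 1) * x₁ := by
      refine mul_lt_mul_of_pos_right (mul_lt_mul_of_pos_left (by linarith) (by linarith)) hx1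
    have s2 : ψ₁ * (ϑ₁ - 1) * x₂ ≤ ψ₂ * (ϑ₁ - 1) * x₁ := by
      refine mul_le_mul (mul_le_mul_of_nonneg_right hψ (by linarith)) hx hx2.le ?_
      exact mul_nonneg (by linarith) (by linarith)
    linarith
  have hex1 : e * x₁ ≤ 1 := mul_le_one₀ he hx1.le hx1'.le
  have hex2 : e * x₂ ≤ 1 := mul_le_one₀ he hx2.le hx2'.le
  set τ := (x₂ - x₁) / x₂ with hτ
  have hτ0 : 0 < τ := div_pos (by linarith) hx2
  have hτx : τ * x₂ = x₂ - x₁ := by rw [hτ]; field_simp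
  -- reduction to a comparison with a gain `f`
  suffices hs : ∃ c f β₁ β₂ : ℝ, 0 < c ∧ 0 ≤ f ∧ 0 ≤ β₁ ∧ 0 ≤ β₂ ∧
      β₁ = quad a (c * x₁) - e * x₁ ∧ β₂ = quad a (c * x₂) - e * x₂ ∧
      0 ≤ 1 - a ^ 2 * (c * x₁ * (c * x₂)) + 2 * f * β₁ ∧
      x₂ / η₂ * (1 + c * x₂) * (1 + f * τ) ≤ x₁ / η₁ * (1 + c * x₁) ∧
      ϑ₂ ^ 2 * (quad a (ϑ₂ - 1) - e * x₂) ≤ (1 + c * x₂) ^ 2 * β₂ ∧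
      (1 + c * x₁) ^ 2 * β₁ ≤ ϑ₁ ^ 2 * (quad a (ϑ₁ - 1) - e * x₁) by
    obtain ⟨c, f, β₁, β₂, hc, hf, hβ1, hβ2, e1, e2, k1, k2, k3, k4⟩ := hs
    have g := quad_gain (e := e) (f := f) hx (by rw [← e1]; exact k1)
    rw [← e1, ← e2] at g
    have g2 := mul_le_mul k2 k2 (by positivity) (by positivity)
    have g3 : 1 + 2 * f * τ ≤ (1 + f * τ) ^ 2 := by linarith only [sq_nonneg (f * τ)]
    have g4 : x₁ * β₂ ≤ x₂ * (1 + f * τ) ^ 2 * β₁ := by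
      refine g.trans (mul_le_mul_of_nonneg_right ?_ hβ1)
      have := mul_le_mul_of_nonneg_left g3 hx2.le
      have e3 : x₂ * (1 + 2 * f * τ) = x₂ + 2 * f * (τ * x₂) := by ring
      rw [hτx] at e3
      linarith
    set X₂ := x₂ / η₂ with hX₂
    set X₁ := x₁ / η₁ with hX₁
    have hX2 : 0 < X₂ := by positivity
    have hX1 : 0 < X₁ := by positivity
    have m1 := mul_le_mul_of_nonneg_left k3 (show 0 ≤ x₂ / η₂ ^ 2 by positivity)
    have m2 := mul_le_mul_of_nonneg_left k4 (show 0 ≤ x₁ / η₁ ^ 2 by positivity)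
    refine m1.trans (le_trans ?_ m2)
    refine le_of_mul_le_mul_right (a := x₁ * x₂) ?_ (by positivity)
    calc x₂ / η₂ ^ 2 * ((1 + c * x₂) ^ 2 * β₂) * (x₁ * x₂)
        = X₂ ^ 2 * (1 + c * x₂) ^ 2 * (x₁ * β₂) := by rw [hX₂]; ring
      _ ≤ X₂ ^ 2 * (1 + c * x₂) ^ 2 * (x₂ * (1 + f * τ) ^ 2 * β₁) :=
          mul_le_mul_of_nonneg_left g4 (by positivity)
      _ = X₂ * (1 + c * x₂) * (1 + f * τ) * (X₂ * (1 + c * x₂) * (1 + f * τ)) * (x₂ * β₁) := by ring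
      _ ≤ X₁ * (1 + c * x₁) * (X₁ * (1 + c * x₁)) * (x₂ * β₁) :=
          mul_le_mul_of_nonneg_right g2 (by positivity)
      _ = _ := by rw [hX₁]; ring
  rcases hcr with rfl | rfl
  · have hcr := h₂.crit
    have eϑ := h₂.crit_ϑ
    have es := h₂.c_spec
    set c := C₂ / (2 * ψ₂)
    have hc0 : 0 < c := by linarith [hcr.c_gt]
    have hcx1 : 0 < c * x₁ := by positivity
    have hcx2 : c * x₁ < c * x₂ := mul_lt_mul_of_pos_left hx hc0
    have key := h₁.psi_left h₂ hcr hR hη₁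
      (h₁.mul_le_cube hR hη₁ (by linarith) hψ es hc0) hx
    have hX1 : c * x₁ ≤ ϑ₁ - 1 := by
      have := h₁.mul_le_left hR hη₁ (by linarith) (P := 1) (by linarith) es
      linarith
    have q1 := quad_ge (a := a) (X := c * x₁)
    have q2 := quad_ge (a := a) (X := c * x₂)
    refine ⟨c, 1 / 10, _, _, hc0, by norm_num, ?_, ?_, rfl, rfl, ?_, ?_, ?_, ?_⟩
    · linarith
    · linarith
    · have p2 := hcr.mul_x_lt
      have hx2s := hcr.x_lt
      have he1 : e * x₁ ≤ 641 / 1000 := by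
          linarith only [mul_le_mul_of_nonneg_right he hx1.le, hx, hx2s]
      exact gain_left_aux ha hcx1 hcx2 p2 he1
    · rw [div_one]
      rw [one_pow, one_mul, one_mul] at key
      refine le_trans (le_of_eq_of_le (by ring) (mul_le_mul_of_nonneg_left (a := x₂)
        (b := (1 + c * x₂) * (1 + τ / 10)) ?_ hx2.le)) key
      have : τ / 10 * (1 + c * x₂) ≤ τ / 10 * (1 + c * (x₁ + x₂)) :=
        mul_le_mul_of_nonneg_left (by linarith) (by positivity)
      have e1 : (x₂ - x₁) / (10 * x₂) = τ / 10 := by rw [hτ]; field_simp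
      rw [e1]; linarith
    · rw [show ϑ₂ - 1 = c * x₂ by linarith, eϑ]
    · have m := quad_le_quad ha (show -1 ≤ c * x₁ by linarith) hX1
      refine mul_le_mul ?_ (by linarith) (by linarith) (sq_nonneg _)
      exact pow_le_pow_left₀ (by linarith) (by linarith) 2
  · have hcr := h₁.crit
    have eϑ := h₁.crit_ϑ
    have es := h₁.c_spec
    set c := C₁ / (2 * ψ₁)
    have hc0 : 0 < c := by linarith [hcr.c_gt]
    have hc2 : c < 2 := by linarith [hcr.c_le, hcr.C_lt]
    have hcx1 : 0 < c * x₁ := by positivity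
    have hcx2 : c * x₁ < c * x₂ := mul_lt_mul_of_pos_left hx hc0
    have hX3 := h₂.le_mul_cube hR hη₂ hψ hc0 es
    have hX2 : ϑ₂ - 1 ≤ c * x₂ := by linarith
    have q1 := quad_ge (a := a) (X := c * x₁)
    have q2 := quad_ge (a := a) (X := c * x₂)
    have b3 : ϑ₂ ^ 2 * (quad a (ϑ₂ - 1) - e * x₂) ≤ (1 + c * x₂) ^ 2 * (quad a (c * x₂) - e * x₂) := by
      have m := quad_le_quad ha (show -1 ≤ ϑ₂ - 1 by linarith) hX2
      have m' := quad_ge (a := a) (X := ϑ₂ - 1)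
      refine mul_le_mul ?_ (by linarith) (by linarith) (sq_nonneg _)
      exact pow_le_pow_left₀ (by linarith) (by linarith) 2
    have b4 : (1 + c * x₁) ^ 2 * (quad a (c * x₁) - e * x₁)
        ≤ ϑ₁ ^ 2 * (quad a (ϑ₁ - 1) - e * x₁) := by
      rw [show ϑ₁ - 1 = c * x₁ by linarith, eϑ]
    by_cases hpq : c * x₁ * (c * x₂) ≤ 1
    · have key := h₁.psi_right h₂ hcr hR hn hη₂ hX3 hx hx2'
      refine ⟨c, 0, _, _, hc0, le_rfl, ?_, ?_, rfl, rfl, ?_, ?_, b3, b4⟩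
      · linarith
      · linarith
      · have : a ^ 2 * (c * x₁ * (c * x₂)) ≤ 1 * (c * x₁ * (c * x₂)) :=
          mul_le_mul_of_nonneg_right ha (by positivity)
        linarith
      · rw [div_one]; linarith
    · have hx11 : 11 / 20 ≤ x₁ := by
        by_contra! hlt
        apply hpq
        have s1 : c * x₁ * (c * x₂) ≤ c * x₁ * c :=
          mul_le_mul_of_nonneg_left (mul_le_of_le_one_right hc0.le hx2'.le) hcx1.le
        exact s1.trans (hcr.sq_mul_le hlt)
      have key := h₁.psi_right_of_factor h₂ hcr hR hn hη₂ hX3 hx hx2' (f := 5 / 4) (by norm_num) (by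
        have := hcr.right_aux' hx11 hx.le hx2'.le; linarith)
      refine ⟨c, 1 / 4, _, _, hc0, by norm_num, ?_, ?_, rfl, rfl, ?_, ?_, b3, b4⟩
      · linarith
      · linarith
      · have hx2s := hcr.x_lt
        have he1 : e * x₁ ≤ 641 / 1000 := by
          linarith only [mul_le_mul_of_nonneg_right he hx1.le, hx, hx2s]
        have hq2 : c * x₂ ≤ 2 := by linarith only [mul_le_mul_of_nonneg_left hx2'.le hc0.le, hc2]
        exact gain_right_aux ha hcx1 hcx2 hq2 he1
      · rw [div_one]
        rw [one_pow, one_mul, one_mul] at key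
        refine le_trans (le_of_eq_of_le (by ring) (mul_le_mul_of_nonneg_left (a := x₂ / η₂)
          (b := (1 + c * x₂) * (1 + τ / 4)) ?_ (by positivity))) key
        have : τ / 4 * (1 + c * x₂) ≤ τ / 4 * (1 + c * (x₁ + x₂)) :=
          mul_le_mul_of_nonneg_left (by linarith) (by positivity)
        have e1 : (5 / 4 - 1) * (x₂ - x₁) / x₂ = τ / 4 := by rw [hτ]; ring
        rw [e1]; linarith

end CellPair

end AnticipatoryTrading

namespace AnticipatoryTrading

/-- The critical value of `x` for a given `X = ϑ - 1`. -/
noncomputable def env (X : ℝ) : ℝ := (1 + 2 * X) / (3 + 2 * X)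

theorem env_eq {X : ℝ} (hX : 0 < X) : 2 * (1 - env X) * (1 + X) = 1 + env X := by
  unfold env; field_simp; ring

theorem env_pos {X : ℝ} (hX : 0 < X) : 0 < env X := by unfold env; positivity

theorem env_lt {X : ℝ} (hX : 0 < X) : env X < 1 := by
  unfold env; rw [div_lt_one (by positivity)]; linarith

theorem env_le {X : ℝ} (hX : 0 < X) : 2 * env X ≤ 1 + 2 * X := by
  unfold env; rw [mul_div_assoc', div_le_iff₀ (by positivity)]; nlinarith

theorem eq_env {x X : ℝ} (hX : 0 < X) (h : 2 * (1 - x) * (1 + X) = 1 + x) : x = env X := by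
  unfold env; rw [eq_div_iff (by positivity)]; linarith

theorem poly_pos {X σ : ℝ} (hX : 207 / 1000 ≤ X) (hσ0 : 0 ≤ σ)
    (hσ : 1 + 2 * X ≤ (1 + σ) * X * (3 + 2 * X)) :
    0 ≤ 2 * X * (1 + X) * (1 + 2 * X) * (3 + 2 * X) - (1 + X) ^ 2 * (1 + 2 * X) * (3 + 2 * X)
      + 73 / 20 * X * (1 + X) ^ 2 * (3 + 2 * X) - 2 * X * (1 + X) ^ 2 * (1 + 2 * X)
      + 2 * σ * X * (1 + 2 * X) * (3 + 2 * X) := by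
  have h0 : 0 < X := by linarith
  rcases le_total (1 / 2) X with h | h
  · have h1 : 0 ≤ 2 * σ * X * (1 + 2 * X) * (3 + 2 * X) := by positivity
    obtain ⟨d, rfl⟩ : ∃ d, X = 1 / 2 + d := ⟨X - 1 / 2, by ring⟩
    have hd : 0 ≤ d := by linarith
    refine add_nonneg ?_ h1
    ring_nf
    positivity
  · have h1 : 2 * ((1 + 2 * X) - X * (3 + 2 * X)) * (1 + 2 * X)
        ≤ 2 * σ * X * (1 + 2 * X) * (3 + 2 * X) := by
      have := mul_le_mul_of_nonneg_right hσ (show 0 ≤ 2 * (1 + 2 * X) by positivity)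
      linarith
    have h2 : 0 ≤ 2 * X * (1 + X) * (1 + 2 * X) * (3 + 2 * X) - (1 + X) ^ 2 * (1 + 2 * X) * (3 + 2 * X)
      + 73 / 20 * X * (1 + X) ^ 2 * (3 + 2 * X) - 2 * X * (1 + X) ^ 2 * (1 + 2 * X)
      + 2 * ((1 + 2 * X) - X * (3 + 2 * X)) * (1 + 2 * X) := by
      obtain ⟨d, rfl⟩ : ∃ d, X = 207 / 1000 + d := ⟨X - 207 / 1000, by ring⟩
      have hd : 0 ≤ d := by linarith
      ring_nf
      nlinarith [pow_nonneg hd 3, pow_nonneg hd 4]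
    linarith

/-- The envelope of the variance terms. -/
noncomputable def envG (a e X : ℝ) : ℝ :=
  env X * (quad a X - e * env X) * (1 + X) ^ 4 / (X * (1 + a * X) ^ 2)

theorem envG_mono {σ e X Y : ℝ} (hσ : 0 ≤ σ) (hσ' : σ ≤ 1) (he : 0 ≤ e) (he1 : e ≤ 1)
    (hX : 0 < X) (hXY : X ≤ Y) (hX' : env X ≤ (1 + σ) * X) :
    envG (1 - σ) e X ≤ envG (1 - σ) e Y := by
  set a := 1 - σ with ha
  have ha0 : 0 ≤ a := by linarith
  have hX2 : 1 + 2 * X ≤ (1 + σ) * X * (3 + 2 * X) := by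
    unfold env at hX'; rwa [div_le_iff₀ (by positivity)] at hX'
  have hX3 : 207 / 1000 ≤ X := by
    have : (1 + σ) * (X * (3 + 2 * X)) ≤ 2 * (X * (3 + 2 * X)) :=
      mul_le_mul_of_nonneg_right (by linarith) (by positivity)
    by_contra! hlt
    nlinarith
  set L : ℝ → ℝ := fun z => 4 * Real.log (1 + z) + Real.log (1 + 2 * z)
    + Real.log (quad a z * (3 + 2 * z) - e * (1 + 2 * z)) - 2 * Real.log (3 + 2 * z) - Real.log z
    - 2 * Real.log (1 + a * z) with hL
  have hJ : ∀ z, 0 < z → 0 < quad a z * (3 + 2 * z) - e * (1 + 2 * z) := fun z hz => by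
    have h1 := mul_le_mul_of_nonneg_right (quad_ge (a := a) (X := z))
      (show 0 ≤ 3 + 2 * z by positivity)
    have h2 := mul_le_mul_of_nonneg_right he1 (show 0 ≤ 1 + 2 * z by positivity)
    nlinarith
  have hlog : ∀ z, 0 < z → envG a e z = Real.exp (L z) := fun z hz => by
    have hJz := hJ z hz
    have : envG a e z = (1 + 2 * z) * (quad a z * (3 + 2 * z) - e * (1 + 2 * z)) * (1 + z) ^ 4
        / ((3 + 2 * z) ^ 2 * z * (1 + a * z) ^ 2) := by
      unfold envG env; field_simp
    have hpos : 0 < envG a e z := by rw [this]; positivity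
    rw [← Real.exp_log hpos, this, Real.log_div (by positivity) (by positivity),
      Real.log_mul (by positivity) (by positivity), Real.log_mul (by positivity) hJz.ne',
      Real.log_mul (by positivity) (by positivity), Real.log_mul (by positivity) (by positivity),
      Real.log_pow, Real.log_pow, Real.log_pow]
    congr 1
    simp only [hL]
    push_cast
    ring
  rw [hlog X hX, hlog Y (by linarith), Real.exp_le_exp]
  have hder : ∀ z, 0 < z → HasDerivAt L (4 * (1 / (1 + z)) + 2 / (1 + 2 * z)
      + ((2 + 2 * a ^ 2 * z) * (3 + 2 * z) + quad a z * 2 - e * 2)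
        / (quad a z * (3 + 2 * z) - e * (1 + 2 * z)) - 2 * (2 / (3 + 2 * z)) - 1 / z
      - 2 * (a / (1 + a * z))) z := fun z hz => by
    have d0 := hasDerivAt_id' z
    have d1 : HasDerivAt (fun y => 1 + y) 1 z := d0.const_add 1
    have dc : ∀ k c : ℝ, HasDerivAt (fun y => c + k * y) k z := fun k c => by
      simpa using (d0.const_mul k).const_add c
    have dq : HasDerivAt (fun y => quad a y) (2 + 2 * a ^ 2 * z) z := by
      have := ((dc 2 1).add ((d0.pow 2).const_mul (a ^ 2)))
      refine this.congr_deriv ?_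
      simp; ring
    have hJz := hJ z hz
    exact ((((((d1.log (by positivity)).const_mul 4).add ((dc 2 1).log (by positivity))).add
      (((dq.mul (dc 2 3)).sub ((dc 2 1).const_mul e)).log hJz.ne')).sub
      (((dc 2 3).log (by positivity)).const_mul 2)).sub (d0.log hz.ne')).sub
      (((dc a 1).log (by positivity)).const_mul 2)
  refine monotoneOn_of_deriv_nonneg (convex_Icc X Y) ?_ ?_ ?_ (Set.left_mem_Icc.2 hXY)
    (Set.right_mem_Icc.2 hXY) hXY
  · exact fun z hz => (hder z (hX.trans_le hz.1)).continuousAt.continuousWithinAt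
  · rw [interior_Icc]
    exact fun z hz => (hder z (hX.trans hz.1)).differentiableAt.differentiableWithinAt
  · rw [interior_Icc]
    intro z hz
    have hz0 : 0 < z := hX.trans hz.1
    rw [(hder z hz0).deriv]
    have hJz := hJ z hz0
    have hz3 : 207 / 1000 ≤ z := hX3.trans hz.1.le
    have e1 : 2 / (3 + 2 * z) + 33 / 20 / (1 + 2 * z)
        ≤ ((2 + 2 * a ^ 2 * z) * (3 + 2 * z) + quad a z * 2 - e * 2)
        / (quad a z * (3 + 2 * z) - e * (1 + 2 * z)) := by
      rw [div_add_div _ _ (by positivity) (by positivity), div_le_div_iff₀ (by positivity) hJz]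
      have k2 : 0 ≤ (2 + 2 * a ^ 2 * z) * (1 + 2 * z) - 33 / 20 * quad a z - 7 / 20 * (1 + 2 * z) := by
        have : (2 + 2 * a ^ 2 * z) * (1 + 2 * z) - 33 / 20 * quad a z - 7 / 20 * (1 + 2 * z)
          = a ^ 2 * (2 * z + (47 / 20) * z ^ 2) := by unfold quad; ring
        rw [this]; positivity
      have k3 : 4 * e ≤ 7 / 20 * (3 + 2 * z) ^ 2 + 33 / 20 * (3 + 2 * z) * e := by nlinarith
      have k4 := mul_le_mul_of_nonneg_right k2 (show 0 ≤ (3 + 2 * z) ^ 2 by positivity)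
      have k5 := mul_le_mul_of_nonneg_right k3 (show 0 ≤ 1 + 2 * z by positivity)
      linarith
    have e2 : a / (1 + a * z) ≤ 1 / (1 + z) - σ / (1 + z) ^ 2 := by
      have hs : σ = 1 - a := by linarith
      rw [div_sub_div _ _ (by positivity) (by positivity), div_le_div_iff₀ (by positivity)
        (by positivity), hs]
      have : 0 ≤ (1 - a) ^ 2 * z * (1 + z) := mul_nonneg (mul_nonneg (sq_nonneg _) hz0.le) (by linarith)
      linarith
    have e3 : 0 ≤ 2 / (1 + z) - 1 / z + 73 / 20 / (1 + 2 * z) - 2 / (3 + 2 * z)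
        + 2 * σ / (1 + z) ^ 2 := by
      have := poly_pos hz3 hσ (by
        have hb : 0 ≤ (z - X) * (2 * (1 + σ) * (X + z) + 3 * (1 + σ) - 2) :=
          mul_nonneg (by linarith [hz.1]) (by nlinarith)
        linarith)
      have h2 : 2 / (1 + z) - 1 / z + 73 / 20 / (1 + 2 * z) - 2 / (3 + 2 * z)
        + 2 * σ / (1 + z) ^ 2 = (2 * z * (1 + z) * (1 + 2 * z) * (3 + 2 * z) - (1 + z) ^ 2 * (1 + 2 * z) * (3 + 2 * z)
      + 73 / 20 * z * (1 + z) ^ 2 * (3 + 2 * z) - 2 * z * (1 + z) ^ 2 * (1 + 2 * z)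
      + 2 * σ * z * (1 + 2 * z) * (3 + 2 * z)) / (z * (1 + z) ^ 2 * (1 + 2 * z) * (3 + 2 * z)) := by
        field_simp
      rw [h2]; positivity
    have e4 : 73 / 20 / (1 + 2 * z) = 2 / (1 + 2 * z) + 33 / 20 / (1 + 2 * z) := by ring
    have e5 : 2 * σ / (1 + z) ^ 2 = 2 * (σ / (1 + z) ^ 2) := by ring
    have e6 : 2 / (1 + z) = 2 * (1 / (1 + z)) := by ring
    have e7 : 2 * (2 / (3 + 2 * z)) = 2 / (3 + 2 * z) + 2 / (3 + 2 * z) := by ring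
    rw [e4, e5, e6] at e3
    rw [e7]
    linarith

end AnticipatoryTrading

namespace AnticipatoryTrading

theorem Cell.env_le_mul {x η C ψ ϑ σ e : ℝ} (h : Cell x η C ψ ϑ) (hη : η ≤ 1) (hϑ : 1 < ϑ)
    (hσ : 0 ≤ σ) (hσ' : σ ≤ 1) (he : e * (1 + σ) = 2 * σ) (hψ : 2 * ψ ≤ 1 + σ) :
    env (ϑ - 1) * (quad (1 - σ) (ϑ - 1) - e * env (ϑ - 1))
      ≤ x / η ^ 2 * (quad (1 - σ) (ϑ - 1) - e * x) := by
  have hx1 := h.lt_one_of_le hη (by linarith)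
  have hb := h.mul_le_of_le hη
  obtain ⟨hx, hη0, hC, hC', -, -, hX, -⟩ := h
  have hX0 : 0 < ϑ - 1 := by linarith
  have q0 := quad_ge (a := 1 - σ) (X := ϑ - 1)
  have e0 := env_eq hX0
  have e1 := env_pos hX0
  have e2 := env_lt hX0
  set z := env (ϑ - 1)
  set b := quad (1 - σ) (ϑ - 1)
  have he0 : 0 ≤ e := by
    by_contra! hlt
    nlinarith
  have he1 : e ≤ 1 := by
    by_contra! hlt
    nlinarith
  have hez : e * z ≤ 1 := by nlinarith
  have hex : e * x ≤ 1 := by nlinarith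
  rcases le_total z x with hzx | hzx
  · have hxX : x ≤ (1 + σ) * (ϑ - 1) := by
      have := mul_le_mul_of_nonneg_right hψ hX0.le
      nlinarith
    have hexX : e * x ≤ 2 * (ϑ - 1) := by
      have s := mul_le_mul_of_nonneg_left hxX he0
      have : e * ((1 + σ) * (ϑ - 1)) = 2 * σ * (ϑ - 1) := by rw [← he]; ring
      nlinarith
    have s1 : 0 ≤ (x - z) * (b - e * x - e * z) := mul_nonneg (by linarith) (by linarith)
    have s2 : x * (b - e * x) ≤ x / η ^ 2 * (b - e * x) := by
      refine mul_le_mul_of_nonneg_right ?_ (by linarith)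
      rw [le_div_iff₀ (by positivity)]
      exact mul_le_of_le_one_right hx.le (pow_le_one₀ hη0.le hη)
    linarith
  · have hq : C * (2 - C) ≤ 1 := by nlinarith [sq_nonneg (C - 1)]
    have hxX : x ≤ x / η := by rw [le_div_iff₀ hη0]; nlinarith
    have hzX : z ≤ x / η := by
      by_contra! hlt
      have s1 : C * (2 - C) * (x / η - x) ≤ 1 * (x / η - x) :=
        mul_le_mul_of_nonneg_right hq (by linarith)
      have s2 : 0 ≤ (1 - η) * (C - 1) := mul_nonneg (by linarith) (by linarith)
      have s3 : 2 * (1 - x) * ϑ < (1 + x) * (1 + z - x) := by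
        rw [hX]; exact mul_lt_mul_of_pos_left (by linarith) (by linarith)
      have s4 := mul_lt_mul_of_pos_right s3 (show 0 < 1 - z by linarith)
      have s5 : 2 * (1 - x) * ϑ * (1 - z) = (1 - x) * (1 + z) := by
        linear_combination (1 - x) * e0
      have s6 : 0 ≤ (z - x) * (2 - (1 + x) * (1 - z)) := mul_nonneg (by linarith) (by nlinarith)
      linarith
    have s1 : z ≤ x / η ^ 2 := by
      have : z * x ≤ x / η * (x / η) := mul_le_mul hzX hxX hx.le (by positivity)
      refine le_of_mul_le_mul_right (a := x) ?_ hx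
      calc z * x ≤ x / η * (x / η) := this
        _ = _ := by ring
    have s2 : b - e * z ≤ b - e * x := by nlinarith
    exact mul_le_mul s1 s2 (by linarith) (by positivity)

theorem Cell.mul_le_env {x η C ψ ϑ a e : ℝ} (h : Cell x η C ψ ϑ) (hη : 1 ≤ η) (hϑ : 1 < ϑ)
    (he0 : 0 ≤ e) (he1 : e ≤ 1) :
    x / η ^ 2 * (quad a (ϑ - 1) - e * x)
      ≤ env (ϑ - 1) * (quad a (ϑ - 1) - e * env (ϑ - 1)) := by
  have hx1 := h.lt_one_of_ge hη (by linarith)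
  obtain ⟨hx, hη0, hC, hC', -, -, hX, -⟩ := h
  have hX0 : 0 < ϑ - 1 := by linarith
  have q0 := quad_ge (a := a) (X := ϑ - 1)
  have e0 := env_eq hX0
  have e1 := env_pos hX0
  have e2 := env_lt hX0
  have e3 := env_le hX0
  set z := env (ϑ - 1)
  set b := quad a (ϑ - 1)
  have hex : e * x ≤ 1 := by nlinarith
  rcases le_total x z with hzx | hzx
  · have hez : e * (x + z) ≤ 1 * (x + z) := mul_le_mul_of_nonneg_right he1 (by linarith)
    have s1 : 0 ≤ (z - x) * (b - e * (x + z)) := mul_nonneg (by linarith) (by linarith)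
    have s2 : x / η ^ 2 * (b - e * x) ≤ x * (b - e * x) :=
      mul_le_mul_of_nonneg_right (div_le_self hx.le (one_le_pow₀ hη)) (by linarith)
    linarith
  · have hq : C * (2 - C) ≤ 1 := by nlinarith [sq_nonneg (C - 1)]
    have hxX : x / η ≤ x := div_le_self hx.le hη
    have hX0 : 0 < x / η := by positivity
    have hzX : x / η ≤ z := by
      by_contra! hlt
      have s1 : C * (2 - C) * (x - x / η) ≤ 1 * (x - x / η) :=
        mul_le_mul_of_nonneg_right hq (by linarith)
      have s2 : 0 ≤ (η - 1) * (C - 1) := mul_nonneg (by linarith) (by linarith)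
      have s3 : (1 + x) * (1 + z - x) < 2 * (1 - x) * ϑ := by
        rw [hX]; exact mul_lt_mul_of_pos_left (by linarith) (by linarith)
      have s4 := mul_lt_mul_of_pos_right s3 (show 0 < 1 - z by linarith)
      have s5 : 2 * (1 - x) * ϑ * (1 - z) = (1 - x) * (1 + z) := by
        linear_combination (1 - x) * e0
      have s6 : 0 ≤ (x - z) * (2 - (1 + x) * (1 - z)) := mul_nonneg (by linarith) (by nlinarith)
      linarith
    have s1 : x / η ^ 2 ≤ z := by
      have : x / η * (x / η) ≤ z * x := mul_le_mul hzX hxX hX0.le e1.le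
      refine le_of_mul_le_mul_right (a := x) ?_ hx
      calc x / η ^ 2 * x = x / η * (x / η) := by ring
        _ ≤ _ := this
    have s2 : b - e * x ≤ b - e * z := by nlinarith
    exact mul_le_mul s1 s2 (by linarith) e1.le

/-- If the envelope does not bind. -/
theorem Cell.mul_le_line {x η C ψ ϑ σ e : ℝ} (h : Cell x η C ψ ϑ) (hη : 1 ≤ η) (hϑ : 1 < ϑ)
    (hσ : 0 ≤ σ) (hσ' : σ ≤ 1) (he : e * (1 + σ) = 2 * σ)
    (h1 : x / η ^ 2 ≤ (1 + σ) * (ϑ - 1)) (h2 : (1 + σ) * (ϑ - 1) ≤ 1) :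
    x / η ^ 2 * (quad (1 - σ) (ϑ - 1) - e * x)
      ≤ (1 + σ) * (ϑ - 1) * (1 + (1 - σ) * (ϑ - 1)) ^ 2 := by
  have hx1 := h.lt_one_of_ge hη (by linarith)
  obtain ⟨hx, hη0, hC, hC', -, -, hX, -⟩ := h
  have q0 := quad_ge (a := 1 - σ) (X := ϑ - 1)
  have hX0 : 0 < ϑ - 1 := by linarith
  generalize ϑ - 1 = X at *
  have hz : quad (1 - σ) X - e * ((1 + σ) * X) = (1 + (1 - σ) * X) ^ 2 := by
    unfold quad; linear_combination -X * he
  rw [← hz]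
  set z := (1 + σ) * X with hzd
  have hz0 : 0 < z := by positivity
  set b := quad (1 - σ) X
  have he0 : 0 ≤ e := by
    by_contra! hlt
    nlinarith
  have he1 : e ≤ 1 := by
    by_contra! hlt
    nlinarith
  have hex : e * x ≤ 1 := by nlinarith
  rcases le_total x z with hzx | hzx
  · have hez : e * (x + z) ≤ e * (2 * z) := mul_le_mul_of_nonneg_left (by linarith) he0
    have e4 : e * (2 * z) = 4 * σ * X := by rw [hzd]; linear_combination 2 * X * he
    have e5 : 4 * σ * X ≤ 1 + 2 * X := by
      linarith [mul_nonneg (sub_nonneg.2 hσ') hX0.le]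
    have s1 : 0 ≤ (z - x) * (b - e * (x + z)) := mul_nonneg (by linarith) (by linarith)
    have s2 : x / η ^ 2 * (b - e * x) ≤ x * (b - e * x) :=
      mul_le_mul_of_nonneg_right (div_le_self hx.le (one_le_pow₀ hη)) (by linarith)
    linarith
  · have s2 : b - e * x ≤ b - e * z := by nlinarith
    exact mul_le_mul h1 s2 (by linarith) hz0.le

/-- If the second state is far from critical. -/
theorem Cell.far {x η C ψ ϑ : ℝ} (h : Cell x η C ψ ϑ) (hη : 1 ≤ η) (hϑ : 0 < ϑ)
    (h1 : 1 < ϑ → 2 * ψ * (ϑ - 1) < x / η ^ 2) : 2 * (x / η ^ 2) ≤ 207 / 500 := by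
  have hη0 := h.η_pos
  have hx := h.x_pos
  rcases le_or_gt ϑ 1 with hϑ1 | hϑ1
  · obtain ⟨-, h3⟩ := h.lt_third hη hϑ hϑ1
    rw [mul_div_assoc', div_le_iff₀ (by positivity)]
    have : (1 + 2 * x) ^ 2 ≤ η ^ 2 := pow_le_pow_left₀ (by positivity) h3 2
    nlinarith [sq_nonneg (2 * x - 1)]
  · have h2 := h1 hϑ1
    have h3 : 2 * ψ * (ϑ - 1) = x * C - (η - 1) * (C - 1) := by linarith [h.eqN]
    rw [h3] at h2
    have hC := h.C_gt
    have hC' := h.C_lt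
    have hle : x / η ^ 2 ≤ x := div_le_self hx.le (one_le_pow₀ hη)
    have h4 : 2 * x - x / η ^ 2 < η - 1 := by
      refine lt_of_mul_lt_mul_right (a := C - 1) ?_ (by linarith)
      have := mul_nonneg (sub_nonneg.2 hle) (show 0 ≤ 2 - C by linarith)
      linarith
    set w := x / η ^ 2 with hw
    have hxw : x = w * η ^ 2 := by rw [hw]; field_simp
    have hw0 : 0 < w := by positivity
    rw [hxw] at h4
    by_contra! hlt
    have h5 : 207 / 1000 * (2 * η ^ 2 - 1) ≤ w * (2 * η ^ 2 - 1) :=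
      mul_le_mul_of_nonneg_right (by linarith) (by nlinarith)
    nlinarith [sq_nonneg (η - 6 / 5)]

namespace CellPair

variable {x₁ η₁ C₁ ψ₁ ϑ₁ x₂ η₂ C₂ ψ₂ ϑ₂ n ρ : ℝ}

set_option maxHeartbeats 1000000 in
/-- Comparison of the variance terms if `ϑ₂ ≤ ϑ₁`. -/
theorem quad_mul_pow_le (h : CellPair x₁ η₁ C₁ ψ₁ ϑ₁ x₂ η₂ C₂ ψ₂ ϑ₂ 1 1) (hψ : ψ₁ ≤ ψ₂)
    (hϑ : ϑ₂ ≤ ϑ₁) {σ e : ℝ} (hσ : 2 * ψ₂ = 1 + σ) (he : e * (1 + σ) = 2 * σ) :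
    2 * (x₂ / η₂ ^ 2 * ϑ₂ ^ 2) ≤ x₁ / η₁ ^ 2 * ϑ₁ ^ 2 ∨
    1 < ϑ₂ ∧ x₂ / η₂ ^ 2 * (quad (1 - σ) (ϑ₂ - 1) - e * x₂) * ϑ₂ ^ 4
        * ((ϑ₁ - 1) * (1 + (1 - σ) * (ϑ₁ - 1)) ^ 2)
      ≤ x₁ / η₁ ^ 2 * (quad (1 - σ) (ϑ₁ - 1) - e * x₁) * ϑ₁ ^ 4
        * ((ϑ₂ - 1) * (1 + (1 - σ) * (ϑ₂ - 1)) ^ 2) := by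
  obtain ⟨h₁, h₂, hR, hn, hη₁, hη₂, hcr, hϑ0⟩ := id h
  have hx1 := h₁.x_pos
  have hx2 := h₂.x_pos
  have hη1 := h₁.η_pos
  have hη2 := h₂.η_pos
  have hϑ1 := h.one_lt_left
  have hψ2 := h₂.ψ_ge
  have hψ2' := h₂.ψ_le
  have hσ0 : 0 ≤ σ := by linarith
  have hσ1 : σ ≤ 1 := by linarith
  have ha0 : 0 ≤ 1 - σ := by linarith
  have he0 : 0 ≤ e := by
    by_contra! hlt
    nlinarith
  have he1 : e ≤ 1 := by
    by_contra! hlt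
    nlinarith
  have hX1 : 0 < ϑ₁ - 1 := by linarith
  have kl := h₁.env_le_mul hη₁ hϑ1 hσ0 hσ1 he (by linarith)
  have hd1 : 0 < (ϑ₁ - 1) * (1 + (1 - σ) * (ϑ₁ - 1)) ^ 2 :=
    mul_pos hX1 (pow_pos (by linarith [mul_nonneg ha0 hX1.le]) 2)
  have g1 : envG (1 - σ) e (ϑ₁ - 1) * ((ϑ₁ - 1) * (1 + (1 - σ) * (ϑ₁ - 1)) ^ 2)
      ≤ x₁ / η₁ ^ 2 * (quad (1 - σ) (ϑ₁ - 1) - e * x₁) * ϑ₁ ^ 4 := by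
    unfold envG
    rw [div_mul_cancel₀ _ hd1.ne', add_sub_cancel]
    exact mul_le_mul_of_nonneg_right kl (by positivity)
  by_cases hϑ2 : 1 < ϑ₂
  swap
  · left
    have hc1 : η₁ = 1 := by
      rcases hcr with rfl | h'
      · exfalso
        apply hϑ2
        rw [h₂.crit_ϑ]
        have := h₂.crit.c_gt
        have := mul_pos (show 0 < C₂ / (2 * ψ₂) by linarith) hx2
        linarith
      · exact h'
    subst hc1
    have hf := h₂.far hη₂ hϑ0 (fun hh => absurd hh hϑ2)
    have hx := h₁.crit.x_gt
    have s1 : ϑ₂ ^ 2 ≤ ϑ₁ ^ 2 := pow_le_pow_left₀ hϑ0.le hϑ 2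
    have s2 := mul_le_mul (show 2 * (x₂ / η₂ ^ 2) ≤ x₁ / 1 ^ 2 by rw [one_pow, div_one]; linarith)
      s1 (by positivity) (by positivity)
    linarith
  have hX2 : 0 < ϑ₂ - 1 := by linarith
  have hd2 : 0 < (ϑ₂ - 1) * (1 + (1 - σ) * (ϑ₂ - 1)) ^ 2 :=
    mul_pos hX2 (pow_pos (by linarith [mul_nonneg ha0 hX2.le]) 2)
  -- it suffices to compare the second state with the envelope
  have red : x₂ / η₂ ^ 2 * (quad (1 - σ) (ϑ₂ - 1) - e * x₂) * ϑ₂ ^ 4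
      ≤ envG (1 - σ) e (ϑ₁ - 1) * ((ϑ₂ - 1) * (1 + (1 - σ) * (ϑ₂ - 1)) ^ 2) →
      x₂ / η₂ ^ 2 * (quad (1 - σ) (ϑ₂ - 1) - e * x₂) * ϑ₂ ^ 4
        * ((ϑ₁ - 1) * (1 + (1 - σ) * (ϑ₁ - 1)) ^ 2)
      ≤ x₁ / η₁ ^ 2 * (quad (1 - σ) (ϑ₁ - 1) - e * x₁) * ϑ₁ ^ 4
        * ((ϑ₂ - 1) * (1 + (1 - σ) * (ϑ₂ - 1)) ^ 2) := fun hle => by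
    have s1 := mul_le_mul_of_nonneg_right hle hd1.le
    have s2 := mul_le_mul_of_nonneg_right g1 hd2.le
    linarith
  have kr := h₂.mul_le_env (a := 1 - σ) hη₂ hϑ2 he0 he1
  have g2 : x₂ / η₂ ^ 2 * (quad (1 - σ) (ϑ₂ - 1) - e * x₂) * ϑ₂ ^ 4
      ≤ envG (1 - σ) e (ϑ₂ - 1) * ((ϑ₂ - 1) * (1 + (1 - σ) * (ϑ₂ - 1)) ^ 2) := by
    unfold envG
    rw [div_mul_cancel₀ _ hd2.ne', add_sub_cancel]
    exact mul_le_mul_of_nonneg_right kr (by positivity)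
  have direct : env (ϑ₂ - 1) ≤ (1 + σ) * (ϑ₂ - 1) → x₂ / η₂ ^ 2 * (quad (1 - σ) (ϑ₂ - 1) - e * x₂)
      * ϑ₂ ^ 4 ≤ envG (1 - σ) e (ϑ₁ - 1) * ((ϑ₂ - 1) * (1 + (1 - σ) * (ϑ₂ - 1)) ^ 2) :=
    fun hle => g2.trans (mul_le_mul_of_nonneg_right
      (envG_mono hσ0 hσ1 he0 he1 hX2 (by linarith) hle) hd2.le)
  rcases hcr with rfl | rfl
  · refine Or.inr ⟨hϑ2, red (direct ?_)⟩
    have hX := h₂.eqX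
    have e1 : x₂ = env (ϑ₂ - 1) := by
      refine eq_env hX2 ?_
      rw [add_sub_cancel, hX]; ring
    rw [← e1, ← hσ]
    have := h₂.mul_le_of_le le_rfl
    have c := mul_le_mul_of_nonneg_left h₂.C_gt.le hx2.le
    linarith
  · rcases le_or_gt (env (ϑ₂ - 1)) ((1 + σ) * (ϑ₂ - 1)) with hl | hl
    · exact Or.inr ⟨hϑ2, red (direct hl)⟩
    rcases lt_or_ge ((1 + σ) * (ϑ₂ - 1)) (x₂ / η₂ ^ 2) with hm | hm
    · left
      have hf := h₂.far hη₂ hϑ0 (fun _ => by rwa [hσ])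
      have hx := h₁.crit.x_gt
      have s1 : ϑ₂ ^ 2 ≤ ϑ₁ ^ 2 := pow_le_pow_left₀ hϑ0.le hϑ 2
      have s2 := mul_le_mul (show 2 * (x₂ / η₂ ^ 2) ≤ x₁ / 1 ^ 2 by rw [one_pow, div_one]; linarith)
        s1 (by positivity) (by positivity)
      linarith
    · refine Or.inr ⟨hϑ2, red ?_⟩
      have hz2 := env_lt hX2
      have kline := h₂.mul_le_line hη₂ hϑ2 hσ0 hσ1 he hm (by linarith)
      -- the point where the line meets the envelope
      have hx1e : x₁ = env (ϑ₁ - 1) := by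
        refine eq_env hX1 ?_
        rw [add_sub_cancel, h₁.eqX]; ring
      have hend : env (ϑ₁ - 1) ≤ (1 + σ) * (ϑ₁ - 1) := by
        rw [← hx1e, ← hσ]
        have a := h₁.mul_le_of_le le_rfl
        have b : 2 * ψ₁ * (ϑ₁ - 1) ≤ 2 * ψ₂ * (ϑ₁ - 1) :=
          mul_le_mul_of_nonneg_right (by linarith) hX1.le
        have c := mul_le_mul_of_nonneg_left h₁.C_gt.le hx1.le
        linarith
      have hcont : ContinuousOn (fun X => (1 + σ) * X - env X) (Set.Icc (ϑ₂ - 1) (ϑ₁ - 1)) := by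
        unfold env
        refine ContinuousOn.sub (by fun_prop) (ContinuousOn.div (by fun_prop) (by fun_prop) ?_)
        intro z hz
        have := hX2.trans_le hz.1
        positivity
      obtain ⟨Xs, ⟨hs1, hs2⟩, hs3⟩ := intermediate_value_Icc (show ϑ₂ - 1 ≤ ϑ₁ - 1 by linarith) hcont
        (show (0 : ℝ) ∈ Set.Icc _ _ from ⟨by linarith, by linarith⟩)
      have hXs : 0 < Xs := hX2.trans_le hs1
      have hs4 : env Xs = (1 + σ) * Xs := by simp only at hs3; linarith
      have m := envG_mono hσ0 hσ1 he0 he1 hXs hs2 hs4.le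
      have hG : envG (1 - σ) e Xs = (1 + σ) * (1 + Xs) ^ 4 := by
        unfold envG
        have hz : quad (1 - σ) Xs - e * ((1 + σ) * Xs) = (1 + (1 - σ) * Xs) ^ 2 := by
          unfold quad; linear_combination -Xs * he
        rw [hs4, hz]
        have : 0 < 1 + (1 - σ) * Xs := by linarith [mul_nonneg ha0 hXs.le]
        field_simp
      have hp : ϑ₂ ^ 4 ≤ (1 + Xs) ^ 4 := pow_le_pow_left₀ hϑ0.le (by linarith) 4
      calc _ ≤ (1 + σ) * (ϑ₂ - 1) * (1 + (1 - σ) * (ϑ₂ - 1)) ^ 2 * ϑ₂ ^ 4 :=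
            mul_le_mul_of_nonneg_right kline (by positivity)
        _ = (1 + σ) * ϑ₂ ^ 4 * ((ϑ₂ - 1) * (1 + (1 - σ) * (ϑ₂ - 1)) ^ 2) := by ring
        _ ≤ _ := by
          refine mul_le_mul_of_nonneg_right (le_trans ?_ m) hd2.le
          rw [hG]
          exact mul_le_mul_of_nonneg_left hp (by linarith)

end CellPair

end AnticipatoryTrading

namespace AnticipatoryTrading

/-- The ratio of the slopes of the last and the first quote. -/
noncomputable def rr (θ δ u : ℝ) : ℝ :=
  (δ + 2 * θ + u * (1 - δ)) * (δ + 2 * θ - u * δ) * (1 - δ)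
    / (2 * (δ + 2 * θ) ^ 2 * (1 - 2 * δ))

theorem rr_pos {θ δ u : ℝ} (hθ : 0 ≤ θ) (hδ : 0 < δ) (hδ' : δ < 1 / 2) (hu : u < 1)
    (hk : 0 < δ + 2 * θ + u * (1 - δ)) : 0 < rr θ δ u := by
  unfold rr
  have h1 : 0 < δ + 2 * θ - u * δ := by nlinarith
  have h2 : 0 < 1 - δ := by linarith
  have h3 : 0 < 1 - 2 * δ := by linarith
  positivity

theorem log_rr {θ δ u : ℝ} (hθ : 0 ≤ θ) (hδ : 0 < δ) (hδ' : δ < 1 / 2) (hu : u < 1)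
    (hk : 0 < δ + 2 * θ + u * (1 - δ)) :
    Real.log (rr θ δ u) = Real.log (δ + 2 * θ + u * (1 - δ)) + Real.log (δ + 2 * θ - u * δ)
      + Real.log (1 - δ) - (Real.log 2 + 2 * Real.log (δ + 2 * θ) + Real.log (1 - 2 * δ)) := by
  unfold rr
  have h1 : 0 < δ + 2 * θ - u * δ := by nlinarith
  have h2 : 0 < 1 - δ := by linarith
  have h3 : 0 < 1 - 2 * δ := by linarith
  have h4 : 0 < δ + 2 * θ := by linarith
  rw [Real.log_div (by positivity) (by positivity), Real.log_mul (by positivity) (by positivity),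
    Real.log_mul (by positivity) (by positivity), Real.log_mul (by positivity) (by positivity),
    Real.log_mul (by positivity) (by positivity), Real.log_pow]
  push_cast
  ring

/-- A weighted logarithm of `rr`. -/
noncomputable def legF (b₀ b₁ b₂ b₃ θ u δ : ℝ) : ℝ :=
  b₀ * Real.log δ + b₁ * Real.log (δ + θ) + b₂ * Real.log (δ + 2 * θ) + b₃ * Real.log (1 - δ)
    + 2 * Real.log (rr θ δ u)

theorem legF_lt_of_deriv {b₀ b₁ b₂ b₃ θ u δ₀ δ₁ : ℝ} (hθ : 0 ≤ θ) (h0 : 0 < δ₀) (h : δ₀ < δ₁)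
    (h1 : δ₁ < 1 / 2) (hu : u < 1) (hk : 0 < δ₀ + 2 * θ + u * (1 - δ₀))
    (hd : ∀ δ, δ₀ < δ → δ < δ₁ → 0 < b₀ / δ + b₁ / (δ + θ) + (b₂ - 4) / (δ + 2 * θ)
      - (2 + b₃) / (1 - δ) + 2 * ((1 - u) / (δ + 2 * θ + u * (1 - δ)))
      + 2 * ((1 - u) / (δ + 2 * θ - u * δ)) + 4 / (1 - 2 * δ)) :
    legF b₀ b₁ b₂ b₃ θ u δ₀ < legF b₀ b₁ b₂ b₃ θ u δ₁ := by
  set F : ℝ → ℝ := fun δ => b₀ * Real.log δ + b₁ * Real.log (θ + 1 * δ)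
    + (b₂ - 4) * Real.log (2 * θ + 1 * δ) + (2 + b₃) * Real.log (1 + (-1) * δ)
    + 2 * Real.log ((2 * θ + u) + (1 - u) * δ)
    + 2 * Real.log (2 * θ + (1 - u) * δ) - 2 * Real.log (1 + (-2) * δ) - 2 * Real.log 2 with hF
  have hpos : ∀ δ, δ₀ ≤ δ → δ ≤ δ₁ → 0 < δ ∧ 0 < δ + 2 * θ + u * (1 - δ) ∧
      0 < δ + 2 * θ - u * δ ∧ 0 < 1 - δ ∧ 0 < 1 - 2 * δ := fun δ ha hb => by
    have : 0 ≤ (δ - δ₀) * (1 - u) := mul_nonneg (by linarith) (by linarith)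
    refine ⟨by linarith, by linarith, ?_, by linarith, by linarith⟩
    have : 0 < δ * (1 - u) := mul_pos (by linarith) (by linarith)
    linarith
  have hFe : ∀ δ, δ₀ ≤ δ → δ ≤ δ₁ → legF b₀ b₁ b₂ b₃ θ u δ = F δ := fun δ ha hb => by
    obtain ⟨p1, p2, p3, p4, p5⟩ := hpos δ ha hb
    unfold legF
    rw [log_rr hθ p1 (by linarith) hu p2]
    simp only [hF]
    rw [show θ + 1 * δ = δ + θ by ring, show 2 * θ + 1 * δ = δ + 2 * θ by ring,
      show 1 + -1 * δ = 1 - δ by ring, show 2 * θ + u + (1 - u) * δ = δ + 2 * θ + u * (1 - δ) by ring,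
      show 2 * θ + (1 - u) * δ = δ + 2 * θ - u * δ by ring, show 1 + -2 * δ = 1 - 2 * δ by ring]
    ring
  rw [hFe _ le_rfl h.le, hFe _ h.le le_rfl]
  have hder : ∀ δ, δ₀ ≤ δ → δ ≤ δ₁ → HasDerivAt F (b₀ / δ + b₁ / (δ + θ) + (b₂ - 4) / (δ + 2 * θ)
      - (2 + b₃) / (1 - δ) + 2 * ((1 - u) / (δ + 2 * θ + u * (1 - δ)))
      + 2 * ((1 - u) / (δ + 2 * θ - u * δ)) + 4 / (1 - 2 * δ)) δ := fun δ ha hb => by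
    obtain ⟨p1, p2, p3, p4, p5⟩ := hpos δ ha hb
    have d0 := hasDerivAt_id' δ
    have dc : ∀ k c : ℝ, HasDerivAt (fun y => c + k * y) k δ := fun k c => by
      simpa using (d0.const_mul k).const_add c
    have := (((((((d0.log p1.ne').const_mul b₀).add
      (((dc 1 θ).log (by linarith)).const_mul b₁)).add
      (((dc 1 (2 * θ)).log (by linarith)).const_mul (b₂ - 4))).add
      (((dc (-1) 1).log (by linarith)).const_mul (2 + b₃))).add
      (((dc (1 - u) (2 * θ + u)).log (by linarith)).const_mul 2)).add
      (((dc (1 - u) (2 * θ)).log (by linarith)).const_mul 2)).sub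
      (((dc (-2) 1).log (by linarith)).const_mul 2)
    refine (this.sub_const (2 * Real.log 2)).congr_deriv ?_
    rw [show θ + 1 * δ = δ + θ by ring, show 2 * θ + 1 * δ = δ + 2 * θ by ring,
      show 1 + -1 * δ = 1 - δ by ring, show 2 * θ + u + (1 - u) * δ = δ + 2 * θ + u * (1 - δ) by ring,
      show 2 * θ + (1 - u) * δ = δ + 2 * θ - u * δ by ring, show 1 + -2 * δ = 1 - 2 * δ by ring]
    ring
  refine strictMonoOn_of_deriv_pos (convex_Icc δ₀ δ₁) ?_ ?_ (Set.left_mem_Icc.2 h.le)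
    (Set.right_mem_Icc.2 h.le) h
  · exact fun z hz => (hder z hz.1 hz.2).continuousAt.continuousWithinAt
  · rw [interior_Icc]
    intro z hz
    rw [(hder z hz.1.le hz.2.le).deriv]
    exact hd z hz.1 hz.2

/-- Monotonicity in `δ` of a weighted logarithm of `rr`. -/
theorem legF_lt {b₀ b₁ b₂ b₃ θ u δ₀ δ₁ : ℝ} (hθ : 0 ≤ θ) (h0 : 0 < δ₀) (h : δ₀ < δ₁)
    (h1 : δ₁ < 1 / 2) (hu0 : 0 < u) (hu : u < 1) (hk : u * (1 - δ₀) ≤ δ₀ + 2 * θ) (hb : b₃ ≤ 2)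
    (hE : ∀ σ : ℝ, 0 < σ → σ ≤ 1 → 0 < b₀ + 2 * b₁ * σ / (1 + σ) + (b₂ - 4) * σ
      - (2 + b₃) * (σ * u) + (1 - u) * σ + 2 * σ * (1 + u) / (1 - σ * u)) :
    legF b₀ b₁ b₂ b₃ θ u δ₀ < legF b₀ b₁ b₂ b₃ θ u δ₁ := by
  have hk0 : 0 < δ₀ + 2 * θ + u * (1 - δ₀) := by
    have : 0 < u * (1 - δ₀) := mul_pos hu0 (by linarith)
    linarith
  refine legF_lt_of_deriv hθ h0 h h1 hu hk0 fun δ ha hb' => ?_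
  have hδ : 0 < δ := by linarith
  have hM : 0 < δ + 2 * θ := by linarith
  have hδ1 : 0 < 1 - δ := by linarith
  have hδ2 : 0 < 1 - 2 * δ := by linarith
  have hk' : u * (1 - δ) ≤ δ + 2 * θ := by nlinarith
  obtain ⟨σ, hσ⟩ : ∃ σ, σ = δ / (δ + 2 * θ) := ⟨_, rfl⟩
  have hσM : σ * (δ + 2 * θ) = δ := by rw [hσ]; field_simp
  have hσ0 : 0 < σ := by rw [hσ]; positivity
  have hσ1 : σ ≤ 1 := by rw [hσ, div_le_one hM]; linarith
  obtain ⟨d, hd⟩ : ∃ d, d = δ / (1 - δ) := ⟨_, rfl⟩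
  have hd0 : 0 < d := by rw [hd]; positivity
  have hd1 : d < 1 := by rw [hd, div_lt_one hδ1]; linarith
  have hdu : σ * u ≤ d := by
    rw [hd, hσ, div_mul_eq_mul_div, div_le_div_iff₀ hM hδ1]
    have := mul_le_mul_of_nonneg_left hk' hδ.le
    linarith
  have hsu : 0 < σ * u := by positivity
  have hsu1 : 0 < 1 - σ * u := by nlinarith
  have e := hE σ hσ0 hσ1
  have eδ : δ = d / (1 + d) := by rw [hd]; field_simp; ring
  have eM : δ + 2 * θ = d / (σ * (1 + d)) := by
    rw [eq_div_iff (by positivity)]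
    have : d = (1 + d) * δ := by rw [hd]; field_simp; ring
    linear_combination (1 + d) * hσM - this
  have em : δ + θ = (1 + σ) / 2 * (d / (σ * (1 + d))) := by
    rw [← eM]; linear_combination -hσM / 2
  have e1 : 1 - δ = 1 / (1 + d) := by rw [eδ]; field_simp; ring
  have e2 : 1 - 2 * δ = (1 - d) / (1 + d) := by rw [eδ]; field_simp; ring
  have e3 : δ + 2 * θ + u * (1 - δ) = (d + σ * u) / (σ * (1 + d)) := by
    rw [eM, e1]; field_simp
  have e4 : δ + 2 * θ - u * δ = d * (1 - σ * u) / (σ * (1 + d)) := by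
    rw [eM, eδ]; field_simp
  have h1d : 0 < 1 - d := by linarith
  have key : 0 < b₀ + 2 * b₁ * σ / (1 + σ) + (b₂ - 4) * σ - (2 + b₃) * d
      + 2 * (1 - u) * σ * (d / (d + σ * u)) + 2 * (1 - u) * σ / (1 - σ * u) + 4 * d / (1 - d) := by
    have c1 : 1 / 2 ≤ d / (d + σ * u) := by
      rw [div_le_div_iff₀ (by norm_num) (by positivity)]; linarith
    have c2 : 2 * (1 - u) * σ * (1 / 2) ≤ 2 * (1 - u) * σ * (d / (d + σ * u)) :=
      mul_le_mul_of_nonneg_left c1 (mul_nonneg (by linarith) hσ0.le)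
    have c3 : 4 * (σ * u) / (1 - σ * u) + 4 * (d - σ * u) ≤ 4 * d / (1 - d) := by
      have i1 : 4 * (σ * u) / (1 - σ * u) = 4 / (1 - σ * u) - 4 := by field_simp; ring
      have i2 : 4 * d / (1 - d) = 4 / (1 - d) - 4 := by field_simp; ring
      rw [i1, i2]
      have i3 : 4 / (1 - d) - 4 / (1 - σ * u) - 4 * (d - σ * u)
          = 4 * (d - σ * u) * (1 - (1 - d) * (1 - σ * u)) / ((1 - d) * (1 - σ * u)) := by
        field_simp; ring
      have i4 : (1 - d) * (1 - σ * u) ≤ 1 := by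
        have := mul_le_mul (show 1 - d ≤ 1 by linarith) (show 1 - σ * u ≤ 1 by linarith) hsu1.le
          (by norm_num)
        linarith
      have : 0 ≤ 4 / (1 - d) - 4 / (1 - σ * u) - 4 * (d - σ * u) := by
        rw [i3]
        exact div_nonneg (mul_nonneg (by linarith) (by linarith)) (by positivity)
      linarith
    have c4 : 2 * σ * (1 + u) / (1 - σ * u)
        = 2 * (1 - u) * σ / (1 - σ * u) + 4 * (σ * u) / (1 - σ * u) := by
      rw [← add_div]; congr 1; ring
    have c5 := mul_nonneg (show 0 ≤ 2 - b₃ by linarith) (sub_nonneg.2 hdu)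
    linarith
  have fin : b₀ / δ + b₁ / (δ + θ) + (b₂ - 4) / (δ + 2 * θ)
      - (2 + b₃) / (1 - δ) + 2 * ((1 - u) / (δ + 2 * θ + u * (1 - δ)))
      + 2 * ((1 - u) / (δ + 2 * θ - u * δ)) + 4 / (1 - 2 * δ)
      = (b₀ + 2 * b₁ * σ / (1 + σ) + (b₂ - 4) * σ - (2 + b₃) * d
      + 2 * (1 - u) * σ * (d / (d + σ * u)) + 2 * (1 - u) * σ / (1 - σ * u) + 4 * d / (1 - d))
        * ((1 + d) / d) := by
    rw [e3, e4, em, eM, e1, e2, eδ]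
    field_simp
  rw [fin]
  positivity

/-- Monotonicity of `(δ + θ) r²`. -/
theorem mul_rr_sq_le {θ u δ₀ δ₁ : ℝ} (hθ : 0 ≤ θ) (h0 : 0 < δ₀) (h : δ₀ ≤ δ₁)
    (h1 : δ₁ < 1 / 2) (hu : u < 1) (hk0 : 0 < δ₀ + 2 * θ + u * (1 - δ₀))
    (hk : u * (1 - δ₀) ≤ δ₀ + 2 * θ) :
    (δ₀ + θ) * rr θ δ₀ u ^ 2 ≤ (δ₁ + θ) * rr θ δ₁ u ^ 2 := by
  rcases h.eq_or_lt with rfl | hlt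
  · exact le_rfl
  have r0 := rr_pos hθ h0 (by linarith) hu hk0
  have hk1 : 0 < δ₁ + 2 * θ + u * (1 - δ₁) := by nlinarith
  have r1 := rr_pos hθ (by linarith) h1 hu hk1
  have key : legF 0 1 0 0 θ u δ₀ < legF 0 1 0 0 θ u δ₁ := by
    rcases le_or_gt u 0 with hu0 | hu0
    · refine legF_lt_of_deriv hθ h0 hlt h1 hu hk0 fun δ ha hb => ?_
      have p0 : 0 < δ := by linarith
      have p1 : 0 < δ + 2 * θ := by linarith
      have p2 : 0 < δ + 2 * θ + u * (1 - δ) := by nlinarith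
      have p3 : 0 < δ + 2 * θ - u * δ := by nlinarith
      have c1 : 1 / (δ + 2 * θ) ≤ (1 - u) / (δ + 2 * θ + u * (1 - δ)) := by
        rw [div_le_div_iff₀ p1 p2]; nlinarith
      have c2 : 1 / (δ + 2 * θ) ≤ (1 - u) / (δ + 2 * θ - u * δ) := by
        rw [div_le_div_iff₀ p1 p3]; nlinarith
      have c3 : 2 / (1 - δ) ≤ 4 / (1 - 2 * δ) := by
        rw [div_le_div_iff₀ (by linarith) (by linarith)]; linarith
      have c4 : 0 < 1 / (δ + θ) := by positivity
      have c5 : (0 - 4) / (δ + 2 * θ) = - (2 * (1 / (δ + 2 * θ))) - 2 * (1 / (δ + 2 * θ)) := by ring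
      rw [c5, zero_div, add_zero]
      linarith
    · refine legF_lt hθ h0 hlt h1 hu0 hu hk (by norm_num) fun σ hσ hσ1 => ?_
      have hsu : 0 < σ * u := by positivity
      have hsu1 : 0 < 1 - σ * u := by nlinarith
      have : (0 : ℝ) + 2 * 1 * σ / (1 + σ) + (0 - 4) * σ - (2 + 0) * (σ * u) + (1 - u) * σ
          + 2 * σ * (1 + u) / (1 - σ * u) = σ * ((1 - u) * (1 - σ)
            + σ * u * (3 * u + 3 * σ - 1) + 3 * (σ * u) ^ 2) / ((1 + σ) * (1 - σ * u)) := by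
        field_simp; ring
      rw [this]
      refine div_pos (mul_pos hσ ?_) (by positivity)
      have q0 : 0 ≤ (1 - u) * (1 - σ) := mul_nonneg (by linarith) (by linarith)
      rcases le_total 1 (3 * u + 3 * σ) with hc | hc
      · have := mul_nonneg hsu.le (sub_nonneg.2 hc)
        have : 0 < 3 * (σ * u) ^ 2 := by positivity
        linarith
      · nlinarith
  unfold legF at key
  have l0 : Real.log ((δ₀ + θ) * rr θ δ₀ u ^ 2) < Real.log ((δ₁ + θ) * rr θ δ₁ u ^ 2) := by
    rw [Real.log_mul (by positivity) (by positivity), Real.log_mul (by linarith) (by positivity),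
      Real.log_pow, Real.log_pow]
    push_cast
    linarith
  exact ((Real.log_lt_log_iff (by positivity) (mul_pos (by linarith) (by positivity))).1 l0).le

/-- Monotonicity of `δ r² (1 - δ)`. -/
theorem mul_rr_sq_mul_lt {θ u δ₀ δ₁ : ℝ} (hθ : 0 ≤ θ) (h0 : 0 < δ₀) (h : δ₀ < δ₁)
    (h1 : δ₁ < 1 / 2) (hu0 : 0 < u) (hu : u < 1) (hk : u * (1 - δ₀) ≤ δ₀ + 2 * θ) :
    δ₀ * rr θ δ₀ u ^ 2 * (1 - δ₀) < δ₁ * rr θ δ₁ u ^ 2 * (1 - δ₁) := by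
  have r0 := rr_pos hθ h0 (by linarith) hu (by nlinarith)
  have r1 := rr_pos hθ (h0.trans h) h1 hu (by nlinarith)
  have key : legF 1 0 0 1 θ u δ₀ < legF 1 0 0 1 θ u δ₁ := by
    refine legF_lt hθ h0 h h1 hu0 hu hk (by norm_num) fun σ hσ hσ1 => ?_
    have hsu : 0 < σ * u := by positivity
    have hsu1 : 0 < 1 - σ * u := by nlinarith
    have : (1 : ℝ) + 2 * 0 * σ / (1 + σ) + (0 - 4) * σ - (2 + 1) * (σ * u) + (1 - u) * σ
          + 2 * σ * (1 + u) / (1 - σ * u) = ((1 - σ) * (1 - 3 * (σ * u)) + 4 * (σ * u) ^ 2)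
            / (1 - σ * u) := by
        field_simp; ring
    rw [this]
    refine div_pos ?_ hsu1
    generalize σ * u = t at *
    have : 0 ≤ σ * (4 * t ^ 2) := by positivity
    nlinarith [sq_nonneg (8 * t - 3), mul_nonneg (sub_nonneg.2 hσ1) (sq_nonneg (8 * t - 3))]
  unfold legF at key
  have hp1 : 0 < 1 - δ₀ := by linarith
  have hp2 : 0 < 1 - δ₁ := by linarith
  have hp3 : 0 < δ₁ := by linarith
  refine (Real.log_lt_log_iff (by positivity) (by positivity)).1 ?_
  rw [Real.log_mul (by positivity) (by positivity), Real.log_mul (by positivity) (by positivity),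
    Real.log_mul (by positivity) (by positivity), Real.log_mul (by positivity) (by positivity),
    Real.log_pow, Real.log_pow]
  push_cast
  linarith

/-- Monotonicity of `(δ r²)² (1 - δ)³`. -/
theorem mul_rr_sq_sq_mul_lt {θ u δ₀ δ₁ : ℝ} (hθ : 0 ≤ θ) (h0 : 0 < δ₀) (h : δ₀ < δ₁)
    (h1 : δ₁ < 1 / 2) (hu0 : 1 / 9 < u) (hu : u < 1) (hk : u * (1 - δ₀) ≤ δ₀ + 2 * θ) :
    (δ₀ * rr θ δ₀ u ^ 2) ^ 2 * (1 - δ₀) ^ 3 < (δ₁ * rr θ δ₁ u ^ 2) ^ 2 * (1 - δ₁) ^ 3 := by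
  have r0 := rr_pos hθ h0 (by linarith) hu (by nlinarith)
  have r1 := rr_pos hθ (h0.trans h) h1 hu (by nlinarith)
  have key : legF 1 0 0 (3 / 2) θ u δ₀ < legF 1 0 0 (3 / 2) θ u δ₁ := by
    refine legF_lt hθ h0 h h1 (by linarith) hu hk (by norm_num) fun σ hσ hσ1 => ?_
    have hsu : σ / 9 < σ * u := by nlinarith
    have hsu1 : 0 < 1 - σ * u := by nlinarith
    have hsu2 : σ * u ≤ σ := by nlinarith
    have : (1 : ℝ) + 2 * 0 * σ / (1 + σ) + (0 - 4) * σ - (2 + 3 / 2) * (σ * u) + (1 - u) * σ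
          + 2 * σ * (1 + u) / (1 - σ * u) = ((1 - σ) * (1 - 3 * (σ * u))
            + σ * u * (9 / 2 * (σ * u) - 1 / 2)) / (1 - σ * u) := by
        field_simp; ring
    rw [this]
    refine div_pos ?_ hsu1
    generalize σ * u = t at *
    have ht : 0 < t := by linarith
    rcases le_total t (2 / 7) with hc | hc
    · have c1 := mul_lt_mul_of_pos_left hsu ht
      have c2 := mul_nonneg (sub_nonneg.2 hσ1) (sub_nonneg.2 hc)
      linarith
    · have c1 : (1 - σ) * (3 * t - 1) ≤ (1 - t) * (3 * t - 1) ∨ 3 * t - 1 ≤ 0 := by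
        rcases le_total (3 * t - 1) 0 with hh | hh
        · exact Or.inr hh
        · exact Or.inl (mul_le_mul_of_nonneg_right (by linarith) hh)
      rcases c1 with c1 | c1
      · nlinarith [sq_nonneg (10 * t - 3)]
      · have := mul_nonneg (sub_nonneg.2 hσ1) (neg_nonneg.2 c1)
        nlinarith
  unfold legF at key
  have hp1 : 0 < 1 - δ₀ := by linarith
  have hp2 : 0 < 1 - δ₁ := by linarith
  have hp3 : 0 < δ₁ := by linarith
  refine (Real.log_lt_log_iff (by positivity) (by positivity)).1 ?_
  rw [Real.log_mul (by positivity) (by positivity), Real.log_mul (by positivity) (by positivity),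
    Real.log_pow, Real.log_pow, Real.log_pow, Real.log_pow, Real.log_mul (by positivity) (by positivity),
    Real.log_mul (by positivity) (by positivity), Real.log_pow, Real.log_pow]
  push_cast
  linarith

/-- `r / (1 - u)` increases in `u`. -/
theorem rr_mul_le {θ δ u₁ u₂ : ℝ} (hθ : 0 ≤ θ) (hδ : 0 < δ) (hδ' : δ < 1 / 2) (hu : u₁ ≤ u₂)
    (hu2 : u₂ < 1) (hk : 0 < δ + 2 * θ + u₁ * (1 - δ)) :
    rr θ δ u₁ * (1 - u₂) ≤ rr θ δ u₂ * (1 - u₁) := by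
  unfold rr
  have h3 : 0 < 1 - 2 * δ := by linarith
  have h4 : 0 < δ + 2 * θ := by linarith
  rw [div_mul_eq_mul_div, div_mul_eq_mul_div]
  refine div_le_div_of_nonneg_right ?_ (by positivity)
  have a1 : (δ + 2 * θ - u₁ * δ) * (1 - u₂) ≤ (δ + 2 * θ - u₂ * δ) * (1 - u₁) := by
    have : 0 ≤ (u₂ - u₁) * (2 * θ) := mul_nonneg (by linarith) (by linarith)
    linarith
  have a2 : δ + 2 * θ + u₁ * (1 - δ) ≤ δ + 2 * θ + u₂ * (1 - δ) := by nlinarith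
  have a3 : 0 ≤ (δ + 2 * θ - u₁ * δ) * (1 - u₂) := mul_nonneg (by nlinarith) (by linarith)
  have := mul_le_mul_of_nonneg_right (mul_le_mul a2 a1 a3 (hk.le.trans a2))
    (show 0 ≤ 1 - δ by linarith)
  linarith

/-- A bound for `r²` in terms of `u`. -/
theorem rr_sq_mul_le {θ δ u₁ u₂ : ℝ} (hθ : 0 ≤ θ) (hδ : 0 < δ) (hδ' : δ < 1 / 2) (hu0 : 0 < u₂)
    (hu : u₂ ≤ u₁) (hk : u₁ * (1 - δ) ≤ δ + 2 * θ) :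
    rr θ δ u₁ ^ 2 * (u₂ * (δ + 2 * θ - u₂ * δ) ^ 2)
      ≤ rr θ δ u₂ ^ 2 * (u₁ * (δ + 2 * θ - u₁ * δ) ^ 2) := by
  unfold rr
  have h3 : 0 < 1 - 2 * δ := by linarith
  have h4 : 0 < δ + 2 * θ := by linarith
  rw [div_pow, div_pow, div_mul_eq_mul_div, div_mul_eq_mul_div]
  refine div_le_div_of_nonneg_right ?_ (by positivity)
  have a1 : (δ + 2 * θ + u₁ * (1 - δ)) ^ 2 * u₂ ≤ (δ + 2 * θ + u₂ * (1 - δ)) ^ 2 * u₁ := by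
    have e : (δ + 2 * θ + u₂ * (1 - δ)) ^ 2 * u₁ - (δ + 2 * θ + u₁ * (1 - δ)) ^ 2 * u₂
      = (u₁ - u₂) * ((δ + 2 * θ) ^ 2 - u₁ * (1 - δ) * (u₂ * (1 - δ))) := by ring
    have : u₁ * (1 - δ) * (u₂ * (1 - δ)) ≤ (δ + 2 * θ) * (δ + 2 * θ) := by
      have h5 : u₂ * (1 - δ) ≤ u₁ * (1 - δ) := mul_le_mul_of_nonneg_right hu (by linarith)
      exact mul_le_mul hk (h5.trans hk) (mul_nonneg hu0.le (by linarith)) h4.le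
    have : 0 ≤ (u₁ - u₂) * ((δ + 2 * θ) ^ 2 - u₁ * (1 - δ) * (u₂ * (1 - δ))) :=
      mul_nonneg (by linarith) (by linarith)
    linarith
  have := mul_le_mul_of_nonneg_right a1
    (show 0 ≤ ((δ + 2 * θ - u₁ * δ) * (δ + 2 * θ - u₂ * δ) * (1 - δ)) ^ 2 by positivity)
  linarith

end AnticipatoryTrading

namespace AnticipatoryTrading

/-- The variance share that is left for the last round. -/
noncomputable def vB (a e u x : ℝ) : ℝ := 1 - (1 - a ^ 2) * u ^ 2 - e * x * (1 - u) ^ 2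

theorem vB_mul {a e u x : ℝ} (hu : u < 1) :
    vB a e u x * (1 / (1 - u)) ^ 2 = quad a (1 / (1 - u) - 1) - e * x := by
  have : 1 - u ≠ 0 := by linarith
  unfold vB quad
  field_simp
  ring

/-- The equilibrium conditions in reduced variables. -/
structure RState (θ θ₂ δ u x η C : ℝ) : Prop where
  δ_pos : 0 < δ
  δ_lt : δ < 1 / 2
  u_lt : u < 1
  cell : Cell x η C ((δ + θ) / (δ + 2 * θ)) (1 / (1 - u))
  k_gt : 0 < δ + 2 * θ + u * (1 - δ)
  k_le : u * (1 - δ) ≤ δ + 2 * θ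
  vol : vB (2 * θ / (δ + 2 * θ)) (δ / (δ + θ)) u x ≤ 4 * (δ * rr θ δ u ^ 2) * θ₂
  pure : u * (1 - δ) = δ + 2 * θ ∨
    vB (2 * θ / (δ + 2 * θ)) (δ / (δ + θ)) u x = 4 * (δ * rr θ δ u ^ 2) * θ₂

/-- Inverse of the relative size of the intermediate market, up to a factor depending on `C`. -/
noncomputable def invSize (θ δ u x η : ℝ) : ℝ :=
  x / η ^ 2 * (1 / (1 - u)) ^ 2 * ((δ + θ) * rr θ δ u ^ 2)

/-- Inverse of the squared inventory aversion, up to a factor. -/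
noncomputable def invAversion (θ θ₂ δ u x η : ℝ) : ℝ :=
  x / η ^ 2 * (1 / (1 - u)) ^ 2 * ((δ + θ) * (1 / (1 - δ) + (u / (δ + 2 * θ)) ^ 2 * (δ + 4 * θ)
    + x * (1 - u) ^ 2 / (δ + θ) + 4 * rr θ δ u ^ 2 * θ₂))

/-- The part of `invAversion` that does not come from the last round. -/
noncomputable def invAversionQ (θ δ u x η : ℝ) : ℝ :=
  x / η ^ 2 * ((1 / (1 - u)) ^ 2 * ((δ + θ) / (1 - δ)
    + (δ + θ) * (δ + 4 * θ) * (u / (δ + 2 * θ)) ^ 2) + x)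

theorem invAversion_eq {θ θ₂ δ u x η : ℝ} (hm : δ + θ ≠ 0) (hu : u < 1) :
    invAversion θ θ₂ δ u x η = invAversionQ θ δ u x η + 4 * θ₂ * invSize θ δ u x η := by
  have : 1 - u ≠ 0 := by linarith
  unfold invAversion invAversionQ invSize
  have e : (1 / (1 - u)) ^ 2 * ((δ + θ) * (x * (1 - u) ^ 2 / (δ + θ))) = x := by field_simp
  linear_combination x / η ^ 2 * e

namespace RState

variable {θ θ₂ δ u x η C : ℝ}

theorem M_pos (h : RState θ θ₂ δ u x η C) (hθ : 0 ≤ θ) : 0 < δ + 2 * θ := by linarith [h.δ_pos]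

theorem rr_pos (h : RState θ θ₂ δ u x η C) (hθ : 0 ≤ θ) : 0 < rr θ δ u :=
  AnticipatoryTrading.rr_pos hθ h.δ_pos h.δ_lt h.u_lt h.k_gt

theorem invAversion_eq_add (h : RState θ θ₂ δ u x η C) (hθ : 0 ≤ θ) :
    invAversion θ θ₂ δ u x η = x / η ^ 2 * (1 / (1 - u)) ^ 2 * ((δ + θ) / (δ * (1 - δ)))
      + x / η ^ 2 * (1 / (1 - u)) ^ 2 * ((δ + θ) / δ * (4 * (δ * rr θ δ u ^ 2) * θ₂
        - vB (2 * θ / (δ + 2 * θ)) (δ / (δ + θ)) u x)) := by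
  have h1 := h.M_pos hθ
  have h2 := h.δ_pos
  have h3 := h.δ_lt
  have h4 : 1 - δ ≠ 0 := by linarith
  have h5 : δ + θ ≠ 0 := by linarith
  unfold invAversion vB
  rw [← mul_add]
  congr 1
  field_simp
  ring

theorem le_invAversion (h : RState θ θ₂ δ u x η C) (hθ : 0 ≤ θ) :
    x / η ^ 2 * (1 / (1 - u)) ^ 2 * ((δ + θ) / (δ * (1 - δ))) ≤ invAversion θ θ₂ δ u x η := by
  rw [h.invAversion_eq_add hθ]
  have h2 := h.δ_pos
  have := h.vol
  have hx := h.cell.x_pos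
  have h6 : 0 ≤ x / η ^ 2 * (1 / (1 - u)) ^ 2 * ((δ + θ) / δ * (4 * (δ * rr θ δ u ^ 2) * θ₂
        - vB (2 * θ / (δ + 2 * θ)) (δ / (δ + θ)) u x)) :=
    mul_nonneg (by positivity) (mul_nonneg (by positivity) (by linarith))
  linarith

theorem one_div_pos (h : RState θ θ₂ δ u x η C) : 0 < 1 / (1 - u) := by
  have := h.u_lt
  exact _root_.one_div_pos.2 (by linarith)

/-- In a critical state. -/
theorem crit_u (h : RState θ θ₂ δ u x 1 C) : 17 / 100 < u ∧ 207 / 500 < x ∧ x < 641 / 1000 ∧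
    2 * (1 - x) = (1 + x) * (1 - u) := by
  have hu := h.u_lt
  have hc := h.cell.crit
  have h1 := h.cell.eqX
  have h2 : 2 * (1 - x) = (1 + x) * (1 - u) := by
    have h3 : 0 < 1 - u := by linarith
    have : 2 * (1 - x) * (1 / (1 - u)) * (1 - u) = 2 * (1 - x) := by field_simp
    rw [← this, h1]; ring
  refine ⟨?_, hc.x_gt, hc.x_lt, h2⟩
  have := hc.x_gt
  nlinarith

theorem pair {δ₁ u₁ x₁ η₁ C₁ δ₂ u₂ x₂ η₂ C₂ n ρ : ℝ} (h₁ : RState θ θ₂ δ₁ u₁ x₁ η₁ C₁)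
    (h₂ : RState θ θ₂ δ₂ u₂ x₂ η₂ C₂) (hη₁ : η₁ ≤ 1) (hη₂ : 1 ≤ η₂) (hcr : η₂ = 1 ∨ η₁ = 1)
    (hR : Ratio C₁ C₂ n ρ) (hn : n = 1 ∨ n ^ 2 * C₁ = C₂) :
    CellPair x₁ η₁ C₁ ((δ₁ + θ) / (δ₁ + 2 * θ)) (1 / (1 - u₁))
      x₂ η₂ C₂ ((δ₂ + θ) / (δ₂ + 2 * θ)) (1 / (1 - u₂)) n ρ :=
  ⟨h₁.cell, h₂.cell, hR, hn, hη₁, hη₂, hcr, h₂.one_div_pos⟩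

end RState

theorem psi_le_psi {θ δ₁ δ₂ : ℝ} (hθ : 0 ≤ θ) (h1 : 0 < δ₁) (h : δ₁ ≤ δ₂) :
    (δ₁ + θ) / (δ₁ + 2 * θ) ≤ (δ₂ + θ) / (δ₂ + 2 * θ) := by
  rw [div_le_div_iff₀ (by linarith) (by linarith)]
  nlinarith [mul_nonneg hθ (sub_nonneg.2 h)]

namespace CellPair

variable {x₁ η₁ C₁ ψ₁ ϑ₁ x₂ η₂ C₂ ψ₂ ϑ₂ n ρ : ℝ}

theorem sq_hat_mul_le (h : CellPair x₁ η₁ C₁ ψ₁ ϑ₁ x₂ η₂ C₂ ψ₂ ϑ₂ n ρ)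
    (hψ : ψ₁ ≤ ψ₂ ∨ ϑ₂ ≤ ϑ₁) : n * (x₂ / η₂ ^ 2) ≤ ρ ^ 2 * (x₁ / η₁ ^ 2) ∧
      (η₁ < η₂ → x₂ / η₂ ^ 2 < ρ ^ 2 * (x₁ / η₁ ^ 2)) := by
  have hx1 := h.left.x_pos
  have hx2 := h.right.x_pos
  have hη1 := h.left.η_pos
  have hη2 := h.right.η_pos
  have hρ := h.ρ_pos
  have hn := h.ratio.n_ge
  have hρ1 : n ≤ ρ ^ 2 := by nlinarith [h.ρ_ge.1]
  rcases lt_or_ge x₁ x₂ with hx | hx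
  · have k := (h.hat_lt hψ hx).le
    have k2 := mul_le_mul k k (by positivity) (by positivity)
    have k3 : n * (x₂ / η₂ ^ 2) < ρ ^ 2 * (x₁ / η₁ ^ 2) := by
      refine lt_of_mul_lt_mul_right (a := x₂) ?_ hx2.le
      calc n * (x₂ / η₂ ^ 2) * x₂ = n * (x₂ / η₂ * (x₂ / η₂)) := by ring
        _ ≤ n ^ 6 * (x₂ / η₂ * (x₂ / η₂)) :=
          mul_le_mul_of_nonneg_right (le_self_pow₀ hn (by norm_num)) (by positivity)
        _ = n ^ 3 * (x₂ / η₂) * (n ^ 3 * (x₂ / η₂)) := by ring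
        _ ≤ ρ * (x₁ / η₁) * (ρ * (x₁ / η₁)) := k2
        _ = ρ ^ 2 * (x₁ / η₁ ^ 2) * x₁ := by ring
        _ < _ := mul_lt_mul_of_pos_left hx (by positivity)
    refine ⟨k3.le, fun _ => lt_of_le_of_lt ?_ k3⟩
    have : 1 * (x₂ / η₂ ^ 2) ≤ n * (x₂ / η₂ ^ 2) := mul_le_mul_of_nonneg_right hn (by positivity)
    linarith
  · have a : x₂ / η₂ ^ 2 ≤ x₁ / η₁ ^ 2 :=
      div_le_div₀ hx1.le hx (by positivity)
        (pow_le_pow_left₀ hη1.le (h.le_one.trans h.one_le) 2)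
    have b : n * (x₂ / η₂ ^ 2) ≤ ρ ^ 2 * (x₁ / η₁ ^ 2) :=
      mul_le_mul hρ1 a (by positivity) (by positivity)
    refine ⟨b, fun hη => ?_⟩
    have a' : x₂ / η₂ ^ 2 < x₁ / η₁ ^ 2 :=
      div_lt_div₀' hx (pow_lt_pow_left₀ hη hη1.le (by norm_num)) hx1 (by positivity)
    have c : 1 * (x₁ / η₁ ^ 2) ≤ ρ ^ 2 * (x₁ / η₁ ^ 2) :=
      mul_le_mul_of_nonneg_right (by linarith) (by positivity)
    linarith

end CellPair

section TwoStates

variable {θ θ₂ δ₁ u₁ x₁ η₁ C₁ δ₂ u₂ x₂ η₂ C₂ n ρ : ℝ}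

theorem one_div_le {u v : ℝ} (hv : v < 1) (h : u ≤ v) : 1 / (1 - u) ≤ 1 / (1 - v) :=
  one_div_le_one_div_of_le (by linarith) (by linarith)

theorem rr_ratio_le (hθ : 0 ≤ θ) (h₁ : RState θ θ₂ δ₁ u₁ x₁ η₁ C₁)
    (h₂ : RState θ θ₂ δ₂ u₂ x₂ η₂ C₂) (hδ : δ₂ ≤ δ₁) (hu : u₂ ≤ u₁) :
    (1 / (1 - u₂)) ^ 2 * ((δ₂ + θ) * rr θ δ₂ u₂ ^ 2)
      ≤ (1 / (1 - u₁)) ^ 2 * ((δ₁ + θ) * rr θ δ₁ u₁ ^ 2) := by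
  have d1 := h₁.δ_pos
  have k := mul_rr_sq_le hθ h₂.δ_pos hδ h₁.δ_lt h₂.u_lt h₂.k_gt h₂.k_le
  have hk : 0 < δ₁ + 2 * θ + u₂ * (1 - δ₁) := by
    have := h₂.k_gt
    have := mul_nonneg (sub_nonneg.2 hδ) (sub_nonneg.2 h₂.u_lt.le)
    linarith
  have l := rr_mul_le hθ d1 h₁.δ_lt hu h₁.u_lt hk
  have r0 := AnticipatoryTrading.rr_pos hθ d1 h₁.δ_lt h₂.u_lt hk
  have t1 : 0 < 1 - u₁ := by linarith [h₁.u_lt]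
  have t2 : 0 < 1 - u₂ := by linarith [h₂.u_lt]
  have l2 : rr θ δ₁ u₂ * (1 / (1 - u₂)) ≤ rr θ δ₁ u₁ * (1 / (1 - u₁)) := by
    rw [mul_one_div, mul_one_div, div_le_div_iff₀ t2 t1]
    exact l
  have l3 := pow_le_pow_left₀ (by positivity) l2 2
  calc (1 / (1 - u₂)) ^ 2 * ((δ₂ + θ) * rr θ δ₂ u₂ ^ 2)
      ≤ (1 / (1 - u₂)) ^ 2 * ((δ₁ + θ) * rr θ δ₁ u₂ ^ 2) :=
        mul_le_mul_of_nonneg_left k (by positivity)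
    _ = (δ₁ + θ) * (rr θ δ₁ u₂ * (1 / (1 - u₂))) ^ 2 := by ring
    _ ≤ (δ₁ + θ) * (rr θ δ₁ u₁ * (1 / (1 - u₁))) ^ 2 :=
        mul_le_mul_of_nonneg_left l3 (by linarith)
    _ = _ := by ring

/-- Comparison of intermediate market sizes for `δ₂ ≤ δ₁` and `u₂ ≤ u₁`. -/
theorem invSize_lt_of_le (hθ : 0 ≤ θ) (h₁ : RState θ θ₂ δ₁ u₁ x₁ η₁ C₁)
    (h₂ : RState θ θ₂ δ₂ u₂ x₂ η₂ C₂)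
    (hp : CellPair x₁ η₁ C₁ ((δ₁ + θ) / (δ₁ + 2 * θ)) (1 / (1 - u₁))
      x₂ η₂ C₂ ((δ₂ + θ) / (δ₂ + 2 * θ)) (1 / (1 - u₂)) n ρ) (hn : 1 < n)
    (hδ : δ₂ ≤ δ₁) (hu : u₂ ≤ u₁) :
    invSize θ δ₂ u₂ x₂ η₂ < ρ ^ 2 * invSize θ δ₁ u₁ x₁ η₁ := by
  have a := (hp.sq_hat_mul_le (Or.inr (one_div_le h₁.u_lt hu))).1
  have b := rr_ratio_le hθ h₁ h₂ hδ hu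
  have r2 := h₂.rr_pos hθ
  have d2 := h₂.δ_pos
  have t2 := h₂.one_div_pos
  have c : 0 < (1 / (1 - u₂)) ^ 2 * ((δ₂ + θ) * rr θ δ₂ u₂ ^ 2) := by positivity
  have hx1 := hp.left.x_pos
  have hη1 := hp.left.η_pos
  have hx2 := hp.right.x_pos
  have hη2 := hp.right.η_pos
  have hw : 0 < x₂ / η₂ ^ 2 := by positivity
  have a' : x₂ / η₂ ^ 2 < ρ ^ 2 * (x₁ / η₁ ^ 2) := by nlinarith
  unfold invSize
  rw [mul_assoc, mul_assoc, ← mul_assoc (ρ ^ 2)]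
  exact mul_lt_mul a' b c (by positivity)

theorem psi_mul_sq {δ : ℝ} (hM : δ + 2 * θ ≠ 0) (u : ℝ) :
    (δ + θ) * (δ + 4 * θ) * (u / (δ + 2 * θ)) ^ 2 = u ^ 2 * (1 + θ * δ / (δ + 2 * θ) ^ 2) := by
  obtain ⟨M, hMe⟩ : ∃ M, M = δ + 2 * θ := ⟨_, rfl⟩
  rw [← hMe] at hM ⊢
  rw [show θ = (M - δ) / 2 by linarith]
  field_simp
  ring

/-- Comparison of inventory aversions for `δ₂ ≤ δ₁` and `0 ≤ u₂ ≤ u₁`. -/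
theorem invAversionQ_le_of_nonneg (hθ : 0 ≤ θ) (h₁ : RState θ θ₂ δ₁ u₁ x₁ η₁ C₁)
    (h₂ : RState θ θ₂ δ₂ u₂ x₂ η₂ C₂)
    (hp : CellPair x₁ η₁ C₁ ((δ₁ + θ) / (δ₁ + 2 * θ)) (1 / (1 - u₁))
      x₂ η₂ C₂ ((δ₂ + θ) / (δ₂ + 2 * θ)) (1 / (1 - u₂)) 1 1)
    (hδ : δ₂ ≤ δ₁) (hu : u₂ ≤ u₁) (hu2 : 0 ≤ u₂) :
    invAversionQ θ δ₂ u₂ x₂ η₂ ≤ invAversionQ θ δ₁ u₁ x₁ η₁ ∧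
      (η₁ < η₂ → invAversionQ θ δ₂ u₂ x₂ η₂ < invAversionQ θ δ₁ u₁ x₁ η₁) := by
  have hϑ := one_div_le h₁.u_lt hu
  have a := hp.sq_hat_mul_le (Or.inr hϑ)
  have hx1 := hp.left.x_pos
  have hη1 := hp.left.η_pos
  have hx2 := hp.right.x_pos
  have hη2 := hp.right.η_pos
  have d1 := h₁.δ_pos
  have d2 := h₂.δ_pos
  have d1' := h₁.δ_lt
  have d2' := h₂.δ_lt
  have M1 := h₁.M_pos hθ
  have M2 := h₂.M_pos hθ
  have t2 := h₂.one_div_pos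
  have hsq : (x₂ / η₂) ^ 2 ≤ (x₁ / η₁) ^ 2 := by
    refine pow_le_pow_left₀ (by positivity) ?_ 2
    rcases lt_or_ge x₁ x₂ with hx | hx
    · have := hp.hat_lt (Or.inr hϑ) hx
      linarith
    · exact div_le_div₀ hx1.le hx hη1 (hp.le_one.trans hp.one_le)
  have hN : (δ₂ + θ) / (1 - δ₂) + (δ₂ + θ) * (δ₂ + 4 * θ) * (u₂ / (δ₂ + 2 * θ)) ^ 2
      ≤ (δ₁ + θ) / (1 - δ₁) + (δ₁ + θ) * (δ₁ + 4 * θ) * (u₁ / (δ₁ + 2 * θ)) ^ 2 := by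
    rw [psi_mul_sq M1.ne', psi_mul_sq M2.ne']
    have c1 : u₂ ^ 2 * (1 + θ * δ₁ / (δ₁ + 2 * θ) ^ 2) ≤ u₁ ^ 2 * (1 + θ * δ₁ / (δ₁ + 2 * θ) ^ 2) :=
      mul_le_mul_of_nonneg_right (pow_le_pow_left₀ hu2 hu 2) (by positivity)
    have c2 : (δ₂ + θ) / (1 - δ₂) + (δ₁ - δ₂) ≤ (δ₁ + θ) / (1 - δ₁) := by
      rw [div_add' _ _ _ (by linarith : 1 - δ₂ ≠ 0), div_le_div_iff₀ (by linarith) (by linarith)]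
      have : 0 ≤ (δ₁ - δ₂) * (δ₁ * (1 - δ₂) + δ₂ + θ) :=
        mul_nonneg (by linarith) (by have := mul_pos d1 (show 0 < 1 - δ₂ by linarith); linarith)
      linarith
    have c3 : u₂ ^ 2 * (θ * δ₂ / (δ₂ + 2 * θ) ^ 2) ≤ u₂ ^ 2 * (θ * δ₁ / (δ₁ + 2 * θ) ^ 2)
        + (δ₁ - δ₂) := by
      have e : θ * δ₂ / (δ₂ + 2 * θ) ^ 2 - θ * δ₁ / (δ₁ + 2 * θ) ^ 2
          = (δ₁ - δ₂) * (θ * (δ₁ * δ₂ - 4 * θ ^ 2)) / ((δ₁ + 2 * θ) ^ 2 * (δ₂ + 2 * θ) ^ 2) := by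
        field_simp; ring
      have f1 : u₂ ^ 2 ≤ 2 * (δ₂ + 2 * θ) := by
        have a1 := mul_nonneg hu2 (sub_nonneg.2 h₂.u_lt.le)
        have a2 := mul_nonneg hu2 (sub_nonneg.2 d2'.le)
        linarith only [h₂.k_le, a1, a2]
      have f2 : θ * (δ₁ * δ₂ - 4 * θ ^ 2) * (2 * (δ₂ + 2 * θ))
          ≤ (δ₁ + 2 * θ) ^ 2 * (δ₂ + 2 * θ) ^ 2 := by
        have g1 : 2 * (θ * δ₁) ≤ (δ₁ + 2 * θ) ^ 2 := by
          linarith only [mul_nonneg hθ d1.le, sq_nonneg δ₁, sq_nonneg θ]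
        have g2 : δ₂ * (δ₂ + 2 * θ) ≤ (δ₂ + 2 * θ) ^ 2 := by
          linarith only [mul_nonneg hθ M2.le]
        have g3 := mul_le_mul g1 g2 (by positivity) (by positivity)
        have : 0 ≤ θ ^ 3 * (δ₂ + 2 * θ) := by positivity
        linarith
      have f3 : u₂ ^ 2 * (θ * (δ₁ * δ₂ - 4 * θ ^ 2)) ≤ (δ₁ + 2 * θ) ^ 2 * (δ₂ + 2 * θ) ^ 2 := by
        rcases le_total (θ * (δ₁ * δ₂ - 4 * θ ^ 2)) 0 with hh | hh
        · have := mul_nonneg (sq_nonneg u₂) (neg_nonneg.2 hh)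
          have : 0 ≤ (δ₁ + 2 * θ) ^ 2 * (δ₂ + 2 * θ) ^ 2 := by positivity
          linarith
        · have := mul_le_mul_of_nonneg_right f1 hh
          linarith
      have f4 : u₂ ^ 2 * ((δ₁ - δ₂) * (θ * (δ₁ * δ₂ - 4 * θ ^ 2))
          / ((δ₁ + 2 * θ) ^ 2 * (δ₂ + 2 * θ) ^ 2)) ≤ δ₁ - δ₂ := by
        rw [mul_div_assoc', div_le_iff₀ (by positivity)]
        have := mul_le_mul_of_nonneg_left f3 (sub_nonneg.2 hδ)
        linarith
      rw [← e] at f4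
      linarith
    linarith
  have hϑ2 := pow_le_pow_left₀ t2.le hϑ 2
  have hN2 : 0 < (δ₂ + θ) / (1 - δ₂) + (δ₂ + θ) * (δ₂ + 4 * θ) * (u₂ / (δ₂ + 2 * θ)) ^ 2 := by
    have : 0 < (δ₂ + θ) / (1 - δ₂) := div_pos (by linarith) (by linarith)
    positivity
  have m := mul_le_mul hϑ2 hN hN2.le (by positivity)
  have eQ : ∀ δ u x η : ℝ, invAversionQ θ δ u x η = x / η ^ 2 * ((1 / (1 - u)) ^ 2
      * ((δ + θ) / (1 - δ) + (δ + θ) * (δ + 4 * θ) * (u / (δ + 2 * θ)) ^ 2)) + (x / η) ^ 2 := by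
    intro δ u x η; unfold invAversionQ; ring
  rw [eQ, eQ]
  have a1 : x₂ / η₂ ^ 2 ≤ x₁ / η₁ ^ 2 := by linarith [a.1]
  have p2 : 0 < (1 / (1 - u₂)) ^ 2
      * ((δ₂ + θ) / (1 - δ₂) + (δ₂ + θ) * (δ₂ + 4 * θ) * (u₂ / (δ₂ + 2 * θ)) ^ 2) := by positivity
  refine ⟨add_le_add (mul_le_mul a1 m p2.le (by positivity)) hsq, fun hη => ?_⟩
  have a2 : x₂ / η₂ ^ 2 < x₁ / η₁ ^ 2 := by linarith [a.2 hη]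
  exact add_lt_add_of_lt_of_le (mul_lt_mul a2 m p2 (by positivity)) hsq

/-- Comparison of inventory aversions for `δ₂ ≤ δ₁` and `u₂ ≤ 0`. -/
theorem invAversionQ_lt_of_nonpos (hθ : 0 ≤ θ) (h₁ : RState θ θ₂ δ₁ u₁ x₁ 1 C₁)
    (h₂ : RState θ θ₂ δ₂ u₂ x₂ η₂ C₂) (hη₂ : 1 ≤ η₂) (hδ : δ₂ ≤ δ₁) (hu2 : u₂ ≤ 0) :
    invAversionQ θ δ₂ u₂ x₂ η₂ < invAversionQ θ δ₁ u₁ x₁ 1 := by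
  have hx2 := h₂.cell.x_pos
  have hη2 := h₂.cell.η_pos
  have d1 := h₁.δ_pos
  have d2 := h₂.δ_pos
  have d1' := h₁.δ_lt
  have d2' := h₂.δ_lt
  have M1 := h₁.M_pos hθ
  have M2 := h₂.M_pos hθ
  have t2 := h₂.one_div_pos
  have t2' : 1 / (1 - u₂) ≤ 1 := by
    rw [div_le_one (by linarith)]; linarith
  obtain ⟨hx3, hη3⟩ := h₂.cell.lt_third hη₂ t2 t2'
  obtain ⟨c1, c2, c3, c4⟩ := h₁.crit_u
  have hu1 := h₁.u_lt
  have e1 : x₂ / η₂ ^ 2 ≤ 1 / 8 := by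
    rw [div_le_div_iff₀ (by positivity) (by norm_num)]
    have : (1 + 2 * x₂) ^ 2 ≤ η₂ ^ 2 := pow_le_pow_left₀ (by positivity) hη3 2
    linarith only [sq_nonneg (2 * x₂ - 1), this]
  have e2 : x₂ / η₂ ^ 2 * x₂ ≤ 1 / 25 := by
    rw [div_mul_eq_mul_div, div_le_div_iff₀ (by positivity) (by norm_num)]
    have : (1 + 2 * x₂) ^ 2 ≤ η₂ ^ 2 := pow_le_pow_left₀ (by positivity) hη3 2
    nlinarith
  set w := x₂ / η₂ ^ 2 with hw
  have hw0 : 0 < w := by positivity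
  set t := 1 / (1 - u₂) with ht
  have ht2 : t ^ 2 ≤ 1 := pow_le_one₀ t2.le t2'
  have htu : t ^ 2 * u₂ ^ 2 ≤ 1 := by
    have : t * u₂ = t - 1 := by rw [ht]; field_simp [show 1 - u₂ ≠ 0 by linarith]; ring
    rw [← mul_pow, this]
    linarith only [mul_nonneg t2.le (show 0 ≤ 2 - t by linarith only [t2'])]
  have em : (δ₂ + θ) / (1 - δ₂) ≤ (δ₁ + θ) / (1 - δ₁) :=
    div_le_div₀ (by linarith) (by linarith) (by linarith) (by linarith)
  have em0 : 0 < (δ₂ + θ) / (1 - δ₂) := div_pos (by linarith) (by linarith)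
  have em1 : 17 / 200 ≤ (δ₁ + θ) / (1 - δ₁) := by
    rw [le_div_iff₀ (by linarith)]
    have := mul_nonneg (sub_nonneg.2 c1.le) (show 0 ≤ 1 - δ₁ by linarith)
    linarith only [h₁.k_le, this, d1]
  set N₁ := (δ₁ + θ) / (1 - δ₁)
  have g1 : 3 / 5 * N₁ + 171 / 1000 ≤ invAversionQ θ δ₁ u₁ x₁ 1 := by
    unfold invAversionQ
    have s1 : 0 ≤ (δ₁ + θ) * (δ₁ + 4 * θ) * (u₁ / (δ₁ + 2 * θ)) ^ 2 := by positivity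
    have s2 : 3 / 5 ≤ x₁ * (1 / (1 - u₁)) ^ 2 := by
      rw [one_div, inv_pow, ← div_eq_mul_inv, le_div_iff₀ (pow_pos (by linarith) 2)]
      nlinarith only [c1, c2, c3, hu1, c4]
    have s3 := mul_le_mul s2 (show N₁ ≤ N₁ + (δ₁ + θ) * (δ₁ + 4 * θ) * (u₁ / (δ₁ + 2 * θ)) ^ 2 by
      linarith) (by linarith) (by positivity)
    rw [one_pow, div_one]
    nlinarith
  have g2 : invAversionQ θ δ₂ u₂ x₂ η₂ ≤ 1 / 8 * N₁ + 9 / 64 + 1 / 25 := by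
    unfold invAversionQ
    rw [psi_mul_sq M2.ne']
    have s0 : θ * δ₂ / (δ₂ + 2 * θ) ^ 2 ≤ 1 / 8 := by
      rw [div_le_div_iff₀ (by positivity) (by norm_num)]; linarith only [sq_nonneg (δ₂ - 2 * θ)]
    have s00 : 0 ≤ θ * δ₂ / (δ₂ + 2 * θ) ^ 2 := by positivity
    have s1 : t ^ 2 * ((δ₂ + θ) / (1 - δ₂)) ≤ 1 * N₁ := mul_le_mul ht2 em em0.le (by norm_num)
    have s2 : t ^ 2 * u₂ ^ 2 * (1 + θ * δ₂ / (δ₂ + 2 * θ) ^ 2) ≤ 1 * (9 / 8) :=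
      mul_le_mul htu (by linarith) (by linarith) (by norm_num)
    have s3 : w * (t ^ 2 * ((δ₂ + θ) / (1 - δ₂)) + t ^ 2 * u₂ ^ 2 * (1 + θ * δ₂ / (δ₂ + 2 * θ) ^ 2))
        ≤ 1 / 8 * (1 * N₁ + 1 * (9 / 8)) :=
      mul_le_mul e1 (by linarith) (by positivity) (by norm_num)
    linarith
  linarith

theorem rr_sq_ge {δ u : ℝ} (hδ : 0 < δ) (hδ' : δ < 1 / 2) (hM : 0 < δ + 2 * θ) (hu0 : 0 < u)
    (hk : u * (1 - δ) ≤ δ + 2 * θ) : u * (1 - δ) ≤ rr θ δ u ^ 2 * (δ + 2 * θ) := by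
  have h1 : (δ + 2 * θ + u * (1 - δ)) / (2 * (δ + 2 * θ)) ≤ rr θ δ u := by
    unfold rr
    have h2 : 0 < 1 - 2 * δ := by linarith
    have h3 : 0 < u * (1 - δ) := mul_pos hu0 (by linarith)
    rw [div_le_div_iff₀ (by positivity) (by positivity)]
    have h4 : (δ + 2 * θ) * (1 - 2 * δ) ≤ (δ + 2 * θ - u * δ) * (1 - δ) := by
      have := mul_le_mul_of_nonneg_left hk hδ.le
      linarith
    have := mul_le_mul_of_nonneg_left h4
      (show 0 ≤ (δ + 2 * θ + u * (1 - δ)) * (2 * (δ + 2 * θ)) by positivity)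
    linarith
  have h3 : 0 < u * (1 - δ) := mul_pos hu0 (by linarith)
  have h5 := pow_le_pow_left₀ (by positivity) h1 2
  have h6 := mul_le_mul_of_nonneg_right h5 hM.le
  refine le_trans ?_ h6
  rw [div_pow, div_mul_eq_mul_div, le_div_iff₀ (by positivity)]
  have := mul_nonneg hM.le (sq_nonneg (δ + 2 * θ - u * (1 - δ)))
  linarith

theorem rr_eq_one {δ u : ℝ} (hM : 0 < δ + 2 * θ) (hδ' : δ < 1 / 2)
    (hk : u * (1 - δ) = δ + 2 * θ) : rr θ δ u = 1 := by
  unfold rr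
  have h2 : 0 < 1 - 2 * δ := by linarith
  rw [div_eq_one_iff_eq (by positivity)]
  rw [hk]
  linear_combination -2 * (δ + 2 * θ) * δ * hk

theorem u_pos_of_one_lt {u : ℝ} (hu : u < 1) (h : 1 < 1 / (1 - u)) : 0 < u := by
  rw [lt_div_iff₀ (by linarith)] at h
  linarith

/-- The parts of `invSize`. -/
theorem invSize_eq {δ u x η : ℝ} (hM : δ + 2 * θ ≠ 0) (hu : u < 1) (hu0 : u ≠ 0) :
    invSize θ δ u x η = x / η ^ 2 * (1 / (1 - u)) * ((δ + θ) / (δ + 2 * θ) * (1 / (1 - u) - 1))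
      * (rr θ δ u ^ 2 * (δ + 2 * θ) / u) := by
  unfold invSize
  have : 1 - u ≠ 0 := by linarith
  have e : 1 / (1 - u) - 1 = u / (1 - u) := by field_simp; ring
  rw [e]
  generalize δ + 2 * θ = M at *
  field_simp

/-- Comparison of intermediate market sizes for `δ₁ < δ₂` if the second state is mixed. -/
theorem invSize_lt_of_mixed (hθ : 0 ≤ θ) (h₁ : RState θ θ₂ δ₁ u₁ x₁ η₁ C₁)
    (h₂ : RState θ θ₂ δ₂ u₂ x₂ η₂ C₂)
    (hp : CellPair x₁ η₁ C₁ ((δ₁ + θ) / (δ₁ + 2 * θ)) (1 / (1 - u₁))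
      x₂ η₂ C₂ ((δ₂ + θ) / (δ₂ + 2 * θ)) (1 / (1 - u₂)) n ρ)
    (hδ : δ₁ < δ₂) (hk : u₂ * (1 - δ₂) = δ₂ + 2 * θ) :
    invSize θ δ₂ u₂ x₂ η₂ < ρ ^ 2 * invSize θ δ₁ u₁ x₁ η₁ := by
  have d1 := h₁.δ_pos
  have M1 := h₁.M_pos hθ
  have M2 := h₂.M_pos hθ
  have hu1 := u_pos_of_one_lt h₁.u_lt hp.one_lt_left
  have hu2 : 0 < u₂ := by
    have : 0 < u₂ * (1 - δ₂) := by rw [hk]; exact M2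
    exact pos_of_mul_pos_left this (by linarith [h₂.δ_lt])
  have w := hp.weight_le (psi_le_psi hθ d1 hδ.le)
  rw [invSize_eq M1.ne' h₁.u_lt hu1.ne', invSize_eq M2.ne' h₂.u_lt hu2.ne',
    rr_eq_one M2 h₂.δ_lt hk]
  have r1 := rr_sq_ge d1 h₁.δ_lt M1 hu1 h₁.k_le
  have hx1 := hp.left.x_pos
  have hη1 := hp.left.η_pos
  have hϑ1 := hp.one_lt_left
  have hA : 0 < x₁ / η₁ ^ 2 * (1 / (1 - u₁)) * ((δ₁ + θ) / (δ₁ + 2 * θ) * (1 / (1 - u₁) - 1)) := by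
    have := h₁.one_div_pos
    have : 0 < 1 / (1 - u₁) - 1 := by linarith
    positivity
  have hρ := hp.ρ_pos
  set A₁ := x₁ / η₁ ^ 2 * (1 / (1 - u₁)) * ((δ₁ + θ) / (δ₁ + 2 * θ) * (1 / (1 - u₁) - 1))
  have e2 : 1 ^ 2 * (δ₂ + 2 * θ) / u₂ = 1 - δ₂ := by rw [← hk]; field_simp
  rw [e2]
  have hW : 1 - δ₂ < rr θ δ₁ u₁ ^ 2 * (δ₁ + 2 * θ) / u₁ := by
    rw [lt_div_iff₀ hu1]
    nlinarith
  calc _ ≤ ρ ^ 2 * A₁ * (1 - δ₂) := mul_le_mul_of_nonneg_right w (by linarith [h₂.δ_lt])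
    _ < ρ ^ 2 * A₁ * (rr θ δ₁ u₁ ^ 2 * (δ₁ + 2 * θ) / u₁) :=
        mul_lt_mul_of_pos_left hW (by positivity)
    _ = _ := mul_assoc _ _ _

theorem invAversionQ_eq {δ u x η : ℝ} (hM : 0 < δ + 2 * θ) (hδ : δ < 1) (hu : u < 1) (hu0 : u ≠ 0)
    (hx : x ≠ 0) :
    invAversionQ θ δ u x η = (x / η) ^ 2 * ((δ + θ) / (δ + 2 * θ) * (1 / (1 - u) - 1) / x
      * (1 / (1 - u) * ((δ + 2 * θ) / (u * (1 - δ)))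
        + (δ + 4 * θ) / (δ + 2 * θ) * (1 / (1 - u) - 1)) + 1) := by
  unfold invAversionQ
  have : 1 - u ≠ 0 := by linarith
  have : 1 - δ ≠ 0 := by linarith
  have e : 1 / (1 - u) - 1 = u / (1 - u) := by field_simp; ring
  rw [e]
  generalize δ + 2 * θ = M at *
  field_simp

theorem mixed_aux {v e ϑ l : ℝ} (hv : 0 ≤ v) (hv1 : v ≤ 1) (he : 1 ≤ e) (he2 : e ≤ 2) (hϑ : 1 ≤ ϑ)
    (hl : 1 < l) : v * (l * ϑ + e * (l * ϑ - 1)) + 1 < l ^ 2 * (v * (ϑ + e * (ϑ - 1)) + 1) := by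
  have h1 : 0 ≤ v * (1 + e) * (l * ϑ - (l + 1) / 2) := by
    refine mul_nonneg (by positivity) ?_
    nlinarith
  have h2 : 0 < 1 + v * (1 - e) / 2 := by nlinarith
  have h3 : 0 < (l - 1) * ((l + 1) * (1 + v * (1 - e) / 2) + v * (1 + e) * (l * ϑ - (l + 1) / 2)) :=
    mul_pos (by linarith) (by have := mul_pos (show 0 < l + 1 by linarith) h2; linarith)
  linarith

/-- Comparison of inventory aversions for `δ₁ < δ₂` if the second state is mixed. -/
theorem invAversionQ_lt_of_mixed (hθ : 0 ≤ θ) (h₁ : RState θ θ₂ δ₁ u₁ x₁ η₁ C₁)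
    (h₂ : RState θ θ₂ δ₂ u₂ x₂ η₂ C₂)
    (hp : CellPair x₁ η₁ C₁ ((δ₁ + θ) / (δ₁ + 2 * θ)) (1 / (1 - u₁))
      x₂ η₂ C₂ ((δ₂ + θ) / (δ₂ + 2 * θ)) (1 / (1 - u₂)) 1 1)
    (hδ : δ₁ < δ₂) (hk : u₂ * (1 - δ₂) = δ₂ + 2 * θ) :
    invAversionQ θ δ₂ u₂ x₂ η₂ < invAversionQ θ δ₁ u₁ x₁ η₁ := by
  have d1 := h₁.δ_pos
  have d2' := h₂.δ_lt
  have M1 := h₁.M_pos hθ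
  have M2 := h₂.M_pos hθ
  have hu1 := u_pos_of_one_lt h₁.u_lt hp.one_lt_left
  have hu2 : 0 < u₂ := by
    have : 0 < u₂ * (1 - δ₂) := by rw [hk]; exact M2
    exact pos_of_mul_pos_left this (by linarith [h₂.δ_lt])
  have hx1 := hp.left.x_pos
  have hη1 := hp.left.η_pos
  have hx2 := hp.right.x_pos
  have hη2 := hp.right.η_pos
  have huu : u₁ < u₂ := by
    by_contra! hle
    have := h₁.k_le
    have := mul_le_mul_of_nonneg_right hle (show 0 ≤ 1 - δ₂ by linarith)
    nlinarith
  obtain ⟨b1, b2⟩ := hp.hat_mul_le (psi_le_psi hθ d1 hδ.le)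
  have nu := hp.left.nu_le hp.right hp.ratio hp.le_one hp.one_le
  rw [invAversionQ_eq M1 (by linarith) h₁.u_lt hu1.ne' hx1.ne',
    invAversionQ_eq M2 (by linarith) h₂.u_lt hu2.ne' hx2.ne', hk, div_self M2.ne', mul_one]
  have hϑ1 := hp.one_lt_left
  have t1 := h₁.one_div_pos
  have hϑ : 1 / (1 - u₁) < 1 / (1 - u₂) :=
    one_div_lt_one_div_of_lt (by linarith [h₂.u_lt]) (by linarith)
  have hk1 : 1 ≤ (δ₁ + 2 * θ) / (u₁ * (1 - δ₁)) := by
    rw [le_div_iff₀ (mul_pos hu1 (by linarith))]; linarith [h₁.k_le]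
  set ϑ₁ := 1 / (1 - u₁)
  set ϑ₂ := 1 / (1 - u₂)
  set v₂ := (δ₂ + θ) / (δ₂ + 2 * θ) * (ϑ₂ - 1) / x₂ with hv₂
  set v₁ := (δ₁ + θ) / (δ₁ + 2 * θ) * (ϑ₁ - 1) / x₁ with hv₁
  have hψ2 : 0 < (δ₂ + θ) / (δ₂ + 2 * θ) := by
    have := h₂.δ_pos
    positivity
  have hv20 : 0 ≤ v₂ := div_nonneg (mul_nonneg hψ2.le (by linarith)) hx2.le
  have hv21 : v₂ ≤ 1 := by
    rw [hv₂, div_le_one hx2]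
    have := hp.right.le_mul_of_ge hp.one_le
    nlinarith [hp.right.C_lt]
  have hv : v₂ ≤ v₁ := by
    rw [hv₁, hv₂, div_le_div_iff₀ hx2 hx1]
    linarith
  have he2 : 1 ≤ (δ₂ + 4 * θ) / (δ₂ + 2 * θ) := by rw [le_div_iff₀ M2]; linarith
  have he2' : (δ₂ + 4 * θ) / (δ₂ + 2 * θ) ≤ 2 := by
    rw [div_le_iff₀ M2]; linarith [h₂.δ_pos]
  have he1 : (δ₂ + 4 * θ) / (δ₂ + 2 * θ) ≤ (δ₁ + 4 * θ) / (δ₁ + 2 * θ) := by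
    rw [div_le_div_iff₀ M2 M1]
    have := mul_nonneg hθ (sub_nonneg.2 hδ.le)
    linarith
  set e₂ := (δ₂ + 4 * θ) / (δ₂ + 2 * θ)
  set e₁ := (δ₁ + 4 * θ) / (δ₁ + 2 * θ)
  set l := ϑ₂ / ϑ₁ with hl
  have hl1 : 1 < l := by rw [hl, lt_div_iff₀ t1]; linarith
  have hlϑ : l * ϑ₁ = ϑ₂ := by rw [hl]; field_simp
  have aux := mixed_aux hv20 hv21 he2 he2' hϑ1.le hl1
  rw [hlϑ] at aux
  have hX : l * (x₂ / η₂) ≤ x₁ / η₁ := by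
    rw [hl, div_mul_eq_mul_div, div_le_iff₀ t1]; linarith
  have hX2 : 0 < x₂ / η₂ := by positivity
  have hX' := pow_le_pow_left₀ (by positivity) hX 2
  have g1 : v₂ * (ϑ₁ + e₂ * (ϑ₁ - 1)) ≤ v₁ * (ϑ₁ * ((δ₁ + 2 * θ) / (u₁ * (1 - δ₁)))
      + e₁ * (ϑ₁ - 1)) := by
    refine mul_le_mul hv ?_ ?_ (hv20.trans hv)
    · have c1 := mul_le_mul_of_nonneg_left hk1 t1.le
      have c2 := mul_le_mul_of_nonneg_right he1 (show 0 ≤ ϑ₁ - 1 by linarith)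
      linarith
    · have := mul_nonneg (show 0 ≤ e₂ by linarith) (show 0 ≤ ϑ₁ - 1 by linarith)
      linarith
  have g0 : 0 ≤ v₂ * (ϑ₁ + e₂ * (ϑ₁ - 1)) := by
    have := mul_nonneg (show 0 ≤ e₂ by linarith) (show 0 ≤ ϑ₁ - 1 by linarith)
    exact mul_nonneg hv20 (by linarith)
  calc (x₂ / η₂) ^ 2 * (v₂ * (ϑ₂ + e₂ * (ϑ₂ - 1)) + 1)
      < (x₂ / η₂) ^ 2 * (l ^ 2 * (v₂ * (ϑ₁ + e₂ * (ϑ₁ - 1)) + 1)) :=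
        mul_lt_mul_of_pos_left aux (by positivity)
    _ = (l * (x₂ / η₂)) ^ 2 * (v₂ * (ϑ₁ + e₂ * (ϑ₁ - 1)) + 1) := by ring
    _ ≤ _ := mul_le_mul hX' (by linarith) (by linarith) (by positivity)

end TwoStates

end AnticipatoryTrading

namespace AnticipatoryTrading

section TwoStates

variable {θ θ₂ δ₁ u₁ x₁ η₁ C₁ δ₂ u₂ x₂ η₂ C₂ n ρ : ℝ}

theorem vB_mono (hθ : 0 ≤ θ) (h1 : 0 < δ₁) (h : δ₁ ≤ δ₂) {u x : ℝ} (hx : 0 < x) :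
    vB (2 * θ / (δ₂ + 2 * θ)) (δ₂ / (δ₂ + θ)) u x
      ≤ vB (2 * θ / (δ₁ + 2 * θ)) (δ₁ / (δ₁ + θ)) u x := by
  have a : 2 * θ / (δ₂ + 2 * θ) ≤ 2 * θ / (δ₁ + 2 * θ) :=
    div_le_div_of_nonneg_left (by linarith) (by linarith) (by linarith)
  have a0 : 0 ≤ 2 * θ / (δ₂ + 2 * θ) := div_nonneg (by linarith) (by linarith)
  have e : δ₁ / (δ₁ + θ) ≤ δ₂ / (δ₂ + θ) := by
    rw [div_le_div_iff₀ (by linarith) (by linarith)]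
    have := mul_nonneg hθ (sub_nonneg.2 h)
    linarith
  have a2 := mul_le_mul_of_nonneg_right (pow_le_pow_left₀ a0 a 2) (sq_nonneg u)
  have e2 := mul_le_mul_of_nonneg_right e (mul_nonneg hx.le (sq_nonneg (1 - u)))
  unfold vB
  linarith

/-- The parameters of `vB` in terms of `σ = δ / (δ + 2 θ)`. -/
theorem vB_params {δ : ℝ} (hθ : 0 ≤ θ) (hδ : 0 < δ) :
    2 * θ / (δ + 2 * θ) = 1 - δ / (δ + 2 * θ) ∧
    δ / (δ + θ) * (1 + δ / (δ + 2 * θ)) = 2 * (δ / (δ + 2 * θ)) ∧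
    2 * ((δ + θ) / (δ + 2 * θ)) = 1 + δ / (δ + 2 * θ) ∧
    (2 * θ / (δ + 2 * θ)) ^ 2 ≤ 1 ∧ 0 ≤ δ / (δ + θ) ∧ δ / (δ + θ) ≤ 1 := by
  have hM : 0 < δ + 2 * θ := by linarith
  have hm : 0 < δ + θ := by linarith
  have e1 : 1 + δ / (δ + 2 * θ) = 2 * (δ + θ) / (δ + 2 * θ) := by
    rw [eq_div_iff hM.ne', add_mul, div_mul_cancel₀ _ hM.ne']; ring
  refine ⟨?_, ?_, ?_, ?_, by positivity, ?_⟩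
  · rw [eq_sub_iff_add_eq, ← add_div, div_eq_one_iff_eq hM.ne']; ring
  · rw [e1]; field_simp
  · rw [e1]; ring
  · refine pow_le_one₀ (by positivity) ?_
    rw [div_le_one hM]; linarith
  · rw [div_le_one hm]; linarith

/-- Comparison of intermediate market sizes for `δ₁ < δ₂` if the second state is pure. -/
theorem invSize_lt_of_pure (hθ : 0 ≤ θ) (hθ₂ : 0 < θ₂) (h₁ : RState θ θ₂ δ₁ u₁ x₁ η₁ C₁)
    (h₂ : RState θ θ₂ δ₂ u₂ x₂ η₂ C₂)
    (hp : CellPair x₁ η₁ C₁ ((δ₁ + θ) / (δ₁ + 2 * θ)) (1 / (1 - u₁))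
      x₂ η₂ C₂ ((δ₂ + θ) / (δ₂ + 2 * θ)) (1 / (1 - u₂)) n ρ) (hn : 1 < n)
    (hδ : δ₁ < δ₂) (hpure : vB (2 * θ / (δ₂ + 2 * θ)) (δ₂ / (δ₂ + θ)) u₂ x₂
      = 4 * (δ₂ * rr θ δ₂ u₂ ^ 2) * θ₂) :
    invSize θ δ₂ u₂ x₂ η₂ < ρ ^ 2 * invSize θ δ₁ u₁ x₁ η₁ := by
  have d1 := h₁.δ_pos
  have d2 := h₂.δ_pos
  have hx1 := hp.left.x_pos
  have hη1 := hp.left.η_pos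
  have hx2 := hp.right.x_pos
  have hη2 := hp.right.η_pos
  have hρ := hp.ρ_pos
  have r1 := h₁.rr_pos hθ
  have r2 := h₂.rr_pos hθ
  obtain ⟨-, -, -, p4, p5, p6⟩ := vB_params hθ d2
  have hB1 := (vB_mono hθ d1 hδ.le (u := u₁) hx1).trans h₁.vol
  set a := 2 * θ / (δ₂ + 2 * θ)
  set e := δ₂ / (δ₂ + θ)
  have q := hp.quad_le (psi_le_psi hθ d1 hδ.le) p4 p6 (by
    rw [← vB_mul h₂.u_lt, hpure]; positivity)
  rw [← vB_mul h₂.u_lt, ← vB_mul h₁.u_lt, hpure] at q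
  have q1 := mul_le_mul_of_nonneg_left hB1
    (show 0 ≤ ρ ^ 2 * (x₁ / η₁ ^ 2 * (1 / (1 - u₁)) ^ 2) by positivity)
  have q2 : 4 * θ₂ * (n * (x₂ / η₂ ^ 2 * (1 / (1 - u₂)) ^ 2 * (δ₂ * rr θ δ₂ u₂ ^ 2)))
      ≤ 4 * θ₂ * (ρ ^ 2 * (x₁ / η₁ ^ 2 * (1 / (1 - u₁)) ^ 2 * (δ₁ * rr θ δ₁ u₁ ^ 2))) := by
    linarith
  have q3 := le_of_mul_le_mul_left q2 (by positivity)
  have t2 := h₂.one_div_pos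
  have t1 := h₁.one_div_pos
  have hw : 0 < x₂ / η₂ ^ 2 * (1 / (1 - u₂)) ^ 2 * (δ₂ * rr θ δ₂ u₂ ^ 2) := by positivity
  have hm : (δ₂ + θ) / δ₂ ≤ (δ₁ + θ) / δ₁ := by
    rw [div_le_div_iff₀ d2 d1]
    linarith only [mul_le_mul_of_nonneg_left hδ.le hθ]
  have e1 : ∀ {δ u x η : ℝ}, 0 < δ → invSize θ δ u x η
      = x / η ^ 2 * (1 / (1 - u)) ^ 2 * (δ * rr θ δ u ^ 2) * ((δ + θ) / δ) := fun h => by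
    unfold invSize; field_simp
  rw [e1 d1, e1 d2]
  have q4 : x₂ / η₂ ^ 2 * (1 / (1 - u₂)) ^ 2 * (δ₂ * rr θ δ₂ u₂ ^ 2)
      < ρ ^ 2 * (x₁ / η₁ ^ 2 * (1 / (1 - u₁)) ^ 2 * (δ₁ * rr θ δ₁ u₁ ^ 2)) := by nlinarith
  have := mul_lt_mul q4 hm (by positivity) (by positivity)
  linarith

/-- Comparison of inventory aversions for `δ₁ < δ₂` if the second state is pure. -/
theorem invAversion_lt_of_weight (hθ : 0 ≤ θ) (h₁ : RState θ θ₂ δ₁ u₁ x₁ η₁ C₁)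
    (h₂ : RState θ θ₂ δ₂ u₂ x₂ η₂ C₂) (hδ : δ₁ < δ₂)
    (hpure : vB (2 * θ / (δ₂ + 2 * θ)) (δ₂ / (δ₂ + θ)) u₂ x₂ = 4 * (δ₂ * rr θ δ₂ u₂ ^ 2) * θ₂)
    (hw : x₂ / η₂ ^ 2 * (1 / (1 - u₂)) ^ 2 * (1 - δ₁)
      < x₁ / η₁ ^ 2 * (1 / (1 - u₁)) ^ 2 * (1 - δ₂)) :
    invAversion θ θ₂ δ₂ u₂ x₂ η₂ < invAversion θ θ₂ δ₁ u₁ x₁ η₁ := by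
  have d1 := h₁.δ_pos
  have d2 := h₂.δ_pos
  have hd1 : 0 < 1 - δ₁ := by linarith [h₁.δ_lt]
  have hd2 : 0 < 1 - δ₂ := by linarith [h₂.δ_lt]
  refine lt_of_lt_of_le ?_ (h₁.le_invAversion hθ)
  rw [h₂.invAversion_eq_add hθ, hpure, sub_self, mul_zero, mul_zero, add_zero]
  have hm : (δ₂ + θ) / δ₂ ≤ (δ₁ + θ) / δ₁ := by
    rw [div_le_div_iff₀ d2 d1]
    linarith only [mul_le_mul_of_nonneg_left hδ.le hθ]
  have t2 := h₂.one_div_pos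
  have hx2 := h₂.cell.x_pos
  have hη2 := h₂.cell.η_pos
  set w₂ := x₂ / η₂ ^ 2 * (1 / (1 - u₂)) ^ 2 with hw₂
  set w₁ := x₁ / η₁ ^ 2 * (1 / (1 - u₁)) ^ 2
  have hw20 : 0 < w₂ := by positivity
  have h3 : w₂ / (1 - δ₂) < w₁ / (1 - δ₁) := by
    rw [div_lt_div_iff₀ hd2 hd1]; exact hw
  have := mul_lt_mul h3 hm (by positivity) ((by positivity : 0 ≤ w₂ / (1 - δ₂)).trans h3.le)
  calc w₂ * ((δ₂ + θ) / (δ₂ * (1 - δ₂))) = w₂ / (1 - δ₂) * ((δ₂ + θ) / δ₂) := by field_simp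
    _ < _ := this
    _ = _ := by field_simp

theorem weight_lt_of_lt (hθ : 0 ≤ θ) (hθ₂ : 0 < θ₂) (h₁ : RState θ θ₂ δ₁ u₁ x₁ η₁ C₁)
    (h₂ : RState θ θ₂ δ₂ u₂ x₂ η₂ C₂)
    (hp : CellPair x₁ η₁ C₁ ((δ₁ + θ) / (δ₁ + 2 * θ)) (1 / (1 - u₁))
      x₂ η₂ C₂ ((δ₂ + θ) / (δ₂ + 2 * θ)) (1 / (1 - u₂)) 1 1)
    (hδ : δ₁ < δ₂) (hu : u₁ < u₂)
    (hpure : vB (2 * θ / (δ₂ + 2 * θ)) (δ₂ / (δ₂ + θ)) u₂ x₂ = 4 * (δ₂ * rr θ δ₂ u₂ ^ 2) * θ₂) :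
    x₂ / η₂ ^ 2 * (1 / (1 - u₂)) ^ 2 * (1 - δ₁)
      < x₁ / η₁ ^ 2 * (1 / (1 - u₁)) ^ 2 * (1 - δ₂) := by
  have d1 := h₁.δ_pos
  have d2 := h₂.δ_pos
  have hx1 := hp.left.x_pos
  have hη1 := hp.left.η_pos
  have hx2 := hp.right.x_pos
  have hη2 := hp.right.η_pos
  have t1 : 0 < 1 - u₁ := by linarith [h₁.u_lt]
  have t2 : 0 < 1 - u₂ := by linarith [h₂.u_lt]
  have hd1 : 0 < 1 - δ₁ := by linarith [h₁.δ_lt]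
  have hd2 : 0 < 1 - δ₂ := by linarith [h₂.δ_lt]
  have hu1 := u_pos_of_one_lt h₁.u_lt hp.one_lt_left
  have r2 := h₂.rr_pos hθ
  obtain ⟨-, -, -, p4, p5, p6⟩ := vB_params hθ d2
  have hB1 := (vB_mono hθ d1 hδ.le (u := u₁) hx1).trans h₁.vol
  have q := hp.quad_mul_le (psi_le_psi hθ d1 hδ.le)
    (one_div_lt_one_div_of_lt t2 (by linarith)) p4 p6
  have hq1 : 0 < vB (2 * θ / (δ₂ + 2 * θ)) (δ₂ / (δ₂ + θ)) u₁ x₁ := by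
    have : 0 < vB (2 * θ / (δ₂ + 2 * θ)) (δ₂ / (δ₂ + θ)) u₁ x₁ * (1 / (1 - u₁)) ^ 2 := by
      rw [vB_mul h₁.u_lt]
      have a1 := quad_ge (a := 2 * θ / (δ₂ + 2 * θ)) (X := 1 / (1 - u₁) - 1)
      have a2 := hp.one_lt_left
      have a3 := hp.lt_one_left
      have a4 := mul_le_one₀ p6 hx1.le a3.le
      linarith only [a1, a2, a4]
    exact pos_of_mul_pos_left this (by positivity)
  rw [← vB_mul h₂.u_lt, ← vB_mul h₁.u_lt] at q
  set B₁ := vB (2 * θ / (δ₂ + 2 * θ)) (δ₂ / (δ₂ + θ)) u₁ x₁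
  set B₂ := vB (2 * θ / (δ₂ + 2 * θ)) (δ₂ / (δ₂ + θ)) u₂ x₂
  have leg := mul_rr_sq_mul_lt hθ d1 hδ h₂.δ_lt hu1 h₁.u_lt h₁.k_le
  have hk : 0 < δ₂ + 2 * θ + u₁ * (1 - δ₂) := by
    have := mul_pos hu1 hd2
    linarith [h₂.M_pos hθ]
  have l2 := rr_mul_le hθ d2 h₂.δ_lt hu.le h₂.u_lt hk
  have r0 := AnticipatoryTrading.rr_pos hθ d2 h₂.δ_lt h₁.u_lt hk
  have l3 := pow_le_pow_left₀ (by positivity) l2 2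
  have g1 : B₁ * (1 - δ₁) * (1 - u₂) ^ 2 < B₂ * (1 - δ₂) * (1 - u₁) ^ 2 := by
    rw [hpure]
    calc B₁ * (1 - δ₁) * (1 - u₂) ^ 2
        ≤ 4 * (δ₁ * rr θ δ₁ u₁ ^ 2) * θ₂ * (1 - δ₁) * (1 - u₂) ^ 2 := by
          gcongr
      _ = 4 * θ₂ * (1 - u₂) ^ 2 * (δ₁ * rr θ δ₁ u₁ ^ 2 * (1 - δ₁)) := by ring
      _ < 4 * θ₂ * (1 - u₂) ^ 2 * (δ₂ * rr θ δ₂ u₁ ^ 2 * (1 - δ₂)) :=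
          mul_lt_mul_of_pos_left leg (by positivity)
      _ = 4 * θ₂ * δ₂ * (1 - δ₂) * (rr θ δ₂ u₁ * (1 - u₂)) ^ 2 := by ring
      _ ≤ 4 * θ₂ * δ₂ * (1 - δ₂) * (rr θ δ₂ u₂ * (1 - u₁)) ^ 2 :=
          mul_le_mul_of_nonneg_left l3 (by positivity)
      _ = _ := by ring
  set w₂ := x₂ / η₂ ^ 2 * (1 / (1 - u₂)) ^ 2 with hw₂
  set w₁ := x₁ / η₁ ^ 2 * (1 / (1 - u₁)) ^ 2 with hw₁
  have hw20 : 0 < w₂ := by positivity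
  have g2 : w₂ * B₂ * (1 - u₁) ^ 2 ≤ w₁ * B₁ * (1 - u₂) ^ 2 := by
    have e1 : w₂ * B₂ * (1 - u₁) ^ 2 = x₂ / η₂ ^ 2 * ((1 / (1 - u₂)) ^ 2 * (B₂ * (1 / (1 - u₂)) ^ 2))
        * ((1 - u₁) ^ 2 * (1 - u₂) ^ 2) := by rw [hw₂]; field_simp
    have e2 : w₁ * B₁ * (1 - u₂) ^ 2 = x₁ / η₁ ^ 2 * ((1 / (1 - u₁)) ^ 2 * (B₁ * (1 / (1 - u₁)) ^ 2))
        * ((1 - u₁) ^ 2 * (1 - u₂) ^ 2) := by rw [hw₁]; field_simp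
    rw [e1, e2]
    exact mul_le_mul_of_nonneg_right q (by positivity)
  refine lt_of_mul_lt_mul_right (a := B₁ * (1 - u₂) ^ 2) ?_ (by positivity)
  calc w₂ * (1 - δ₁) * (B₁ * (1 - u₂) ^ 2) = w₂ * (B₁ * (1 - δ₁) * (1 - u₂) ^ 2) := by ring
    _ < w₂ * (B₂ * (1 - δ₂) * (1 - u₁) ^ 2) := mul_lt_mul_of_pos_left g1 hw20
    _ = (1 - δ₂) * (w₂ * B₂ * (1 - u₁) ^ 2) := by ring
    _ ≤ (1 - δ₂) * (w₁ * B₁ * (1 - u₂) ^ 2) := mul_le_mul_of_nonneg_left g2 hd2.le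
    _ = _ := by ring

theorem sub_one_mul_sq {M δ u : ℝ} (hM : M ≠ 0) (hu : u < 1) :
    (1 / (1 - u) - 1) * (1 + (M - δ) / M * (1 / (1 - u) - 1)) ^ 2
      = (1 / (1 - u)) ^ 3 * (u * (M - u * δ) ^ 2) / M ^ 2 := by
  have h1 : 1 - u ≠ 0 := by linarith
  have e1 : 1 / (1 - u) - 1 = u / (1 - u) := by field_simp; ring
  rw [e1]
  field_simp
  ring

set_option maxHeartbeats 1000000 in
theorem weight_lt_of_ge (hθ : 0 ≤ θ) (hθ₂ : 0 < θ₂) (h₁ : RState θ θ₂ δ₁ u₁ x₁ η₁ C₁)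
    (h₂ : RState θ θ₂ δ₂ u₂ x₂ η₂ C₂)
    (hp : CellPair x₁ η₁ C₁ ((δ₁ + θ) / (δ₁ + 2 * θ)) (1 / (1 - u₁))
      x₂ η₂ C₂ ((δ₂ + θ) / (δ₂ + 2 * θ)) (1 / (1 - u₂)) 1 1)
    (hδ : δ₁ < δ₂) (hu : u₂ ≤ u₁)
    (hpure : vB (2 * θ / (δ₂ + 2 * θ)) (δ₂ / (δ₂ + θ)) u₂ x₂ = 4 * (δ₂ * rr θ δ₂ u₂ ^ 2) * θ₂) :
    x₂ / η₂ ^ 2 * (1 / (1 - u₂)) ^ 2 * (1 - δ₁)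
      < x₁ / η₁ ^ 2 * (1 / (1 - u₁)) ^ 2 * (1 - δ₂) := by
  have d1 := h₁.δ_pos
  have d2 := h₂.δ_pos
  have hx1 := hp.left.x_pos
  have hη1 := hp.left.η_pos
  have hx2 := hp.right.x_pos
  have hη2 := hp.right.η_pos
  have t1 : 0 < 1 - u₁ := by linarith [h₁.u_lt]
  have t2 : 0 < 1 - u₂ := by linarith [h₂.u_lt]
  have hd1 : 0 < 1 - δ₁ := by linarith [h₁.δ_lt]
  have hd2 : 0 < 1 - δ₂ := by linarith [h₂.δ_lt]
  have hϑ := one_div_le h₁.u_lt hu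
  obtain ⟨p1, p2, p3, p4, p5, p6⟩ := vB_params hθ d2
  have hψ := psi_le_psi hθ d1 hδ.le
  have hB1 := (vB_mono hθ d1 hδ.le (u := u₁) hx1).trans h₁.vol
  have hq1 : 0 < vB (2 * θ / (δ₂ + 2 * θ)) (δ₂ / (δ₂ + θ)) u₁ x₁ := by
    have : 0 < vB (2 * θ / (δ₂ + 2 * θ)) (δ₂ / (δ₂ + θ)) u₁ x₁ * (1 / (1 - u₁)) ^ 2 := by
      rw [vB_mul h₁.u_lt]
      have a1 := quad_ge (a := 2 * θ / (δ₂ + 2 * θ)) (X := 1 / (1 - u₁) - 1)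
      have a2 := hp.one_lt_left
      have a3 := hp.lt_one_left
      have a4 := mul_le_one₀ p6 hx1.le a3.le
      linarith only [a1, a2, a4]
    exact pos_of_mul_pos_left this (by positivity)
  have sq := (hp.sq_hat_mul_le (Or.inr hϑ)).1
  rw [one_mul, one_pow, one_mul] at sq
  rcases hp.quad_mul_pow_le hψ hϑ p3 p2 with hF | ⟨hϑ2, hF⟩
  · have hd : 1 - δ₁ < 2 * (1 - δ₂) := by linarith [h₂.δ_lt]
    have hw : 0 < x₂ / η₂ ^ 2 * (1 / (1 - u₂)) ^ 2 := by positivity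
    calc _ < x₂ / η₂ ^ 2 * (1 / (1 - u₂)) ^ 2 * (2 * (1 - δ₂)) := mul_lt_mul_of_pos_left hd hw
      _ = 2 * (x₂ / η₂ ^ 2 * (1 / (1 - u₂)) ^ 2) * (1 - δ₂) := by ring
      _ ≤ _ := mul_le_mul_of_nonneg_right hF hd2.le
  · have hu2 := u_pos_of_one_lt h₂.u_lt hϑ2
    have hu1 : 0 < u₁ := by linarith
    have hu19 : 1 / 9 < u₁ := by
      rcases hp.crit with rfl | rfl
      · linarith [h₂.crit_u.1]
      · linarith [h₁.crit_u.1]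
    rw [← p1, ← vB_mul h₂.u_lt, ← vB_mul h₁.u_lt] at hF
    have hM2 := h₂.M_pos hθ
    have r2 := h₂.rr_pos hθ
    set a := 2 * θ / (δ₂ + 2 * θ) with ha
    set B₁ := vB a (δ₂ / (δ₂ + θ)) u₁ x₁
    set B₂ := vB a (δ₂ / (δ₂ + θ)) u₂ x₂
    have hB20 : 0 < B₂ := by rw [hpure]; positivity
    have leg := mul_rr_sq_sq_mul_lt hθ d1 hδ h₂.δ_lt hu19 h₁.u_lt h₁.k_le
    have hk' : u₁ * (1 - δ₂) ≤ δ₂ + 2 * θ := by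
      linarith only [h₁.k_le, mul_le_mul_of_nonneg_left hδ.le hu1.le, hδ]
    have l2 := rr_sq_mul_le hθ d2 h₂.δ_lt hu2 hu hk'
    set g₁ := u₁ * (δ₂ + 2 * θ - u₁ * δ₂) ^ 2 with hg₁
    set g₂ := u₂ * (δ₂ + 2 * θ - u₂ * δ₂) ^ 2 with hg₂
    have hg20 : 0 < g₂ := by
      have : 0 < δ₂ + 2 * θ - u₂ * δ₂ := by linarith only [mul_pos d2 t2, hθ]
      positivity
    have hg10 : 0 < g₁ := by
      have : 0 < δ₂ + 2 * θ - u₁ * δ₂ := by linarith only [mul_pos d2 t1, hθ]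
      positivity
    have l3 := pow_le_pow_left₀ (by positivity) l2 2
    -- the bound for the ratio of `1 - δ`
    have k1 : B₁ ^ 2 * (1 - δ₁) ^ 3 * g₂ ^ 2 < B₂ ^ 2 * g₁ ^ 2 * (1 - δ₂) ^ 3 := by
      rw [hpure]
      have hB1s := pow_le_pow_left₀ hq1.le hB1 2
      calc B₁ ^ 2 * (1 - δ₁) ^ 3 * g₂ ^ 2
          ≤ (4 * (δ₁ * rr θ δ₁ u₁ ^ 2) * θ₂) ^ 2 * (1 - δ₁) ^ 3 * g₂ ^ 2 := by gcongr
        _ = 16 * θ₂ ^ 2 * g₂ ^ 2 * ((δ₁ * rr θ δ₁ u₁ ^ 2) ^ 2 * (1 - δ₁) ^ 3) := by ring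
        _ < 16 * θ₂ ^ 2 * g₂ ^ 2 * ((δ₂ * rr θ δ₂ u₁ ^ 2) ^ 2 * (1 - δ₂) ^ 3) :=
            mul_lt_mul_of_pos_left leg (by positivity)
        _ = 16 * θ₂ ^ 2 * δ₂ ^ 2 * (1 - δ₂) ^ 3 * (rr θ δ₂ u₁ ^ 2 * g₂) ^ 2 := by ring
        _ ≤ 16 * θ₂ ^ 2 * δ₂ ^ 2 * (1 - δ₂) ^ 3 * (rr θ δ₂ u₂ ^ 2 * g₁) ^ 2 :=
            mul_le_mul_of_nonneg_left l3 (by positivity)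
        _ = _ := by ring
    -- the bound for the ratio of the weights
    have e2 : a = (δ₂ + 2 * θ - δ₂) / (δ₂ + 2 * θ) := by rw [ha]; congr 1; ring
    rw [e2, sub_one_mul_sq hM2.ne' h₁.u_lt, sub_one_mul_sq hM2.ne' h₂.u_lt, ← hg₁, ← hg₂] at hF
    have hϑ1 : 0 < 1 / (1 - u₁) := h₁.one_div_pos
    have hϑ2' : 0 < 1 / (1 - u₂) := h₂.one_div_pos
    set ϑ₁ := 1 / (1 - u₁)
    set ϑ₂ := 1 / (1 - u₂)
    set w₁ := x₁ / η₁ ^ 2 * ϑ₁ ^ 2 with hw₁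
    set w₂ := x₂ / η₂ ^ 2 * ϑ₂ ^ 2 with hw₂
    have hw10 : 0 < w₁ := by positivity
    have hw20 : 0 < w₂ := by positivity
    have k2 : w₂ * B₂ * g₁ * ϑ₂ ≤ w₁ * B₁ * g₂ * ϑ₁ := by
      refine le_of_mul_le_mul_left (a := ϑ₂ ^ 3 * ϑ₁ ^ 3 / (δ₂ + 2 * θ) ^ 2) ?_ (by positivity)
      calc _ = x₂ / η₂ ^ 2 * (B₂ * ϑ₂ ^ 2) * ϑ₂ ^ 4 * (ϑ₁ ^ 3 * g₁ / (δ₂ + 2 * θ) ^ 2) := by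
            rw [hw₂]; ring
        _ ≤ _ := hF
        _ = _ := by rw [hw₁]; ring
    have k3 : w₂ * ϑ₁ ^ 2 ≤ w₁ * ϑ₂ ^ 2 := by
      have := mul_le_mul_of_nonneg_right sq (show 0 ≤ ϑ₁ ^ 2 * ϑ₂ ^ 2 by positivity)
      calc _ = x₂ / η₂ ^ 2 * (ϑ₁ ^ 2 * ϑ₂ ^ 2) := by rw [hw₂]; ring
        _ ≤ _ := this
        _ = _ := by rw [hw₁]; ring
    have k4 := pow_le_pow_left₀ (by positivity) k2 2
    have k5 : w₂ ^ 3 * (B₂ ^ 2 * g₁ ^ 2) ≤ w₁ ^ 3 * (B₁ ^ 2 * g₂ ^ 2) := by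
      have := mul_le_mul k4 k3 (by positivity) (by positivity)
      refine le_of_mul_le_mul_left (a := ϑ₁ ^ 2 * ϑ₂ ^ 2) ?_ (by positivity)
      linarith
    have k6 : (w₂ * (1 - δ₁)) ^ 3 < (w₁ * (1 - δ₂)) ^ 3 := by
      refine lt_of_mul_lt_mul_right (a := B₁ ^ 2 * g₂ ^ 2) ?_ (by positivity)
      calc (w₂ * (1 - δ₁)) ^ 3 * (B₁ ^ 2 * g₂ ^ 2) = w₂ ^ 3 * (B₁ ^ 2 * (1 - δ₁) ^ 3 * g₂ ^ 2) := by
            ring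
        _ < w₂ ^ 3 * (B₂ ^ 2 * g₁ ^ 2 * (1 - δ₂) ^ 3) := mul_lt_mul_of_pos_left k1 (by positivity)
        _ = w₂ ^ 3 * (B₂ ^ 2 * g₁ ^ 2) * (1 - δ₂) ^ 3 := by ring
        _ ≤ w₁ ^ 3 * (B₁ ^ 2 * g₂ ^ 2) * (1 - δ₂) ^ 3 :=
            mul_le_mul_of_nonneg_right k5 (by positivity)
        _ = _ := by ring
    exact lt_of_pow_lt_pow_left₀ 3 (mul_pos hw10 hd2).le k6

end TwoStates

end AnticipatoryTrading

namespace AnticipatoryTrading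

/-- `∑ Lᵢ sⁱ s'ᵏ⁻ⁱ`, where `k + 1` is the length of `L`. -/
noncomputable def hom₁ (s s' : ℝ) : List ℕ → ℝ
  | [] => 0
  | a :: L => a * s' ^ L.length + s * hom₁ s s' L

/-- `∑ Lᵢ tⁱ t'ᵏ⁻ⁱ`, where `Lᵢ` stands for `hom₁ s s' Lᵢ`. -/
noncomputable def hom₂ (s s' t t' : ℝ) : List (List ℕ) → ℝ
  | [] => 0
  | A :: L => hom₁ s s' A * t' ^ L.length + t * hom₂ s s' t t' L

theorem hom₁_nonneg {s s' : ℝ} (hs : 0 ≤ s) (hs' : 0 ≤ s') (L : List ℕ) : 0 ≤ hom₁ s s' L := by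
  induction L with
  | nil => exact le_rfl
  | cons a L ih => unfold hom₁; positivity

theorem hom₂_nonneg {s s' t t' : ℝ} (L : List (List ℕ)) (hs : 0 ≤ s) (hs' : 0 ≤ s') (ht : 0 ≤ t)
    (ht' : 0 ≤ t') : 0 ≤ hom₂ s s' t t' L := by
  induction L with
  | nil => exact le_rfl
  | cons A L ih =>
    have := hom₁_nonneg hs hs' A
    unfold hom₂
    positivity

theorem left_slope_small {x y : ℝ} (hx : 41 / 100 ≤ x) (hx' : x ≤ 1 / 2) (hy : 0 ≤ y)
    (hy' : y ≤ 1) :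
    0 ≤ (1 + y) * (2 * (1 - x) + 2 * (3 * x - 1) * x * y ^ 2) - 2 * (1 - y ^ 2 * x) * (3 * x - 1) * y ^ 2
      - 2 * (1 - x) * (1 + (14 / 25)) * x * (1 + y ^ 2 * x) * (1 + y) := by
  rcases le_total y (1 / 2) with h | h
  · have key := hom₂_nonneg
        [[42527200, 104527200, 84000000, 22000000], [191372400, 470372400, 378000000, 99000000],
        [304433038, 731244900, 569505000, 142750000], [203347195, 467126850, 341512500,
        77875000], [48938107, 106905900, 73132500, 15250000]]
        (sub_nonneg.2 (show 41 / 100 ≤ x by linarith)) (sub_nonneg.2 (show x ≤ 1 / 2 by linarith))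
        (sub_nonneg.2 (show 0 ≤ y by linarith)) (sub_nonneg.2 (show y ≤ 1 / 2 by linarith))
    simp only [hom₂, hom₁, List.length] at key
    linarith only [key]
  · have key := hom₂_nonneg
        [[48938107, 106905900, 73132500, 15250000], [188157661, 388120350, 243547500, 44125000],
        [258864436, 494225400, 275610000, 41500000], [152212836, 270073800, 142110000, 25500000],
        [33746704, 62241600, 44040000, 16000000]]
        (sub_nonneg.2 (show 41 / 100 ≤ x by linarith)) (sub_nonneg.2 (show x ≤ 1 / 2 by linarith))
        (sub_nonneg.2 (show 1 / 2 ≤ y by linarith)) (sub_nonneg.2 (show y ≤ 1 by linarith))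
    simp only [hom₂, hom₁, List.length] at key
    linarith only [key]

theorem left_gain_small {x y : ℝ} (hx : 41 / 100 ≤ x) (hx' : x ≤ 1 / 2) (hy : 1 / 2 ≤ y)
    (hy' : y ≤ 1) :
    0 ≤ y * (2 * (1 - x) + (3 * x - 1) * y ^ 3) * (2 * (14 / 25) + (14 / 25) ^ 2 * (1 - y ^ 2)) - (3 * x - 1) * (1 + y ^ 2) := by
  have key := hom₂_nonneg
      [[531549, 94950], [3857020, 1083400], [11222340, 3982200], [16963776, 7084800], [14157956,
      6779000], [6211376, 3370400], [1119200, 680000]]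
      (sub_nonneg.2 (show 41 / 100 ≤ x by linarith)) (sub_nonneg.2 (show x ≤ 1 / 2 by linarith))
      (sub_nonneg.2 (show 1 / 2 ≤ y by linarith)) (sub_nonneg.2 (show y ≤ 1 by linarith))
  simp only [hom₂, hom₁, List.length] at key
  linarith only [key]

theorem left_gain_small' {x y : ℝ} (hx : 41 / 100 ≤ x) (hx' : x ≤ 1 / 2) (hy : 0 ≤ y)
    (hy' : y ≤ 1 / 2) :
    0 ≤ (1 + (14 / 25) * (1 - y ^ 2)) ^ 2 * (2 * (1 - x) + (3 * x - 1) * y ^ 3) - (2 * (1 - x) + 2 * (3 * x - 1)) := by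
  have key := hom₂_nonneg
      [[2463296, 867200], [17243072, 6070400], [50698368, 17337600], [81201052, 26288200],
      [76512864, 22872000], [42373980, 11363400], [12737096, 2927600], [1594647, 284850]]
      (sub_nonneg.2 (show 41 / 100 ≤ x by linarith)) (sub_nonneg.2 (show x ≤ 1 / 2 by linarith))
      (sub_nonneg.2 (show 0 ≤ y by linarith)) (sub_nonneg.2 (show y ≤ 1 / 2 by linarith))
  simp only [hom₂, hom₁, List.length] at key
  linarith only [key]

theorem left_slope_mid {x y : ℝ} (hx : 1 / 2 ≤ x) (hx' : x ≤ 11 / 20) (hy : 0 ≤ y)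
    (hy' : y ≤ 1) :
    0 ≤ (1 + y) * (2 * (1 - x) + 2 * (3 * x - 1) * x * y ^ 2) - 2 * (1 - y ^ 2 * x) * (3 * x - 1) * y ^ 2
      - (1 - 36 * (x - 1 / 2) ^ 2) * 2 * (1 - x) * (1 + (27 / 50 + 27 / 10 * (x - 1 / 2))) * x * (1 + y ^ 2 * x) * (1 + y) := by
  rcases le_total y (1 / 2) with h | h
  · have key := hom₂_nonneg
        [[147200000, 776000000, 1721280000, 2073440000, 1444196480, 556354080, 93117600],
        [662400000, 3492000000, 7745760000, 9330480000, 6498884160, 2503593360, 419029200],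
        [962400000, 4942840000, 10655820000, 12476436000, 8483460160, 3220790316, 538385670],
        [535600000, 2579100000, 5152590000, 5558010000, 3513047040, 1280284230, 216155975],
        [108400000, 480260000, 861850000, 821014000, 467874560, 169133194, 32281905]]
        (sub_nonneg.2 (show 1 / 2 ≤ x by linarith)) (sub_nonneg.2 (show x ≤ 11 / 20 by linarith))
        (sub_nonneg.2 (show 0 ≤ y by linarith)) (sub_nonneg.2 (show y ≤ 1 / 2 by linarith))
    simp only [hom₂, hom₁, List.length] at key
    linarith only [key]
  · rcases le_total y (3 / 4) with h | h
    · have key := hom₂_nonneg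
          [[867200000, 3842080000, 6894800000, 6568112000, 3742996480, 1353065552, 258255240],
          [3060800000, 12736080000, 20758440000, 17176632000, 8405790720, 2997256392, 684907540],
          [3991200000, 15329960000, 21644820000, 13578204000, 4262526080, 1662849444, 672409530],
          [2358000000, 8397420000, 10149030000, 4131378000, 80059200, 519859278, 461519235],
          [570400000, 2025460000, 2538150000, 1402894000, 672127360, 582400674, 230062005]]
          (sub_nonneg.2 (show 1 / 2 ≤ x by linarith)) (sub_nonneg.2 (show x ≤ 11 / 20 by linarith))
          (sub_nonneg.2 (show 1 / 2 ≤ y by linarith)) (sub_nonneg.2 (show y ≤ 3 / 4 by linarith))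
      simp only [hom₂, hom₁, List.length] at key
      linarith only [key]
    · have key := hom₂_nonneg
          [[570400000, 2025460000, 2538150000, 1402894000, 672127360, 582400674, 230062005],
          [2205200000, 7806260000, 10156170000, 7091774000, 5296959680, 4139346114, 1378976805],
          [3532800000, 13556480000, 21666240000, 22459392000, 19913227520, 12521309952,
          3424782240], [2860800000, 12629440000, 25253280000, 32452256000, 29191678720,
          16052651616, 3828483920], [972800000, 4917760000, 11375360000, 15922944000,
          14095083520, 7169487104, 1566916480]]
          (sub_nonneg.2 (show 1 / 2 ≤ x by linarith)) (sub_nonneg.2 (show x ≤ 11 / 20 by linarith))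
          (sub_nonneg.2 (show 3 / 4 ≤ y by linarith)) (sub_nonneg.2 (show y ≤ 1 by linarith))
      simp only [hom₂, hom₁, List.length] at key
      linarith only [key]

theorem left_gain_mid {x y : ℝ} (hx : 1 / 2 ≤ x) (hx' : x ≤ 11 / 20) (hy : 1 / 2 ≤ y)
    (hy' : y ≤ 1) :
    0 ≤ y * (2 * (1 - x) + (3 * x - 1) * y ^ 3) * (2 * (27 / 50 + 27 / 10 * (x - 1 / 2)) + (27 / 50 + 27 / 10 * (x - 1 / 2)) ^ 2 * (1 - y ^ 2)) - (3 * x - 1) * (1 + y ^ 2) := by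
  have key := hom₂_nonneg
      [[3324640, 7990944, 5590710, 895975], [44740480, 128112000, 119597400, 36065500],
      [173251840, 521335680, 518079600, 169675000], [316674560, 980461056, 1007655840,
      343624400], [308492800, 975883776, 1027643040, 360240400], [155514880, 500453376,
      536826240, 191934400], [31744000, 103372800, 112204800, 40576000]]
      (sub_nonneg.2 (show 1 / 2 ≤ x by linarith)) (sub_nonneg.2 (show x ≤ 11 / 20 by linarith))
      (sub_nonneg.2 (show 1 / 2 ≤ y by linarith)) (sub_nonneg.2 (show y ≤ 1 by linarith))
  simp only [hom₂, hom₁, List.length] at key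
  linarith only [key]

theorem left_gain_mid' {x y : ℝ} (hx : 1 / 2 ≤ x) (hx' : x ≤ 11 / 20) (hy : 0 ≤ y)
    (hy' : y ≤ 1 / 2) :
    0 ≤ (1 + (27 / 50 + 27 / 10 * (x - 1 / 2)) * (1 - y ^ 2)) ^ 2 * (2 * (1 - x) + (3 * x - 1) * y ^ 3) - (2 * (1 - x) + 2 * (3 * x - 1)) := by
  have key := hom₂_nonneg
      [[38051840, 111968256, 107389440, 33286400], [266362880, 783777792, 751726080, 233004800],
      [756510720, 2213480448, 2107710720, 646915200], [1134103040, 3282373632, 3082171680,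
      927870800], [968614400, 2757702144, 2534585760, 740027600], [467316480, 1298655360,
      1155416400, 321249000], [114462720, 305185536, 255839040, 64346400], [9973920, 23972832,
      16772130, 2687925]]
      (sub_nonneg.2 (show 1 / 2 ≤ x by linarith)) (sub_nonneg.2 (show x ≤ 11 / 20 by linarith))
      (sub_nonneg.2 (show 0 ≤ y by linarith)) (sub_nonneg.2 (show y ≤ 1 / 2 by linarith))
  simp only [hom₂, hom₁, List.length] at key
  linarith only [key]

theorem left_slope_large {x y : ℝ} (hx : 11 / 20 ≤ x) (hx' : x ≤ 13 / 20) (hy : 0 ≤ y)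
    (hy' : y ≤ 1) :
    0 ≤ (1 + y) * (2 * (1 - x) + 2 * (3 * x - 1) * x * y ^ 2) - 2 * (1 - y ^ 2 * x) * (3 * x - 1) * y ^ 2
      - (1 - 36 * (x - 1 / 2) ^ 2) * 2 * (1 - x) * (1 + (17 / 25 + 4 * (x - 11 / 20))) * x * (1 + y ^ 2 * x) * (1 + y) := by
  rcases le_total y (2 / 3) with h | h
  · have key := hom₂_nonneg
        [[14503455, 81935145, 232261020, 404974890, 421350255, 233873325, 52668630], [67682790,
        382364010, 1083884760, 1889882820, 1966301190, 1091408850, 245786940], [70972929,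
        379154349, 1165460040, 2334518730, 2723071905, 1632009177, 386164422], [5874834, 6739374,
        221557800, 975768300, 1565821170, 1089966822, 279186132], [2381240, 23013890, 169421500,
        508957500, 701400200, 452093170, 110840020]]
        (sub_nonneg.2 (show 11 / 20 ≤ x by linarith)) (sub_nonneg.2 (show x ≤ 13 / 20 by linarith))
        (sub_nonneg.2 (show 0 ≤ y by linarith)) (sub_nonneg.2 (show y ≤ 2 / 3 by linarith))
    simp only [hom₂, hom₁, List.length] at key
    linarith only [key]
  · have key := hom₂_nonneg
        [[9524960, 92055560, 677686000, 2035830000, 2805600800, 1808372680, 443360080],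
        [45400092, 538854612, 3623000400, 10263443400, 13701962460, 8670302436, 2101788216],
        [146686383, 1561250043, 8320200840, 21036309030, 26506292175, 16235338959, 3858850314],
        [228354093, 2098049553, 9112168440, 20369447730, 23923090125, 14048802189, 3251948094],
        [121117842, 1007348562, 3802707000, 7656452100, 8391584610, 4709542986, 1057700916]]
        (sub_nonneg.2 (show 11 / 20 ≤ x by linarith)) (sub_nonneg.2 (show x ≤ 13 / 20 by linarith))
        (sub_nonneg.2 (show 2 / 3 ≤ y by linarith)) (sub_nonneg.2 (show y ≤ 1 by linarith))
    simp only [hom₂, hom₁, List.length] at key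
    linarith only [key]

theorem left_gain_large {x y : ℝ} (hx : 11 / 20 ≤ x) (hx' : x ≤ 13 / 20) (hy : 1 / 2 ≤ y)
    (hy' : y ≤ 1) :
    0 ≤ y * (2 * (1 - x) + (3 * x - 1) * y ^ 3) * (2 * (17 / 25 + 4 * (x - 11 / 20)) + (17 / 25 + 4 * (x - 11 / 20)) ^ 2 * (1 - y ^ 2)) - (3 * x - 1) * (1 + y ^ 2) := by
  have key := hom₂_nonneg
      [[19919, 122955, 154733, 43897], [605100, 2540540, 3098180, 1118740], [2770880, 11145520,
      13703200, 5240560], [5551056, 22117520, 27559792, 10926128], [5782976, 23027840, 29062272,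
      11814208], [3067776, 12215680, 15533952, 6398848], [646400, 2560000, 3244800, 1331200]]
      (sub_nonneg.2 (show 11 / 20 ≤ x by linarith)) (sub_nonneg.2 (show x ≤ 13 / 20 by linarith))
      (sub_nonneg.2 (show 1 / 2 ≤ y by linarith)) (sub_nonneg.2 (show y ≤ 1 by linarith))
  simp only [hom₂, hom₁, List.length] at key
  linarith only [key]

theorem left_gain_large' {x y : ℝ} (hx : 11 / 20 ≤ x) (hx' : x ≤ 13 / 20) (hy : 0 ≤ y)
    (hy' : y ≤ 1 / 2) :
    0 ≤ (1 + (17 / 25 + 4 * (x - 11 / 20)) * (1 - y ^ 2)) ^ 2 * (2 * (1 - x) + (3 * x - 1) * y ^ 3) - (2 * (1 - x) + 2 * (3 * x - 1)) := by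
  have key := hom₂_nonneg
      [[544256, 2024960, 2217472, 685568], [3809792, 14174720, 15522304, 4798976], [10606848,
      39559680, 43141376, 13138944], [15303232, 57496000, 62374144, 18526976], [12332944,
      47172560, 51125168, 14784752], [5456160, 21723440, 23824000, 6780720], [1141136, 4988400,
      5673712, 1615248], [59757, 368865, 464199, 131691]]
      (sub_nonneg.2 (show 11 / 20 ≤ x by linarith)) (sub_nonneg.2 (show x ≤ 13 / 20 by linarith))
      (sub_nonneg.2 (show 0 ≤ y by linarith)) (sub_nonneg.2 (show y ≤ 1 / 2 by linarith))
  simp only [hom₂, hom₁, List.length] at key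
  linarith only [key]

theorem right_gain {x v : ℝ} (hx : 41 / 100 ≤ x) (hx' : x ≤ 13 / 20) (hv : 0 ≤ v)
    (hv' : v ≤ 1) :
    0 ≤ (1 + x) * (1 - (1 - x) * v) ^ 2 * (2 * (3 / 5 + v * (23 / 10 * x - 9 / 10))
      + (3 / 5 + v * (23 / 10 * x - 9 / 10)) ^ 2 * (1 - x) * v) - (3 * x - 1) * (2 - (1 - x) * v) := by
  rcases le_total x (53 / 100) with h | h
  · have key := hom₂_nonneg
        [[123200000000000, 681600000000000, 1560000000000000, 1888000000000000, 1272000000000000,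
        451200000000000, 65600000000000], [471988400000000, 2661348000000000, 6232155600000000,
        7754910400000000, 5405451600000000, 1999984800000000, 306647600000000], [669496932000000,
        3839969064000000, 9186294444000000, 11736621552000000, 8449334652000000,
        3251118696000000, 522583284000000], [418295040230000, 2417562554820000, 5877237487770000,
        7702011642040000, 5743673708730000, 2312219909700000, 392587869830000], [101365634306600,
        567021233355600, 1364921846643000, 1821857736076000, 1425458347455000, 618085318126800,
        115218459153800], [3832670230311, 10660250906178, 7771478839185, 3507616222140,
        12991714173465, 16212314266338, 5782738566159]]
        (sub_nonneg.2 (show 41 / 100 ≤ x by linarith)) (sub_nonneg.2 (show x ≤ 53 / 100 by linarith))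
        (sub_nonneg.2 (show 0 ≤ v by linarith)) (sub_nonneg.2 (show v ≤ 1 by linarith))
    simp only [hom₂, hom₁, List.length] at key
    linarith only [key]
  · have key := hom₂_nonneg
        [[65600000000000, 336000000000000, 696000000000000, 736000000000000, 408000000000000,
        105600000000000, 8000000000000], [306647600000000, 1679786400000000, 3804459600000000,
        4552926400000000, 3030171600000000, 1060356000000000, 151790000000000], [522583284000000,
        3019880712000000, 7293144732000000, 9426633264000000, 6881089260000000, 2690953800000000,
        440650500000000], [392587869830000, 2398834528260000, 6176746801530000, 8572640812600000,
        6756832628250000, 2864084602500000, 509392643750000], [115218459153800, 764536191718800,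
        2157712715415000, 3293349783100000, 2850380515875000, 1320159146250000, 254733430625000],
        [5782738566159, 53180548527570, 197832885479625, 377171697097500, 389399036240625,
        207369786731250, 44705792484375]]
        (sub_nonneg.2 (show 53 / 100 ≤ x by linarith)) (sub_nonneg.2 (show x ≤ 13 / 20 by linarith))
        (sub_nonneg.2 (show 0 ≤ v by linarith)) (sub_nonneg.2 (show v ≤ 1 by linarith))
    simp only [hom₂, hom₁, List.length] at key
    linarith only [key]

theorem right_slope {x y : ℝ} (hx : 41 / 100 ≤ x) (hx' : x ≤ 13 / 20) (hy : 16 / 25 ≤ y)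
    (hy' : y ≤ 1) :
    0 ≤ (1 + y) * y * (2 * (1 - x) * y ^ 2 + 2 * (3 * x - 1) * x) - 2 * (y ^ 2 - x) * (3 * x - 1)
      - 2 * (1 - x + (3 / 5 * (1 - x) + (1 - y ^ 2) * (23 / 10 * x - 9 / 10))) * (y ^ 2 + x) * x * (1 + y) * y := by
  rcases le_total x (47 / 100) with h | h
  · have key := hom₂_nonneg
        [[1056022168232, 4152456931320, 7050668099736, 3959592987848], [6581990929125,
        14303052551025, 21544256220975, 13883008676475], [25067256460950, 29038130095950,
        18436925743650, 14710338809850], [59443064978125, 68506421540625, 12792644784375,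
        4223545496875], [78491282812500, 114516745312500, 40780110937500, 5290260937500],
        [52398960937500, 93386460937500, 52025695312500, 11336882812500], [13813203125000,
        28512421875000, 20133046875000, 5501328125000]]
        (sub_nonneg.2 (show 41 / 100 ≤ x by linarith)) (sub_nonneg.2 (show x ≤ 47 / 100 by linarith))
        (sub_nonneg.2 (show 16 / 25 ≤ y by linarith)) (sub_nonneg.2 (show y ≤ 1 by linarith))
    simp only [hom₂, hom₁, List.length] at key
    linarith only [key]
  · rcases le_total x (53 / 100) with h | h
    · rcases le_total y (41 / 50) with h | h
      · have key := hom₂_nonneg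
            [[63353487805568, 267310237237632, 375438406184832, 171567411171968],
            [301124532828504, 1295961078415896, 1884092272833096, 889991503122504],
            [574077108039780, 2516789734860420, 3829594630247820, 1889377010851980],
            [562173694515970, 2487049623168930, 4023591370606230, 2103068917708870],
            [304446911869695, 1315699287759855, 2309016378593205, 1301926642777245],
            [93300998863494, 361937571071706, 698399168380506, 431843125884294], [14726239461512,
            45166599775638, 92055447875388, 62041466987462]]
            (sub_nonneg.2 (show 47 / 100 ≤ x by linarith)) (sub_nonneg.2 (show x ≤ 53 / 100 by linarith))
            (sub_nonneg.2 (show 16 / 25 ≤ y by linarith)) (sub_nonneg.2 (show y ≤ 41 / 50 by linarith))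
        simp only [hom₂, hom₁, List.length] at key
        linarith only [key]
      · have key := hom₂_nonneg
            [[14726239461512, 45166599775638, 92055447875388, 62041466987462], [83413874674650,
            180061626235950, 406266206124150, 312654477965250], [255011290925475,
            406319563581075, 848351567311425, 705983403182025], [497559959743750,
            787697800143750, 1241444582981250, 965253907131250], [577978387500000,
            1056253162500000, 1325813512500000, 859704937500000], [354758812500000,
            745961062500000, 842426437500000, 456853687500000], [88021250000000, 205998750000000,
            223938750000000, 107041250000000]]
            (sub_nonneg.2 (show 47 / 100 ≤ x by linarith)) (sub_nonneg.2 (show x ≤ 53 / 100 by linarith))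
            (sub_nonneg.2 (show 41 / 50 ≤ y by linarith)) (sub_nonneg.2 (show y ≤ 1 by linarith))
        simp only [hom₂, hom₁, List.length] at key
        linarith only [key]
    · have key := hom₂_nonneg
          [[10722963198248, 49576868011128, 74768761023480, 35957733420200], [46911158700825,
          232756164737775, 376950886855875, 191584393438125], [76944011235150, 428867115437250,
          775014817736250, 425046007143750], [60187562940625, 405651289734375, 859038051796875,
          517528383203125], [29743851562500, 237935798437500, 588376617187500, 384469570312500],
          [16966242187500, 110043632812500, 266155664062500, 175467773437500], [6690078125000,
          32218359375000, 64177734375000, 39189453125000]]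
          (sub_nonneg.2 (show 53 / 100 ≤ x by linarith)) (sub_nonneg.2 (show x ≤ 13 / 20 by linarith))
          (sub_nonneg.2 (show 16 / 25 ≤ y by linarith)) (sub_nonneg.2 (show y ≤ 1 by linarith))
      simp only [hom₂, hom₁, List.length] at key
      linarith only [key]

theorem right_slack {x y : ℝ} (hx : 41 / 100 ≤ x) (hx' : x ≤ 13 / 20) (hy : 16 / 25 ≤ y)
    (hy' : y ≤ 1) :
    0 ≤ y ^ 3 * (y ^ 2 + x) - 2 * (y ^ 2 - x) := by
  have key := hom₂_nonneg
      [[8423954, 29631554], [25001050, 135186250], [22895900, 253893500], [11133125, 255528125],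
      [13562500, 144062500], [8984375, 37109375]]
      (sub_nonneg.2 (show 41 / 100 ≤ x by linarith)) (sub_nonneg.2 (show x ≤ 13 / 20 by linarith))
      (sub_nonneg.2 (show 16 / 25 ≤ y by linarith)) (sub_nonneg.2 (show y ≤ 1 by linarith))
  simp only [hom₂, hom₁, List.length] at key
  linarith only [key]

end AnticipatoryTrading

namespace AnticipatoryTrading

theorem Crit.q_le_quad {x C c : ℝ} (h : Crit x C c) (hx : 1 / 2 ≤ x) :
    C * (2 - C) ≤ 1 - 36 * (x - 1 / 2) ^ 2 := by
  have h1 := h.x_lt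
  have h0 := h.eq
  have hc : 6 * (x - 1 / 2) ≤ c - 1 := by
    by_contra! hlt
    have a : 2 * x * (1 - x) * (c - 1) < 2 * x * (1 - x) * (6 * (x - 1 / 2)) :=
      mul_lt_mul_of_pos_left hlt (by nlinarith)
    have b : 2 * x * (1 - x) * (6 * (x - 1 / 2)) ≤ 1 / 2 * (6 * (x - 1 / 2)) :=
      mul_le_mul_of_nonneg_right (by nlinarith [sq_nonneg (2 * x - 1)]) (by linarith)
    nlinarith
  have := h.q_le_of_one_le (by linarith)
  nlinarith

theorem left_gain_aux {x X q Q κ y : ℝ} (hx : x < 1) (hX : 2 * (1 - x) * X = 3 * x - 1)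
    (hX0 : 0 ≤ X) (hx0 : 0 < x) (hqQ : q ≤ Q) (hy : 0 < y) (hy' : y ≤ 1) (hκ : 0 ≤ κ)
    (hs : 0 ≤ (1 + y) * (2 * (1 - x) + 2 * (3 * x - 1) * x * y ^ 2)
      - 2 * (1 - y ^ 2 * x) * (3 * x - 1) * y ^ 2
      - Q * 2 * (1 - x) * (1 + κ) * x * (1 + y ^ 2 * x) * (1 + y))
    (hg : 1 / 2 ≤ y → 0 ≤ y * (2 * (1 - x) + (3 * x - 1) * y ^ 3)
      * (2 * κ + κ ^ 2 * (1 - y ^ 2)) - (3 * x - 1) * (1 + y ^ 2))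
    (hg' : y ≤ 1 / 2 → 0 ≤ (1 + κ * (1 - y ^ 2)) ^ 2 * (2 * (1 - x) + (3 * x - 1) * y ^ 3)
      - (2 * (1 - x) + 2 * (3 * x - 1))) :
    q * (1 + κ) * (x * (1 + y)) * (1 + y ^ 2 * x)
      ≤ (1 + y) * (1 + 2 * X * x * y ^ 2) - 2 * (1 - y ^ 2 * x) * X * y ^ 2 ∧
    ∀ t, t ≤ 2 → t * y ≤ 1 → 1 + X * t ≤ (1 + κ * (1 - y ^ 2)) ^ 2 * (1 + y ^ 3 * X) := by
  have h1 : 0 < 2 * (1 - x) := by linarith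
  rw [← hX] at hs hg hg'
  refine ⟨?_, fun t ht hty => ?_⟩
  · refine le_of_mul_le_mul_left ?_ h1
    have : q * ((1 + κ) * (x * (1 + y)) * (1 + y ^ 2 * x) * (2 * (1 - x)))
        ≤ Q * ((1 + κ) * (x * (1 + y)) * (1 + y ^ 2 * x) * (2 * (1 - x))) :=
      mul_le_mul_of_nonneg_right hqQ (by positivity)
    linarith
  · rcases le_total (1 / 2) y with hh | hh
    · have g := hg hh
      have g2 : 0 ≤ y * (1 + y ^ 3 * X) * (2 * κ + κ ^ 2 * (1 - y ^ 2)) - X * (1 + y ^ 2) := by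
        refine nonneg_of_mul_nonneg_right (a := 2 * (1 - x)) ?_ h1
        linarith
      have g3 := mul_nonneg g2 (show 0 ≤ 1 - y ^ 2 by nlinarith)
      refine le_of_mul_le_mul_left (a := y) ?_ hy
      have := mul_le_mul_of_nonneg_left hty hX0
      linarith
    · have g := hg' hh
      have g2 : 0 ≤ (1 + κ * (1 - y ^ 2)) ^ 2 * (1 + y ^ 3 * X) - (1 + 2 * X) := by
        refine nonneg_of_mul_nonneg_right (a := 2 * (1 - x)) ?_ h1
        linarith
      have := mul_le_mul_of_nonneg_left ht hX0
      linarith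

theorem exists_left_gain {x X q y : ℝ} (hx : 207 / 500 < x) (hx' : x < 641 / 1000)
    (hX : 2 * (1 - x) * X = 3 * x - 1) (hX0 : 0 ≤ X) (hq : q ≤ 1)
    (hq' : 1 / 2 ≤ x → q ≤ 1 - 36 * (x - 1 / 2) ^ 2) (hy : 0 < y) (hy' : y ≤ 1) :
    ∃ κ, 0 ≤ κ ∧ q * (1 + κ) * (x * (1 + y)) * (1 + y ^ 2 * x)
      ≤ (1 + y) * (1 + 2 * X * x * y ^ 2) - 2 * (1 - y ^ 2 * x) * X * y ^ 2 ∧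
    ∀ t, t ≤ 2 → t * y ≤ 1 → 1 + X * t ≤ (1 + κ * (1 - y ^ 2)) ^ 2 * (1 + y ^ 3 * X) := by
  have h1 : x < 1 := by linarith
  have h0 : 0 < x := by linarith
  rcases le_total x (1 / 2) with h | h
  · refine ⟨14 / 25, by norm_num, left_gain_aux h1 hX hX0 h0 hq hy hy' (by norm_num) ?_
      (fun hh => left_gain_small (by linarith) h hh hy')
      (fun hh => left_gain_small' (by linarith) h hy.le hh)⟩
    have := left_slope_small (by linarith) h hy.le hy'
    linarith
  · rcases le_total x (11 / 20) with h2 | h2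
    · exact ⟨27 / 50 + 27 / 10 * (x - 1 / 2), by linarith,
        left_gain_aux h1 hX hX0 h0 (hq' h) hy hy' (by linarith) (left_slope_mid h h2 hy.le hy')
          (fun hh => left_gain_mid h h2 hh hy') (fun hh => left_gain_mid' h h2 hy.le hh)⟩
    · exact ⟨17 / 25 + 4 * (x - 11 / 20), by linarith,
        left_gain_aux h1 hX hX0 h0 (hq' h) hy hy' (by linarith)
          (left_slope_large h2 (by linarith) hy.le hy')
          (fun hh => left_gain_large h2 (by linarith) hh hy')
          (fun hh => left_gain_large' h2 (by linarith) hy.le hh)⟩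

theorem exists_right_gain {x X y z : ℝ} (hx : 207 / 500 < x) (hx' : x < 641 / 1000)
    (hX : 2 * (1 - x) * X = 3 * x - 1) (hy : 0 < y) (hy' : y ≤ 1) (hz : z * y ^ 2 = x)
    (hz1 : z ≤ 1) :
    ∃ κ, 0 ≤ κ ∧ (1 + κ) * (1 + z) * x * (1 + y) * y
        ≤ (1 + y) * y * (1 + 2 * X * z) - 2 * (1 - z) * X ∧
      X ≤ y ^ 4 * ((1 + κ * (1 - y ^ 2)) ^ 2 * (1 + X) - 1) ∧ 2 * (1 - z) ≤ y ^ 3 * (1 + z) := by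
  have h1 : 0 < 1 - x := by linarith
  have hyx : x ≤ y ^ 2 := by nlinarith [sq_nonneg y]
  have hy2 : 16 / 25 ≤ y := by nlinarith
  obtain ⟨v, hv⟩ : ∃ v, v = (1 - y ^ 2) / (1 - x) := ⟨_, rfl⟩
  have hvx : (1 - x) * v = 1 - y ^ 2 := by rw [hv]; field_simp
  have hv0 : 0 ≤ v := by rw [hv]; exact div_nonneg (by nlinarith) h1.le
  have hv1 : v ≤ 1 := by rw [hv, div_le_one h1]; linarith
  have e1 := right_gain (v := v) (x := x) (by linarith) (by linarith) hv0 hv1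
  have e2 := right_slope (y := y) (x := x) (by linarith) (by linarith) hy2 hy'
  have e3 := right_slack (y := y) (x := x) (by linarith) (by linarith) hy2 hy'
  obtain ⟨κ, hκ⟩ : ∃ κ, κ = 3 / 5 + v * (23 / 10 * x - 9 / 10) := ⟨_, rfl⟩
  have hκx : κ * (1 - x) = 3 / 5 * (1 - x) + (1 - y ^ 2) * (23 / 10 * x - 9 / 10) := by
    rw [hκ, ← hvx]; ring
  rw [← hκ, hvx, mul_assoc (κ ^ 2), hvx, ← hX] at e1
  rw [← hκx, ← hX] at e2
  have hy20 : 0 < y ^ 2 := by positivity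
  refine ⟨κ, by rw [hκ]; nlinarith, ?_, ?_, ?_⟩
  · refine le_of_mul_le_mul_left (a := 2 * (1 - x) * y ^ 2) ?_ (by positivity)
    have e4 : 0 ≤ (1 + y) * y * (2 * (1 - x) * y ^ 2 + 2 * (2 * (1 - x) * X) * (z * y ^ 2))
        - 2 * (y ^ 2 - z * y ^ 2) * (2 * (1 - x) * X)
        - 2 * (1 - x + κ * (1 - x)) * (y ^ 2 + z * y ^ 2) * x * (1 + y) * y := by
      rw [hz]; exact e2
    linarith
  · have e5 : 1 + x = 2 * (1 - x) * (1 + X) := by linarith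
    rw [e5] at e1
    have e6 : 0 ≤ (1 + X) * y ^ 4 * (2 * κ + κ ^ 2 * (1 - y ^ 2)) - X * (1 + y ^ 2) := by
      refine nonneg_of_mul_nonneg_right (a := 2 * (1 - x)) ?_ (by linarith)
      linarith
    have := mul_nonneg e6 (show 0 ≤ 1 - y ^ 2 by nlinarith)
    linarith
  · refine le_of_mul_le_mul_left (a := y ^ 2) ?_ hy20
    have e4 : 0 ≤ y ^ 3 * (y ^ 2 + z * y ^ 2) - 2 * (y ^ 2 - z * y ^ 2) := by rw [hz]; exact e3
    linarith

end AnticipatoryTrading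

namespace AnticipatoryTrading

theorem mul_one_add_le {A B e : ℝ} (hA : 0 ≤ A) (hB : A ≤ B) (he : 0 ≤ e) :
    A * (1 + A) * (e + 2 * B) ≤ B * (1 + B) * (e + 2 * A) := by
  have : 0 ≤ (B - A) * (e * (1 + A + B) + 2 * (A * B)) :=
    mul_nonneg (by linarith) (by have := hA.trans hB; positivity)
  linarith

namespace CellPair

variable {x₁ η₁ C₁ ψ₁ ϑ₁ x₂ η₂ C₂ ψ₂ ϑ₂ n ρ P : ℝ}

theorem gain_of_ge (h : CellPair x₁ η₁ C₁ ψ₁ ϑ₁ x₂ η₂ C₂ ψ₂ ϑ₂ n ρ) (hP1 : 1 ≤ P)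
    (hP : ψ₁ = ψ₂ * P) (hϑ : ϑ₁ < ϑ₂) (hx : x₂ ≤ x₁) (hL : P ^ 3 * (ϑ₁ - 1) ≤ ϑ₂ - 1) :
    ∃ l, 1 ≤ l ∧ n ^ 3 * l * (x₂ / η₂) ≤ ρ * (x₁ / η₁) ∧
      (1 < n → 1 + (ϑ₂ - 1) * P < n ^ 4 * l ^ 2 * ϑ₁) ∧
      (n = 1 → ϑ₂ + 13 / 200 * (ϑ₂ - ϑ₁) ≤ l ^ 2 * ϑ₁) := by
  have h1 := h.one_lt_left
  have hn := h.ratio.n_ge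
  have hψ₂ : 0 < ψ₂ := by linarith [h.right.ψ_ge]
  have hx1 := h.left.x_pos
  have hx2 := h.right.x_pos
  have nu := h.left.nu_le h.right h.ratio h.le_one h.one_le
  have hX1 : 0 < ϑ₁ - 1 := by linarith
  have hX2 : 0 < ϑ₂ - 1 := by linarith
  have nu2 : ϑ₂ - 1 ≤ n ^ 2 * P * (ϑ₁ - 1) := by
    refine le_of_mul_le_mul_left (a := ψ₂ * x₁) ?_ (by positivity)
    have : n ^ 2 * (ψ₁ * (ϑ₁ - 1) * x₂) ≤ n ^ 2 * (ψ₁ * (ϑ₁ - 1) * x₁) := by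
      rw [hP]; gcongr
    rw [hP] at nu this
    linarith
  have hPn : P ≤ n := by
    have a : P ^ 2 * (P * (ϑ₁ - 1)) ≤ n ^ 2 * (P * (ϑ₁ - 1)) := by linarith
    have b := le_of_mul_le_mul_right a (by positivity)
    exact le_of_sq_le_sq b (by linarith)
  have hP0 : 0 < P := by linarith
  refine ⟨1, le_rfl, ?_, fun hn1 => ?_, fun hn1 => ?_⟩
  · rw [mul_one]
    have a := h.hat_right_le.trans (hx.trans h.le_hat_left)
    have b : 0 < x₂ / η₂ := div_pos hx2 h.right.η_pos
    exact mul_le_mul h.ρ_ge.2.2 a b.le h.ρ_pos.le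
  · have a : n ^ 2 * (P * P) ≤ n ^ 2 * (n * n) := by gcongr
    have b := mul_le_mul_of_nonneg_right a hX1.le
    have c := mul_le_mul_of_nonneg_right nu2 hP0.le
    have d : 1 < n ^ 4 := one_lt_pow₀ hn1 (by norm_num)
    linarith
  · have hP' : P = 1 := le_antisymm (hn1 ▸ hPn) hP1
    rw [hn1, hP'] at nu2
    linarith

set_option maxHeartbeats 800000 in
theorem gain_left_of_sq_le (h : CellPair x₁ η₁ C₁ ψ₁ ϑ₁ x₂ 1 C₂ ψ₂ ϑ₂ n ρ) (hP1 : 1 ≤ P)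
    (hP2 : P ≤ 2) (hP : ψ₁ = ψ₂ * P) (hx : x₁ < x₂) (hS : P ^ 2 * x₁ ≤ n ^ 2 * x₂) :
    ∃ l, 1 ≤ l ∧ n ^ 3 * l * (x₂ / 1) ≤ ρ * (x₁ / η₁) ∧
      (1 < n → 1 + (ϑ₂ - 1) * P < n ^ 4 * l ^ 2 * ϑ₁) ∧
      (n = 1 → ϑ₂ + 13 / 200 * (ϑ₂ - ϑ₁) ≤ l ^ 2 * ϑ₁) := by
  have h1 := h.one_lt_left
  have hn := h.ratio.n_ge
  have hψ₂ : 0 < ψ₂ := by linarith [h.right.ψ_ge]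
  have hx1 := h.left.x_pos
  have hx2 := h.right.x_pos
  have hcr := h.right.crit
  have eϑ := h.right.crit_ϑ
  have hl := h.left.mul_le_left (P := P) h.ratio h.le_one hψ₂ hP.le h.right.c_spec
  set c := C₂ / (2 * ψ₂)
  have hc0 : 0 < c := by linarith [hcr.c_gt]
  obtain ⟨y, hy⟩ : ∃ y, y = √(x₁ / x₂) := ⟨_, rfl⟩
  have hy0 : 0 < y := by rw [hy]; positivity
  have hy2 : y ^ 2 * x₂ = x₁ := by rw [hy, Real.sq_sqrt (by positivity)]; field_simp
  have hy1 : y < 1 := by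
    by_contra! hge
    have : 1 * x₂ ≤ y ^ 2 * x₂ := mul_le_mul_of_nonneg_right (one_le_pow₀ hge) hx2.le
    linarith
  have hPy : P * y ≤ n := by
    refine le_of_sq_le_sq (le_of_mul_le_mul_right (a := x₂) ?_ hx2) (by linarith)
    rw [mul_pow, mul_assoc, hy2]; exact hS
  obtain ⟨X, hX⟩ : ∃ X, X = c * x₂ := ⟨_, rfl⟩
  have hX0 : 0 < X := by rw [hX]; positivity
  have hXe : 2 * (1 - x₂) * X = 3 * x₂ - 1 := by rw [hX]; linear_combination hcr.eq
  have hX129 : X < 129 / 100 := by rw [hX]; exact hcr.mul_x_lt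
  obtain ⟨κ, hκ0, hκa, hκb⟩ := exists_left_gain hcr.x_gt hcr.x_lt hXe hX0.le hcr.q_le hcr.q_le_quad
    hy0 hy1.le
  have hcx : c * x₁ = y ^ 2 * X := by rw [← hy2, hX]; ring
  have hX1 : y ^ 3 * X ≤ n ^ 3 * (ϑ₁ - 1) := by
    have a := mul_le_mul_of_nonneg_left hPy (show 0 ≤ n ^ 2 * (ϑ₁ - 1) by
      have := sub_pos.2 h1; positivity)
    have b := mul_le_mul_of_nonneg_right hl hy0.le
    rw [hcx] at b
    linarith
  have core := h.left.core_left (p := 1 / y) (κ := κ) hcr.C_gt hcr.C_lt h.ratio h.le_one hx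
    hcr.x_lt_one hc0.le hcr.c_le (by rw [le_div_iff₀ hy0]; linarith) (by
      rw [hcx, mul_assoc, one_div, inv_mul_eq_div, le_div_iff₀ hy0]; linarith) (by
      rw [div_div_eq_mul_div, div_one, hcx]
      have e : 2 * (1 - x₁) * (1 + y ^ 2 * X * y) - (1 + x₁) = (1 - y) * ((1 + y)
          * (1 + 2 * X * x₂ * y ^ 2) - 2 * (1 - y ^ 2 * x₂) * X * y ^ 2) := by
        rw [← hy2]; linear_combination y ^ 2 * hXe
      rw [e]
      have := mul_le_mul_of_nonneg_left hκa (show 0 ≤ 1 - y by linarith)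
      rw [← hy2]
      linarith)
  have hl1 : 1 ≤ 1 + κ * (1 - y ^ 2) := by
    have := mul_nonneg hκ0 (sub_nonneg.2 (pow_le_one₀ hy0.le hy1.le (n := 2)))
    linarith
  have hl2 : 1 ≤ (1 + κ * (1 - y ^ 2)) ^ 2 := one_le_pow₀ hl1
  refine ⟨1 + κ * (1 - y ^ 2), hl1, ?_, fun hn1 => ?_, fun hn1 => ?_⟩
  · rw [div_one]
    refine le_trans (le_of_eq ?_) core
    rw [← hy2]; ring
  · generalize (1 + κ * (1 - y ^ 2)) ^ 2 = L at *
    have hn0 : 0 < n := by linarith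
    have b := hκb (P / n) (by rw [div_le_iff₀ hn0]; linarith)
      (by rw [div_mul_eq_mul_div, div_le_one hn0]; exact hPy)
    have b2 : n * (1 + X * (P / n)) = n + X * P := by field_simp
    have b3 := mul_le_mul_of_nonneg_left b hn0.le
    rw [b2] at b3
    have hϑX : ϑ₂ - 1 = X := by rw [eϑ, hX]; ring
    rw [hϑX]
    have y3 : y ^ 3 * X ≤ 2 := by
      have : y ^ 3 ≤ 1 := pow_le_one₀ hy0.le hy1.le
      linarith only [mul_le_mul_of_nonneg_right this hX0.le, hX129]
    have c1 : n * (1 + y ^ 3 * X) ≤ n ^ 3 * ϑ₁ := by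
      have : 0 ≤ (n - 1) * (n * (n + 1) - y ^ 3 * X) := by
        refine mul_nonneg (by linarith) ?_
        linarith only [mul_le_mul hn hn zero_le_one hn0.le, hn, y3]
      linarith
    have c2 := mul_le_mul_of_nonneg_left c1 (show 0 ≤ L by linarith)
    have c3 : n ^ 3 * 1 ≤ n ^ 3 * n := by gcongr
    have c4 := mul_le_mul_of_nonneg_right c3 (show 0 ≤ L * ϑ₁ by
      exact mul_nonneg (by linarith) (by linarith))
    linarith
  · generalize (1 + κ * (1 - y ^ 2)) ^ 2 = L at *
    rw [hn1, one_pow, one_mul] at hX1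
    have hϑX : ϑ₂ = 1 + X := by rw [eϑ, hX]
    have b : 1 + X + 13 / 200 * (X * (1 - y ^ 3)) ≤ L * (1 + y ^ 3 * X) := by
      rcases le_total (1 / 2) y with hh | hh
      · have b := hκb (1 / y) (by rw [div_le_iff₀ hy0]; linarith) (by field_simp; rfl)
        refine le_trans ?_ b
        have : 1 + 13 / 200 * (1 - y ^ 3) ≤ 1 / y := by
          rw [le_div_iff₀ hy0]
          have h3 : 0 ≤ y ^ 3 := by positivity
          have h4 : 0 ≤ (1 - y) * (1 - 13 / 200 * (y * (1 + y + y ^ 2))) := by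
            have h5 : y * (1 + y + y ^ 2) ≤ 1 * 3 :=
              mul_le_mul hy1.le (by linarith only [hy1, pow_le_one₀ hy0.le hy1.le (n := 2)])
                (by positivity) (by norm_num)
            exact mul_nonneg (by linarith only [hy1]) (by linarith only [h5])
          linarith only [h3, h4]
        have := mul_le_mul_of_nonneg_left this hX0.le
        linarith
      · have b := hκb 2 le_rfl (by linarith)
        refine le_trans ?_ b
        have : 0 ≤ X * y ^ 3 := by positivity
        linarith
    have c1 := mul_le_mul_of_nonneg_left hX1 (show 0 ≤ L by linarith)
    rw [hϑX]
    linarith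

set_option maxHeartbeats 800000 in
theorem gain_right_of_sq_le (h : CellPair x₁ 1 C₁ ψ₁ ϑ₁ x₂ η₂ C₂ ψ₂ ϑ₂ n ρ) (hP1 : 1 ≤ P)
    (hP : ψ₁ = ψ₂ * P) (hx : x₁ < x₂) (hS : P ^ 2 * x₁ ≤ n ^ 2 * x₂) :
    ∃ l, 1 ≤ l ∧ n ^ 3 * l * (x₂ / η₂) ≤ ρ * (x₁ / 1) ∧
      (1 < n → 1 + (ϑ₂ - 1) * P < n ^ 4 * l ^ 2 * ϑ₁) ∧
      (n = 1 → ϑ₂ + 13 / 200 * (ϑ₂ - ϑ₁) ≤ l ^ 2 * ϑ₁) := by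
  have h1 := h.one_lt_left
  have hn := h.ratio.n_ge
  have hψ₂ : 0 < ψ₂ := by linarith [h.right.ψ_ge]
  have hx1 := h.left.x_pos
  have hx2 := h.right.x_pos
  have hx21 := h.lt_one_right
  have hcr := h.left.crit
  have eϑ := h.left.crit_ϑ
  have hcs := h.left.c_spec
  set c := C₁ / (2 * ψ₁)
  have hc0 : 0 < c := by linarith [hcr.c_gt]
  have hl := h.right.le_mul_right (P := P) h.ratio h.one_le hP.le hc0.le hcs
  obtain ⟨y, hy⟩ : ∃ y, y = √(x₁ / x₂) := ⟨_, rfl⟩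
  have hy0 : 0 < y := by rw [hy]; positivity
  have hy2 : y ^ 2 * x₂ = x₁ := by rw [hy, Real.sq_sqrt (by positivity)]; field_simp
  have hy1 : y < 1 := by
    by_contra! hge
    have : 1 * x₂ ≤ y ^ 2 * x₂ := mul_le_mul_of_nonneg_right (one_le_pow₀ hge) hx2.le
    linarith
  have hPy : P * y ≤ n := by
    refine le_of_sq_le_sq (le_of_mul_le_mul_right (a := x₂) ?_ hx2) (by linarith)
    rw [mul_pow, mul_assoc, hy2]; exact hS
  obtain ⟨p, hp⟩ : ∃ p, p = 1 / y := ⟨_, rfl⟩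
  have hpy : p * y = 1 := by rw [hp]; field_simp
  have hp1 : 1 < p := by rw [hp, lt_div_iff₀ hy0]; linarith
  have hp0 : 0 < p := by linarith
  have hPp : P ≤ n * p := by
    have := mul_le_mul_of_nonneg_right hPy hp0.le
    rwa [mul_assoc, mul_comm y, hpy, mul_one] at this
  obtain ⟨X, hX⟩ : ∃ X, X = c * x₁ := ⟨_, rfl⟩
  have hX0 : 0 < X := by rw [hX]; positivity
  have hXe : 2 * (1 - x₁) * X = 3 * x₁ - 1 := by rw [hX]; linear_combination hcr.eq
  obtain ⟨κ, hκ0, hκa, hκb, hκc⟩ := exists_right_gain hcr.x_gt hcr.x_lt hXe hy0 hy1.le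
    (by linarith : x₂ * y ^ 2 = x₁) hx21.le
  have hxp : x₁ * p ^ 2 = x₂ := by
    calc x₁ * p ^ 2 = x₂ * (p * y) ^ 2 := by rw [← hy2]; ring
      _ = x₂ := by rw [hpy]; ring
  have hcx : c * x₂ = X * p ^ 2 := by rw [← hxp, hX]; ring
  have hX2 : ϑ₂ - 1 ≤ n ^ 2 * P * (X * p ^ 2) := by rw [← hcx]; linarith
  have core := h.right.core_right (p := p) (κ := κ) (c := c) h.ratio h.one_le hx1 hx hx21 (by
      rcases h.n_eq with hh | hh
      · exact Or.inl hh
      · refine Or.inr ?_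
        rw [← hh]
        exact mul_le_mul_of_nonneg_left hcr.c_le (by positivity)) (by
      refine hX2.trans ?_
      have := mul_le_mul_of_nonneg_left hPp (show 0 ≤ n ^ 2 * (X * p ^ 2) by positivity)
      rw [← hcx] at this ⊢
      linarith) hp1.le (by
      have := mul_le_mul_of_nonneg_left hκc (show 0 ≤ p * x₂ by positivity)
      have e : p * x₂ * (y ^ 3 * (1 + x₂)) = x₁ * (1 + x₂) := by
        calc _ = (p * y) * (y ^ 2 * x₂) * (1 + x₂) := by ring
          _ = _ := by rw [hpy, hy2]; ring
      linarith) hκ0 (by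
      have hq : C₂ * (2 - C₂) ≤ 1 := by linarith [sq_nonneg (C₂ - 1)]
      have e : (1 + x₂) - 2 * (1 - x₂) * (1 + c * p * x₂)
          = (p ^ 2 - 1) * (1 + 2 * X * x₂) - 2 * (1 - x₂) * X * (p ^ 3 - p ^ 2) := by
        rw [show c * p * x₂ = X * p ^ 2 * p by rw [← hcx]; ring, ← hxp]
        linear_combination -p ^ 2 * hXe
      have e2 : (p ^ 2 - 1) * (1 + 2 * X * x₂) - 2 * (1 - x₂) * X * (p ^ 3 - p ^ 2)
          = (1 - y) * p ^ 3 * ((1 + y) * y * (1 + 2 * X * x₂) - 2 * (1 - x₂) * X) := by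
        have e3 : p ^ 3 * y = p ^ 2 := by linear_combination p ^ 2 * hpy
        have e4 : p ^ 3 * y ^ 3 = 1 := by rw [← mul_pow, hpy, one_pow]
        linear_combination (-(1 + 2 * X * x₂) - 2 * (1 - x₂) * X) * e3 + (1 + 2 * X * x₂) * e4
      have e5 : (1 + κ) * (x₂ - x₁) * (1 + x₂)
          = (1 - y) * p ^ 3 * ((1 + κ) * (1 + x₂) * x₁ * (1 + y) * y) := by
        have e3 : p ^ 3 * y = p ^ 2 := by linear_combination p ^ 2 * hpy
        have e4 : p ^ 3 * y ^ 3 = 1 := by rw [← mul_pow, hpy, one_pow]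
        linear_combination (-(1 + κ) * (1 + x₂)) * hxp
          + (1 + κ) * (1 + x₂) * x₁ * (e4 - e3)
      rw [e, e2]
      have a := mul_le_mul_of_nonneg_left hκa (show 0 ≤ (1 - y) * p ^ 3 from
        mul_nonneg (by linarith) (by positivity))
      rw [← e5] at a
      refine le_trans ?_ a
      have b : 0 ≤ (1 + κ) * (x₂ - x₁) * (1 + x₂) :=
        mul_nonneg (mul_nonneg (by linarith) (by linarith)) (by linarith)
      have := mul_le_mul_of_nonneg_right hq b
      linarith)
  have hl1 : 1 ≤ 1 + κ * (1 - y ^ 2) := by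
    have := mul_nonneg hκ0 (sub_nonneg.2 (pow_le_one₀ hy0.le hy1.le (n := 2)))
    linarith
  have hϑ1 : ϑ₁ = 1 + X := by rw [eϑ, hX]
  have hb : 1 + X * p ^ 4 ≤ (1 + κ * (1 - y ^ 2)) ^ 2 * ϑ₁ := by
    have := mul_le_mul_of_nonneg_right hκb (show 0 ≤ p ^ 4 by positivity)
    have e : ∀ w, y ^ 4 * w * p ^ 4 = w := fun w => by
      calc _ = (p * y) ^ 4 * w := by ring
        _ = w := by rw [hpy]; ring
    rw [e] at this
    rw [hϑ1]
    linarith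
  refine ⟨1 + κ * (1 - y ^ 2), hl1, ?_, fun hn1 => ?_, fun hn1 => ?_⟩
  · rw [div_one]
    refine le_of_mul_le_mul_right (a := x₂) ?_ hx2
    refine le_trans (le_of_eq ?_) core
    rw [← hy2]; ring
  · have a : (ϑ₂ - 1) * P ≤ n ^ 2 * P * (X * p ^ 2) * P :=
      mul_le_mul_of_nonneg_right hX2 (by linarith)
    have b := pow_le_pow_left₀ (by linarith) hPp 2
    have b2 := mul_le_mul_of_nonneg_left b (show 0 ≤ n ^ 2 * (X * p ^ 2) by positivity)
    have d : 1 < n ^ 4 := one_lt_pow₀ hn1 (by norm_num)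
    have b3 := mul_le_mul_of_nonneg_left hb (show 0 ≤ n ^ 4 by positivity)
    linarith
  · refine le_trans ?_ hb
    rw [hn1] at hX2 hPp
    have a := mul_le_mul_of_nonneg_left hPp (show 0 ≤ X * p ^ 2 by positivity)
    have b : 0 ≤ X * ((p - 1) * (p ^ 3 - 13 / 200 * (p ^ 2 + p + 1))) := by
      refine mul_nonneg hX0.le (mul_nonneg (by linarith) ?_)
      have h3 : p ^ 2 ≤ p ^ 3 := pow_le_pow_right₀ hp1.le (by norm_num)
      have h4 : p ≤ p ^ 2 := le_self_pow₀ hp1.le (by norm_num)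
      linarith only [h3, h4, hp1]
    rw [hϑ1]
    linarith

end CellPair

end AnticipatoryTrading

namespace AnticipatoryTrading

namespace CellPair

variable {x₁ η₁ C₁ ψ₁ ϑ₁ x₂ η₂ C₂ ψ₂ ϑ₂ n ρ P : ℝ}

theorem left_bound (h : CellPair x₁ η₁ C₁ ψ₁ ϑ₁ x₂ 1 C₂ ψ₂ ϑ₂ n ρ) (hP1 : 1 ≤ P)
    (h2 : (1 + x₁) * ϑ₂ < (1 + x₂) * ϑ₁)
    (h3 : P ^ 3 * (ϑ₁ - 1) * (2 * ϑ₂ - (1 + x₂)) * ϑ₁ ≤ (ϑ₂ - 1) * (2 * ϑ₁ - (1 + x₁)) * ϑ₂) :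
    x₁ + 2 * x₂ - 1 ≤ 2 * (1 - x₂) * (ϑ₁ - 1) ∧
      (0 ≤ x₁ + 2 * x₂ - 1 → P ^ 3 * (x₁ + 2 * x₂ - 1) ≤ 3 * x₂ - 1) := by
  have h1 := h.one_lt_left
  have hϑ2 := h.ϑ_pos
  have hx1 := h.left.x_pos
  have hx11 := h.lt_one_left
  have hx21 := h.lt_one_right
  have e : 2 * (1 - x₂) * ϑ₂ = 1 + x₂ := by
    have := h.right.eqX
    rw [div_one] at this
    linarith
  have a : 1 + x₁ < 2 * (1 - x₂) * ϑ₁ := by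
    refine lt_of_mul_lt_mul_right (a := ϑ₂) ?_ hϑ2.le
    rw [← e] at h2
    linarith
  refine ⟨by linarith, fun h0 => ?_⟩
  have b : P ^ 3 * (ϑ₁ - 1) * (2 * x₂) * ϑ₁ ≤ (ϑ₂ - 1) * (2 * ϑ₁ - (1 + x₁)) := by
    refine le_of_mul_le_mul_right (a := ϑ₂) ?_ hϑ2
    rw [← e] at h3
    linarith
  have hd : 0 < 2 * (1 - x₂) := by linarith
  obtain ⟨z, hz⟩ : ∃ z, z = (x₁ + 2 * x₂ - 1) / (2 * (1 - x₂)) := ⟨_, rfl⟩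
  have hz' : 2 * (1 - x₂) * z = x₁ + 2 * x₂ - 1 := by rw [hz, mul_div_cancel₀ _ hd.ne']
  have hz0 : 0 ≤ z := by rw [hz]; positivity
  have hz1 : z ≤ ϑ₁ - 1 := by rw [hz, div_le_iff₀ hd]; linarith
  have m := mul_one_add_le hz0 hz1 (show 0 ≤ 1 - x₁ by linarith)
  rw [show 1 - x₁ + 2 * z = 2 * x₂ * (1 + z) by linarith] at m
  have m2 : z * (2 * ϑ₁ - (1 + x₁)) ≤ (ϑ₁ - 1) * (2 * x₂) * ϑ₁ := by
    refine le_of_mul_le_mul_right (a := 1 + z) ?_ (by linarith)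
    linarith
  have m3 := mul_le_mul_of_nonneg_left m2 (show 0 ≤ P ^ 3 by positivity)
  have m4 : P ^ 3 * z ≤ ϑ₂ - 1 := by
    refine le_of_mul_le_mul_right (a := 2 * ϑ₁ - (1 + x₁)) ?_ (by linarith)
    linarith
  have m5 := mul_le_mul_of_nonneg_left m4 hd.le
  rw [← hz']
  linarith

theorem right_bound (h : CellPair x₁ 1 C₁ ψ₁ ϑ₁ x₂ η₂ C₂ ψ₂ ϑ₂ n ρ) (hϑ : ϑ₁ < ϑ₂)
    (h2 : (1 + x₁) * ϑ₂ < (1 + x₂) * ϑ₁)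
    (h3 : P ^ 3 * (ϑ₁ - 1) * (2 * ϑ₂ - (1 + x₂)) * ϑ₁ ≤ (ϑ₂ - 1) * (2 * ϑ₁ - (1 + x₁)) * ϑ₂) :
    2 * (1 - x₁) * (ϑ₂ - 1) ≤ x₂ + 2 * x₁ - 1 ∧ P ^ 3 * (3 * x₁ - 1) ≤ x₂ + 2 * x₁ - 1 := by
  have h1 := h.one_lt_left
  have hϑ2 := h.ϑ_pos
  have hx1 := h.left.x_pos
  have hx11 := h.lt_one_left
  have hx21 := h.lt_one_right
  have e : 2 * (1 - x₁) * ϑ₁ = 1 + x₁ := by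
    have := h.left.eqX
    rw [div_one] at this
    linarith
  have hϑ1 : 0 < ϑ₁ := by linarith
  have a : 2 * (1 - x₁) * ϑ₂ < 1 + x₂ := by
    refine lt_of_mul_lt_mul_right (a := ϑ₁) ?_ hϑ1.le
    rw [← e] at h2
    linarith
  refine ⟨by linarith, ?_⟩
  have b : P ^ 3 * (ϑ₁ - 1) * (2 * ϑ₂ - (1 + x₂)) ≤ (ϑ₂ - 1) * (2 * x₁) * ϑ₂ := by
    refine le_of_mul_le_mul_right (a := ϑ₁) ?_ hϑ1
    rw [← e] at h3
    linarith
  have hd : 0 < 2 * (1 - x₁) := by linarith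
  obtain ⟨z, hz⟩ : ∃ z, z = (x₂ + 2 * x₁ - 1) / (2 * (1 - x₁)) := ⟨_, rfl⟩
  have hz' : 2 * (1 - x₁) * z = x₂ + 2 * x₁ - 1 := by rw [hz, mul_div_cancel₀ _ hd.ne']
  have hz1 : ϑ₂ - 1 ≤ z := by rw [hz, le_div_iff₀ hd]; linarith
  have m := mul_one_add_le (by linarith) hz1 (show 0 ≤ 1 - x₂ by linarith)
  rw [show 1 - x₂ + 2 * z = 2 * x₁ * (1 + z) by linarith] at m
  have m2 : (ϑ₂ - 1) * (2 * x₁) * ϑ₂ ≤ z * (2 * ϑ₂ - (1 + x₂)) := by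
    refine le_of_mul_le_mul_right (a := 1 + z) ?_ (by linarith)
    linarith
  have m4 : P ^ 3 * (ϑ₁ - 1) ≤ z := by
    refine le_of_mul_le_mul_right (a := 2 * ϑ₂ - (1 + x₂)) ?_ (by linarith)
    linarith
  have m5 := mul_le_mul_of_nonneg_left m4 hd.le
  rw [← hz', show 3 * x₁ - 1 = 2 * (1 - x₁) * (ϑ₁ - 1) by linarith]
  linarith

theorem gain_left_of_lt_half (h : CellPair x₁ η₁ C₁ ψ₁ ϑ₁ x₂ 1 C₂ ψ₂ ϑ₂ n ρ)
    (hP2 : P ≤ 2) (hx : x₁ < x₂) (hx2 : x₂ ≤ 1 / 2)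
    (h2 : x₁ + 2 * x₂ - 1 ≤ 2 * (1 - x₂) * (ϑ₁ - 1))
    (h3 : 0 ≤ x₁ + 2 * x₂ - 1 → P ^ 3 * (x₁ + 2 * x₂ - 1) ≤ 3 * x₂ - 1) :
    ∃ l, 1 ≤ l ∧ n ^ 3 * l * (x₂ / 1) ≤ ρ * (x₁ / η₁) ∧
      (1 < n → 1 + (ϑ₂ - 1) * P < n ^ 4 * l ^ 2 * ϑ₁) ∧
      (n = 1 → ϑ₂ + 13 / 200 * (ϑ₂ - ϑ₁) ≤ l ^ 2 * ϑ₁) := by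
  have h1 := h.one_lt_left
  have hn := h.ratio.n_ge
  have hx1 := h.left.x_pos
  have hx2' := h.right.x_pos
  have hcr := h.right.crit
  have eϑ := h.right.crit_ϑ
  set c := C₂ / (2 * ψ₂)
  have hd : 0 < 2 * (1 - x₂) := by linarith
  have hd3 : 0 < 3 * x₂ - 1 := by linarith [hcr.x_gt]
  obtain ⟨X, hX⟩ : ∃ X, X = c * x₂ := ⟨_, rfl⟩
  have hXe : 2 * (1 - x₂) * X = 3 * x₂ - 1 := by rw [hX]; linear_combination hcr.eq
  have hX0 : 1 / 5 ≤ X := by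
    refine le_of_mul_le_mul_left (a := 2 * (1 - x₂)) ?_ hd
    rw [hXe]; linarith [hcr.x_gt]
  obtain ⟨s, hs⟩ : ∃ s, s = (x₂ - x₁) / (3 * x₂ - 1) := ⟨_, rfl⟩
  have hs' : s * (3 * x₂ - 1) = x₂ - x₁ := by rw [hs, div_mul_cancel₀ _ hd3.ne']
  have hs0 : 0 ≤ s := by rw [hs]; exact div_nonneg (by linarith) hd3.le
  have hsX : 2 * (1 - x₂) * (X * s) = x₂ - x₁ := by linear_combination s * hXe + hs'
  obtain ⟨z, hz⟩ : ∃ z, z = max (X * (1 - s)) 0 := ⟨_, rfl⟩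
  have hz0 : 0 ≤ z := by rw [hz]; exact le_max_right _ _
  have hzX : X * (1 - s) ≤ z := by rw [hz]; exact le_max_left _ _
  have hz1 : z ≤ ϑ₁ - 1 := by
    rw [hz]
    refine max_le ?_ (by linarith)
    refine le_of_mul_le_mul_left (a := 2 * (1 - x₂)) ?_ hd
    linarith
  have hzx : z * x₂ ≤ X * x₁ := by
    rw [hz, max_mul_of_nonneg _ _ hx2'.le, zero_mul]
    refine max_le ?_ (by positivity)
    refine le_of_mul_le_mul_left (a := 2 * (1 - x₂)) ?_ hd
    have : 0 ≤ (x₂ - x₁) * (1 - 2 * x₂) := mul_nonneg (by linarith) (by linarith)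
    have e : 2 * (1 - x₂) * (X * (1 - s) * x₂) = (3 * x₂ - 1 - (x₂ - x₁)) * x₂ := by
      linear_combination x₂ * (hXe - hsX)
    have e2 : 2 * (1 - x₂) * (X * x₁) = (3 * x₂ - 1) * x₁ := by linear_combination x₁ * hXe
    rw [e, e2]
    linarith
  have core := h.left.core_left (p := 1) (κ := x₂ / (1 - x₂)) (c := z / x₁) hcr.C_gt hcr.C_lt
    h.ratio h.le_one hx hcr.x_lt_one (by positivity) (by
      rw [div_le_iff₀ hx1]
      have : z ≤ c * x₁ := by
        refine le_of_mul_le_mul_right (a := x₂) ?_ hx2'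
        rw [hX] at hzx
        linarith
      exact this.trans (mul_le_mul_of_nonneg_right hcr.c_le hx1.le)) le_rfl (by
      rw [div_mul_cancel₀ _ hx1.ne']
      have := mul_le_mul_of_nonneg_right (one_le_pow₀ hn (n := 3)) (show 0 ≤ ϑ₁ - 1 by linarith)
      linarith) (by
      rw [div_one, div_mul_cancel₀ _ hx1.ne']
      have hq := hcr.q_le
      have e : 1 + x₂ / (1 - x₂) = 1 / (1 - x₂) := by
        have : 1 - x₂ ≠ 0 := by linarith
        field_simp; ring
      rw [e]
      have b : 2 * (1 - x₂) * (1 + X * (1 - s)) = 1 + x₁ := by linarith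
      have b2 : (1 - x₁) * (1 + X * (1 - s)) ≤ (1 - x₁) * (1 + z) :=
        mul_le_mul_of_nonneg_left (by linarith) (by linarith)
      have b3 : 2 * (1 - x₁) * (1 + X * (1 - s)) - (1 + x₁)
          = 1 / (1 - x₂) * (x₂ - x₁) * (1 + x₁) := by
        have : 1 - x₂ ≠ 0 := by linarith
        field_simp
        linear_combination (1 - x₁) * b
      have b4 : 0 ≤ 1 / (1 - x₂) * (x₂ - x₁) * (1 + x₁) :=
        mul_nonneg (mul_nonneg (by have : 0 < 1 - x₂ := by linarith
                                   positivity) (by linarith)) (by linarith)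
      have b5 := mul_le_mul_of_nonneg_right hq b4
      linarith)
  have hw : x₂ / (1 - x₂) * (x₂ - x₁) = x₂ * (2 * (X * s)) := by
    have : 1 - x₂ ≠ 0 := by linarith
    rw [← hsX]
    field_simp
  have hP3 : P ≤ 1 + 3 * s := by
    rcases le_total (1 / 3) s with hh | hh
    · linarith
    · have a : 0 ≤ x₁ + 2 * x₂ - 1 := by
        have := mul_le_mul_of_nonneg_right hh hd3.le
        linarith
      have b := h3 a
      have b2 : P ^ 3 * (1 - s) ≤ 1 := by
        refine le_of_mul_le_mul_right (a := 3 * x₂ - 1) ?_ hd3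
        have : (1 - s) * (3 * x₂ - 1) = x₁ + 2 * x₂ - 1 := by linarith
        rw [mul_assoc, this]; linarith
      by_contra! hlt
      have c1 := pow_le_pow_left₀ (by linarith) hlt.le 3
      have c2 := mul_le_mul_of_nonneg_right c1 (show 0 ≤ 1 - s by linarith)
      have c3 : 0 ≤ s ^ 2 * (18 - 27 * s ^ 2) := by
        refine mul_nonneg (sq_nonneg s) ?_
        linarith only [pow_le_pow_left₀ hs0 hh 2]
      have c4 : s ≤ 0 := by linarith
      have c5 : s = 0 := le_antisymm c4 hs0
      rw [c5] at hlt b2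
      linarith only [one_lt_pow₀ (by linarith only [hlt] : 1 < P) three_ne_zero, b2]
  have hϑX : ϑ₂ = 1 + X := by rw [eϑ, hX]
  have hl1 : 1 ≤ 1 + 2 * (X * s) := by
    have : 0 ≤ X * s := mul_nonneg (by linarith) hs0
    linarith
  have main : ∀ w, w ≤ 1 + 3 * s → w ≤ 2 →
      1 + X * w + 13 / 200 * (X * s) ≤ (1 + 2 * (X * s)) ^ 2 * (1 + z) := fun w hw1 hw2 => by
    have hX00 : 0 ≤ X := by linarith
    rcases le_total s 1 with hh | hh
    · have g1 := mul_le_mul_of_nonneg_left hw1 hX00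
      have g2 : 0 ≤ X * s * (4 * X - 13 / 200) := mul_nonneg (mul_nonneg hX00 hs0) (by linarith)
      have g3 : 0 ≤ X ^ 3 * s ^ 2 * (1 - s) := mul_nonneg (by positivity) (by linarith)
      have g4 := mul_le_mul_of_nonneg_left hzX (sq_nonneg (1 + 2 * (X * s)))
      linarith
    · have hw4 : X * w ≤ X * (2 * s) := mul_le_mul_of_nonneg_left (by linarith) hX00
      have g4 := mul_nonneg hz0 (sq_nonneg (1 + 2 * (X * s)))
      have g5 : 0 ≤ X * s := mul_nonneg hX00 hs0
      have g6 := sq_nonneg (X * s)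
      linarith
  have hl2 : 0 < (1 + 2 * (X * s)) ^ 2 := by positivity
  have mz := mul_le_mul_of_nonneg_left hz1 hl2.le
  have hXs : 0 ≤ X * s := mul_nonneg (by linarith) hs0
  refine ⟨1 + 2 * (X * s), hl1, ?_, fun hn1 => ?_, fun _ => ?_⟩
  · rw [div_one]
    rw [hw] at core
    linarith
  · have m := main P hP3 hP2
    have d : 1 < n ^ 4 := one_lt_pow₀ hn1 (by norm_num)
    have d2 := mul_lt_mul_of_pos_right d (show 0 < (1 + 2 * (X * s)) ^ 2 * ϑ₁ by positivity)
    rw [hϑX]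
    linarith
  · have m := main 1 (by linarith) (by norm_num)
    rw [hϑX]
    linarith

set_option maxHeartbeats 1000000 in
theorem gain_right_of_bound (h : CellPair x₁ 1 C₁ ψ₁ ϑ₁ x₂ η₂ C₂ ψ₂ ϑ₂ n ρ) (hP1 : 1 ≤ P)
    (hϑ : ϑ₁ < ϑ₂) (hx : x₁ < x₂)
    (h2 : 2 * (1 - x₁) * (ϑ₂ - 1) ≤ x₂ + 2 * x₁ - 1)
    (h3 : P ^ 3 * (3 * x₁ - 1) ≤ x₂ + 2 * x₁ - 1) :
    ∃ l, 1 ≤ l ∧ n ^ 3 * l * (x₂ / η₂) ≤ ρ * (x₁ / 1) ∧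
      (1 < n → 1 + (ϑ₂ - 1) * P < n ^ 4 * l ^ 2 * ϑ₁) ∧
      (n = 1 → ϑ₂ + 13 / 200 * (ϑ₂ - ϑ₁) ≤ l ^ 2 * ϑ₁) := by
  have h1 := h.one_lt_left
  have hn := h.ratio.n_ge
  have hx1 := h.left.x_pos
  have hx2 := h.right.x_pos
  have hx21 := h.lt_one_right
  have hcr := h.left.crit
  have eϑ := h.left.crit_ϑ
  set c := C₁ / (2 * ψ₁)
  have hc0 : 0 < c := by linarith [hcr.c_gt]
  have hx0 := hcr.x_gt
  have hx0' := hcr.x_lt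
  have hd : 0 < 2 * (1 - x₁) := by linarith
  have hd3 : 0 < 3 * x₁ - 1 := by linarith
  obtain ⟨X, hX⟩ : ∃ X, X = c * x₁ := ⟨_, rfl⟩
  have hXe : 2 * (1 - x₁) * X = 3 * x₁ - 1 := by rw [hX]; linear_combination hcr.eq
  have hX0 : 1 / 5 ≤ X := by
    refine le_of_mul_le_mul_left (a := 2 * (1 - x₁)) ?_ hd
    rw [hXe]; linarith
  obtain ⟨s, hs⟩ : ∃ s, s = (x₂ - x₁) / (3 * x₁ - 1) := ⟨_, rfl⟩
  have hs' : s * (3 * x₁ - 1) = x₂ - x₁ := by rw [hs, div_mul_cancel₀ _ hd3.ne']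
  have hs0 : 0 ≤ s := by rw [hs]; exact div_nonneg (by linarith) hd3.le
  have hs1 : s ≤ 243 / 100 := by
    rw [hs, div_le_iff₀ hd3]; linarith
  have hsX : 2 * (1 - x₁) * (X * s) = x₂ - x₁ := by linear_combination s * hXe + hs'
  obtain ⟨z, hz⟩ : ∃ z, z = X * (1 + s) := ⟨_, rfl⟩
  have hz' : 2 * (1 - x₁) * z = x₂ + 2 * x₁ - 1 := by rw [hz]; linarith
  have hzϑ : ϑ₂ - 1 ≤ z := by
    refine le_of_mul_le_mul_left (a := 2 * (1 - x₁)) ?_ hd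
    rw [hz']; exact h2
  have hX00 : 0 < X := by linarith
  have hz0 : 0 < z := by rw [hz]; positivity
  have core' : ∀ b p, b * p * x₂ = z → b ≤ c → 1 ≤ p → 2 * p * x₂ * (1 - x₂) ≤ x₁ * (1 + x₂) →
      n ^ 3 * (x₂ + x₁ / (1 - x₁) * (x₂ - x₁)) * (x₂ / η₂) ≤ ρ * x₁ * x₂ := by
    intro b p hb hbc hp hp'
    refine h.right.core_right (p := p) (c := b) h.ratio h.one_le hx1 hx hx21 ?_ ?_ hp hp'
      (by have : 0 < 1 - x₁ := by linarith
          positivity) ?_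
    · rcases h.n_eq with hh | hh
      · exact Or.inl hh
      · refine Or.inr ?_
        rw [← hh]
        exact mul_le_mul_of_nonneg_left (hbc.trans hcr.c_le) (by positivity)
    · have := mul_le_mul_of_nonneg_right (one_le_pow₀ hn (n := 3)) hz0.le
      rw [show b * p * n ^ 3 * x₂ = n ^ 3 * z by rw [← hb]; ring]
      linarith
    · rw [hb]
      have e : 1 + x₁ / (1 - x₁) = 1 / (1 - x₁) := by
        have : 1 - x₁ ≠ 0 := by linarith
        field_simp; ring
      rw [e]
      have b3 : (1 + x₂) - 2 * (1 - x₂) * (1 + z) = 1 / (1 - x₁) * (x₂ - x₁) * (1 + x₂) := by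
        have : 1 - x₁ ≠ 0 := by linarith
        field_simp
        linear_combination -(1 - x₂) * hz'
      have b4 : 0 ≤ 1 / (1 - x₁) * (x₂ - x₁) * (1 + x₂) :=
        mul_nonneg (mul_nonneg (by have : 0 < 1 - x₁ := by linarith
                                   positivity) (by linarith)) (by linarith)
      have b5 := mul_le_mul_of_nonneg_right
        (show C₂ * (2 - C₂) ≤ 1 by linarith [sq_nonneg (C₂ - 1)]) b4
      rw [b3]
      linarith
  have core : n ^ 3 * (x₂ + x₁ / (1 - x₁) * (x₂ - x₁)) * (x₂ / η₂) ≤ ρ * x₁ * x₂ := by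
    rcases le_total (1 / 2) x₁ with hh | hh
    · refine core' (z / x₂) 1 (by rw [mul_one, div_mul_cancel₀ _ hx2.ne']) ?_ le_rfl ?_
      · rw [div_le_iff₀ hx2]
        refine le_of_mul_le_mul_left (a := 2 * (1 - x₁) * x₁) ?_ (by positivity)
        have e : 2 * (1 - x₁) * x₁ * (c * x₂) = (3 * x₁ - 1) * x₂ := by
          rw [← hXe, hX]; ring
        have e2 : 2 * (1 - x₁) * x₁ * z = (x₂ + 2 * x₁ - 1) * x₁ := by rw [← hz']; ring
        rw [e, e2]
        have : 0 ≤ (x₂ - x₁) * (2 * x₁ - 1) := mul_nonneg (by linarith) (by linarith)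
        linarith
      · have := hcr.two_mul_lt hx2.le
        linarith
    · have e : c * (x₁ * (1 + s) / x₂) * x₂ = z := by
        rw [hz, hX]; field_simp
      refine core' c (x₁ * (1 + s) / x₂) e le_rfl ?_ ?_
      · rw [le_div_iff₀ hx2]
        have : 0 ≤ s * (1 - 2 * x₁) := mul_nonneg hs0 (by linarith)
        linarith
      · have e2 : 2 * (x₁ * (1 + s) / x₂) * x₂ * (1 - x₂) = x₁ * (2 * (1 + s) * (1 - x₂)) := by
          field_simp
        rw [e2]
        refine mul_le_mul_of_nonneg_left ?_ hx1.le
        refine le_of_mul_le_mul_right (a := 3 * x₁ - 1) ?_ hd3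
        have e3 : 2 * (1 + s) * (1 - x₂) * (3 * x₁ - 1) = 2 * (x₂ + 2 * x₁ - 1) * (1 - x₂) := by
          linear_combination 2 * (1 - x₂) * hs'
        rw [e3]
        nlinarith only [sq_nonneg (x₂ - x₁ - 223 / 2000), hx0, hx0', hx, hx21]
  have hw : x₁ / (1 - x₁) * (x₂ - x₁) = x₁ * (2 * (X * s)) := by
    have : 1 - x₁ ≠ 0 := by linarith
    rw [← hsX]
    field_simp
  rw [hw] at core
  have hP3 : P ≤ 1 + s / 3 := by
    have b2 : P ^ 3 ≤ 1 + s := by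
      refine le_of_mul_le_mul_right (a := 3 * x₁ - 1) ?_ hd3
      linarith
    by_contra! hlt
    have c1 := pow_lt_pow_left₀ hlt (by linarith) (n := 3) (by norm_num)
    have c2 : 0 ≤ s ^ 2 * (9 + s) := by positivity
    linarith
  obtain ⟨ξ, hξ⟩ : ∃ ξ, ξ = x₁ / x₂ := ⟨_, rfl⟩
  have hξx : ξ * x₂ = x₁ := by rw [hξ]; field_simp
  have hξ1 : x₁ ≤ ξ := by
    rw [hξ, le_div_iff₀ hx2]
    have := mul_le_mul_of_nonneg_left hx21.le hx1.le
    linarith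
  have hϑX : ϑ₁ = 1 + X := by rw [eϑ, hX]
  have hl0 : 0 ≤ 2 * (X * s) * ξ :=
    mul_nonneg (mul_nonneg (by norm_num) (mul_nonneg hX00.le hs0)) (by linarith)
  have main : 1 + X * ((1 + s) * (1 + s / 3)) ≤ (1 + 2 * (X * s) * ξ) ^ 2 * ϑ₁ := by
    have a1 : 199 / 100 ≤ 4 * x₁ * (1 + X) := by
      refine le_of_mul_le_mul_left (a := 2 * (1 - x₁)) ?_ hd
      have e : 4 * x₁ * (2 * (1 - x₁) * X) = 4 * x₁ * (3 * x₁ - 1) := by rw [hXe]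
      linarith only [e, hx0, sq_nonneg (x₁ - 207 / 500)]
    have a2 : 199 / 100 ≤ 4 * ξ * (1 + X) := by
      have := mul_le_mul_of_nonneg_right hξ1 (show 0 ≤ 1 + X by linarith)
      linarith
    have a3 : 2 / 5 ≤ ξ := by linarith
    have a4 : 1 / 5 * (2 / 5) ≤ X * ξ := mul_le_mul hX0 a3 (by norm_num) hX00.le
    have a5 : 1 / 5 * (2 / 5) * (199 / 100) ≤ X * ξ * (4 * ξ * (1 + X)) :=
      mul_le_mul a4 a2 (by norm_num) (by linarith)
    have a6 := mul_le_mul_of_nonneg_left a5 hs0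
    have a7 : 0 ≤ (1 + X) * (4 * ξ + 4 * X * s * ξ ^ 2) - (4 / 3 + s / 3) := by linarith
    have a8 := mul_nonneg (mul_nonneg hX00.le hs0) a7
    rw [hϑX]
    linarith
  refine ⟨1 + 2 * (X * s) * ξ, by linarith, ?_, fun hn1 => ?_, fun _ => ?_⟩
  · rw [div_one]
    refine le_of_mul_le_mul_right (a := x₂) ?_ hx2
    rw [← hξx] at core ⊢
    linarith
  · have d : 1 < n ^ 4 := one_lt_pow₀ hn1 (by norm_num)
    have d2 := mul_lt_mul_of_pos_right d (show 0 < (1 + 2 * (X * s) * ξ) ^ 2 * ϑ₁ by positivity)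
    have d3 : (ϑ₂ - 1) * P ≤ z * (1 + s / 3) :=
      mul_le_mul hzϑ hP3 (by linarith) hz0.le
    rw [hz] at d3
    linarith
  · rw [hz] at hzϑ
    have : 0 ≤ X * s * s := by positivity
    have : 0 ≤ X * s := by positivity
    rw [hϑX] at main ⊢
    linarith

theorem exists_gain (h : CellPair x₁ η₁ C₁ ψ₁ ϑ₁ x₂ η₂ C₂ ψ₂ ϑ₂ n ρ) (hP1 : 1 ≤ P) (hP2 : P ≤ 2)
    (hP : ψ₁ = ψ₂ * P) (hϑ : ϑ₁ < ϑ₂)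
    (hL : P ^ 3 * (ϑ₁ - 1) ≤ ϑ₂ - 1 ∨ ((1 + x₁) * ϑ₂ < (1 + x₂) * ϑ₁ ∧
      P ^ 3 * (ϑ₁ - 1) * (2 * ϑ₂ - (1 + x₂)) * ϑ₁ ≤ (ϑ₂ - 1) * (2 * ϑ₁ - (1 + x₁)) * ϑ₂)) :
    ∃ l, 1 ≤ l ∧ n ^ 3 * l * (x₂ / η₂) ≤ ρ * (x₁ / η₁) ∧
      (1 < n → 1 + (ϑ₂ - 1) * P < n ^ 4 * l ^ 2 * ϑ₁) ∧
      (n = 1 → ϑ₂ + 13 / 200 * (ϑ₂ - ϑ₁) ≤ l ^ 2 * ϑ₁) := by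
  have h1 := h.one_lt_left
  have hx1 := h.left.x_pos
  have hx2 := h.right.x_pos
  have hn := h.ratio.n_ge
  have hψ₂ : 0 < ψ₂ := by linarith [h.right.ψ_ge]
  rcases hL with hL | ⟨h2, h3⟩
  · rcases le_or_gt x₂ x₁ with hx | hx
    · exact h.gain_of_ge hP1 hP hϑ hx hL
    · have nu := h.left.nu_le h.right h.ratio h.le_one h.one_le
      have hS : P ^ 2 * x₁ ≤ n ^ 2 * x₂ := by
        have a := mul_le_mul_of_nonneg_right hL (show 0 ≤ ψ₂ * x₁ by positivity)
        rw [hP] at nu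
        refine le_of_mul_le_mul_right (a := ψ₂ * (P * (ϑ₁ - 1))) ?_
          (mul_pos hψ₂ (mul_pos (by linarith) (by linarith)))
        linarith
      rcases h.crit with rfl | rfl
      · exact h.gain_left_of_sq_le hP1 hP2 hP hx hS
      · exact h.gain_right_of_sq_le hP1 hP hx hS
  · have hx : x₁ < x₂ := by
      by_contra! hle
      have : (1 + x₂) * ϑ₁ ≤ (1 + x₁) * ϑ₂ := mul_le_mul (by linarith) hϑ.le (by linarith)
        (by linarith)
      linarith
    rcases h.crit with rfl | rfl
    · obtain ⟨b1, b2⟩ := h.left_bound hP1 h2 h3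
      rcases le_total x₂ (1 / 2) with hh | hh
      · exact h.gain_left_of_lt_half hP2 hx hh b1 b2
      · refine h.gain_left_of_sq_le hP1 hP2 hP hx ?_
        have a : 0 < x₁ + 2 * x₂ - 1 := by linarith
        have b := b2 a.le
        have c : (3 * x₂ - 1) * x₁ ≤ x₂ * (x₁ + 2 * x₂ - 1) := by
          have : 0 ≤ (x₂ - x₁) * (2 * x₂ - 1) := mul_nonneg (by linarith) (by linarith)
          linarith
        have d : P ^ 3 * x₁ ≤ x₂ := by
          refine le_of_mul_le_mul_right (a := x₁ + 2 * x₂ - 1) ?_ a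
          have := mul_le_mul_of_nonneg_right b hx1.le
          linarith
        have e : P ^ 2 * x₁ ≤ P ^ 3 * x₁ :=
          mul_le_mul_of_nonneg_right (pow_le_pow_right₀ hP1 (by norm_num)) hx1.le
        have f := mul_le_mul_of_nonneg_right (one_le_pow₀ hn (n := 2)) hx2.le
        linarith
    · obtain ⟨b1, b2⟩ := h.right_bound hϑ h2 h3
      exact h.gain_right_of_bound hP1 hϑ hx b1 b2

end CellPair

end AnticipatoryTrading

namespace AnticipatoryTrading

/-- Monotonicity of `δ r² / ψ³`. -/
theorem mul_rr_sq_div_le {θ u δ₀ δ₁ : ℝ} (hθ : 0 ≤ θ) (h0 : 0 < δ₀) (h : δ₀ ≤ δ₁)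
    (h1 : δ₁ < 1 / 2) (hu0 : 17 / 100 < u) (hu : u < 1) (hk : u * (1 - δ₀) ≤ δ₀ + 2 * θ) :
    δ₀ * rr θ δ₀ u ^ 2 * ((δ₁ + θ) / (δ₁ + 2 * θ)) ^ 3
      ≤ δ₁ * rr θ δ₁ u ^ 2 * ((δ₀ + θ) / (δ₀ + 2 * θ)) ^ 3 := by
  rcases h.eq_or_lt with rfl | hlt
  · exact le_rfl
  have r0 := rr_pos hθ h0 (by linarith) hu (by nlinarith)
  have r1 := rr_pos hθ (h0.trans hlt) h1 hu (by nlinarith)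
  have key : legF 1 (-3) 3 0 θ u δ₀ < legF 1 (-3) 3 0 θ u δ₁ := by
    refine legF_lt hθ h0 hlt h1 (by linarith) hu hk (by norm_num) fun σ hσ hσ1 => ?_
    have ht : 17 / 100 * σ < σ * u := by rw [mul_comm]; exact mul_lt_mul_of_pos_left hu0 hσ
    have hsu1 : 0 < 1 - σ * u := by
      have : σ * u < 1 * 1 := mul_lt_mul' hσ1 hu (by linarith) (by norm_num)
      linarith
    have : (1 : ℝ) + 2 * (-3) * σ / (1 + σ) + (3 - 4) * σ - (2 + 0) * (σ * u) + (1 - u) * σ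
          + 2 * σ * (1 + u) / (1 - σ * u) = ((1 - 2 * σ) * (1 - σ - 2 * (σ * u))
            + 3 * (1 + σ) * (σ * u) ^ 2) / ((1 + σ) * (1 - σ * u)) := by
        field_simp; ring
    rw [this]
    refine div_pos ?_ (by positivity)
    generalize σ * u = t at *
    have ht0 : 0 < t := by linarith
    rcases le_total σ (1 / 2) with hh | hh
    · have a : 0 < 3 * (1 + σ) * t ^ 2 := by positivity
      rcases le_total (1 - σ - 2 * t) 0 with h3 | h3
      · have b : (2 * t - (1 - σ)) * (1 - 2 * σ) ≤ (2 * t - (1 - σ)) * 1 :=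
          mul_le_mul_of_nonneg_left (by linarith) (by linarith)
        have c : 0 ≤ 3 * (t - 1 / 3) ^ 2 + 3 * σ * t ^ 2 := by positivity
        nlinarith
      · have := mul_nonneg (show 0 ≤ 1 - 2 * σ by linarith) h3
        linarith
    · have a : 17 / 100 * σ * (17 / 100 * σ) ≤ t * t := mul_le_mul ht.le ht.le (by linarith) ht0.le
      have b : (2 * σ - 1) * (1 - σ - 2 * t) ≤ (2 * σ - 1) * (1 - σ - 2 * (17 / 100 * σ)) :=
        mul_le_mul_of_nonneg_left (by linarith) (by linarith)
      have c : 3 * (3 / 2) * (17 / 100 * σ * (17 / 100 * σ)) ≤ 3 * (1 + σ) * (t * t) :=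
        mul_le_mul (by linarith) a (by positivity) (by linarith)
      nlinarith [sq_nonneg (σ - 3 / 5)]
  unfold legF at key
  have hp3 : 0 < δ₁ := by linarith
  refine le_of_lt ((Real.log_lt_log_iff (by positivity) (by positivity)).1 ?_)
  rw [Real.log_mul (by positivity) (by positivity), Real.log_mul (by positivity) (by positivity),
    Real.log_mul (by positivity) (by positivity), Real.log_mul (by positivity) (by positivity),
    Real.log_pow, Real.log_pow, Real.log_pow, Real.log_pow,
    Real.log_div (by positivity) (by positivity), Real.log_div (by positivity) (by positivity)]
  push_cast
  linarith

/-- A bound for the growth of `(δ + 2 θ) r²`. -/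
theorem mul_rr_sq_le_mul {θ u δ₀ δ₁ P : ℝ} (hθ : 0 ≤ θ) (h0 : 0 < δ₀) (h : δ₀ ≤ δ₁)
    (h1 : δ₁ < 1 / 2) (hu0 : 0 < u) (hu : u < 1) (hk : u * (1 - δ₀) ≤ δ₀ + 2 * θ) (hP1 : 1 ≤ P)
    (hP : (δ₁ + θ) / (δ₁ + 2 * θ) = (δ₀ + θ) / (δ₀ + 2 * θ) * P) :
    rr θ δ₀ u ^ 2 * (δ₀ + 2 * θ) ≤ (1 + u * (P - 1)) * (rr θ δ₁ u ^ 2 * (δ₁ + 2 * θ)) := by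
  have r0 := rr_pos hθ h0 (by linarith) hu (by nlinarith)
  have r1 := rr_pos hθ (h0.trans_le h) h1 hu (by nlinarith)
  have hM1 : 0 < δ₁ + 2 * θ := by linarith
  have hm1 : 0 < δ₁ + θ := by linarith
  rcases h.eq_or_lt with rfl | hlt
  · have : 0 ≤ u * (P - 1) * (rr θ δ₀ u ^ 2 * (δ₀ + 2 * θ)) :=
      mul_nonneg (mul_nonneg hu0.le (by linarith)) (by positivity)
    linarith
  have key : legF 0 u (1 - u) 0 θ u δ₀ < legF 0 u (1 - u) 0 θ u δ₁ := by
    refine legF_lt hθ h0 hlt h1 hu0 hu hk (by norm_num) fun σ hσ hσ1 => ?_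
    have hsu : 0 < σ * u := by positivity
    have hsu1 : 0 < 1 - σ * u := by nlinarith
    have : (0 : ℝ) + 2 * u * σ / (1 + σ) + (1 - u - 4) * σ - (2 + 0) * (σ * u) + (1 - u) * σ
          + 2 * σ * (1 + u) / (1 - σ * u) = 2 * σ * (σ * u) * (u + σ + 2 * (σ * u))
            / ((1 + σ) * (1 - σ * u)) := by
        have hne : 1 - u * σ ≠ 0 := by rw [mul_comm]; exact hsu1.ne'
        have hne' : 1 + σ ≠ 0 := by positivity
        rw [mul_comm σ u]
        field_simp
        ring
    rw [this]
    positivity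
  have hP0 : 0 < P := by linarith
  have hb : P ^ u ≤ 1 + u * (P - 1) := by
    have := rpow_one_add_le_one_add_mul_self (s := P - 1) (by linarith) hu0.le hu.le
    rwa [add_sub_cancel] at this
  refine le_trans ?_ (mul_le_mul_of_nonneg_right hb (by positivity))
  refine le_of_lt ((Real.log_lt_log_iff (by positivity) (by positivity)).1 ?_)
  have hl : Real.log P = Real.log (δ₁ + θ) - Real.log (δ₁ + 2 * θ)
      - (Real.log (δ₀ + θ) - Real.log (δ₀ + 2 * θ)) := by
    rw [← Real.log_div (by positivity) (by positivity),
      ← Real.log_div (by positivity) (by positivity), hP,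
      Real.log_mul (by positivity) (by positivity)]
    ring
  rw [Real.log_mul (by positivity) (by positivity), Real.log_mul (by positivity) (by positivity),
    Real.log_mul (by positivity) (by positivity), Real.log_pow, Real.log_pow,
    Real.log_rpow hP0, hl]
  unfold legF at key
  push_cast
  linarith

theorem rr_sq_mul_le' {θ δ u₁ u₂ : ℝ} (hθ : 0 ≤ θ) (hδ : 0 < δ) (hδ' : δ < 1 / 2) (hu0 : 0 < u₂)
    (hu : u₂ ≤ u₁) (hu1 : u₁ < 1) (hk : u₁ * (1 - δ) ≤ δ + 2 * θ) :
    rr θ δ u₁ ^ 2 * u₂ ≤ rr θ δ u₂ ^ 2 * u₁ := by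
  have a := rr_sq_mul_le hθ hδ hδ' hu0 hu hk
  have b : 0 < δ + 2 * θ - u₁ * δ := by nlinarith
  have c : δ + 2 * θ - u₁ * δ ≤ δ + 2 * θ - u₂ * δ := by nlinarith
  have d := pow_le_pow_left₀ b.le c 2
  refine le_of_mul_le_mul_right (a := (δ + 2 * θ - u₁ * δ) ^ 2) ?_ (by positivity)
  have := mul_le_mul_of_nonneg_left d (show 0 ≤ rr θ δ u₁ ^ 2 * u₂ by positivity)
  linarith

/-- The comparison of the shares left for the last round. -/
theorem vB_cross {σ a e x₁ x₂ u₁ u₂ K : ℝ} (hσ : 0 < σ) (hσ1 : σ ≤ 1) (ha : a = 1 - σ)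
    (he : e * (1 + σ) = 2 * σ) (hu1 : 0 < u₁) (hu : u₁ < u₂) (hu2 : u₂ < 1) (hx2 : x₂ < 1)
    (hK : K * (vB a e u₂ x₂ * u₁) ≤ vB a e u₁ x₁ * u₂) :
    K * (1 / (1 - u₁) - 1) ≤ 1 / (1 - u₂) - 1 ∨
      ((1 + x₁) * (1 / (1 - u₂)) < (1 + x₂) * (1 / (1 - u₁)) ∧
      K * (1 / (1 - u₁) - 1) * (2 * (1 / (1 - u₂)) - (1 + x₂)) * (1 / (1 - u₁))
        ≤ (1 / (1 - u₂) - 1) * (2 * (1 / (1 - u₁)) - (1 + x₁)) * (1 / (1 - u₂))) := by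
  have he0 : 0 < e := by
    by_contra! hle
    have := mul_nonpos_of_nonpos_of_nonneg hle (show 0 ≤ 1 + σ by linarith)
    linarith
  have hse : 0 ≤ 1 - a ^ 2 - e := by
    refine nonneg_of_mul_nonneg_left (b := 1 + σ) ?_ (by linarith)
    have : (1 - a ^ 2 - e) * (1 + σ) = σ ^ 2 * (1 - σ) := by rw [ha]; linear_combination -he
    rw [this]
    exact mul_nonneg (sq_nonneg σ) (by linarith)
  have t1 : 0 < 1 - u₁ := by linarith
  have t2 : 0 < 1 - u₂ := by linarith
  obtain ⟨p, hp⟩ : ∃ p, p = 1 / (1 - u₁) := ⟨_, rfl⟩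
  obtain ⟨q, hq⟩ : ∃ q, q = 1 / (1 - u₂) := ⟨_, rfl⟩
  have hp' : p * (1 - u₁) = 1 := by rw [hp]; field_simp
  have hq' : q * (1 - u₂) = 1 := by rw [hq]; field_simp
  have hp0 : 0 < p := by rw [hp]; positivity
  have hq0 : 0 < q := by rw [hq]; positivity
  have hpq : p < q := by rw [hp, hq]; exact one_div_lt_one_div_of_lt t2 (by linarith)
  have hpX : p - 1 = p * u₁ := by linarith
  have hqX : q - 1 = q * u₂ := by linarith
  have hq1 : 1 < q := by nlinarith
  obtain ⟨g₁, hg₁⟩ : ∃ g, g = 2 - (1 - u₁) * (1 + x₁) := ⟨_, rfl⟩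
  obtain ⟨g₂, hg₂⟩ : ∃ g, g = 2 - (1 - u₂) * (1 + x₂) := ⟨_, rfl⟩
  have hg20 : 0 < g₂ := by
    have : (1 - u₂) * (1 + x₂) < (1 - u₂) * 2 := mul_lt_mul_of_pos_left (by linarith) t2
    linarith
  obtain ⟨b₁, hb₁⟩ : ∃ b, b = a ^ 2 * p + (1 - a ^ 2 - e) * (1 + u₁) := ⟨_, rfl⟩
  obtain ⟨b₂, hb₂⟩ : ∃ b, b = a ^ 2 * q + (1 - a ^ 2 - e) * (1 + u₂) := ⟨_, rfl⟩
  have hb : b₁ ≤ b₂ := by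
    have c1 := mul_le_mul_of_nonneg_left hpq.le (sq_nonneg a)
    have c2 := mul_le_mul_of_nonneg_left hu.le hse
    linarith
  have hb2 : 0 ≤ b₂ := by
    have := mul_nonneg hse (show 0 ≤ 1 + u₂ by linarith)
    rw [hb₂]
    have : 0 ≤ a ^ 2 * q := by positivity
    linarith
  have e1 : vB a e u₁ x₁ * p = b₁ + e * g₁ := by
    rw [hb₁, hg₁]; unfold vB
    linear_combination ((1 - a ^ 2) * (1 + u₁) - e * x₁ * (1 - u₁)) * hp'
  have e2 : vB a e u₂ x₂ * q = b₂ + e * g₂ := by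
    rw [hb₂, hg₂]; unfold vB
    linear_combination ((1 - a ^ 2) * (1 + u₂) - e * x₂ * (1 - u₂)) * hq'
  have hB2 : 0 < b₂ + e * g₂ := by have := mul_pos he0 hg20; linarith
  have hKX : K * (p - 1) * (b₂ + e * g₂) ≤ (q - 1) * (b₁ + e * g₁) := by
    rw [hpX, hqX, ← e1, ← e2]
    have := mul_le_mul_of_nonneg_right hK (mul_pos hp0 hq0).le
    linarith
  have f1 : 2 * p - (1 + x₁) = g₁ * p := by rw [hg₁]; linear_combination (1 + x₁) * hp'
  have f2 : 2 * q - (1 + x₂) = g₂ * q := by rw [hg₂]; linear_combination (1 + x₂) * hq'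
  rw [← hp, ← hq, f1, f2]
  have hqX0 : 0 < q - 1 := by linarith
  rcases le_or_gt g₁ g₂ with hg | hg
  · left
    refine le_of_mul_le_mul_right (a := b₂ + e * g₂) ?_ hB2
    have c1 := mul_le_mul_of_nonneg_left hg he0.le
    have c2 := mul_le_mul_of_nonneg_left (show b₁ + e * g₁ ≤ b₂ + e * g₂ by linarith) hqX0.le
    linarith
  · right
    constructor
    · have c1 := mul_lt_mul_of_pos_right hg (mul_pos hp0 hq0)
      have c2 : g₂ * (p * q) = (2 * q - (1 + x₂)) * p := by rw [f2]; ring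
      have c3 : g₁ * (p * q) = (2 * p - (1 + x₁)) * q := by rw [f1]; ring
      rw [c2, c3] at c1
      linarith
    · have c1 : (b₁ + e * g₁) * g₂ ≤ (b₂ + e * g₂) * g₁ := by
        have d1 : b₁ * g₂ ≤ b₂ * g₂ := mul_le_mul_of_nonneg_right hb hg20.le
        have d2 : b₂ * g₂ ≤ b₂ * g₁ := mul_le_mul_of_nonneg_left hg.le hb2
        linarith
      have c2 : K * (p - 1) * g₂ ≤ (q - 1) * g₁ := by
        refine le_of_mul_le_mul_right (a := b₂ + e * g₂) ?_ hB2
        have d1 := mul_le_mul_of_nonneg_right hKX hg20.le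
        have d2 := mul_le_mul_of_nonneg_left c1 hqX0.le
        linarith
      have := mul_le_mul_of_nonneg_right c2 (mul_pos hp0 hq0).le
      linarith

end AnticipatoryTrading

namespace AnticipatoryTrading

section Spread

variable {θ θ₂ δ₁ u₁ x₁ η₁ C₁ δ₂ u₂ x₂ η₂ C₂ n ρ : ℝ}

/-- The data for the comparison if `δ₂ ≤ δ₁` and `u₁ < u₂`. -/
theorem exists_gain_of_lt (hθ : 0 ≤ θ) (hθ₂ : 0 < θ₂) (h₁ : RState θ θ₂ δ₁ u₁ x₁ η₁ C₁)
    (h₂ : RState θ θ₂ δ₂ u₂ x₂ η₂ C₂)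
    (hp : CellPair x₁ η₁ C₁ ((δ₁ + θ) / (δ₁ + 2 * θ)) (1 / (1 - u₁))
      x₂ η₂ C₂ ((δ₂ + θ) / (δ₂ + 2 * θ)) (1 / (1 - u₂)) n ρ)
    (hδ : δ₂ ≤ δ₁) (hu : u₁ < u₂) :
    ∃ P l, 1 ≤ P ∧ (δ₁ + θ) / (δ₁ + 2 * θ) = (δ₂ + θ) / (δ₂ + 2 * θ) * P ∧
      1 ≤ l ∧ n ^ 3 * l * (x₂ / η₂) ≤ ρ * (x₁ / η₁) ∧
      (1 < n → 1 + (1 / (1 - u₂) - 1) * P < n ^ 4 * l ^ 2 * (1 / (1 - u₁))) ∧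
      (n = 1 → 1 / (1 - u₂) + 13 / 200 * (1 / (1 - u₂) - 1 / (1 - u₁))
        ≤ l ^ 2 * (1 / (1 - u₁))) := by
  have d1 := h₁.δ_pos
  have d2 := h₂.δ_pos
  have M1 := h₁.M_pos hθ
  have M2 := h₂.M_pos hθ
  have hu1 := u_pos_of_one_lt h₁.u_lt hp.one_lt_left
  have hu2 : 0 < u₂ := by linarith
  have hu17 : 17 / 100 < u₂ := by
    rcases hp.crit with rfl | rfl
    · exact h₂.crit_u.1
    · linarith [h₁.crit_u.1]
  have hψ := psi_le_psi hθ d2 hδ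
  have hψ2 : 0 < (δ₂ + θ) / (δ₂ + 2 * θ) := by linarith [h₂.cell.ψ_ge]
  obtain ⟨P, hP⟩ : ∃ P, P = (δ₁ + θ) / (δ₁ + 2 * θ) / ((δ₂ + θ) / (δ₂ + 2 * θ)) := ⟨_, rfl⟩
  have hP' : (δ₁ + θ) / (δ₁ + 2 * θ) = (δ₂ + θ) / (δ₂ + 2 * θ) * P := by
    rw [hP, mul_div_cancel₀ _ hψ2.ne']
  have hP1 : 1 ≤ P := by rw [hP, le_div_iff₀ hψ2]; linarith
  have hP2 : P ≤ 2 := by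
    rw [hP, div_le_iff₀ hψ2]; linarith [h₁.cell.ψ_le, h₂.cell.ψ_ge]
  have k1 : u₁ * (1 - δ₁) < δ₁ + 2 * θ := by
    have := h₂.k_le
    have a : u₁ * (1 - δ₁) ≤ u₁ * (1 - δ₂) := mul_le_mul_of_nonneg_left (by linarith) hu1.le
    have b : u₁ * (1 - δ₂) < u₂ * (1 - δ₂) := mul_lt_mul_of_pos_right hu (by linarith [h₂.δ_lt])
    linarith
  have pure1 : vB (2 * θ / (δ₁ + 2 * θ)) (δ₁ / (δ₁ + θ)) u₁ x₁ = 4 * (δ₁ * rr θ δ₁ u₁ ^ 2) * θ₂ :=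
    h₁.pure.resolve_left k1.ne
  have k12 : u₂ * (1 - δ₁) ≤ δ₁ + 2 * θ := by
    have := h₂.k_le
    have : u₂ * (1 - δ₁) ≤ u₂ * (1 - δ₂) := mul_le_mul_of_nonneg_left (by linarith) hu2.le
    linarith
  have leg := mul_rr_sq_div_le hθ d2 hδ h₁.δ_lt hu17 h₂.u_lt h₂.k_le
  have leg2 := rr_sq_mul_le' hθ d1 h₁.δ_lt hu1 hu.le h₂.u_lt k12
  obtain ⟨p1, p2, -, -, p5, -⟩ := vB_params hθ d2
  have hB1 := vB_mono hθ d2 hδ (u := u₁) hp.left.x_pos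
  have hσ : 0 < δ₂ / (δ₂ + 2 * θ) := by positivity
  have hσ1 : δ₂ / (δ₂ + 2 * θ) ≤ 1 := by rw [div_le_one M2]; linarith
  have hK : P ^ 3 * (vB (2 * θ / (δ₂ + 2 * θ)) (δ₂ / (δ₂ + θ)) u₂ x₂ * u₁)
      ≤ vB (2 * θ / (δ₂ + 2 * θ)) (δ₂ / (δ₂ + θ)) u₁ x₁ * u₂ := by
    refine le_trans ?_ (mul_le_mul_of_nonneg_right hB1 hu2.le)
    rw [pure1]
    rw [hP', mul_pow] at leg
    have leg' : δ₂ * rr θ δ₂ u₂ ^ 2 * P ^ 3 ≤ δ₁ * rr θ δ₁ u₂ ^ 2 := by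
      refine le_of_mul_le_mul_left (a := ((δ₂ + θ) / (δ₂ + 2 * θ)) ^ 3) ?_ (by positivity)
      linarith
    calc P ^ 3 * (vB (2 * θ / (δ₂ + 2 * θ)) (δ₂ / (δ₂ + θ)) u₂ x₂ * u₁)
        ≤ P ^ 3 * (4 * (δ₂ * rr θ δ₂ u₂ ^ 2) * θ₂ * u₁) := by
          have := h₂.vol
          gcongr
      _ = 4 * θ₂ * u₁ * (δ₂ * rr θ δ₂ u₂ ^ 2 * P ^ 3) := by ring
      _ ≤ 4 * θ₂ * u₁ * (δ₁ * rr θ δ₁ u₂ ^ 2) := mul_le_mul_of_nonneg_left leg' (by positivity)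
      _ = 4 * θ₂ * δ₁ * (rr θ δ₁ u₂ ^ 2 * u₁) := by ring
      _ ≤ 4 * θ₂ * δ₁ * (rr θ δ₁ u₁ ^ 2 * u₂) := mul_le_mul_of_nonneg_left leg2 (by positivity)
      _ = _ := by ring
  have hL := vB_cross hσ hσ1 p1 p2 hu1 hu h₂.u_lt hp.lt_one_right hK
  obtain ⟨l, hl⟩ := hp.exists_gain hP1 hP2 hP'
    (one_div_lt_one_div_of_lt (by linarith [h₂.u_lt]) (by linarith)) hL
  exact ⟨P, l, hP1, hP', hl⟩

/-- Comparison of intermediate market sizes for `δ₂ ≤ δ₁` and `u₁ < u₂`. -/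
theorem invSize_lt_of_spread (hθ : 0 ≤ θ) (hθ₂ : 0 < θ₂) (h₁ : RState θ θ₂ δ₁ u₁ x₁ η₁ C₁)
    (h₂ : RState θ θ₂ δ₂ u₂ x₂ η₂ C₂)
    (hp : CellPair x₁ η₁ C₁ ((δ₁ + θ) / (δ₁ + 2 * θ)) (1 / (1 - u₁))
      x₂ η₂ C₂ ((δ₂ + θ) / (δ₂ + 2 * θ)) (1 / (1 - u₂)) n ρ) (hn : 1 < n)
    (hδ : δ₂ ≤ δ₁) (hu : u₁ < u₂) :
    invSize θ δ₂ u₂ x₂ η₂ < ρ ^ 2 * invSize θ δ₁ u₁ x₁ η₁ := by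
  obtain ⟨P, l, hP1, hP, hl1, hl, hs, -⟩ := exists_gain_of_lt hθ hθ₂ h₁ h₂ hp hδ hu
  have hs := hs hn
  have d1 := h₁.δ_pos
  have d2 := h₂.δ_pos
  have M1 := h₁.M_pos hθ
  have M2 := h₂.M_pos hθ
  have hu1 := u_pos_of_one_lt h₁.u_lt hp.one_lt_left
  have hu2 : 0 < u₂ := by linarith
  have hx1 := hp.left.x_pos
  have hη1 := hp.left.η_pos
  have hx2 := hp.right.x_pos
  have hη2 := hp.right.η_pos
  have r1 := h₁.rr_pos hθ
  have k12 : u₂ * (1 - δ₁) ≤ δ₁ + 2 * θ := by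
    have := h₂.k_le
    have : u₂ * (1 - δ₁) ≤ u₂ * (1 - δ₂) := mul_le_mul_of_nonneg_left (by linarith) hu2.le
    linarith
  have leg := mul_rr_sq_le_mul hθ d2 hδ h₁.δ_lt hu2 h₂.u_lt h₂.k_le hP1 hP
  have leg2 := rr_sq_mul_le' hθ d1 h₁.δ_lt hu1 hu.le h₂.u_lt k12
  rw [invSize_eq M1.ne' h₁.u_lt hu1.ne', invSize_eq M2.ne' h₂.u_lt hu2.ne']
  have nu := hp.left.nu_le hp.right hp.ratio hp.le_one hp.one_le
  have t1 := h₁.one_div_pos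
  have t2 : 1 < 1 / (1 - u₂) := by rw [lt_div_iff₀ (by linarith [h₂.u_lt])]; linarith
  have hϑ1 := hp.one_lt_left
  have hψ1 : 0 < (δ₁ + θ) / (δ₁ + 2 * θ) := by linarith [h₁.cell.ψ_ge]
  have hψ2 : 0 < (δ₂ + θ) / (δ₂ + 2 * θ) := by linarith [h₂.cell.ψ_ge]
  have e2 : 1 / (1 - u₂) - 1 = u₂ * (1 / (1 - u₂)) := by
    have : 1 - u₂ ≠ 0 := by linarith [h₂.u_lt]
    field_simp; ring
  set ψ₁ := (δ₁ + θ) / (δ₁ + 2 * θ)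
  set ψ₂ := (δ₂ + θ) / (δ₂ + 2 * θ)
  set ϑ₁ := 1 / (1 - u₁)
  set ϑ₂ := 1 / (1 - u₂)
  set R₁ := rr θ δ₁ u₁ ^ 2 * (δ₁ + 2 * θ) / u₁ with hR₁
  have hR10 : 0 < R₁ := by positivity
  have hW : rr θ δ₂ u₂ ^ 2 * (δ₂ + 2 * θ) / u₂ ≤ (1 + u₂ * (P - 1)) * R₁ := by
    rw [div_le_iff₀ hu2]
    refine leg.trans ?_
    rw [mul_assoc]
    refine mul_le_mul_of_nonneg_left ?_
      (by have := mul_nonneg hu2.le (show 0 ≤ P - 1 by linarith); linarith)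
    rw [hR₁, div_mul_eq_mul_div, le_div_iff₀ hu1]
    have := mul_le_mul_of_nonneg_right leg2 M1.le
    linarith
  have hX2 : 0 < ϑ₂ - 1 := by linarith
  have hX1 : 0 < ϑ₁ - 1 := by linarith
  have hv : ψ₂ * (ϑ₂ - 1) / x₂ ≤ n ^ 2 * (ψ₁ * (ϑ₁ - 1) / x₁) := by
    rw [div_le_iff₀ hx2]
    refine le_of_mul_le_mul_right (a := x₁) ?_ hx1
    have : n ^ 2 * (ψ₁ * (ϑ₁ - 1) / x₁) * x₂ * x₁ = n ^ 2 * (ψ₁ * (ϑ₁ - 1) * x₂) := by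
      generalize ψ₁ * (ϑ₁ - 1) = N
      field_simp
    rw [this]
    exact nu
  have hn0 : 0 < n := by linarith
  have hsq := pow_le_pow_left₀ (by positivity) hl 2
  have hw2 : 0 < (x₂ / η₂) ^ 2 := by positivity
  have hPX : 0 < 1 + (ϑ₂ - 1) * P := by
    have := mul_pos hX2 (show 0 < P by linarith); linarith
  calc x₂ / η₂ ^ 2 * ϑ₂ * (ψ₂ * (ϑ₂ - 1)) * (rr θ δ₂ u₂ ^ 2 * (δ₂ + 2 * θ) / u₂)
      ≤ x₂ / η₂ ^ 2 * ϑ₂ * (ψ₂ * (ϑ₂ - 1)) * ((1 + u₂ * (P - 1)) * R₁) :=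
        mul_le_mul_of_nonneg_left hW (by positivity)
    _ = (x₂ / η₂) ^ 2 * (ψ₂ * (ϑ₂ - 1) / x₂) * (ϑ₂ + u₂ * ϑ₂ * (P - 1)) * R₁ := by
        field_simp
    _ = (x₂ / η₂) ^ 2 * (1 + (ϑ₂ - 1) * P) * R₁ * (ψ₂ * (ϑ₂ - 1) / x₂) := by
        rw [← e2]; ring
    _ ≤ (x₂ / η₂) ^ 2 * (1 + (ϑ₂ - 1) * P) * R₁ * (n ^ 2 * (ψ₁ * (ϑ₁ - 1) / x₁)) :=
        mul_le_mul_of_nonneg_left hv (by positivity)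
    _ = (x₂ / η₂) ^ 2 * R₁ * (n ^ 2 * (ψ₁ * (ϑ₁ - 1) / x₁)) * (1 + (ϑ₂ - 1) * P) := by ring
    _ < (x₂ / η₂) ^ 2 * R₁ * (n ^ 2 * (ψ₁ * (ϑ₁ - 1) / x₁)) * (n ^ 4 * l ^ 2 * ϑ₁) :=
        mul_lt_mul_of_pos_left hs (by positivity)
    _ = (n ^ 3 * l * (x₂ / η₂)) ^ 2 * (ϑ₁ * R₁ * (ψ₁ * (ϑ₁ - 1) / x₁)) := by ring
    _ ≤ (ρ * (x₁ / η₁)) ^ 2 * (ϑ₁ * R₁ * (ψ₁ * (ϑ₁ - 1) / x₁)) :=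
        mul_le_mul_of_nonneg_right hsq (by positivity)
    _ = _ := by field_simp

/-- The comparison of `1 / k + (2 - σ) u`. -/
theorem spread_aux {u₁ u₂ ϑ₁ ϑ₂ k₁ k₂ e₁ e₂ L : ℝ} (hu1 : 0 < u₁) (hu : u₁ < u₂)
    (hu19 : u₁ < 9 / 16) (h₁ : ϑ₁ * (1 - u₁) = 1) (h₂ : ϑ₂ * (1 - u₂) = 1) (hϑ1 : 0 < ϑ₁)
    (hϑ2 : 0 < ϑ₂)
    (hk2 : 1 ≤ k₂) (he : 1 ≤ e₂) (he' : e₂ ≤ 2) (hd : e₁ ≤ e₂)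
    (hk : u₂ * ((1 + (e₂ - e₁)) * k₂) ≤ k₁ * u₁)
    (hL : ϑ₂ + 13 / 200 * (ϑ₂ - ϑ₁) ≤ L * ϑ₁) :
    ϑ₂ * (k₂ + e₂ * u₂) < L * ϑ₁ * (k₁ + e₁ * u₁) := by
  have a1 : k₂ + e₂ * u₁ + (u₂ - u₁) * (k₂ / u₁) ≤ k₁ + e₁ * u₁ := by
    refine le_of_mul_le_mul_right (a := u₁) ?_ hu1
    have b1 : (u₂ - u₁) * (k₂ / u₁) * u₁ = (u₂ - u₁) * k₂ := by field_simp
    have b2 : u₁ * u₁ ≤ u₂ * k₂ := mul_le_mul hu.le (by linarith) hu1.le (by linarith)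
    have b3 := mul_le_mul_of_nonneg_left b2 (show 0 ≤ e₂ - e₁ by linarith)
    linarith
  have hΔ : ϑ₂ - ϑ₁ = ϑ₁ * ϑ₂ * (u₂ - u₁) := by linear_combination ϑ₁ * h₂ - ϑ₂ * h₁
  have hd0 : 0 < u₂ - u₁ := by linarith
  have hk0 : 0 ≤ (u₂ - u₁) * (k₂ / u₁) := by positivity
  have a2 : 1 / u₁ ≤ k₂ / u₁ := div_le_div_of_nonneg_right hk2 hu1.le
  have hf : 0 < 1 / u₁ - e₂ + 13 / 200 * (ϑ₁ * (1 + e₂ * u₁)) := by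
    have c0 : 0 < ϑ₁ * (1 + e₂ * u₁) := by positivity
    rcases le_or_gt u₁ (1 / 2) with hh | hh
    · have : 2 ≤ 1 / u₁ := by rw [le_div_iff₀ hu1]; linarith
      linarith
    · have c1 : 16 / 9 ≤ 1 / u₁ := by rw [le_div_iff₀ hu1]; linarith
      have c2 : 2 ≤ ϑ₁ := by nlinarith
      have c3 : e₂ * (1 / 2) ≤ e₂ * u₁ := mul_le_mul_of_nonneg_left hh.le (by linarith)
      have c4 : 2 * (1 + e₂ * (1 / 2)) ≤ ϑ₁ * (1 + e₂ * u₁) :=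
        mul_le_mul c2 (by linarith) (by linarith) hϑ1.le
      linarith
  have hf2 := mul_pos (mul_pos hϑ2 hd0) hf
  have g0 : 1 + e₂ * u₁ ≤ k₁ + e₁ * u₁ := by linarith
  have g1 : 0 ≤ k₁ + e₁ * u₁ := by
    have : 0 ≤ e₂ * u₁ := by positivity
    linarith
  have g2 := mul_le_mul_of_nonneg_right hL g1
  have g3 := mul_le_mul_of_nonneg_left g0 (show 0 ≤ ϑ₁ * ϑ₂ * (u₂ - u₁) by positivity)
  have g4 := mul_le_mul_of_nonneg_left a1 hϑ2.le
  have g5 := mul_le_mul_of_nonneg_left a2 (mul_pos hϑ2 hd0).le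
  rw [hΔ] at g2
  linarith

/-- Comparison of inventory aversions for `δ₂ ≤ δ₁` and `u₁ < u₂`. -/
theorem invAversionQ_lt_of_spread (hθ : 0 ≤ θ) (hθ₂ : 0 < θ₂) (h₁ : RState θ θ₂ δ₁ u₁ x₁ η₁ C₁)
    (h₂ : RState θ θ₂ δ₂ u₂ x₂ η₂ C₂)
    (hp : CellPair x₁ η₁ C₁ ((δ₁ + θ) / (δ₁ + 2 * θ)) (1 / (1 - u₁))
      x₂ η₂ C₂ ((δ₂ + θ) / (δ₂ + 2 * θ)) (1 / (1 - u₂)) 1 1)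
    (hδ : δ₂ ≤ δ₁) (hu : u₁ < u₂) :
    invAversionQ θ δ₂ u₂ x₂ η₂ < invAversionQ θ δ₁ u₁ x₁ η₁ := by
  obtain ⟨P, l, -, -, hl1, hl, -, hs⟩ := exists_gain_of_lt hθ hθ₂ h₁ h₂ hp hδ hu
  have hs := hs rfl
  rw [one_pow, one_mul, one_mul] at hl
  have d1 := h₁.δ_pos
  have d2 := h₂.δ_pos
  have d1' := h₁.δ_lt
  have d2' := h₂.δ_lt
  have M1 := h₁.M_pos hθ
  have M2 := h₂.M_pos hθ
  have hu1 := u_pos_of_one_lt h₁.u_lt hp.one_lt_left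
  have hu2 : 0 < u₂ := by linarith
  have hx1 := hp.left.x_pos
  have hη1 := hp.left.η_pos
  have hx2 := hp.right.x_pos
  have hη2 := hp.right.η_pos
  have hu916 : u₁ < 9 / 16 := by
    rcases hp.crit with rfl | rfl
    · obtain ⟨-, -, c3, c4⟩ := h₂.crit_u
      by_contra! hge
      nlinarith
    · obtain ⟨-, -, c3, c4⟩ := h₁.crit_u
      by_contra! hge
      nlinarith
  rw [invAversionQ_eq M1 (by linarith) h₁.u_lt hu1.ne' hx1.ne',
    invAversionQ_eq M2 (by linarith) h₂.u_lt hu2.ne' hx2.ne']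
  have nu := hp.left.nu_le hp.right hp.ratio hp.le_one hp.one_le
  rw [one_pow, one_mul] at nu
  have t1 := h₁.one_div_pos
  have t2 := h₂.one_div_pos
  have t2' : 1 < 1 / (1 - u₂) := by rw [lt_div_iff₀ (by linarith [h₂.u_lt])]; linarith
  have e1 : 1 / (1 - u₁) - 1 = u₁ * (1 / (1 - u₁)) := by
    have : 1 - u₁ ≠ 0 := by linarith [h₁.u_lt]
    field_simp; ring
  have e2 : 1 / (1 - u₂) - 1 = u₂ * (1 / (1 - u₂)) := by
    have : 1 - u₂ ≠ 0 := by linarith [h₂.u_lt]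
    field_simp; ring
  have hψ2 : 0 < (δ₂ + θ) / (δ₂ + 2 * θ) := by linarith [h₂.cell.ψ_ge]
  have hk2 : 1 ≤ (δ₂ + 2 * θ) / (u₂ * (1 - δ₂)) := by
    rw [le_div_iff₀ (mul_pos hu2 (by linarith))]; linarith [h₂.k_le]
  have he : 1 ≤ (δ₂ + 4 * θ) / (δ₂ + 2 * θ) := by rw [le_div_iff₀ M2]; linarith
  have he' : (δ₂ + 4 * θ) / (δ₂ + 2 * θ) ≤ 2 := by rw [div_le_iff₀ M2]; linarith
  have hd : (δ₁ + 4 * θ) / (δ₁ + 2 * θ) ≤ (δ₂ + 4 * θ) / (δ₂ + 2 * θ) := by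
    rw [div_le_div_iff₀ M1 M2]
    have := mul_nonneg hθ (sub_nonneg.2 hδ)
    linarith
  have hk : u₂ * ((1 + ((δ₂ + 4 * θ) / (δ₂ + 2 * θ) - (δ₁ + 4 * θ) / (δ₁ + 2 * θ)))
      * ((δ₂ + 2 * θ) / (u₂ * (1 - δ₂)))) ≤ (δ₁ + 2 * θ) / (u₁ * (1 - δ₁)) * u₁ := by
    have f1 : 0 < 1 - δ₁ := by linarith
    have f2 : 0 < 1 - δ₂ := by linarith
    have g1 : (1 + ((δ₂ + 4 * θ) / (δ₂ + 2 * θ) - (δ₁ + 4 * θ) / (δ₁ + 2 * θ))) * (δ₂ + 2 * θ)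
        ≤ δ₁ + 2 * θ := by
      have : (δ₁ + 4 * θ) / (δ₁ + 2 * θ) = 1 + 2 * θ / (δ₁ + 2 * θ) := by field_simp; ring
      rw [this]
      have g2 : (1 + ((δ₂ + 4 * θ) / (δ₂ + 2 * θ) - (1 + 2 * θ / (δ₁ + 2 * θ)))) * (δ₂ + 2 * θ)
          = (δ₂ + 2 * θ) + 2 * θ * (δ₁ - δ₂) / (δ₁ + 2 * θ) := by
        field_simp; ring
      rw [g2]
      have : 2 * θ * (δ₁ - δ₂) / (δ₁ + 2 * θ) ≤ δ₁ - δ₂ := by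
        rw [div_le_iff₀ M1]
        have := mul_nonneg d1.le (sub_nonneg.2 hδ)
        linarith
      linarith
    calc _ = (1 + ((δ₂ + 4 * θ) / (δ₂ + 2 * θ) - (δ₁ + 4 * θ) / (δ₁ + 2 * θ))) * (δ₂ + 2 * θ)
          / (1 - δ₂) := by
          generalize (1 + ((δ₂ + 4 * θ) / (δ₂ + 2 * θ) - (δ₁ + 4 * θ) / (δ₁ + 2 * θ))) = w
          field_simp
      _ ≤ (δ₁ + 2 * θ) / (1 - δ₁) := div_le_div₀ M1.le g1 f1 (by linarith)
      _ = _ := by field_simp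
  have aux := spread_aux hu1 hu hu916
    (by field_simp [show 1 - u₁ ≠ 0 by linarith [h₁.u_lt]])
    (by field_simp [show 1 - u₂ ≠ 0 by linarith [h₂.u_lt]]) t1 t2 hk2 he he' hd hk hs
  set ψ₁ := (δ₁ + θ) / (δ₁ + 2 * θ)
  set ψ₂ := (δ₂ + θ) / (δ₂ + 2 * θ)
  set ϑ₁ := 1 / (1 - u₁)
  set ϑ₂ := 1 / (1 - u₂)
  set k₁ := (δ₁ + 2 * θ) / (u₁ * (1 - δ₁))
  set k₂ := (δ₂ + 2 * θ) / (u₂ * (1 - δ₂))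
  set a₁ := (δ₁ + 4 * θ) / (δ₁ + 2 * θ)
  set a₂ := (δ₂ + 4 * θ) / (δ₂ + 2 * θ)
  have hX2 : 0 < ϑ₂ - 1 := by linarith
  have hv : ψ₂ * (ϑ₂ - 1) / x₂ ≤ ψ₁ * (ϑ₁ - 1) / x₁ := by
    rw [div_le_div_iff₀ hx2 hx1]; linarith
  have hv0 : 0 < ψ₂ * (ϑ₂ - 1) / x₂ := by positivity
  set v₁ := ψ₁ * (ϑ₁ - 1) / x₁
  set v₂ := ψ₂ * (ϑ₂ - 1) / x₂
  rw [e1, e2]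
  have hsq := pow_le_pow_left₀ (by positivity) hl 2
  have hw2 : 0 < (x₂ / η₂) ^ 2 := by positivity
  have hpos : 0 ≤ ϑ₂ * (k₂ + a₂ * u₂) := by positivity
  have hpos1 : 0 ≤ l ^ 2 * (ϑ₁ * (k₁ + a₁ * u₁)) := by linarith
  have hl2 : 1 ≤ l ^ 2 := one_le_pow₀ hl1
  have hpos2 : 0 ≤ ϑ₁ * (k₁ + a₁ * u₁) := nonneg_of_mul_nonneg_right hpos1 (by linarith)
  calc (x₂ / η₂) ^ 2 * (v₂ * (ϑ₂ * k₂ + a₂ * (u₂ * ϑ₂)) + 1)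
      = (x₂ / η₂) ^ 2 * (v₂ * (ϑ₂ * (k₂ + a₂ * u₂)) + 1) := by ring
    _ < (x₂ / η₂) ^ 2 * (v₂ * (l ^ 2 * ϑ₁ * (k₁ + a₁ * u₁)) + 1) := by
        refine mul_lt_mul_of_pos_left ?_ hw2
        have := mul_lt_mul_of_pos_left aux hv0
        linarith
    _ ≤ (x₂ / η₂) ^ 2 * (l ^ 2 * (v₁ * (ϑ₁ * (k₁ + a₁ * u₁)) + 1)) := by
        refine mul_le_mul_of_nonneg_left ?_ hw2.le
        have := mul_le_mul_of_nonneg_right hv hpos1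
        linarith
    _ = (l * (x₂ / η₂)) ^ 2 * (v₁ * (ϑ₁ * (k₁ + a₁ * u₁)) + 1) := by ring
    _ ≤ (x₁ / η₁) ^ 2 * (v₁ * (ϑ₁ * (k₁ + a₁ * u₁)) + 1) := by
        refine mul_le_mul_of_nonneg_right hsq ?_
        have := mul_nonneg (hv0.le.trans hv) hpos2
        linarith
    _ = _ := by ring

end Spread

section Main

variable {θ θ₂ δ₁ u₁ x₁ η₁ C₁ δ₂ u₂ x₂ η₂ C₂ : ℝ}

/-- The comparison of `C`. -/
theorem RState.invSize_lt (hθ : 0 ≤ θ) (hθ₂ : 0 < θ₂) (h₁ : RState θ θ₂ δ₁ u₁ x₁ η₁ C₁)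
    (h₂ : RState θ θ₂ δ₂ u₂ x₂ η₂ C₂) (hη₁ : η₁ ≤ 1) (hη₂ : 1 ≤ η₂) (hcr : η₂ = 1 ∨ η₁ = 1)
    (hC : C₁ < C₂) : invSize θ δ₂ u₂ x₂ η₂ * ((2 - C₂) / (C₂ - 1)) ^ 2
      < invSize θ δ₁ u₁ x₁ η₁ * ((2 - C₁) / (C₁ - 1)) ^ 2 := by
  have c1 := h₁.cell.C_gt
  have c2 := h₂.cell.C_lt
  have c3 : 0 < (2 - C₂) * (C₁ - 1) := mul_pos (by linarith) (by linarith)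
  obtain ⟨n, hn⟩ : ∃ n, n = √(C₂ / C₁) := ⟨_, rfl⟩
  have hn0 : 0 ≤ n := by rw [hn]; positivity
  have hn2 : n ^ 2 * C₁ = C₂ := by
    rw [hn, Real.sq_sqrt (div_nonneg (by linarith) (by linarith))]
    field_simp [show C₁ ≠ 0 by linarith]
  have hn1 : 1 < n := by
    by_contra! hle
    have : n ^ 2 * C₁ ≤ 1 * C₁ :=
      mul_le_mul_of_nonneg_right (pow_le_one₀ hn0 hle) (by linarith)
    linarith
  obtain ⟨ρ, hρ⟩ : ∃ ρ, ρ = (2 - C₁) * (C₂ - 1) / ((2 - C₂) * (C₁ - 1)) := ⟨_, rfl⟩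
  have hR : Ratio C₁ C₂ n ρ := Ratio.of_le c1 hC.le c2 hn0 hn2 (by
    rw [hρ, div_mul_cancel₀ _ c3.ne'])
  have hp := h₁.pair h₂ hη₁ hη₂ hcr hR (Or.inr hn2)
  have key : invSize θ δ₂ u₂ x₂ η₂ < ρ ^ 2 * invSize θ δ₁ u₁ x₁ η₁ := by
    rcases le_or_gt δ₂ δ₁ with hδ | hδ
    · rcases le_or_gt u₂ u₁ with hu | hu
      · exact invSize_lt_of_le hθ h₁ h₂ hp hn1 hδ hu
      · exact invSize_lt_of_spread hθ hθ₂ h₁ h₂ hp hn1 hδ hu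
    · rcases h₂.pure with hm | hm
      · exact invSize_lt_of_mixed hθ h₁ h₂ hp hδ hm
      · exact invSize_lt_of_pure hθ hθ₂ h₁ h₂ hp hn1 hδ hm
  have c4 : 0 < 2 - C₂ := by linarith
  have c5 : 0 < C₂ - 1 := by linarith
  have c6 : 0 < C₁ - 1 := by linarith
  have := mul_lt_mul_of_pos_right key (show 0 < ((2 - C₂) / (C₂ - 1)) ^ 2 by positivity)
  refine this.trans_eq ?_
  rw [hρ]
  field_simp

/-- The comparison of inventory aversions. -/
theorem RState.invAversion_le (hθ : 0 ≤ θ) (hθ₂ : 0 < θ₂) (h₁ : RState θ θ₂ δ₁ u₁ x₁ η₁ C₁)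
    (h₂ : RState θ θ₂ δ₂ u₂ x₂ η₂ C₂) (hη₁ : η₁ ≤ 1) (hη₂ : 1 ≤ η₂) (hcr : η₂ = 1 ∨ η₁ = 1)
    (hC : C₂ ≤ C₁) (hs : invSize θ δ₂ u₂ x₂ η₂ ≤ invSize θ δ₁ u₁ x₁ η₁) :
    invAversion θ θ₂ δ₂ u₂ x₂ η₂ ≤ invAversion θ θ₂ δ₁ u₁ x₁ η₁ ∧
      (η₁ < η₂ → invAversion θ θ₂ δ₂ u₂ x₂ η₂ < invAversion θ θ₂ δ₁ u₁ x₁ η₁) := by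
  have hR := Ratio.of_ge h₂.cell.C_gt hC
  have hp := h₁.pair h₂ hη₁ hη₂ hcr hR (Or.inl rfl)
  have d1 := h₁.δ_pos
  have d2 := h₂.δ_pos
  have e1 := invAversion_eq (θ₂ := θ₂) (x := x₁) (η := η₁) (show δ₁ + θ ≠ 0 by linarith) h₁.u_lt
  have e2 := invAversion_eq (θ₂ := θ₂) (x := x₂) (η := η₂) (show δ₂ + θ ≠ 0 by linarith) h₂.u_lt
  have hs' := mul_le_mul_of_nonneg_left hs (show 0 ≤ 4 * θ₂ by positivity)
  have lt_of : invAversionQ θ δ₂ u₂ x₂ η₂ < invAversionQ θ δ₁ u₁ x₁ η₁ →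
      invAversion θ θ₂ δ₂ u₂ x₂ η₂ ≤ invAversion θ θ₂ δ₁ u₁ x₁ η₁ ∧
      (η₁ < η₂ → invAversion θ θ₂ δ₂ u₂ x₂ η₂ < invAversion θ θ₂ δ₁ u₁ x₁ η₁) := fun h => by
    rw [e1, e2]
    exact ⟨by linarith, fun _ => by linarith⟩
  rcases le_or_gt δ₂ δ₁ with hδ | hδ
  · rcases le_or_gt u₂ u₁ with hu | hu
    · rcases le_or_gt u₂ 0 with hu0 | hu0
      · rcases hcr with rfl | rfl
        · linarith [h₂.crit_u.1]
        · exact lt_of (invAversionQ_lt_of_nonpos hθ h₁ h₂ hη₂ hδ hu0)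
      · obtain ⟨a, b⟩ := invAversionQ_le_of_nonneg hθ h₁ h₂ hp hδ hu hu0.le
        rw [e1, e2]
        exact ⟨by linarith, fun hη => by linarith [b hη]⟩
    · exact lt_of (invAversionQ_lt_of_spread hθ hθ₂ h₁ h₂ hp hδ hu)
  · rcases h₂.pure with hm | hm
    · exact lt_of (invAversionQ_lt_of_mixed hθ h₁ h₂ hp hδ hm)
    · have : invAversion θ θ₂ δ₂ u₂ x₂ η₂ < invAversion θ θ₂ δ₁ u₁ x₁ η₁ := by
        refine invAversion_lt_of_weight hθ h₁ h₂ hδ hm ?_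
        rcases lt_or_ge u₁ u₂ with hu | hu
        · exact weight_lt_of_lt hθ hθ₂ h₁ h₂ hp hδ hu hm
        · exact weight_lt_of_ge hθ hθ₂ h₁ h₂ hp hδ hu hm
      exact ⟨this.le, fun _ => this⟩

/-- States with the same market sizes are ordered by their inventory aversions. -/
theorem RState.invAversion_mono (hθ : 0 ≤ θ) (hθ₂ : 0 < θ₂) (h₁ : RState θ θ₂ δ₁ u₁ x₁ η₁ C₁)
    (h₂ : RState θ θ₂ δ₂ u₂ x₂ η₂ C₂) (hη₁ : η₁ ≤ 1) (hη₂ : 1 ≤ η₂) (hcr : η₂ = 1 ∨ η₁ = 1)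
    (hs : invSize θ δ₂ u₂ x₂ η₂ * ((2 - C₂) / (C₂ - 1)) ^ 2
      = invSize θ δ₁ u₁ x₁ η₁ * ((2 - C₁) / (C₁ - 1)) ^ 2) :
    invAversion θ θ₂ δ₂ u₂ x₂ η₂ ≤ invAversion θ θ₂ δ₁ u₁ x₁ η₁ ∧
      (η₁ < η₂ → invAversion θ θ₂ δ₂ u₂ x₂ η₂ < invAversion θ θ₂ δ₁ u₁ x₁ η₁) := by
  have hC : C₂ ≤ C₁ := by
    by_contra! hC
    exact (h₁.invSize_lt hθ hθ₂ h₂ hη₁ hη₂ hcr hC).ne hs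
  refine h₁.invAversion_le hθ hθ₂ h₂ hη₁ hη₂ hcr hC ?_
  have c1 := h₁.cell.C_lt
  have c2 := h₂.cell.C_gt
  have g1 : 0 < (2 - C₁) / (C₁ - 1) := div_pos (by linarith) (by linarith)
  have g : (2 - C₁) / (C₁ - 1) ≤ (2 - C₂) / (C₂ - 1) := by
    rw [div_le_div_iff₀ (by linarith) (by linarith)]
    linarith
  have g2 := pow_le_pow_left₀ g1.le g 2
  have hx1 := h₁.cell.x_pos
  have hη1 := h₁.cell.η_pos
  have r1 := h₁.rr_pos hθ
  have d1 := h₁.δ_pos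
  have t1 := h₁.one_div_pos
  have i1 : 0 ≤ invSize θ δ₁ u₁ x₁ η₁ := by unfold invSize; positivity
  refine le_of_mul_le_mul_right (a := ((2 - C₂) / (C₂ - 1)) ^ 2) ?_
    (pow_pos (g1.trans_le g) 2)
  rw [hs]
  exact mul_le_mul_of_nonneg_left g2 i1

end Main

end AnticipatoryTrading

open Set Filter Topology
namespace AnticipatoryTrading

theorem continuousOn_of_sign {F : ℝ → ℝ → ℝ} {s : Set ℝ} {d : ℝ → ℝ} {a b : ℝ}
    (hd : ∀ x ∈ s, d x ∈ Ioo a b)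
    (hF : ∀ c ∈ Ioo a b, ContinuousOn (fun x => F x c) s)
    (hneg : ∀ x ∈ s, ∀ c ∈ Ioo a b, c < d x → F x c < 0)
    (hpos : ∀ x ∈ s, ∀ c ∈ Ioo a b, d x < c → 0 < F x c) : ContinuousOn d s := by
  intro x hx
  refine tendsto_order.2 ⟨fun l hl => ?_, fun l hl => ?_⟩
  · obtain ⟨c, hc, hc'⟩ := exists_between (max_lt hl (hd x hx).1)
    have hcI : c ∈ Ioo a b := ⟨(le_max_right _ _).trans_lt hc, hc'.trans (hd x hx).2⟩
    have := (hF c hcI x hx).eventually (gt_mem_nhds (hneg x hx c hcI hc'))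
    filter_upwards [this, self_mem_nhdsWithin] with y hy hys
    by_contra! h
    exact (hpos y hys c hcI (h.trans_lt ((le_max_left _ _).trans_lt hc))).not_gt hy
  · obtain ⟨c, hc, hc'⟩ := exists_between (lt_min hl (hd x hx).2)
    have hcI : c ∈ Ioo a b := ⟨(hd x hx).1.trans hc, hc'.trans_le (min_le_right _ _)⟩
    have := (hF c hcI x hx).eventually (lt_mem_nhds (hpos x hx c hcI hc))
    filter_upwards [this, self_mem_nhdsWithin] with y hy hys
    by_contra! h
    exact (hneg y hys c hcI ((hc'.trans_le (min_le_left _ _)).trans_le h)).not_gt hy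

theorem vB_anti {θ u x δ₀ δ₁ : ℝ} (hθ : 0 ≤ θ) (hδ : 0 < δ₀) (h : δ₀ ≤ δ₁) (hx : 0 ≤ x) :
    vB (2 * θ / (δ₁ + 2 * θ)) (δ₁ / (δ₁ + θ)) u x
      ≤ vB (2 * θ / (δ₀ + 2 * θ)) (δ₀ / (δ₀ + θ)) u x := by
  have hδ₁ := hδ.trans_le h
  have a0 : 0 ≤ 2 * θ / (δ₁ + 2 * θ) := by positivity
  have a1 : 2 * θ / (δ₁ + 2 * θ) ≤ 2 * θ / (δ₀ + 2 * θ) :=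
    div_le_div_of_nonneg_left (by linarith) (by linarith) (by linarith)
  have e1 : δ₀ / (δ₀ + θ) ≤ δ₁ / (δ₁ + θ) := by
    rw [div_le_div_iff₀ (by linarith) (by linarith)]
    have := mul_le_mul_of_nonneg_right h hθ
    linarith
  have a2 := mul_le_mul_of_nonneg_right (pow_le_pow_left₀ a0 a1 2) (sq_nonneg u)
  have e2 := mul_le_mul_of_nonneg_right e1 (show 0 ≤ x * (1 - u) ^ 2 by positivity)
  unfold vB
  linarith

/-- The volatility condition, in a form that extends to `δ = 1 / 2`. -/
noncomputable def volGap (θ θ₂ δ u x : ℝ) : ℝ :=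
  4 * (δ * ((δ + 2 * θ + u * (1 - δ)) * (δ + 2 * θ - u * δ) * (1 - δ)
    / (2 * (δ + 2 * θ) ^ 2)) ^ 2) * θ₂
    - (1 - 2 * δ) ^ 2 * vB (2 * θ / (δ + 2 * θ)) (δ / (δ + θ)) u x

theorem volGap_eq {θ θ₂ δ u x : ℝ} (hδ : δ < 1 / 2) :
    volGap θ θ₂ δ u x = (1 - 2 * δ) ^ 2 * (4 * (δ * rr θ δ u ^ 2) * θ₂
      - vB (2 * θ / (δ + 2 * θ)) (δ / (δ + θ)) u x) := by
  have h : 1 - 2 * δ ≠ 0 := by linarith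
  have : (δ + 2 * θ + u * (1 - δ)) * (δ + 2 * θ - u * δ) * (1 - δ) / (2 * (δ + 2 * θ) ^ 2)
      = rr θ δ u * (1 - 2 * δ) := by
    rw [rr, div_mul_eq_mul_div, mul_div_mul_right _ _ h]
  rw [volGap, this]
  ring

theorem exists_slope {θ θ₂ u x : ℝ} (hθ : 0 ≤ θ) (hθ₂ : 0 < θ₂) (hu0 : 0 < u) (hu : u < 1)
    (hx : 0 ≤ x) :
    ∃ d ∈ Ioo (0 : ℝ) (1 / 2), 0 ≤ volGap θ θ₂ d u x ∧ 0 ≤ d + 2 * θ - u * (1 - d) ∧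
      (volGap θ θ₂ d u x = 0 ∨ d + 2 * θ - u * (1 - d) = 0) ∧
      (∀ c ∈ Ioo (0 : ℝ) (1 / 2), c < d →
        min (volGap θ θ₂ c u x) (c + 2 * θ - u * (1 - c)) < 0) ∧
      ∀ c ∈ Ioo (0 : ℝ) (1 / 2), d < c →
        0 < min (volGap θ θ₂ c u x) (c + 2 * θ - u * (1 - c)) := by
  set F : ℝ → ℝ := fun c => min (volGap θ θ₂ c u x) (c + 2 * θ - u * (1 - c)) with hF
  have hm : ∀ c₀ c₁, 0 < c₀ → c₀ < c₁ → c₁ < 1 / 2 → u * (1 - c₀) ≤ c₀ + 2 * θ →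
      (0 ≤ volGap θ θ₂ c₀ u x → 0 < volGap θ θ₂ c₁ u x) := by
    intro c₀ c₁ h0 h h1 hk
    rw [volGap_eq (h.trans h1), volGap_eq h1]
    have p0 : 0 < (1 - 2 * c₀) ^ 2 := by have : 0 < 1 - 2 * c₀ := by linarith
                                         positivity
    have p1 : 0 < (1 - 2 * c₁) ^ 2 := by have : 0 < 1 - 2 * c₁ := by linarith
                                         positivity
    intro hh
    refine mul_pos p1 ?_
    have hh := nonneg_of_mul_nonneg_right hh p0
    have l := mul_rr_sq_mul_lt hθ h0 h h1 hu0 hu hk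
    have l' : c₀ * rr θ c₀ u ^ 2 < c₁ * rr θ c₁ u ^ 2 := by
      refine lt_of_mul_lt_mul_right (a := 1 - c₁) (lt_of_le_of_lt ?_ l) (by linarith)
      exact mul_le_mul_of_nonneg_left (by linarith) (by positivity)
    have l2 := mul_lt_mul_of_pos_right l' (show 0 < 4 * θ₂ by positivity)
    have := vB_anti (u := u) hθ h0 h.le hx
    linarith
  set L := max ((u - 2 * θ) / (1 + u)) 0 with hL
  have hLu : L < 1 / 2 := by
    refine max_lt ?_ (by norm_num)
    rw [div_lt_iff₀ (by linarith)]
    linarith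
  have hpos : ∀ c ∈ Icc L (1 / 2), 0 < c + 2 * θ := by
    intro c hc
    have h1 := (le_max_left _ _).trans hc.1
    have h2 := (le_max_right _ _).trans hc.1
    rw [div_le_iff₀ (by linarith)] at h1
    rcases hθ.eq_or_lt with h | h
    · subst h
      have : 0 < c * (1 + u) := by linarith
      have := pos_of_mul_pos_left this (by linarith)
      linarith
    · linarith
  have hpos' : ∀ c ∈ Icc L (1 / 2), 0 < c + θ := by
    intro c hc
    have := hpos c hc
    have h2 := (le_max_right _ _).trans hc.1
    linarith
  have hcont : ContinuousOn F (Icc L (1 / 2)) := by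
    have h1 : ∀ c ∈ Icc L (1 / 2), c + 2 * θ ≠ 0 := fun c hc => (hpos c hc).ne'
    have h2 : ∀ c ∈ Icc L (1 / 2), c + θ ≠ 0 := fun c hc => (hpos' c hc).ne'
    have h3 : ∀ c ∈ Icc L (1 / 2), 2 * (c + 2 * θ) ^ 2 ≠ 0 := fun c hc => by
      have := h1 c hc; positivity
    refine ContinuousOn.inf ?_ (by fun_prop)
    unfold volGap vB
    fun_prop (disch := assumption)
  have hFL : F L ≤ 0 := by
    rcases le_total ((u - 2 * θ) / (1 + u)) 0 with h | h
    · have hθ' : 0 < θ := by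
        rw [div_le_iff₀ (by linarith)] at h
        linarith
      have : L = 0 := max_eq_right h
      rw [this]
      refine (min_le_left _ _).trans ?_
      have : 2 * θ ≠ 0 := by positivity
      simp [volGap, vB, this]
    · have hL' : L = (u - 2 * θ) / (1 + u) := max_eq_left h
      have : L * (1 + u) = u - 2 * θ := by
        rw [hL', div_mul_cancel₀]; linarith
      exact (min_le_right _ _).trans (by linarith)
  have hF1 : 0 < F (1 / 2) := by
    have h1 : 0 < 1 / 2 + 2 * θ - u * (1 / 2) := by linarith
    have h2 : 0 < 1 / 2 + 2 * θ := by linarith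
    refine lt_min ?_ (by linarith)
    have : volGap θ θ₂ (1 / 2) u x = 4 * (1 / 2 * ((1 / 2 + 2 * θ + u * (1 - 1 / 2)) *
        (1 / 2 + 2 * θ - u * (1 / 2)) * (1 - 1 / 2) / (2 * (1 / 2 + 2 * θ) ^ 2)) ^ 2) * θ₂ := by
      unfold volGap; ring
    rw [this]
    have : (0 : ℝ) < 1 - 1 / 2 := by norm_num
    positivity
  obtain ⟨d, hd, hd0⟩ := intermediate_value_Icc hLu.le hcont ⟨hFL, hF1.le⟩
  have hd1 : d < 1 / 2 := lt_of_le_of_ne hd.2 (by rintro rfl; exact hF1.ne' hd0)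
  have hdpos : 0 < d := by
    refine lt_of_le_of_ne ((le_max_right _ _).trans hd.1) ?_
    rintro rfl
    have h := hpos 0 hd
    have hθ' : θ ≠ 0 := by intro h'; simp [h'] at h
    have : volGap θ θ₂ 0 u x < 0 := by simp [volGap, vB, hθ']
    have h4 : F 0 < 0 := (min_le_left _ _).trans_lt this
    exact h4.ne hd0
  have v0 : 0 ≤ volGap θ θ₂ d u x := hd0.symm.le.trans (min_le_left _ _)
  have k0 : 0 ≤ d + 2 * θ - u * (1 - d) := hd0.symm.le.trans (min_le_right _ _)
  refine ⟨d, ⟨hdpos, hd1⟩, v0, k0, ?_, ?_, ?_⟩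
  · rcases min_choice (volGap θ θ₂ d u x) (d + 2 * θ - u * (1 - d)) with h | h
    · exact Or.inl (h.symm.trans hd0)
    · exact Or.inr (h.symm.trans hd0)
  · intro c hc hcd
    by_contra! hh
    have a1 := (le_min_iff.1 hh).1
    have a2 := (le_min_iff.1 hh).2
    have b1 := hm c d hc.1 hcd hd1 (by linarith) a1
    have b2 : 0 < d + 2 * θ - u * (1 - d) := by
      have := mul_lt_mul_of_pos_left hcd hu0
      linarith
    exact (lt_min b1 b2).ne' hd0
  · intro c hc hcd
    refine lt_min (hm d c hdpos hcd hc.2 (by linarith) v0) ?_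
    have := mul_lt_mul_of_pos_left hcd hu0
    linarith

/-- Every market has a state in which the HFT does not trade in the last round. -/
theorem exists_critical {θ θ₂ Ξ : ℝ} (hθ : 0 ≤ θ) (hθ₂ : 0 < θ₂) (hΞ : 0 < Ξ) :
    ∃ δ u x C, RState θ θ₂ δ u x 1 C ∧
      invSize θ δ u x 1 * (2 * (2 - C) / (C - 1)) ^ 2 = Ξ := by
  set U : ℝ → ℝ := fun x => (3 * x - 1) / (1 + x) with hU
  have hu : ∀ x ∈ Icc (2 / 5 : ℝ) (13 / 20), 0 < U x ∧ U x < 1 := by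
    intro x hx
    refine ⟨div_pos (by linarith [hx.1]) (by linarith [hx.1]), ?_⟩
    rw [hU, div_lt_one (by linarith [hx.1])]
    linarith [hx.2]
  have hUc : ContinuousOn U (Icc (2 / 5 : ℝ) (13 / 20)) := by
    have : ∀ x ∈ Icc (2 / 5 : ℝ) (13 / 20), 1 + x ≠ 0 := fun x hx => by linarith [hx.1]
    fun_prop (disch := assumption)
  have hex : ∀ x : ℝ, ∃ d : ℝ, x ∈ Icc (2 / 5 : ℝ) (13 / 20) → d ∈ Ioo (0 : ℝ) (1 / 2) ∧
      0 ≤ volGap θ θ₂ d (U x) x ∧ 0 ≤ d + 2 * θ - U x * (1 - d) ∧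
      (volGap θ θ₂ d (U x) x = 0 ∨ d + 2 * θ - U x * (1 - d) = 0) ∧
      (∀ c ∈ Ioo (0 : ℝ) (1 / 2), c < d →
        min (volGap θ θ₂ c (U x) x) (c + 2 * θ - U x * (1 - c)) < 0) ∧
      ∀ c ∈ Ioo (0 : ℝ) (1 / 2), d < c →
        0 < min (volGap θ θ₂ c (U x) x) (c + 2 * θ - U x * (1 - c)) := by
    intro x
    by_cases hx : x ∈ Icc (2 / 5 : ℝ) (13 / 20)
    · obtain ⟨d, h1, h2⟩ := exists_slope hθ hθ₂ (hu x hx).1 (hu x hx).2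
        (show 0 ≤ x by linarith [hx.1])
      exact ⟨d, fun _ => ⟨h1, h2⟩⟩
    · exact ⟨0, fun h => absurd h hx⟩
  choose d hd using hex
  have hdc : ContinuousOn d (Icc (2 / 5 : ℝ) (13 / 20)) := by
    refine continuousOn_of_sign (F := fun x c => min (volGap θ θ₂ c (U x) x)
      (c + 2 * θ - U x * (1 - c))) (fun x hx => (hd x hx).1) ?_
      (fun x hx => (hd x hx).2.2.2.2.1) (fun x hx => (hd x hx).2.2.2.2.2)
    intro c hc
    refine ContinuousOn.inf ?_ (by fun_prop)
    unfold volGap vB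
    fun_prop
  set Cc : ℝ → ℝ := fun x => (d x + θ) / (d x + 2 * θ) * ((3 * x - 1) / (x * (1 - x))) with hCc
  set S : ℝ → ℝ := fun x => invSize θ (d x) (U x) x 1 with hS
  have hSpos : ∀ x ∈ Icc (2 / 5 : ℝ) (13 / 20), 0 < S x := by
    intro x hx
    have h1 := (hd x hx).1
    have h2 := hu x hx
    have h3 : 0 < 1 - U x := by linarith
    have h4 := rr_pos hθ h1.1 h1.2 h2.2 (by have := h1.1; have := mul_pos h2.1 (show 0 < 1 - d x by linarith [h1.2]); linarith)
    have h5 : 0 < x := by linarith [hx.1]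
    have h6 := h1.1
    simp only [hS, invSize]
    positivity
  have hCcc : ContinuousOn Cc (Icc (2 / 5 : ℝ) (13 / 20)) := by
    have h1 : ∀ x ∈ Icc (2 / 5 : ℝ) (13 / 20), d x + 2 * θ ≠ 0 := fun x hx => by
      have := (hd x hx).1.1; positivity
    have h2 : ∀ x ∈ Icc (2 / 5 : ℝ) (13 / 20), x * (1 - x) ≠ 0 := fun x hx =>
      (mul_pos (by linarith [hx.1]) (by linarith [hx.2])).ne'
    fun_prop (disch := assumption)
  have hSc : ContinuousOn S (Icc (2 / 5 : ℝ) (13 / 20)) := by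
    have h1 : ∀ x ∈ Icc (2 / 5 : ℝ) (13 / 20), 2 * (d x + 2 * θ) ^ 2 * (1 - 2 * d x) ≠ 0 :=
      fun x hx => by
        have := (hd x hx).1.1
        have : 0 < 1 - 2 * d x := by linarith [(hd x hx).1.2]
        positivity
    have h2 : ∀ x ∈ Icc (2 / 5 : ℝ) (13 / 20), 1 - U x ≠ 0 := fun x hx => by
      linarith [(hu x hx).2]
    simp only [hS]
    unfold invSize rr
    fun_prop (disch := assumption)
  set J : ℝ → ℝ := fun x => S x * (4 * max (2 - Cc x) 0 ^ 2) - Ξ * max (Cc x - 1) 0 ^ 2 with hJ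
  have hJc : ContinuousOn J (Icc (2 / 5 : ℝ) (13 / 20)) := by
    have h1 : ContinuousOn (fun x => max (2 - Cc x) 0) (Icc (2 / 5 : ℝ) (13 / 20)) :=
      (continuousOn_const.sub hCcc).sup continuousOn_const
    have h2 : ContinuousOn (fun x => max (Cc x - 1) 0) (Icc (2 / 5 : ℝ) (13 / 20)) :=
      (hCcc.sub continuousOn_const).sup continuousOn_const
    fun_prop
  have hψ : ∀ x ∈ Icc (2 / 5 : ℝ) (13 / 20), 1 / 2 ≤ (d x + θ) / (d x + 2 * θ) ∧
      (d x + θ) / (d x + 2 * θ) ≤ 1 := by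
    intro x hx
    have := (hd x hx).1.1
    constructor
    · rw [div_le_div_iff₀ (by norm_num) (by linarith)]; linarith
    · rw [div_le_one (by linarith)]; linarith
  have m0 : (2 / 5 : ℝ) ∈ Icc (2 / 5 : ℝ) (13 / 20) := by constructor <;> norm_num
  have m1 : (13 / 20 : ℝ) ∈ Icc (2 / 5 : ℝ) (13 / 20) := by constructor <;> norm_num
  have hJpos : ∀ x ∈ Icc (2 / 5 : ℝ) (13 / 20), Cc x ≤ 1 → 0 < J x := by
    intro x hx h
    have h1 : 0 < 2 - Cc x := by linarith
    have := hSpos x hx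
    simp only [hJ]
    rw [max_eq_left h1.le, max_eq_right (by linarith)]
    simp only [ne_eq, OfNat.ofNat_ne_zero, not_false_eq_true, zero_pow, mul_zero, sub_zero]
    positivity
  have hJneg : ∀ x ∈ Icc (2 / 5 : ℝ) (13 / 20), 2 ≤ Cc x → J x < 0 := by
    intro x hx h
    have h1 : 0 < Cc x - 1 := by linarith
    simp only [hJ]
    rw [max_eq_right (by linarith), max_eq_left h1.le]
    simp only [ne_eq, OfNat.ofNat_ne_zero, not_false_eq_true, zero_pow, mul_zero, zero_sub]
    have : 0 < Ξ * (Cc x - 1) ^ 2 := by positivity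
    linarith
  have e0 : 0 ≤ J (2 / 5) := by
    refine (hJpos _ m0 ?_).le
    have := (hψ _ m0).2
    simp only [hCc]
    norm_num
    linarith
  have e1 : J (13 / 20) ≤ 0 := by
    refine (hJneg _ m1 ?_).le
    have := (hψ _ m1).1
    simp only [hCc]
    norm_num
    linarith
  obtain ⟨x, hx, hx0⟩ := intermediate_value_Icc' (by norm_num) hJc ⟨e1, e0⟩
  have hC1 : 1 < Cc x := by
    by_contra! h; exact (hJpos x hx h).ne' hx0
  have hC2 : Cc x < 2 := by
    by_contra! h; exact (hJneg x hx h).ne hx0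
  obtain ⟨hdI, hv, hk, hvk, -, -⟩ := hd x hx
  have hx1 := hx.1
  have hx2 := hx.2
  have hU1 : 1 / (1 - U x) = (1 + x) / (2 * (1 - x)) := by
    have h1 : 1 + x ≠ 0 := by linarith
    have h2 : 2 * (1 - x) ≠ 0 := by linarith
    have : 1 - U x = 2 * (1 - x) / (1 + x) := by
      simp only [hU]; field_simp; ring
    rw [this, one_div_div]
  have p2 : 0 < (1 - 2 * d x) ^ 2 := by
    have : 0 < 1 - 2 * d x := by linarith [hdI.2]
    positivity
  rw [volGap_eq hdI.2] at hv hvk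
  refine ⟨d x, U x, x, Cc x, ⟨hdI.1, hdI.2, (hu x hx).2, ⟨by linarith, one_pos, hC1, hC2,
    (hψ x hx).1, (hψ x hx).2, ?_, ?_⟩, ?_, by linarith, ?_, ?_⟩, ?_⟩
  · rw [hU1]
    have h2 : 1 - x ≠ 0 := by linarith
    field_simp
    ring
  · rw [hU1]
    have h2 : 1 - x ≠ 0 := by linarith
    have h3 : x ≠ 0 := by linarith
    simp only [hCc]
    generalize (d x + θ) / (d x + 2 * θ) = p
    field_simp
    ring
  · have := mul_pos (hu x hx).1 (show 0 < 1 - d x by linarith [hdI.2])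
    linarith [hdI.1]
  · linarith [nonneg_of_mul_nonneg_right hv p2]
  · rcases hvk with h | h
    · right
      linarith [(mul_eq_zero.1 h).resolve_left p2.ne']
    · left; linarith
  · have h1 : 0 < Cc x - 1 := by linarith
    simp only [hJ] at hx0
    rw [max_eq_left (by linarith), max_eq_left h1.le] at hx0
    rw [div_pow, mul_div_assoc', div_eq_iff (by positivity)]
    linarith

end AnticipatoryTrading

namespace AnticipatoryTrading

/-- The equilibrium conditions for finite inventory aversion `g`, in units in which the slope of the
first quote and the variance of the first noise order are `1`. -/
structure NormEq (θ θp θ₂ δ r K d₁ d₂ l₁ l₂ g L : ℝ) : Prop where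
  δ_pos : 0 < δ
  δ_lt : δ < 1
  r_pos : 0 < r
  g_nonneg : 0 ≤ g
  L_pos : 0 < L
  quote₁ : l₁ * (d₁ ^ 2 * (δ + θ) + θp) = d₁
  quote₂ : d₁ * (1 - (δ + 2 * θ) * K) * (r + g) = l₂ * (r + 2 * g) * θp
  impact : l₂ * d₁ + r * d₂ = K
  foc₁ : (δ + θ) * (2 * (l₁ + g) * d₁ + (l₂ + 2 * g) * d₂) = 1
  foc₂ : 2 * (δ + θ) * (2 * (r + g) * d₂ + (l₂ + 2 * g) * d₁) = 1 + δ * K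
  soc : (l₂ + 2 * g) ^ 2 < 4 * (l₁ + g) * (r + g)
  volatility : 1 / L = 1 / (1 - δ) + K ^ 2 * (δ + 4 * θ)
    + d₁ ^ 2 / θp * (1 - (δ + 2 * θ) * K) ^ 2 + 4 * r ^ 2 * θ₂
  informed : (K * (1 - δ) = 1 ∧ r = 1 ∧ L ≤ δ * (1 - δ)) ∨
    (L = δ * (1 - δ) ∧
      2 * r * (1 - 2 * δ) = (1 + K * (1 - δ)) * (1 - δ * (1 + K * (1 - δ))) ∧
      (1 + K * (1 - δ)) ^ 2 < 4 * r)

namespace NormEq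

variable {θ θp θ₂ δ r K d₁ d₂ l₁ l₂ g L : ℝ}

/-- The last-round condition after elimination of the second impact. -/
theorem inventory (h : NormEq θ θp θ₂ δ r K d₁ d₂ l₁ l₂ g L) :
    2 * (δ + θ) * (r * d₂ + 2 * g * (d₁ + d₂)) = 1 - (δ + 2 * θ) * K := by
  have h1 := h.foc₂
  have h2 := h.impact
  rw [← h2] at h1 ⊢
  linarith

/-- The first condition after elimination of the inventory aversion. -/
theorem first_order (h : NormEq θ θp θ₂ δ r K d₁ d₂ l₁ l₂ g L) :
    2 * (δ + θ) * ((l₂ - r) * d₂)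
      = 1 + (δ + 2 * θ) * K - 4 * ((δ + θ) * (l₁ * d₁)) := by
  have h1 := h.inventory
  have h2 := h.foc₁
  linarith

theorem l₁_mul_lt (hθ : 0 ≤ θ) (hp : 0 < θp) (h : NormEq θ θp θ₂ δ r K d₁ d₂ l₁ l₂ g L) :
    0 ≤ (δ + θ) * (l₁ * d₁) ∧ (δ + θ) * (l₁ * d₁) < 1 := by
  have hm : 0 < δ + θ := by linarith [h.δ_pos]
  have hD : 0 < d₁ ^ 2 * (δ + θ) + θp := by positivity
  have : (δ + θ) * (l₁ * d₁) = d₁ ^ 2 * (δ + θ) / (d₁ ^ 2 * (δ + θ) + θp) := by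
    rw [eq_div_iff hD.ne']
    linear_combination ((δ + θ) * d₁) * h.quote₁
  rw [this, div_lt_one hD]
  exact ⟨by positivity, by linarith⟩

theorem d₁_pos (hθ : 0 ≤ θ) (hp : 0 < θp) (h : NormEq θ θp θ₂ δ r K d₁ d₂ l₁ l₂ g L) :
    0 < d₁ := by
  by_contra! hd
  have hδ := h.δ_pos
  have hr := h.r_pos
  have hg := h.g_nonneg
  have hm : 0 < δ + θ := by linarith
  have hrg : 0 < r + g := by linarith
  have hD : 0 < d₁ ^ 2 * (δ + θ) + θp := by positivity
  have inv := h.inventory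
  have imp := h.impact
  have fo := h.first_order
  obtain ⟨-, q⟩ := h.l₁_mul_lt hθ hp
  have cr : d₁ * ((δ + θ) * (4 * (l₁ + g) * (r + g) - (l₂ + 2 * g) ^ 2))
      = 2 * (r + g) - (l₂ + 2 * g) * (1 + δ * K) / 2 := by
    linear_combination 2 * (r + g) * h.foc₁ - (l₂ + 2 * g) / 2 * h.foc₂
  have cr0 : 2 * (r + g) - (l₂ + 2 * g) * (1 + δ * K) / 2 ≤ 0 := by
    rw [← cr]
    exact mul_nonpos_of_nonpos_of_nonneg hd
      (mul_pos hm (by linarith [h.soc])).le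
  have hl1 : l₁ ≤ 0 := by
    by_contra! hl
    have := mul_pos hl hD
    linarith [h.quote₁]
  have sq : (l₂ + 2 * g) ^ 2 < (r + 2 * g) ^ 2 := by
    have h1 : l₁ * (r + g) ≤ 0 := mul_nonpos_of_nonpos_of_nonneg hl1 hrg.le
    have h2 := h.soc
    have h3 : 0 < r ^ 2 := by positivity
    linarith
  obtain ⟨s1, s2⟩ := abs_lt.1 (lt_of_pow_lt_pow_left₀ 2 (by linarith) (by rwa [sq_abs]) :
    |l₂ + 2 * g| < r + 2 * g)
  have hMδ : ∀ {k : ℝ}, 0 ≤ k → δ * k ≤ (δ + 2 * θ) * k := fun hk =>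
    mul_le_mul_of_nonneg_right (by linarith) hk
  rcases lt_trichotomy (l₂ + 2 * g) 0 with hP | hP | hP
  · have hj : 1 + δ * K < 0 := by
      by_contra! hj
      have := mul_nonpos_of_nonpos_of_nonneg hP.le hj
      linarith
    have hK : K < 0 := by
      by_contra! hK
      have := mul_nonneg hδ.le hK
      linarith
    have hMK : (δ + 2 * θ) * K < 0 := mul_neg_of_pos_of_neg (by linarith) hK
    have hl2 : l₂ < 0 := by linarith
    have a1 : 0 ≤ l₂ * d₁ := mul_nonneg_of_nonpos_of_nonpos hl2.le hd
    have a2 : r * d₂ < 0 := by linarith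
    have a3 : d₂ < 0 := by
      by_contra! h'
      have := mul_nonneg hr.le h'
      linarith
    have a4 : 2 * g * (d₁ + d₂) ≤ 0 :=
      mul_nonpos_of_nonneg_of_nonpos (by linarith) (by linarith)
    have a5 : 2 * (δ + θ) * (r * d₂ + 2 * g * (d₁ + d₂)) < 0 :=
      mul_neg_of_pos_of_neg (by linarith) (by linarith)
    linarith
  · rw [hP] at cr0
    linarith
  · have hj : 1 < δ * K := by
      by_contra! hj
      have a1 := mul_le_mul_of_nonneg_left (show 1 + δ * K ≤ 2 by linarith) hP.le
      linarith
    have hK : 0 < K := pos_of_mul_pos_right (by linarith) hδ.le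
    have hMK := hMδ hK.le
    have hT : 1 - (δ + 2 * θ) * K < 0 := by linarith
    have hl2 : 0 ≤ l₂ := by
      have h1 : 0 ≤ l₂ * ((r + 2 * g) * θp) := by
        rw [← mul_assoc, ← h.quote₂]
        exact mul_nonneg (mul_nonneg_of_nonpos_of_nonpos hd hT.le) hrg.le
      exact nonneg_of_mul_nonneg_left h1 (by positivity)
    have hl2r : l₂ < r := by linarith
    have a1 : l₂ * d₁ ≤ 0 := mul_nonpos_of_nonneg_of_nonpos hl2 hd
    have hd2 : 0 < d₂ := pos_of_mul_pos_right (show 0 < r * d₂ by linarith) hr.le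
    have a2 : r * d₂ + 2 * g * (d₁ + d₂) < 0 := by
      by_contra! h'
      have := mul_nonneg (show 0 ≤ 2 * (δ + θ) by linarith) h'
      linarith
    have a3 : d₁ + d₂ < 0 := by
      by_contra! h'
      have := mul_nonneg (show 0 ≤ 2 * g by linarith) h'
      have := mul_pos hr hd2
      linarith
    have a4 : l₂ * (d₁ + d₂) ≤ 0 := mul_nonpos_of_nonneg_of_nonpos hl2 a3.le
    have a5 : K ≤ (r - l₂) * d₂ := by linarith
    have a6 := mul_le_mul_of_nonneg_left a5 (show 0 ≤ 2 * (δ + θ) by linarith)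
    linarith

theorem T_pos (hθ : 0 ≤ θ) (hp : 0 < θp) (h : NormEq θ θp θ₂ δ r K d₁ d₂ l₁ l₂ g L) :
    0 < 1 - (δ + 2 * θ) * K := by
  by_contra! hT
  have hd := h.d₁_pos hθ hp
  have hδ := h.δ_pos
  have hr := h.r_pos
  have hg := h.g_nonneg
  have hK : 0 < K := pos_of_mul_pos_right (show 0 < (δ + 2 * θ) * K by linarith) (by linarith)
  have hl2 : l₂ ≤ 0 := by
    by_contra! hl
    have h1 : 0 < l₂ * (r + 2 * g) * θp := by positivity
    rw [← h.quote₂] at h1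
    have := mul_nonpos_of_nonpos_of_nonneg (mul_nonpos_of_nonneg_of_nonpos hd.le hT)
      (show 0 ≤ r + g by linarith)
    linarith
  have a1 := mul_nonpos_of_nonpos_of_nonneg hl2 hd.le
  have hd2 : 0 < d₂ := pos_of_mul_pos_right (show 0 < r * d₂ by linarith [h.impact]) hr.le
  have : 0 < 2 * (δ + θ) * (r * d₂ + 2 * g * (d₁ + d₂)) := by positivity
  linarith [h.inventory]

theorem j_bounds (hθ : 0 ≤ θ) (hp : 0 < θp) (h : NormEq θ θp θ₂ δ r K d₁ d₂ l₁ l₂ g L) :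
    -1 < δ * K ∧ δ * K < 1 := by
  have hd := h.d₁_pos hθ hp
  have hT := h.T_pos hθ hp
  have hδ := h.δ_pos
  have hr := h.r_pos
  have hg := h.g_nonneg
  have hm : 0 < δ + θ := by linarith
  rcases lt_or_ge 0 K with hK | hK
  · have := mul_pos hδ hK
    have := mul_le_mul_of_nonneg_right (show δ ≤ δ + 2 * θ by linarith) hK.le
    constructor <;> linarith
  · have a0 := mul_nonpos_of_nonneg_of_nonpos hδ.le hK
    refine ⟨?_, by linarith⟩
    have hl2 : 0 < l₂ := by
      have h1 : 0 < l₂ * ((r + 2 * g) * θp) := by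
        rw [← mul_assoc, ← h.quote₂]
        exact mul_pos (mul_pos hd hT) (by linarith)
      exact pos_of_mul_pos_left h1 (by positivity)
    have a1 := mul_pos hl2 hd
    have a2 : r * d₂ < 0 := by linarith [h.impact]
    have hd2 : d₂ < 0 := by
      by_contra! h'
      have := mul_nonneg hr.le h'
      linarith
    have a3 : 0 < r * d₂ + 2 * g * (d₁ + d₂) :=
      pos_of_mul_pos_right (by rw [h.inventory]; exact hT) (show 0 ≤ 2 * (δ + θ) by linarith)
    have a4 : 0 < d₁ + d₂ := by
      by_contra! h'
      have := mul_nonpos_of_nonneg_of_nonpos (show 0 ≤ 2 * g by linarith) h'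
      linarith
    have a5 := mul_pos hl2 a4
    have a6 : 0 < (l₂ - r) * d₂ := by linarith [h.impact]
    have a7 : 0 < 2 * (δ + θ) * ((l₂ - r) * d₂) := by positivity
    have a8 := (h.l₁_mul_lt hθ hp).1
    have a9 := mul_le_mul_of_nonpos_right (show δ ≤ δ + 2 * θ by linarith) hK
    linarith [h.first_order]

/-- The consequences of the optimality of the first informed order. -/
theorem informed_bounds (hθ : 0 ≤ θ) (hp : 0 < θp) (h : NormEq θ θp θ₂ δ r K d₁ d₂ l₁ l₂ g L) :
    δ < 1 / 2 ∧ 0 < 1 + K * (1 - δ) ∧ K * (1 - δ) ≤ 1 ∧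
      2 * r * (1 - 2 * δ) = (1 + K * (1 - δ)) * (1 - δ * (1 + K * (1 - δ))) := by
  have hδ := h.δ_pos
  have hδ1 := h.δ_lt
  have hr := h.r_pos
  obtain ⟨j0, j1⟩ := h.j_bounds hθ hp
  rcases h.informed with ⟨hk, rfl, -⟩ | ⟨-, hr', hs⟩
  · have hK : 0 < K := pos_of_mul_pos_left (by linarith) (show 0 ≤ 1 - δ by linarith)
    refine ⟨?_, by linarith, hk.le, by rw [hk]; ring⟩
    have : δ * K < K * (1 - δ) := by linarith
    have := lt_of_mul_lt_mul_right (show δ * K < (1 - δ) * K by linarith) hK.le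
    linarith
  · have e : 1 - δ * (1 + K * (1 - δ)) = (1 - δ) * (1 - δ * K) := by ring
    have p : 0 < (1 - δ) * (1 - δ * K) := mul_pos (by linarith) (by linarith)
    have hδ2 : δ < 1 / 2 := by
      by_contra! h'
      have a1 : 2 * r * (1 - 2 * δ) ≤ 0 :=
        mul_nonpos_of_nonneg_of_nonpos (by linarith) (by linarith)
      rw [hr', e] at a1
      have a2 : 1 + K * (1 - δ) ≤ 0 := by
        by_contra! h''
        linarith [mul_pos h'' p]
      have a3 := mul_le_mul_of_nonneg_left a2 hδ.le
      have a4 := mul_lt_mul_of_pos_right j0 (show 0 < 1 - δ by linarith)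
      linarith
    have hk : 0 < 1 + K * (1 - δ) := by
      have : 0 < 2 * r * (1 - 2 * δ) := mul_pos (by linarith) (by linarith)
      rw [hr', e] at this
      exact pos_of_mul_pos_left this p.le
    refine ⟨hδ2, hk, ?_, hr'⟩
    have a1 := mul_lt_mul_of_pos_right hs (show 0 < 1 - 2 * δ by linarith)
    have a2 : (1 + K * (1 - δ)) * ((1 + K * (1 - δ)) * (1 - 2 * δ))
        < (1 + K * (1 - δ)) * (2 * (1 - δ * (1 + K * (1 - δ)))) := by linarith
    have a3 := lt_of_mul_lt_mul_left a2 hk.le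
    linarith

theorem small_of_g_eq_zero (hθ : 0 ≤ θ) (hp : 0 < θp)
    (h : NormEq θ θp θ₂ δ r K d₁ d₂ l₁ l₂ 0 L) : 0 < d₂ := by
  have h1 := h.inventory
  have h2 := h.T_pos hθ hp
  have hδ := h.δ_pos
  rw [← h1] at h2
  have h3 : 0 < 2 * (δ + θ) * r * d₂ := by linarith
  exact pos_of_mul_pos_right h3 (by have := h.r_pos; positivity)

/-- An equilibrium with positive inventory aversion determines a state. -/
theorem exists_state (hθ : 0 ≤ θ) (hp : 0 < θp) (hg : 0 < g)
    (h : NormEq θ θp θ₂ δ r K d₁ d₂ l₁ l₂ g L) :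
    ∃ u x η C, RState θ θ₂ δ u x η C ∧
      invSize θ δ u x η * (2 * (2 - C) / (C - 1)) ^ 2 = 1 / θp ∧
      invAversion θ θ₂ δ u x η = 1 / (16 * θp * (g ^ 2 * L)) ∧
      (η < 1 ↔ 0 < d₂) ∧ (1 < η ↔ d₂ < 0) := by
  have hd := h.d₁_pos hθ hp
  have hT := h.T_pos hθ hp
  have hδ := h.δ_pos
  have hr := h.r_pos
  have hL := h.L_pos
  obtain ⟨hδ2, hk0, hk1, hreq⟩ := h.informed_bounds hθ hp
  have hm : 0 < δ + θ := by linarith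
  have hM : 0 < δ + 2 * θ := by linarith
  have hrg : 0 < r + 2 * g := by linarith
  have hvol := h.volatility
  have hq2 := h.quote₂
  have himp := h.impact
  have hinv := h.inventory
  have hfo := h.first_order
  have hq1 := h.quote₁
  have h2δ : 0 < 1 - 2 * δ := by linarith
  have h1δ : 0 < 1 - δ := by linarith
  obtain ⟨T, hTe⟩ : ∃ T, T = 1 - (δ + 2 * θ) * K := ⟨_, rfl⟩
  rw [← hTe] at hT hvol hq2 hinv
  have hu : 1 - (1 - T) = T := by ring
  have hKe : K = (1 - T) / (δ + 2 * θ) := by rw [eq_div_iff hM.ne']; linarith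
  have hrr : rr θ δ (1 - T) = r := by
    have e1 : δ + 2 * θ + (1 - T) * (1 - δ) = (δ + 2 * θ) * (1 + K * (1 - δ)) := by
      rw [hTe]; ring
    have e2 : (δ + 2 * θ - (1 - T) * δ) * (1 - δ)
        = (δ + 2 * θ) * (1 - δ * (1 + K * (1 - δ))) := by
      rw [hTe]; ring
    rw [rr, mul_assoc (δ + 2 * θ + _), e1, e2, div_eq_iff (by positivity)]
    linear_combination (-(δ + 2 * θ) ^ 2) * hreq
  have hd2 : d₂ * (r + 2 * g) * (2 * (δ + θ)) = T - 4 * g * (δ + θ) * d₁ := by linarith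
  have hη : 0 < 4 * g * (δ + θ) * d₁ / T := by positivity
  have hl₂ : l₂ = d₁ * T * (r + g) / ((r + 2 * g) * θp) := by
    rw [eq_div_iff (by positivity)]; linarith
  have hl₁ : l₁ = d₁ / (d₁ ^ 2 * (δ + θ) + θp) := by
    rw [eq_div_iff (by positivity)]; linarith
  have hd₂ : d₂ = (T - 4 * g * (δ + θ) * d₁) / ((r + 2 * g) * (2 * (δ + θ))) := by
    rw [eq_div_iff (by positivity)]; linarith
  have hV : 1 / L - 1 / (1 - δ) = (1 - vB (2 * θ / (δ + 2 * θ)) (δ / (δ + θ)) (1 - T)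
      (d₁ ^ 2 * (δ + θ) / θp) + 4 * (δ * r ^ 2) * θ₂) / δ := by
    rw [hvol, hKe]
    unfold vB
    field_simp
    ring
  have hk1' : (1 - T) * (1 - δ) ≤ δ + 2 * θ := by
    have := mul_le_mul_of_nonneg_left hk1 hM.le
    rw [hTe]; linarith
  refine ⟨1 - T, d₁ ^ 2 * (δ + θ) / θp, 4 * g * (δ + θ) * d₁ / T, 2 * (r + g) / (r + 2 * g),
    ⟨hδ, hδ2, by linarith, ⟨by positivity, hη, ?_, ?_, ?_, ?_, ?_, ?_⟩, ?_, hk1', ?_, ?_⟩,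
    ?_, ?_, ?_, ?_⟩
  · rw [lt_div_iff₀ hrg]; linarith
  · rw [div_lt_iff₀ hrg]; linarith
  · rw [div_le_div_iff₀ (by norm_num) hM]; linarith
  · rw [div_le_one hM]; linarith
  · rw [hu]
    have e : 2 * (δ + θ) * ((l₂ - r) * d₂) = 2 - T - 4 * ((δ + θ) * (l₁ * d₁)) := by
      rw [hfo, hTe]; ring
    rw [hl₂, hd₂, hl₁] at e
    have hxp : 0 < d₁ ^ 2 * (δ + θ) + θp := by positivity
    field_simp at e ⊢
    linear_combination (-4 * g) * e
  · rw [hu]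
    have e : l₂ * d₁ + r * d₂ = (1 - T) / (δ + 2 * θ) := by rw [himp, hKe]
    rw [hl₂, hd₂] at e
    field_simp at e ⊢
    linear_combination (-1) * e
  · have := mul_pos hM hk0
    rw [hTe]; linarith
  · rw [hrr]
    have : 1 / δ ≤ 1 / L - 1 / (1 - δ) := by
      have e : 1 / (δ * (1 - δ)) - 1 / (1 - δ) = 1 / δ := by field_simp
      have : L ≤ δ * (1 - δ) := by
        rcases h.informed with ⟨-, -, h'⟩ | ⟨h', -⟩
        · exact h'
        · exact h'.le
      have := one_div_le_one_div_of_le hL this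
      linarith
    rw [hV, div_le_div_iff_of_pos_right hδ] at this
    linarith
  · rcases h.informed with ⟨hk, -, -⟩ | ⟨h', -⟩
    · left
      have : (δ + 2 * θ) * (K * (1 - δ)) = δ + 2 * θ := by rw [hk, mul_one]
      rw [hTe]; linarith
    · right
      have e : 1 / (δ * (1 - δ)) - 1 / (1 - δ) = 1 / δ := by field_simp
      rw [← h', hV, div_left_inj' hδ.ne'] at e
      rw [hrr]
      linarith
  · have e1 : 2 - 2 * (r + g) / (r + 2 * g) = 2 * g / (r + 2 * g) := by field_simp; ring
    have e2 : 2 * (r + g) / (r + 2 * g) - 1 = r / (r + 2 * g) := by field_simp; ring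
    rw [invSize, hrr, hu, e1, e2]
    field_simp
    ring
  · have e : 1 / (1 - δ) + ((1 - T) / (δ + 2 * θ)) ^ 2 * (δ + 4 * θ)
        + d₁ ^ 2 * (δ + θ) / θp * (1 - (1 - T)) ^ 2 / (δ + θ) + 4 * r ^ 2 * θ₂ = 1 / L := by
      rw [hvol, hKe, hu]
      field_simp
    rw [invAversion, hrr, e, hu]
    field_simp
    ring
  · rw [div_lt_one hT]
    constructor
    · intro h'
      have : 0 < d₂ * (r + 2 * g) * (2 * (δ + θ)) := by linarith
      exact pos_of_mul_pos_left (pos_of_mul_pos_left this (by positivity)) hrg.le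
    · intro h'
      have : 0 < d₂ * (r + 2 * g) * (2 * (δ + θ)) := by positivity
      linarith
  · rw [one_lt_div hT]
    constructor
    · intro h'
      by_contra! h''
      have : 0 ≤ d₂ * (r + 2 * g) * (2 * (δ + θ)) := by positivity
      linarith
    · intro h'
      have : d₂ * ((r + 2 * g) * (2 * (δ + θ))) < 0 :=
        mul_neg_of_neg_of_pos h' (by positivity)
      linarith

end NormEq

/-- An HFT who has to close her position trades first in the direction of the informed trader. -/
theorem pos_of_closing {θ θp δ r K d l₁ l₂ : ℝ} (hθ : 0 ≤ θ) (hp : 0 < θp) (hδ : 0 < δ)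
    (quote₁ : l₁ * (d ^ 2 * (δ + θ) + θp) = d) (impact : (l₂ - r) * d = K)
    (foc : 4 * (δ + θ) * ((l₁ + r - l₂) * d) = 1 - δ * K) (soc : 0 < l₁ + r - l₂) : 0 < d := by
  by_contra! hd
  have hm : 0 < δ + θ := by linarith
  have a1 := mul_nonpos_of_nonneg_of_nonpos soc.le hd
  have a2 : 4 * (δ + θ) * ((l₁ + r - l₂) * d) ≤ 0 :=
    mul_nonpos_of_nonneg_of_nonpos (by linarith) a1
  have hj : 1 ≤ δ * K := by linarith
  have hK : 0 < K := pos_of_mul_pos_right (by linarith) hδ.le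
  have hD : 0 < d ^ 2 * (δ + θ) + θp := by positivity
  have q : (δ + θ) * (l₁ * d) < 1 := by
    have : (δ + θ) * (l₁ * d) = d ^ 2 * (δ + θ) / (d ^ 2 * (δ + θ) + θp) := by
      rw [eq_div_iff hD.ne']
      linear_combination ((δ + θ) * d) * quote₁
    rw [this, div_lt_one hD]
    linarith
  have := mul_nonneg hθ hK.le
  have e : (δ + θ) * ((l₁ + r - l₂) * d) = (δ + θ) * (l₁ * d) - (δ + θ) * K := by
    rw [← impact]; ring
  linarith

end AnticipatoryTrading

open MeasureTheory ProbabilityTheory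
open scoped ENNReal NNReal
namespace AnticipatoryTrading

section Forms

variable {Ω : Type*} [MeasurableSpace Ω] {P : Measure Ω}

/-- The primitive random variables as a family. -/
def Shocks.family (S : Shocks Ω) : Fin 6 → Ω → ℝ := ![S.v, S.u1, S.u1p, S.u2, S.ε, S.z]

/-- The means of the primitive random variables. -/
def Market.mean (M : Market) : Fin 6 → ℝ := ![M.p0, 0, 0, 0, 0, 0]

/-- The standard deviations of the primitive random variables. -/
def Market.sd (M : Market) (σz : ℝ) : Fin 6 → ℝ := ![M.σv, M.σ1, M.σ1p, M.σ2, M.σε, σz]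

/-- An affine form in the centred primitive random variables. -/
def form (M : Market) (S : Shocks Ω) (a : Fin 6 → ℝ) (c : ℝ) : Ω → ℝ :=
  fun ω => ∑ i, a i * (S.family i ω - M.mean i) + c

variable {M : Market} {S : Shocks Ω} {σz : ℝ}

namespace Shocks.IsModel

theorem measurable (h : S.IsModel M σz P) (i : Fin 6) : Measurable (S.family i) := by
  fin_cases i
  exacts [h.measurable_v, h.measurable_u1, h.measurable_u1p, h.measurable_u2, h.measurable_ε,
    h.measurable_z]

theorem law (h : S.IsModel M σz P) (i : Fin 6) :
    P.map (S.family i) = gaussianReal (M.mean i) (M.sd σz i ^ 2).toNNReal := by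
  fin_cases i
  exacts [h.law_v, h.law_u1, h.law_u1p, h.law_u2, h.law_ε, h.law_z]

theorem integral_sub (h : S.IsModel M σz P) (i : Fin 6) :
    ∫ ω, (S.family i ω - M.mean i) ∂P = 0 := by
  have hi : Integrable (fun x : ℝ => x) (gaussianReal (M.mean i) (M.sd σz i ^ 2).toNNReal) :=
    (memLp_id_gaussianReal 1).integrable (by norm_num)
  rw [← integral_map (f := fun x => x - M.mean i) (h.measurable i).aemeasurable (by fun_prop),
    h.law i, MeasureTheory.integral_sub hi (integrable_const _)]
  simp

variable [IsProbabilityMeasure P]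

theorem memLp_sub (h : S.IsModel M σz P) (i : Fin 6) :
    MemLp (fun ω => S.family i ω - M.mean i) 2 P := by
  have h1 : MemLp id 2 (P.map (S.family i)) := by
    rw [h.law i]; exact memLp_id_gaussianReal 2
  exact ((memLp_map_measure_iff h1.aestronglyMeasurable (h.measurable i).aemeasurable).1 h1).sub
    (memLp_const _)

theorem integral_sub_mul_sub (h : S.IsModel M σz P) (i j : Fin 6) :
    ∫ ω, (S.family i ω - M.mean i) * (S.family j ω - M.mean j) ∂P
      = if i = j then M.sd σz i ^ 2 else 0 := by
  split_ifs with hij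
  · subst hij
    have := variance_id_gaussianReal (μ := M.mean i) (v := (M.sd σz i ^ 2).toNNReal)
    rw [variance_eq_integral aemeasurable_id] at this
    simp only [id_eq, integral_id_gaussianReal] at this
    rw [← integral_map (f := fun x => (x - M.mean i) * (x - M.mean i))
      (h.measurable i).aemeasurable (by fun_prop), h.law i]
    simp only [← pow_two]
    rw [this, Real.coe_toNNReal _ (sq_nonneg _)]
  · have hi : IndepFun (S.family i) (S.family j) P := h.indep.indepFun hij
    have := (hi.comp (φ := fun x => x - M.mean i) (ψ := fun x => x - M.mean j) (by fun_prop)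
      (by fun_prop)).integral_fun_mul_eq_mul_integral
      (h.memLp_sub i).aestronglyMeasurable (h.memLp_sub j).aestronglyMeasurable
    exact this.trans (by simp only [Function.comp_apply]; rw [h.integral_sub i, zero_mul])

theorem memLp_form (h : S.IsModel M σz P) (a : Fin 6 → ℝ) (c : ℝ) :
    MemLp (form M S a c) 2 P :=
  (memLp_finsetSum _ fun i _ => (h.memLp_sub i).const_mul (a i)).add (memLp_const c)

theorem integral_form_mul (h : S.IsModel M σz P) (a b : Fin 6 → ℝ) (c d : ℝ) :
    ∫ ω, form M S a c ω * form M S b d ω ∂P = ∑ i, a i * b i * M.sd σz i ^ 2 + c * d := by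
  have hi : ∀ i, Integrable (fun ω => S.family i ω - M.mean i) P := fun i =>
    (h.memLp_sub i).integrable (by norm_num)
  have hij : ∀ i j, Integrable (fun ω => a i * b j *
      ((S.family i ω - M.mean i) * (S.family j ω - M.mean j))) P := fun i j =>
    ((h.memLp_sub i).integrable_mul (h.memLp_sub j)).const_mul _
  have e : ∀ ω, form M S a c ω * form M S b d ω
      = ∑ i, ∑ j, a i * b j * ((S.family i ω - M.mean i) * (S.family j ω - M.mean j))
        + (∑ i, (d * a i + c * b i) * (S.family i ω - M.mean i) + c * d) := by
    intro ω
    unfold form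
    rw [add_mul, mul_add, mul_add, Finset.sum_mul_sum, Finset.sum_mul, Finset.mul_sum,
      ← add_assoc, ← add_assoc, add_assoc (∑ i, ∑ j, _), ← Finset.sum_add_distrib]
    refine congrArg₂ _ (congrArg₂ _ ?_ ?_) rfl
    · exact Finset.sum_congr rfl fun i _ => Finset.sum_congr rfl fun j _ => by ring
    · exact Finset.sum_congr rfl fun i _ => by ring
  simp only [e]
  have h1 : Integrable (fun ω => ∑ i, (d * a i + c * b i) * (S.family i ω - M.mean i)) P :=
    integrable_finsetSum _ fun i _ => (hi i).const_mul _
  have h2 : Integrable (fun ω => ∑ i, ∑ j, a i * b j *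
      ((S.family i ω - M.mean i) * (S.family j ω - M.mean j))) P :=
    integrable_finsetSum _ fun i _ => integrable_finsetSum _ fun j _ => hij i j
  have h3 : Integrable (fun ω => ∑ i, (d * a i + c * b i) * (S.family i ω - M.mean i) + c * d) P :=
    h1.add (integrable_const _)
  rw [integral_add h2 h3, integral_add h1 (integrable_const _),
    integral_finsetSum _ fun i _ => integrable_finsetSum _ fun j _ => hij i j,
    integral_finsetSum _ fun i _ => (hi i).const_mul _]
  simp only [integral_finsetSum _ fun j _ => hij _ j, integral_const_mul,
    h.integral_sub_mul_sub, h.integral_sub]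
  simp

end Shocks.IsModel

/-- Coefficients with respect to two forms in `v`, `u1`, `z`, the shocks `ε`, `u1p`, `u2`, and
`1`. -/
structure Vec where
  a : ℝ
  b : ℝ
  c : ℝ
  d : ℝ
  e : ℝ
  k : ℝ

/-- The affine form with the given coefficients. -/
def Vec.form (A : Vec) (M : Market) (S : Shocks Ω) (d f : Fin 3 → ℝ) : Ω → ℝ :=
  AnticipatoryTrading.form M S ![A.a * d 0 + A.b * f 0, A.a * d 1 + A.b * f 1, A.d, A.e, A.c,
    A.a * d 2 + A.b * f 2] A.k

/-- Covariance of two forms in `v`, `u1`, `z`. -/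
def Market.cov (M : Market) (σz : ℝ) (d f : Fin 3 → ℝ) : ℝ :=
  d 0 * f 0 * M.σv ^ 2 + d 1 * f 1 * M.σ1 ^ 2 + d 2 * f 2 * σz ^ 2

/-- Second moments. -/
def Vec.dot (A B : Vec) (M : Market) (σz : ℝ) (d f : Fin 3 → ℝ) : ℝ :=
  A.a * B.a * M.cov σz d d + (A.a * B.b + A.b * B.a) * M.cov σz d f + A.b * B.b * M.cov σz f f
    + A.c * B.c * M.σε ^ 2 + A.d * B.d * M.σ1p ^ 2 + A.e * B.e * M.σ2 ^ 2 + A.k * B.k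

variable [IsProbabilityMeasure P]

theorem Shocks.IsModel.integral_mul (h : S.IsModel M σz P) (A B : Vec) (d f : Fin 3 → ℝ) :
    ∫ ω, A.form M S d f ω * B.form M S d f ω ∂P = A.dot B M σz d f := by
  unfold Vec.form
  rw [h.integral_form_mul]
  simp [Fin.sum_univ_six, Vec.dot, Market.cov, Market.sd]
  ring

theorem Shocks.IsModel.integral_payoff (h : S.IsModel M σz P) (d f : Fin 3 → ℝ) {F : Ω → ℝ}
    (A B C D E : Vec) (γ : ℝ)
    (hF : ∀ ω, F ω = A.form M S d f ω * B.form M S d f ω + C.form M S d f ω * D.form M S d f ω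
      - γ * (E.form M S d f ω * E.form M S d f ω)) :
    ∫ ω, F ω ∂P = A.dot B M σz d f + C.dot D M σz d f - γ * E.dot E M σz d f := by
  have hi : ∀ A B : Vec, Integrable (fun ω => A.form M S d f ω * B.form M S d f ω) P :=
    fun A B => (h.memLp_form _ _).integrable_mul (h.memLp_form _ _)
  simp only [hF]
  have h1 : Integrable (fun ω => A.form M S d f ω * B.form M S d f ω
      + C.form M S d f ω * D.form M S d f ω) P := (hi A B).add (hi C D)
  rw [MeasureTheory.integral_sub h1 ((hi E E).const_mul γ), integral_add (hi A B) (hi C D),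
    integral_const_mul, h.integral_mul, h.integral_mul, h.integral_mul]

end Forms

section Optimality

variable {Ω : Type*} {m : MeasurableSpace Ω} [MeasurableSpace Ω] {P : Measure Ω}
  [IsProbabilityMeasure P] {feasible : (Ω → ℝ) → Prop} {payoff : (Ω → ℝ) → Ω → ℝ} {a : Ω → ℝ}

theorem IsArgmax.integral_le (h : IsArgmax m P feasible payoff a) (hm : m ≤ ‹MeasurableSpace Ω›)
    {b : Ω → ℝ} (hb : Admissible m P b) (hf : feasible b) :
    ∫ ω, payoff b ω ∂P ≤ ∫ ω, payoff a ω ∂P ∧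
      (∫ ω, payoff b ω ∂P = ∫ ω, payoff a ω ∂P → b =ᵐ[P] a) := by
  obtain ⟨h1, h2⟩ := h.2.2 b hb hf
  rw [← integral_condExp hm (f := payoff b), ← integral_condExp hm (f := payoff a)]
  exact ⟨integral_mono_ae integrable_condExp integrable_condExp h1, fun h' =>
    h2 ((integral_eq_iff_of_ae_le integrable_condExp integrable_condExp h1).1 h')⟩

/-- First and second order conditions for a perturbation of an optimal order. -/
theorem IsArgmax.first_order (h : IsArgmax m P feasible payoff a) (hm : m ≤ ‹MeasurableSpace Ω›)
    {φ : Ω → ℝ} (hφ : Admissible m P φ) (hf : ∀ t : ℝ, feasible fun ω => a ω + t * φ ω)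
    {I : ℝ → ℝ} (hI : ∀ t, ∫ ω, payoff (fun ω => a ω + t * φ ω) ω ∂P = I t) {B C : ℝ}
    (hq : ∀ t, I t = I 0 + B * t + C * t ^ 2) :
    B = 0 ∧ (∫ ω, φ ω * φ ω ∂P ≠ 0 → C < 0) := by
  have ha : (fun ω => a ω + 0 * φ ω) = a := by funext ω; ring
  have key : ∀ t : ℝ, B * t + C * t ^ 2 ≤ 0 ∧
      (B * t + C * t ^ 2 = 0 → (fun ω => a ω + t * φ ω) =ᵐ[P] a) := by
    intro t
    have := h.integral_le hm (b := fun ω => a ω + t * φ ω)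
      ⟨h.1.1.add (hφ.1.const_mul t), h.1.2.add (hφ.2.const_mul t)⟩ (hf t)
    have h0 := hI 0
    rw [ha] at h0
    rw [hI, h0, hq t] at this
    exact ⟨by linarith [this.1], fun h' => this.2 (by linarith)⟩
  have hB : B = 0 := by
    by_contra hB
    have hs : 0 < 1 / (|C| + 1) := by positivity
    have h1 := (key (B * (1 / (|C| + 1)))).1
    have h2 : 0 < 1 + C * (1 / (|C| + 1)) := by
      have e : 1 + C * (1 / (|C| + 1)) = (|C| + 1 + C) / (|C| + 1) := by field_simp
      rw [e]
      exact div_pos (by linarith [neg_abs_le C]) (by positivity)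
    have h3 : 0 < B ^ 2 * (1 / (|C| + 1)) * (1 + C * (1 / (|C| + 1))) := by positivity
    linarith
  refine ⟨hB, fun hne => ?_⟩
  obtain ⟨h1, h2⟩ := key 1
  refine lt_of_le_of_ne (by linarith) fun hC => hne ?_
  have h3 := h2 (by rw [hB, hC]; ring)
  have : ∀ᵐ ω ∂P, φ ω * φ ω = 0 := by
    filter_upwards [h3] with ω hω
    have : φ ω = 0 := by linarith
    rw [this, mul_zero]
  rw [integral_congr_ae this, integral_zero]

/-- Residuals of conditional expectations are orthogonal to the information. -/
theorem integral_sub_mul_of_condExp (hm : m ≤ ‹MeasurableSpace Ω›) {f g φ : Ω → ℝ}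
    (h : f =ᵐ[P] P[g | m]) (hφ : Measurable[m] φ) (hφ2 : MemLp φ 2 P) (hf : MemLp f 2 P)
    (hg : MemLp g 2 P) : ∫ ω, (g ω - f ω) * φ ω ∂P = 0 := by
  have i1 : Integrable (g * φ) P := hg.integrable_mul hφ2
  have i2 : Integrable (f * φ) P := hf.integrable_mul hφ2
  have h1 := condExp_mul_of_stronglyMeasurable_right hφ.stronglyMeasurable i1
    (hg.integrable (by norm_num))
  have h2 : f * φ =ᵐ[P] P[g * φ | m] := (h.mul (Filter.EventuallyEq.refl _ φ)).trans h1.symm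
  have h3 := integral_congr_ae h2
  rw [integral_condExp hm] at h3
  have e : ∀ ω, (g ω - f ω) * φ ω = (g * φ) ω - (f * φ) ω := fun ω => by
    simp only [Pi.mul_apply]; ring
  simp only [e]
  rw [integral_sub i1 i2, h3, sub_self]

end Optimality

end AnticipatoryTrading

open MeasureTheory ProbabilityTheory
open scoped ENNReal NNReal
namespace AnticipatoryTrading

section Extraction

variable {Ω : Type*} [MeasurableSpace Ω] {P : Measure Ω} [IsProbabilityMeasure P] {M : Market}
  {S : Shocks Ω} {c : Coeffs}

omit [MeasurableSpace Ω] in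
theorem Vec.form_apply (A : Vec) (d f : Fin 3 → ℝ) (ω : Ω) :
    A.form M S d f ω = A.a * (d 0 * (S.v ω - M.p0) + d 1 * S.u1 ω + d 2 * S.z ω)
      + A.b * (f 0 * (S.v ω - M.p0) + f 1 * S.u1 ω + f 2 * S.z ω)
      + A.c * S.ε ω + A.d * S.u1p ω + A.e * S.u2 ω + A.k := by
  simp [Vec.form, AnticipatoryTrading.form, Fin.sum_univ_six, Shocks.family, Market.mean]
  ring

namespace Coeffs

/-- The residual of the value given the first order flow. -/
def valueResidual (c : Coeffs) : Fin 3 → ℝ := ![1 - c.l1 * c.α1, -c.l1, -c.l1]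

/-- The residual of the first informed order given the first order flow. -/
def orderResidual (c : Coeffs) : Fin 3 → ℝ := ![(1 - c.δ) * c.α1, -c.δ, 1 - c.δ]

/-- The impact of the HFT on the last quote. -/
def impact (c : Coeffs) : ℝ := c.l21 * c.direction1 + c.l22 * c.direction2

end Coeffs

theorem Shocks.IsModel.admissible {E : Type*} [MeasurableSpace E] {X : Ω → E} {σz : ℝ}
    (hS : S.IsModel M σz P) {g : E → ℝ} (hg : Measurable g) {A : Vec} {d f : Fin 3 → ℝ}
    (h : ∀ ω, A.form M S d f ω = g (X ω)) : Admissible (info X) P (A.form M S d f) := by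
  refine ⟨?_, hS.memLp_form _ _⟩
  rw [show A.form M S d f = g ∘ X from funext h]
  exact hg.comp (comap_measurable X)

theorem it2_conditions (hS : S.IsModel M c.σz P) (h : ITOptimal2 (c.profile M) S P) :
    0 < c.l22 ∧ 2 * c.l22 * c.α21 = 1 ∧ 2 * c.l22 * c.α22 = -c.impact := by
  have hv := hS.measurable_v
  have hu := hS.measurable_u1
  have key : ∀ x φ₀ φ₁ : ℝ,
      M.σv ^ 2 * (φ₀ * (1 - c.l1 * x - c.impact * x * (1 - c.δ)
        - 2 * c.l22 * (c.α21 * (1 - c.l1 * x) + c.α22 * (x * (1 - c.δ)))))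
      + M.σ1 ^ 2 * (φ₁ * (-c.l1 + c.impact * c.δ + 2 * c.l22 * (c.α21 * c.l1 + c.α22 * c.δ))) = 0 ∧
      (M.σv ^ 2 * φ₀ ^ 2 + M.σ1 ^ 2 * φ₁ ^ 2 ≠ 0 →
        -c.l22 * (M.σv ^ 2 * φ₀ ^ 2 + M.σ1 ^ 2 * φ₁ ^ 2) < 0) := by
    intro x φ₀ φ₁
    have e0 : (fun ω => x * (S.v ω - M.p0))
        = (⟨x, 0, 0, 0, 0, 0⟩ : Vec).form M S ![1, 0, 0] ![0, 1, 0] := by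
      funext ω; simp [Vec.form_apply]
    have ha := h (fun ω => x * (S.v ω - M.p0)) (by
      rw [e0]
      exact hS.admissible (g := fun p => x * (p.1 - M.p0)) (by fun_prop) fun ω => by
        simp [Vec.form_apply])
    have hφ := ha.first_order
      (φ := (⟨φ₀, φ₁, 0, 0, 0, 0⟩ : Vec).form M S ![1, 0, 0] ![0, 1, 0])
      (Measurable.comap_le (by simp only [flow1, Profile.ordersIT]; fun_prop))
      (hS.admissible (g := fun p => φ₀ * (p.1 - M.p0) + φ₁ * (p.2.2 - p.2.1)) (by fun_prop)
        fun ω => by simp [Vec.form_apply, flow1, Profile.ordersIT])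
      (fun _ => trivial)
      (fun t => hS.integral_payoff ![1, 0, 0] ![0, 1, 0]
        ⟨1 - c.l1 * x - c.impact * x * (1 - c.δ)
            - c.l22 * (c.α21 * (1 - c.l1 * x) + c.α22 * (x * (1 - c.δ)) + t * φ₀),
          -c.l1 + c.impact * c.δ - c.l22 * (-(c.α21 * c.l1 + c.α22 * c.δ) + t * φ₁), -c.impact,
          -(c.l21 + c.l22 * c.β22), -c.l22, 0⟩
        ⟨c.α21 * (1 - c.l1 * x) + c.α22 * (x * (1 - c.δ)) + t * φ₀,
          -(c.α21 * c.l1 + c.α22 * c.δ) + t * φ₁, 0, 0, 0, 0⟩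
        ⟨0, 0, 0, 0, 0, 0⟩ ⟨0, 0, 0, 0, 0, 0⟩ ⟨0, 0, 0, 0, 0, 0⟩ 0 fun ω => by
          simp only [itProfit2, price2, flow1, flow1p, flow2, Profile.ordersIT, Coeffs.profile,
            Coeffs.impact, Coeffs.direction1, Coeffs.direction2, Vec.form_apply,
            Matrix.cons_val]
          ring)
      (B := M.σv ^ 2 * (φ₀ * (1 - c.l1 * x - c.impact * x * (1 - c.δ)
        - 2 * c.l22 * (c.α21 * (1 - c.l1 * x) + c.α22 * (x * (1 - c.δ)))))
      + M.σ1 ^ 2 * (φ₁ * (-c.l1 + c.impact * c.δ + 2 * c.l22 * (c.α21 * c.l1 + c.α22 * c.δ))))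
      (C := -c.l22 * (M.σv ^ 2 * φ₀ ^ 2 + M.σ1 ^ 2 * φ₁ ^ 2)) (by
        intro t
        simp only [Vec.dot, Market.cov, Matrix.cons_val]
        ring)
    refine ⟨hφ.1, fun hne => hφ.2 ?_⟩
    rw [hS.integral_mul]
    simp only [Vec.dot, Market.cov, Matrix.cons_val]
    intro h0
    exact hne (by linarith)
  have hV : M.σv ^ 2 ≠ 0 := pow_ne_zero _ M.σv_pos.ne'
  have hs : M.σ1 ^ 2 ≠ 0 := pow_ne_zero _ M.σ1_pos.ne'
  have k1 := (key 0 1 0).1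
  have k2 := (key 1 1 0).1
  have k3 := (key 0 0 1).1
  simp only [one_mul, zero_mul, mul_zero, add_zero, zero_add, mul_one, sub_zero, mul_eq_zero, hV,
    hs, false_or] at k1 k2 k3
  have k4 : 0 < c.l22 := by
    have := (key 0 1 0).2 (by simpa using M.σv_pos.ne')
    have hp : 0 < M.σv ^ 2 := pow_pos M.σv_pos 2
    by_contra! h'
    have := mul_nonneg_of_nonpos_of_nonpos h' (show -M.σv ^ 2 ≤ 0 by linarith)
    linarith
  exact ⟨k4, by linarith, by linear_combination k3 + k1 - k2⟩

end Extraction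

end AnticipatoryTrading

open MeasureTheory ProbabilityTheory
open scoped ENNReal NNReal
namespace AnticipatoryTrading

section Conditions

variable {Ω : Type*} [MeasurableSpace Ω] {P : Measure Ω} {M : Market} {S : Shocks Ω} {c : Coeffs}

theorem measurable_path_flow1 (hS : S.IsModel M c.σz P) :
    Measurable (flow1 S ((c.profile M).path S)) := by
  have hv := hS.measurable_v
  have hu := hS.measurable_u1
  have hz := hS.measurable_z
  unfold flow1
  simp only [Profile.path, Profile.ordersIT, Coeffs.profile]
  fun_prop

theorem measurable_path_signal (hS : S.IsModel M c.σz P) :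
    Measurable (signal S ((c.profile M).path S)) := by
  have hv := hS.measurable_v
  have he := hS.measurable_ε
  have hz := hS.measurable_z
  unfold signal
  simp only [Profile.path, Profile.ordersIT, Coeffs.profile]
  fun_prop

variable [IsProbabilityMeasure P]

/-- The conditions for efficient quotes and for the slope of the expected informed order. -/
theorem quote_conditions (hS : S.IsModel M c.σz P)
    (hδ : (fun ω => c.δ * flow1 S ((c.profile M).path S) ω) =ᵐ[P]
      P[((c.profile M).path S).i1 | info (flow1 S ((c.profile M).path S))])
    (h : EfficientQuotes (c.profile M) S P) :
    (1 - c.l1 * c.α1) * c.α1 * M.σv ^ 2 = c.l1 * (M.σ1 ^ 2 + c.σz ^ 2) ∧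
    (1 - c.δ) * (c.α1 ^ 2 * M.σv ^ 2 + c.σz ^ 2) = c.δ * M.σ1 ^ 2 ∧
    (⟨1, -(c.l1p * c.β1), -(c.l1p * c.β1), -c.l1p, 0, 0⟩ : Vec).dot ⟨0, c.β1, c.β1, 1, 0, 0⟩
      M c.σz c.valueResidual c.orderResidual = 0 ∧
    (⟨1 - c.l22 * c.α21, -(c.l22 * c.α22) - c.impact, -c.impact, -(c.l21 + c.l22 * c.β22),
      -c.l22, 0⟩ : Vec).dot ⟨0, c.β1, c.β1, 1, 0, 0⟩
      M c.σz c.valueResidual c.orderResidual = 0 ∧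
    (⟨1 - c.l22 * c.α21, -(c.l22 * c.α22) - c.impact, -c.impact, -(c.l21 + c.l22 * c.β22),
      -c.l22, 0⟩ : Vec).dot ⟨c.α21, c.α22 + c.direction2, c.direction2, c.β22, 1, 0⟩
      M c.σz c.valueResidual c.orderResidual = 0 := by
  have m1 := measurable_path_flow1 hS
  have m1p : Measurable (flow1p S ((c.profile M).path S)) := by
    have hs := measurable_path_signal hS
    have hp := hS.measurable_u1p
    have : flow1p S ((c.profile M).path S) = fun ω => c.β1 * (signal S ((c.profile M).path S) ω
      - c.δ * flow1 S ((c.profile M).path S) ω) + S.u1p ω := rfl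
    rw [this]
    fun_prop
  have m2 : Measurable (flow2 S ((c.profile M).path S)) := by
    have hv := hS.measurable_v
    have hu := hS.measurable_u1
    have hp := hS.measurable_u1p
    have hu2 := hS.measurable_u2
    have he := hS.measurable_ε
    have hz := hS.measurable_z
    unfold flow2
    simp only [Profile.path, Profile.ordersIT, Coeffs.profile]
    fun_prop
  have lv : (fun ω => S.v ω) = AnticipatoryTrading.form M S ![1, 0, 0, 0, 0, 0] M.p0 := by
    funext ω
    simp [AnticipatoryTrading.form, Fin.sum_univ_six, Shocks.family, Market.mean]
  have hv2 : MemLp S.v 2 P := by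
    rw [show S.v = fun ω => S.v ω from rfl, lv]
    exact hS.memLp_form _ _
  have key : ∀ {E : Type} [MeasurableSpace E] {X : Ω → E} (_ : Measurable X) {p g : Ω → ℝ}
      (_ : p =ᵐ[P] P[g | info X]) (_ : MemLp g 2 P) {G : E → ℝ} (_ : Measurable G) (A B : Vec)
      (d f : Fin 3 → ℝ) (_ : ∀ ω, B.form M S d f ω = G (X ω))
      (_ : ∀ ω, g ω - p ω = A.form M S d f ω), A.dot B M c.σz d f = 0 := by
    intro E _ X hX p g hp hg G hG A B d f hB hA
    have adm := hS.admissible hG hB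
    have hp2 : MemLp p 2 P := by
      have : p = fun ω => g ω - A.form M S d f ω := by funext ω; rw [← hA]; ring
      rw [this]
      exact hg.sub (hS.memLp_form _ _)
    have := integral_sub_mul_of_condExp hX.comap_le hp adm.1 adm.2 hp2 hg
    simp only [hA] at this
    rw [← hS.integral_mul, this]
  obtain ⟨q1, q2, q3⟩ := h
  refine ⟨?_, ?_, ?_, ?_, ?_⟩
  · have := key m1 q1 hv2 measurable_id ⟨1, 0, 0, 0, 0, 0⟩ ⟨0, 1, 0, 0, 0, 0⟩ c.valueResidual
      ![c.α1, 1, 1]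
      (fun ω => by
        simp [Vec.form_apply, flow1, Profile.path, Profile.ordersIT, Coeffs.profile]; ring)
      (fun ω => by
        simp [Vec.form_apply, price1, flow1, Profile.path, Profile.ordersIT, Coeffs.profile,
          Coeffs.valueResidual]; ring)
    simp [Vec.dot, Market.cov, Coeffs.valueResidual] at this
    linarith
  · have hi : MemLp ((c.profile M).path S).i1 2 P := by
      have : ((c.profile M).path S).i1
          = (⟨1, 0, 0, 0, 0, 0⟩ : Vec).form M S ![c.α1, 0, 1] ![0, 0, 0] := by
        funext ω
        simp [Vec.form_apply, Profile.path, Profile.ordersIT, Coeffs.profile]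
      rw [this]
      exact hS.memLp_form _ _
    have := key m1 hδ hi measurable_id ⟨1, 0, 0, 0, 0, 0⟩ ⟨0, 1, 0, 0, 0, 0⟩ c.orderResidual
      ![c.α1, 1, 1]
      (fun ω => by
        simp [Vec.form_apply, flow1, Profile.path, Profile.ordersIT, Coeffs.profile]; ring)
      (fun ω => by
        simp [Vec.form_apply, flow1, Profile.path, Profile.ordersIT, Coeffs.profile,
          Coeffs.orderResidual]; ring)
    simp [Vec.dot, Market.cov, Coeffs.orderResidual] at this
    linarith
  · exact key (m1.prodMk m1p) q2 hv2 measurable_snd _ _ _ _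
      (fun ω => by
        simp [Vec.form_apply, flow1p, Profile.path, Profile.ordersIT, Coeffs.profile,
          Coeffs.orderResidual]; ring)
      (fun ω => by
        simp [Vec.form_apply, price1p, flow1, flow1p, Profile.path, Profile.ordersIT,
          Coeffs.profile, Coeffs.valueResidual, Coeffs.orderResidual]; ring)
  all_goals
    have hR : ∀ ω, S.v ω - price2 S ((c.profile M).path S) (c.profile M) ω
        = (⟨1 - c.l22 * c.α21, -(c.l22 * c.α22) - c.impact, -c.impact, -(c.l21 + c.l22 * c.β22),
            -c.l22, 0⟩ : Vec).form M S c.valueResidual c.orderResidual ω := fun ω => by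
      simp only [Vec.form_apply, price2, flow1, flow1p, flow2, Profile.path, Profile.ordersIT,
        Coeffs.profile, Coeffs.valueResidual, Coeffs.orderResidual, Coeffs.impact,
        Coeffs.direction1, Coeffs.direction2, Matrix.cons_val]
      ring
  · exact key (m1.prodMk (m1p.prodMk m2)) q3 hv2 (measurable_fst.comp measurable_snd) _ _ _ _
      (fun ω => by
        simp [Vec.form_apply, flow1p, Profile.path, Profile.ordersIT, Coeffs.profile,
          Coeffs.orderResidual]; ring) hR
  · exact key (m1.prodMk (m1p.prodMk m2)) q3 hv2 (measurable_snd.comp measurable_snd) _ _ _ _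
      (fun ω => by
        simp only [Vec.form_apply, flow2, Profile.path, Profile.ordersIT, Coeffs.profile,
          Coeffs.valueResidual, Coeffs.orderResidual, Coeffs.direction2, Matrix.cons_val,
          Function.comp_apply]
        ring) hR

set_option linter.unusedVariables false in
/-- The conditions for the second order of the HFT if her inventory aversion is finite. -/
theorem hft2_conditions (hS : S.IsModel M c.σz P) (hγ : M.γ ≠ ∞)
    (h : HFTOptimal2 (c.profile M) S M P) :
    0 < c.l22 + M.γ.toReal ∧ 2 * (c.l22 + M.γ.toReal) * c.β22 = -c.l21 ∧
    2 * (c.l22 + M.γ.toReal) * c.β23 = -(c.l21 + 2 * M.γ.toReal) ∧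
    2 * (c.l22 + M.γ.toReal) * c.β21
        * (M.cov c.σz c.orderResidual c.orderResidual + M.σε ^ 2)
      = (1 - c.l22 * c.α21) * M.cov c.σz c.valueResidual c.orderResidual
        - c.l22 * c.α22 * M.cov c.σz c.orderResidual c.orderResidual := by
  have m1 := measurable_path_flow1 hS
  have ms := measurable_path_signal hS
  have hp := hS.measurable_u1p
  have key : ∀ x φe φu φ₁ : ℝ,
      φe * ((1 - c.l22 * c.α21) * M.cov c.σz c.valueResidual c.orderResidual
        - c.l22 * c.α22 * M.cov c.σz c.orderResidual c.orderResidual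
        - 2 * (c.l22 + M.γ.toReal) * c.β21
          * (M.cov c.σz c.orderResidual c.orderResidual + M.σε ^ 2))
      + φu * (M.σ1p ^ 2 * (-c.l21 - 2 * (c.l22 + M.γ.toReal) * c.β22))
      + φ₁ * (x * (-c.l21 - 2 * M.γ.toReal - 2 * (c.l22 + M.γ.toReal) * c.β23)) = 0 ∧
      (φe ^ 2 * (M.cov c.σz c.orderResidual c.orderResidual + M.σε ^ 2) + φu ^ 2 * M.σ1p ^ 2
          + φ₁ ^ 2 ≠ 0 →
        -(c.l22 + M.γ.toReal) * (φe ^ 2 * (M.cov c.σz c.orderResidual c.orderResidual + M.σε ^ 2)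
          + φu ^ 2 * M.σ1p ^ 2 + φ₁ ^ 2) < 0) := by
    intro x φe φu φ₁
    have ha := h (fun _ => x) ⟨measurable_const, memLp_const x⟩
    have hφ := ha.first_order
      (φ := (⟨0, φe, φe, φu, 0, φ₁⟩ : Vec).form M S c.valueResidual c.orderResidual)
      (Measurable.comap_le (by fun_prop))
      (hS.admissible (g := fun p => φe * (p.1 - c.δ * p.2.1) + φu * (p.2.2 - x) + φ₁)
        (by fun_prop) fun ω => by
          simp [Vec.form_apply, flow1, signal, Profile.path, Profile.ordersIT, Coeffs.profile,
            Coeffs.orderResidual]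
          ring)
      (fun _ h' => absurd h' hγ)
      (fun t => hS.integral_payoff c.valueResidual c.orderResidual
        ⟨1 - c.l22 * c.α21, -(c.l22 * c.α22) - c.l22 * (c.β21 + t * φe),
          -(c.l22 * (c.β21 + t * φe)), -c.l21 - c.l22 * (c.β22 + t * φu), -c.l22,
          -(c.l21 * x) - c.l22 * (c.β23 * x + t * φ₁)⟩
        ⟨0, c.β21 + t * φe, c.β21 + t * φe, c.β22 + t * φu, 0, c.β23 * x + t * φ₁⟩
        ⟨0, 0, 0, 0, 0, 0⟩ ⟨0, 0, 0, 0, 0, 0⟩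
        ⟨0, c.β21 + t * φe, c.β21 + t * φe, c.β22 + t * φu, 0, x + c.β23 * x + t * φ₁⟩
        M.γ.toReal fun ω => by
          simp only [hftProfit2, penalty, price2, flow1, flow1p, flow2, signal,
            Profile.path, Profile.ordersIT, Profile.ordersHFT, Coeffs.profile, Vec.form_apply,
            Coeffs.valueResidual, Coeffs.orderResidual, Matrix.cons_val]
          ring)
      (B := φe * ((1 - c.l22 * c.α21) * M.cov c.σz c.valueResidual c.orderResidual
        - c.l22 * c.α22 * M.cov c.σz c.orderResidual c.orderResidual
        - 2 * (c.l22 + M.γ.toReal) * c.β21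
          * (M.cov c.σz c.orderResidual c.orderResidual + M.σε ^ 2))
      + φu * (M.σ1p ^ 2 * (-c.l21 - 2 * (c.l22 + M.γ.toReal) * c.β22))
      + φ₁ * (x * (-c.l21 - 2 * M.γ.toReal - 2 * (c.l22 + M.γ.toReal) * c.β23)))
      (C := -(c.l22 + M.γ.toReal)
        * (φe ^ 2 * (M.cov c.σz c.orderResidual c.orderResidual + M.σε ^ 2)
          + φu ^ 2 * M.σ1p ^ 2 + φ₁ ^ 2)) (by
        intro t
        simp only [Vec.dot]
        ring)
    refine ⟨hφ.1, fun hne => hφ.2 ?_⟩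
    rw [hS.integral_mul]
    simp only [Vec.dot]
    intro h0
    exact hne (by linarith)
  have hs : M.σ1p ^ 2 ≠ 0 := pow_ne_zero _ M.σ1p_pos.ne'
  have k1 := (key 0 1 0 0).1
  have k2 := (key 0 0 1 0).1
  have k3 := (key 1 0 0 1).1
  have k4 := (key 0 0 0 1).2 (by norm_num)
  simp only [one_mul, zero_mul, mul_zero, add_zero, zero_add, mul_eq_zero, hs, false_or] at k1 k2 k3
  exact ⟨by linarith, by linarith, by linarith, by linarith⟩

set_option linter.unusedVariables false in
/-- The conditions for the second order of the HFT if her inventory aversion is infinite. -/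
theorem hft2_closing (hS : S.IsModel M c.σz P) (hγ : M.γ = ∞)
    (hm : 0 < M.cov c.σz c.orderResidual c.orderResidual + M.σε ^ 2)
    (h : HFTOptimal2 (c.profile M) S M P) : c.β21 = 0 ∧ c.β22 = 0 ∧ c.β23 = -1 := by
  have key : ∀ x : ℝ, c.β21 ^ 2 * (M.cov c.σz c.orderResidual c.orderResidual + M.σε ^ 2)
      + c.β22 ^ 2 * M.σ1p ^ 2 + (x * (1 + c.β23)) ^ 2 = 0 := by
    intro x
    have ha := (h (fun _ => x) ⟨measurable_const, memLp_const x⟩).2.1 hγ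
    have e : ∀ ω, x + ((c.profile M).ordersHFT S fun _ => x).x2 ω
        = (⟨0, c.β21, c.β21, c.β22, 0, x * (1 + c.β23)⟩ : Vec).form M S c.valueResidual
          c.orderResidual ω := fun ω => by
      simp [Vec.form_apply, flow1, signal, Profile.path, Profile.ordersIT, Profile.ordersHFT,
        Coeffs.profile, Coeffs.orderResidual]
      ring
    have h2 := hS.integral_mul ⟨0, c.β21, c.β21, c.β22, 0, x * (1 + c.β23)⟩
      ⟨0, c.β21, c.β21, c.β22, 0, x * (1 + c.β23)⟩ c.valueResidual c.orderResidual
    simp only [← e] at h2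
    rw [integral_congr_ae (g := fun _ => (0 : ℝ)) (by
      filter_upwards [ha] with ω hω
      have hω' : x + ((c.profile M).ordersHFT S fun _ => x).x2 ω = 0 := hω
      rw [hω', mul_zero]), integral_zero] at h2
    simp only [Vec.dot] at h2
    linarith
  have hp : 0 < M.σ1p ^ 2 := pow_pos M.σ1p_pos 2
  have k0 := key 0
  have k1 := key 1
  have a1 := mul_nonneg (sq_nonneg c.β21) hm.le
  have a2 := mul_nonneg (sq_nonneg c.β22) hp.le
  refine ⟨?_, ?_, ?_⟩
  · have : c.β21 ^ 2 * (M.cov c.σz c.orderResidual c.orderResidual + M.σε ^ 2) = 0 := by linarith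
    exact pow_eq_zero_iff two_ne_zero |>.1 ((mul_eq_zero.1 this).resolve_right hm.ne')
  · have : c.β22 ^ 2 * M.σ1p ^ 2 = 0 := by linarith
    exact pow_eq_zero_iff two_ne_zero |>.1 ((mul_eq_zero.1 this).resolve_right hp.ne')
  · have : (1 + c.β23) ^ 2 = 0 := by linarith
    linarith [pow_eq_zero_iff two_ne_zero |>.1 this]

set_option linter.unusedVariables false in
/-- The conditions for the first order of the HFT. -/
theorem hft1_conditions (hS : S.IsModel M c.σz P)
    (hγ : M.γ = ∞ → c.β21 = 0 ∧ c.β22 = 0 ∧ c.β23 = -1)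
    (hm : 0 < M.cov c.σz c.orderResidual c.orderResidual + M.σε ^ 2)
    (h : HFTOptimal1 (c.profile M) S M P) :
    M.cov c.σz c.valueResidual c.orderResidual
      + c.β23 * ((1 - c.l22 * c.α21) * M.cov c.σz c.valueResidual c.orderResidual
        - c.l22 * c.α22 * M.cov c.σz c.orderResidual c.orderResidual)
      = (M.cov c.σz c.orderResidual c.orderResidual + M.σε ^ 2) * (2 * c.l1p * c.direction1
        + (c.l21 + c.l22 * c.β23) * c.direction2 + c.impact * c.β23
        + 2 * M.γ.toReal * (c.direction1 + c.direction2) * (1 + c.β23)) ∧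
    0 < c.l1p + (c.l21 + c.l22 * c.β23) * c.β23 + M.γ.toReal * (1 + c.β23) ^ 2 := by
  have m1 := measurable_path_flow1 hS
  have ms := measurable_path_signal hS
  have hφ := IsArgmax.first_order h
    (φ := (⟨0, 1, 1, 0, 0, 0⟩ : Vec).form M S c.valueResidual c.orderResidual)
    (Measurable.comap_le (by fun_prop))
    (hS.admissible (g := fun p => p.1 - c.δ * p.2) (by fun_prop) fun ω => by
      simp [Vec.form_apply, flow1, signal, Profile.path, Profile.ordersIT, Coeffs.profile,
        Coeffs.orderResidual]
      ring)
    (fun t h' => by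
      obtain ⟨h1, h2, h3⟩ := hγ h'
      refine Filter.Eventually.of_forall fun ω => ?_
      simp [Profile.ordersHFT, Coeffs.profile, h1, h2, h3])
    (fun t => hS.integral_payoff c.valueResidual c.orderResidual
      ⟨1, -(c.l1p * (c.β1 + t)), -(c.l1p * (c.β1 + t)), -c.l1p, 0, 0⟩
      ⟨0, c.β1 + t, c.β1 + t, 0, 0, 0⟩
      ⟨1 - c.l22 * c.α21,
        -(c.l22 * c.α22) - c.l21 * (c.β1 + t) - c.l22 * (c.direction2 + c.β23 * t),
        -(c.l21 * (c.β1 + t)) - c.l22 * (c.direction2 + c.β23 * t), -c.l21 - c.l22 * c.β22,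
        -c.l22, 0⟩
      ⟨0, c.direction2 + c.β23 * t, c.direction2 + c.β23 * t, c.β22, 0, 0⟩
      ⟨0, c.β1 + t + (c.direction2 + c.β23 * t), c.β1 + t + (c.direction2 + c.β23 * t), c.β22,
        0, 0⟩
      M.γ.toReal fun ω => by
        simp only [hftProfit1, hftProfit2, penalty, price1p, price2, flow1, flow1p, flow2, signal,
          Profile.path, Profile.ordersIT, Profile.ordersHFT, Coeffs.profile, Vec.form_apply,
          Coeffs.valueResidual, Coeffs.orderResidual, Coeffs.direction2, Matrix.cons_val]
        ring)
    (B := M.cov c.σz c.valueResidual c.orderResidual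
      + c.β23 * ((1 - c.l22 * c.α21) * M.cov c.σz c.valueResidual c.orderResidual
        - c.l22 * c.α22 * M.cov c.σz c.orderResidual c.orderResidual)
      - (M.cov c.σz c.orderResidual c.orderResidual + M.σε ^ 2) * (2 * c.l1p * c.direction1
        + (c.l21 + c.l22 * c.β23) * c.direction2 + c.impact * c.β23
        + 2 * M.γ.toReal * (c.direction1 + c.direction2) * (1 + c.β23)))
    (C := -(M.cov c.σz c.orderResidual c.orderResidual + M.σε ^ 2)
      * (c.l1p + (c.l21 + c.l22 * c.β23) * c.β23 + M.γ.toReal * (1 + c.β23) ^ 2)) (by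
      intro t
      simp only [Vec.dot, Coeffs.impact, Coeffs.direction1]
      ring)
  have hC := hφ.2 (by
    rw [hS.integral_mul]
    simp only [Vec.dot]
    intro h0
    linarith)
  refine ⟨by linarith [hφ.1], ?_⟩
  by_contra! h'
  have := mul_nonpos_of_nonneg_of_nonpos hm.le h'
  linarith

set_option linter.unusedVariables false in
/-- The conditions for the first order of the informed trader. -/
theorem it1_conditions (hS : S.IsModel M c.σz P) (h22 : 0 < c.l22)
    (h21 : 2 * c.l22 * c.α21 = 1) (h22' : 2 * c.l22 * c.α22 = -c.impact) :
    (ITIndifferent1 (c.profile M) S P →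
      (c.l1 + c.impact * (1 - c.δ)) ^ 2 = 4 * c.l22 * c.l1 ∧
      c.l1 + c.impact * (1 - c.δ) = 2 * c.l22) ∧
    (ITOptimal1 (c.profile M) S P →
      2 * c.l22 * (1 - 2 * c.l1 * c.α1)
        = (c.l1 + c.impact * (1 - c.δ)) * (1 - (c.l1 + c.impact * (1 - c.δ)) * c.α1) ∧
      (c.l1 + c.impact * (1 - c.δ)) ^ 2 < 4 * c.l22 * c.l1) := by
  have hV : 0 < M.σv ^ 2 := pow_pos M.σv_pos 2
  have hadm : ∀ x : ℝ, Admissible (info S.v) P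
      ((⟨x, 0, 0, 0, 0, 0⟩ : Vec).form M S ![1, 0, 0] ![0, 1, 0]) := fun x =>
    hS.admissible (g := fun p => x * (p - M.p0)) (by fun_prop) fun ω => by simp [Vec.form_apply]
  have hα21 : c.α21 = 1 / (2 * c.l22) := by rw [eq_div_iff (by positivity)]; linarith
  have hα22 : c.α22 = -c.impact / (2 * c.l22) := by rw [eq_div_iff (by positivity)]; linarith
  have key : ∀ (x : ℝ), ∫ ω, itTotal (c.profile M) S
      ((⟨x, 0, 0, 0, 0, 0⟩ : Vec).form M S ![1, 0, 0] ![0, 1, 0]) ω ∂P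
      = M.σv ^ 2 * (x - c.l1 * x ^ 2
        + (1 - (c.l1 + c.impact * (1 - c.δ)) * x) ^ 2 / (4 * c.l22))
        + M.σ1 ^ 2 * ((c.l1 - c.impact * c.δ) ^ 2 / (4 * c.l22)) := by
    intro x
    rw [hS.integral_payoff ![1, 0, 0] ![0, 1, 0] ⟨x, 0, 0, 0, 0, 0⟩
      ⟨1 - c.l1 * x, -c.l1, 0, 0, 0, 0⟩
      ⟨1 - c.l1 * x - c.impact * x * (1 - c.δ)
          - c.l22 * (c.α21 * (1 - c.l1 * x) + c.α22 * (x * (1 - c.δ))),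
        -c.l1 + c.impact * c.δ - c.l22 * (-(c.α21 * c.l1 + c.α22 * c.δ)), -c.impact,
        -(c.l21 + c.l22 * c.β22), -c.l22, 0⟩
      ⟨c.α21 * (1 - c.l1 * x) + c.α22 * (x * (1 - c.δ)),
        -(c.α21 * c.l1 + c.α22 * c.δ), 0, 0, 0, 0⟩ ⟨0, 0, 0, 0, 0, 0⟩ 0 fun ω => by
      simp only [itTotal, itProfit1, itProfit2, price1, price2, flow1, flow1p, flow2,
        Profile.ordersIT, Coeffs.profile, Coeffs.impact, Coeffs.direction1, Coeffs.direction2,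
        Vec.form_apply, Matrix.cons_val]
      ring]
    rw [hα21, hα22]
    simp only [Vec.dot, Market.cov, Matrix.cons_val]
    field_simp
    ring
  constructor
  · intro h
    have e : ∀ x y : ℝ, ∫ ω, itTotal (c.profile M) S
        ((⟨x, 0, 0, 0, 0, 0⟩ : Vec).form M S ![1, 0, 0] ![0, 1, 0]) ω ∂P
        = ∫ ω, itTotal (c.profile M) S
          ((⟨y, 0, 0, 0, 0, 0⟩ : Vec).form M S ![1, 0, 0] ![0, 1, 0]) ω ∂P := fun x y => by
      rw [← integral_condExp hS.measurable_v.comap_le,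
        ← integral_condExp hS.measurable_v.comap_le (f := itTotal (c.profile M) S
          ((⟨y, 0, 0, 0, 0, 0⟩ : Vec).form M S ![1, 0, 0] ![0, 1, 0]))]
      exact integral_congr_ae (h _ _ (hadm x) (hadm y))
    have e1 := e 1 0
    have e2 := e (-1) 0
    rw [key, key, add_left_inj, mul_right_inj' hV.ne'] at e1 e2
    field_simp at e1 e2
    exact ⟨by linarith, by linarith⟩
  · intro h
    have ha : (fun ω => (c.profile M).i1 (S.v ω) 0)
        = (⟨c.α1, 0, 0, 0, 0, 0⟩ : Vec).form M S ![1, 0, 0] ![0, 1, 0] := by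
      funext ω
      simp [Vec.form_apply, Coeffs.profile]
    unfold ITOptimal1 at h
    rw [ha] at h
    have hφ := IsArgmax.first_order h hS.measurable_v.comap_le (hadm 1) (fun _ => trivial)
      (I := fun t => M.σv ^ 2 * (c.α1 + t - c.l1 * (c.α1 + t) ^ 2
        + (1 - (c.l1 + c.impact * (1 - c.δ)) * (c.α1 + t)) ^ 2 / (4 * c.l22))
        + M.σ1 ^ 2 * ((c.l1 - c.impact * c.δ) ^ 2 / (4 * c.l22)))
      (fun t => by
        have e : (fun ω => (⟨c.α1, 0, 0, 0, 0, 0⟩ : Vec).form M S ![1, 0, 0] ![0, 1, 0] ω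
            + t * (⟨1, 0, 0, 0, 0, 0⟩ : Vec).form M S ![1, 0, 0] ![0, 1, 0] ω)
            = (⟨c.α1 + t, 0, 0, 0, 0, 0⟩ : Vec).form M S ![1, 0, 0] ![0, 1, 0] := by
          funext ω
          simp [Vec.form_apply]
          ring
        rw [e]
        exact key (c.α1 + t))
      (B := M.σv ^ 2 * (1 - 2 * c.l1 * c.α1 - (c.l1 + c.impact * (1 - c.δ))
        * (1 - (c.l1 + c.impact * (1 - c.δ)) * c.α1) / (2 * c.l22)))
      (C := M.σv ^ 2 * (-c.l1 + (c.l1 + c.impact * (1 - c.δ)) ^ 2 / (4 * c.l22))) (by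
        intro t
        field_simp
        ring)
    have hB := (mul_eq_zero.1 hφ.1).resolve_left hV.ne'
    have hC := hφ.2 (by
      rw [hS.integral_mul]
      simp [Vec.dot, Market.cov]
      exact M.σv_pos.ne')
    have hC' := neg_of_mul_neg_right hC hV.le
    constructor
    · field_simp at hB
      linarith
    · have : (c.l1 + c.impact * (1 - c.δ)) ^ 2 / (4 * c.l22) < c.l1 := by linarith
      rw [div_lt_iff₀ (by positivity)] at this
      linarith

end Conditions

end AnticipatoryTrading

open MeasureTheory ProbabilityTheory
open scoped ENNReal NNReal
namespace AnticipatoryTrading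

section Reduction

variable {Ω : Type*} [MeasurableSpace Ω] {P : Measure Ω} [IsProbabilityMeasure P] {M : Market}
  {S : Shocks Ω} {c : Coeffs}

/-- The moments of the residuals, and the optimality of the first informed order. -/
theorem Coeffs.IsLinearEquilibrium.moments (h : c.IsLinearEquilibrium M S P) :
    0 < c.l1 ∧ 0 < c.δ ∧ c.δ < 1 ∧
    M.cov c.σz c.valueResidual c.valueResidual = M.σv ^ 2 - c.l1 ^ 2 * M.σ1 ^ 2 / (1 - c.δ) ∧
    M.cov c.σz c.valueResidual c.orderResidual = c.l1 * M.σ1 ^ 2 ∧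
    M.cov c.σz c.orderResidual c.orderResidual = c.δ * M.σ1 ^ 2 ∧
    ((c.impact * (1 - c.δ) = c.l1 ∧ c.l22 = c.l1 ∧
        c.l1 ^ 2 * M.σ1 ^ 2 ≤ c.δ * (1 - c.δ) * M.σv ^ 2) ∨
      (c.l1 ^ 2 * M.σ1 ^ 2 = c.δ * (1 - c.δ) * M.σv ^ 2 ∧
        2 * c.l22 * (1 - 2 * c.δ) * c.l1 = (c.l1 + c.impact * (1 - c.δ))
          * (c.l1 - c.δ * (c.l1 + c.impact * (1 - c.δ))) ∧
        (c.l1 + c.impact * (1 - c.δ)) ^ 2 < 4 * c.l22 * c.l1)) := by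
  have hS := h.model
  have core : IsEquilibriumCore (c.profile M) S M P := by
    rcases h.equilibrium with h' | h'
    · exact h'.2.1
    · exact h'.2.1
  obtain ⟨q1, q2, -⟩ := quote_conditions hS h.slope core.quotes
  obtain ⟨i1, i2, i3⟩ := it2_conditions hS core.it2
  obtain ⟨t1, t2⟩ := it1_conditions hS i1 i2 i3
  have hl1 : 0 < c.l1 := by
    refine pos_of_mul_pos_right (a := 4 * c.l22) ?_ (by linarith)
    rcases h.equilibrium with h' | h'
    · obtain ⟨a, b⟩ := t1 h'.2.2
      rw [← a, b]
      positivity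
    · exact (sq_nonneg _).trans_lt (t2 h'.2.2).2
  have hV : 0 < M.σv ^ 2 := pow_pos M.σv_pos 2
  have hs : 0 < M.σ1 ^ 2 := pow_pos M.σ1_pos 2
  have hZ : 0 ≤ c.σz ^ 2 := sq_nonneg _
  have hA : 0 ≤ c.α1 ^ 2 * M.σv ^ 2 + c.σz ^ 2 := by positivity
  have e1 : (1 - c.δ) * (c.α1 ^ 2 * M.σv ^ 2 + c.σz ^ 2 + M.σ1 ^ 2) = M.σ1 ^ 2 := by linarith
  have hδ1 : 0 < 1 - c.δ := by
    refine pos_of_mul_pos_left (b := c.α1 ^ 2 * M.σv ^ 2 + c.σz ^ 2 + M.σ1 ^ 2) ?_ (by linarith)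
    rw [e1]; exact hs
  have e2 : (1 - c.δ) * (c.α1 * M.σv ^ 2) = c.l1 * M.σ1 ^ 2 := by
    linear_combination (1 - c.δ) * q1 + c.l1 * e1
  have hα : 0 < c.α1 := by
    have : 0 < c.α1 * ((1 - c.δ) * M.σv ^ 2) := by
      have : 0 < c.l1 * M.σ1 ^ 2 := by positivity
      linarith
    exact pos_of_mul_pos_left this (by positivity)
  have hδ : 0 < c.δ := by
    have : 0 < c.δ * M.σ1 ^ 2 := by rw [← q2]; positivity
    exact pos_of_mul_pos_left this hs.le
  have hL : c.l1 ^ 2 * M.σ1 ^ 2 = (1 - c.δ) * (1 - c.δ) * (c.α1 ^ 2 * M.σv ^ 2) * M.σv ^ 2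
      / M.σ1 ^ 2 := by
    rw [eq_div_iff hs.ne']
    linear_combination (-(c.l1 * M.σ1 ^ 2 + (1 - c.δ) * (c.α1 * M.σv ^ 2))) * e2
  refine ⟨hl1, hδ, by linarith, ?_, ?_, ?_, ?_⟩
  · have : c.l1 ^ 2 * M.σ1 ^ 2 / (1 - c.δ) = c.l1 * (c.α1 * M.σv ^ 2) := by
      rw [div_eq_iff hδ1.ne']
      linear_combination (-c.l1) * e2
    rw [this]
    simp only [Market.cov, Coeffs.valueResidual, Matrix.cons_val]
    linear_combination (-c.l1) * q1
  · simp only [Market.cov, Coeffs.valueResidual, Coeffs.orderResidual, Matrix.cons_val]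
    linear_combination (1 - c.δ) * q1
  · simp only [Market.cov, Coeffs.orderResidual, Matrix.cons_val]
    linear_combination (1 - c.δ) * q2
  · rcases h.equilibrium with h' | h'
    · obtain ⟨a, b⟩ := t1 h'.2.2
      have : c.l22 = c.l1 := by
        rw [b] at a
        have : c.l22 * (c.l22 - c.l1) = 0 := by linarith
        linarith [(mul_eq_zero.1 this).resolve_left i1.ne']
      refine Or.inl ⟨by linarith, this, ?_⟩
      rw [hL, div_le_iff₀ hs]
      have : (1 - c.δ) * (c.α1 ^ 2 * M.σv ^ 2) ≤ c.δ * M.σ1 ^ 2 := by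
        rw [← q2]
        exact mul_le_mul_of_nonneg_left (by linarith) hδ1.le
      have := mul_le_mul_of_nonneg_left this (show 0 ≤ (1 - c.δ) * M.σv ^ 2 by positivity)
      linarith
    · obtain ⟨a, b⟩ := t2 h'.2.2
      rw [h'.1] at q2
      have e3 : c.l1 ^ 2 * M.σ1 ^ 2 = c.δ * (1 - c.δ) * M.σv ^ 2 := by
        rw [hL, div_eq_iff hs.ne']
        linear_combination ((1 - c.δ) * M.σv ^ 2) * q2
      have e4 : c.l1 * c.α1 = c.δ := by
        have : (c.l1 * c.α1 - c.δ) * ((1 - c.δ) * M.σv ^ 2) = 0 := by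
          linear_combination c.l1 * e2 + e3
        linarith [(mul_eq_zero.1 this).resolve_right (by positivity)]
      refine Or.inr ⟨e3, ?_, b⟩
      rw [show 2 * c.l1 * c.α1 = 2 * (c.l1 * c.α1) by ring, e4] at a
      linear_combination c.l1 * a - (c.l1 + c.impact * (1 - c.δ)) ^ 2 * e4

theorem Coeffs.IsLinearEquilibrium.normEq (h : c.IsLinearEquilibrium M S P) (hγ : M.γ ≠ ∞) :
    NormEq M.θε M.θ1p M.θ2 c.δ (c.l22 / c.l1) (c.impact / c.l1) c.direction1 c.direction2
      (c.l1p / c.l1) (c.l21 / c.l1) (M.γ.toReal / c.l1) (c.l1 ^ 2 * M.σ1 ^ 2 / M.σv ^ 2) := by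
  have hS := h.model
  have core : IsEquilibriumCore (c.profile M) S M P := by
    rcases h.equilibrium with h' | h'
    · exact h'.2.1
    · exact h'.2.1
  obtain ⟨hl, hδ, hδ1, mD, mDf, mf, hIT⟩ := h.moments
  obtain ⟨-, -, q3, q4, q5⟩ := quote_conditions hS h.slope core.quotes
  obtain ⟨i1, i2, i3⟩ := it2_conditions hS core.it2
  obtain ⟨f1, f2, f3, f4⟩ := hft2_conditions hS hγ core.hft2
  have hV : 0 < M.σv ^ 2 := pow_pos M.σv_pos 2
  have hs : 0 < M.σ1 ^ 2 := pow_pos M.σ1_pos 2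
  have hp : 0 < M.σ1p ^ 2 := pow_pos M.σ1p_pos 2
  have hε : 0 ≤ M.σε ^ 2 := sq_nonneg _
  have hm : 0 < M.cov c.σz c.orderResidual c.orderResidual + M.σε ^ 2 := by rw [mf]; positivity
  obtain ⟨o1, o2⟩ := hft1_conditions hS (fun h' => absurd h' hγ) hm core.hft1
  simp only [Vec.dot] at q3 q4 q5
  rw [mDf, mf] at q3 q4 q5 o1 f4
  rw [mD] at q5
  have eε : M.σε ^ 2 = M.θε * M.σ1 ^ 2 := by rw [Market.θε, div_mul_cancel₀ _ hs.ne']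
  have ep : M.σ1p ^ 2 = M.θ1p * M.σ1 ^ 2 := by rw [Market.θ1p, div_mul_cancel₀ _ hs.ne']
  have e2 : M.σ2 ^ 2 = M.θ2 * M.σ1 ^ 2 := by rw [Market.θ2, div_mul_cancel₀ _ hs.ne']
  have hθp : 0 < M.θ1p := div_pos hp hs
  have ed2 : c.direction2 = c.β21 + c.β23 * c.direction1 := rfl
  have ed1 : c.β1 = c.direction1 := rfl
  have hK : c.impact = c.l21 * c.direction1 + c.l22 * c.direction2 := rfl
  have hγ0 : 0 ≤ M.γ.toReal := ENNReal.toReal_nonneg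
  rw [eε] at q3 q4 q5 o1 f4
  rw [ep] at q3 q4 q5
  rw [e2] at q5
  rw [ed1] at q3 q4
  have hls : c.l1 * M.σ1 ^ 2 ≠ 0 := by positivity
  generalize M.γ.toReal = γ at *
  generalize M.θε = θ at *
  generalize M.θ1p = θp at *
  generalize M.θ2 = θ₂ at *
  generalize c.direction1 = d₁ at *
  generalize c.direction2 = d₂ at *
  generalize c.impact = κ at *
  have hδ1' : 0 < 1 - c.δ := by linarith
  have E3 : d₁ * c.l1 = c.l1p * (d₁ ^ 2 * (c.δ + θ) + θp) := by
    refine mul_right_cancel₀ hs.ne' ?_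
    linear_combination q3
  have E4 : d₁ * (c.l1 - κ * (c.δ + 2 * θ)) = 2 * (c.l21 + c.l22 * c.β22) * θp := by
    refine mul_right_cancel₀ hs.ne' ?_
    linear_combination 2 * q4 + d₁ * c.l1 * M.σ1 ^ 2 * i2 + d₁ * c.δ * M.σ1 ^ 2 * i3
  have E4' : d₁ * (c.l1 - κ * (c.δ + 2 * θ)) * (c.l22 + γ) = c.l21 * (c.l22 + 2 * γ) * θp := by
    linear_combination (c.l22 + γ) * E4 + c.l22 * θp * f2
  have F4 : 4 * (c.l22 + γ) * c.β21 * (c.δ + θ) = c.l1 + κ * c.δ := by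
    refine mul_right_cancel₀ hs.ne' ?_
    linear_combination 2 * f4 - c.l1 * M.σ1 ^ 2 * i2 - c.δ * M.σ1 ^ 2 * i3
  have F : 2 * (c.δ + θ) * (2 * (c.l22 + γ) * d₂ + (c.l21 + 2 * γ) * d₁) = c.l1 + κ * c.δ := by
    rw [ed2]
    linear_combination F4 + 2 * (c.δ + θ) * d₁ * f3
  have O1 : (c.δ + θ) * (2 * (c.l1p + γ) * d₁ + (c.l21 + 2 * γ) * d₂) = c.l1 := by
    refine mul_right_cancel₀ hs.ne' ?_
    linear_combination (-1) * o1 - c.β23 * M.σ1 ^ 2 / 2 * F - c.β23 * M.σ1 ^ 2 * (c.δ + θ) * hK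
      + c.β23 * c.l1 * M.σ1 ^ 2 / 2 * i2 * (-1) - c.β23 * c.δ * M.σ1 ^ 2 / 2 * i3
  have O2 : (c.l21 + 2 * γ) ^ 2 < 4 * (c.l1p + γ) * (c.l22 + γ) := by
    have := mul_pos (show 0 < 4 * (c.l22 + γ) by linarith) o2
    have e : 4 * (c.l22 + γ) * (c.l1p + (c.l21 + c.l22 * c.β23) * c.β23 + γ * (1 + c.β23) ^ 2)
        = 4 * (c.l1p + γ) * (c.l22 + γ) - (c.l21 + 2 * γ) ^ 2 := by
      linear_combination (2 * (c.l22 + γ) * c.β23 + c.l21 + 2 * γ) * f3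
    linarith
  have Q5 : M.σv ^ 2 = c.l1 ^ 2 * M.σ1 ^ 2 / (1 - c.δ) + κ ^ 2 * (c.δ + 4 * θ) * M.σ1 ^ 2
      + d₁ ^ 2 / θp * (c.l1 - κ * (c.δ + 2 * θ)) ^ 2 * M.σ1 ^ 2
      + 4 * c.l22 ^ 2 * θ₂ * M.σ1 ^ 2 := by
    have E4'' : c.l22 * c.β22 = d₁ * (c.l1 - κ * (c.δ + 2 * θ)) / (2 * θp) - c.l21 := by
      field_simp
      linear_combination (-1) * E4
    have e1 : c.l22 * c.α21 = 1 / 2 := by linarith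
    have e3 : c.l22 * c.α22 = -κ / 2 := by linarith
    generalize c.l1 ^ 2 * M.σ1 ^ 2 / (1 - c.δ) = w at *
    have q := congrArg (fun x => c.l22 * x) q5
    simp only [mul_zero] at q
    have q' : (1 - c.l22 * c.α21) * (c.l22 * c.α21) * (M.σv ^ 2 - w)
        + ((1 - c.l22 * c.α21) * (c.l22 * c.α22 + c.l22 * d₂)
          + (-(c.l22 * c.α22) - κ) * (c.l22 * c.α21)) * (c.l1 * M.σ1 ^ 2)
        + (-(c.l22 * c.α22) - κ) * (c.l22 * c.α22 + c.l22 * d₂) * (c.δ * M.σ1 ^ 2)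
        - κ * (c.l22 * d₂) * (θ * M.σ1 ^ 2)
        - (c.l21 + c.l22 * c.β22) * (c.l22 * c.β22) * (θp * M.σ1 ^ 2)
        - c.l22 ^ 2 * (θ₂ * M.σ1 ^ 2) = 0 := by
      linear_combination q
    rw [e1, e3, E4'', show c.l22 * d₂ = κ - c.l21 * d₁ by linarith] at q'
    field_simp at q' ⊢
    linear_combination q'
  refine ⟨hδ, hδ1, by positivity, by positivity, by positivity, ?_, ?_, ?_, ?_, ?_, ?_, ?_, ?_⟩
  · field_simp
    linear_combination (-1) * E3
  · field_simp
    linear_combination E4'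
  · field_simp
    linear_combination (-1) * hK
  · field_simp
    linear_combination O1
  · field_simp
    linear_combination F
  · have : 4 * (c.l1p / c.l1 + γ / c.l1) * (c.l22 / c.l1 + γ / c.l1)
        - (c.l21 / c.l1 + 2 * (γ / c.l1)) ^ 2
        = (4 * (c.l1p + γ) * (c.l22 + γ) - (c.l21 + 2 * γ) ^ 2) / c.l1 ^ 2 := by
      field_simp
    have h2 : 0 < (4 * (c.l1p + γ) * (c.l22 + γ) - (c.l21 + 2 * γ) ^ 2) / c.l1 ^ 2 :=
      div_pos (by linarith) (by positivity)
    linarith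
  · rw [one_div_div, div_eq_iff (by positivity)]
    rw [Q5]
    field_simp
  · rcases hIT with ⟨a, b, c'⟩ | ⟨a, b, c'⟩
    · refine Or.inl ⟨?_, ?_, ?_⟩
      · field_simp; linarith
      · rw [b, div_self hl.ne']
      · rw [div_le_iff₀ hV]; linarith
    · refine Or.inr ⟨?_, ?_, ?_⟩
      · rw [div_eq_iff hV.ne']; linarith
      · field_simp
        linear_combination b
      · have e : (1 + κ / c.l1 * (1 - c.δ)) ^ 2 = (c.l1 + κ * (1 - c.δ)) ^ 2 / c.l1 ^ 2 := by
          field_simp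
        rw [e, div_lt_iff₀ (by positivity)]
        have : 4 * (c.l22 / c.l1) * c.l1 ^ 2 = 4 * c.l22 * c.l1 := by field_simp
        rw [this]
        exact c'

theorem Coeffs.IsLinearEquilibrium.isRoundTripper (h : c.IsLinearEquilibrium M S P)
    (hγ : M.γ = ∞) : c.IsRoundTripper := by
  have hS := h.model
  have core : IsEquilibriumCore (c.profile M) S M P := by
    rcases h.equilibrium with h' | h'
    · exact h'.2.1
    · exact h'.2.1
  obtain ⟨hl, hδ, hδ1, mD, mDf, mf, hIT⟩ := h.moments
  obtain ⟨-, -, q3, -, -⟩ := quote_conditions hS h.slope core.quotes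
  obtain ⟨i1, i2, i3⟩ := it2_conditions hS core.it2
  have hs : 0 < M.σ1 ^ 2 := pow_pos M.σ1_pos 2
  have hp : 0 < M.σ1p ^ 2 := pow_pos M.σ1p_pos 2
  have hε : 0 ≤ M.σε ^ 2 := sq_nonneg _
  have hm : 0 < M.cov c.σz c.orderResidual c.orderResidual + M.σε ^ 2 := by rw [mf]; positivity
  have f := hft2_closing hS hγ hm core.hft2
  obtain ⟨o1, o2⟩ := hft1_conditions hS (fun _ => f) hm core.hft1
  obtain ⟨f1, f2, f3⟩ := f
  have ed2 : c.direction2 = -c.direction1 := by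
    simp [Coeffs.direction1, Coeffs.direction2, f1, f3]
  have hγ0 : M.γ.toReal = 0 := by rw [hγ, ENNReal.toReal_top]
  have hK : c.impact = c.l21 * c.direction1 + c.l22 * c.direction2 := rfl
  have ed1 : c.β1 = c.direction1 := rfl
  simp only [Vec.dot] at q3
  rw [mDf, mf] at q3 o1
  have eε : M.σε ^ 2 = M.θε * M.σ1 ^ 2 := by rw [Market.θε, div_mul_cancel₀ _ hs.ne']
  have ep : M.σ1p ^ 2 = M.θ1p * M.σ1 ^ 2 := by rw [Market.θ1p, div_mul_cancel₀ _ hs.ne']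
  rw [eε] at q3 o1
  rw [ep, ed1] at q3
  rw [hγ0, f3] at o1 o2
  rw [ed2] at o1 hK
  have hd : 0 < c.direction1 := by
    refine pos_of_closing (θ := M.θε) (θp := M.θ1p) (δ := c.δ) (r := c.l22 / c.l1)
      (K := c.impact / c.l1) (l₁ := c.l1p / c.l1) (l₂ := c.l21 / c.l1) (div_nonneg hε hs.le)
      (div_pos hp hs) hδ ?_ ?_ ?_ ?_
    · field_simp
      refine mul_right_cancel₀ hs.ne' ?_
      linear_combination (-1) * q3
    · field_simp
      linear_combination (-1) * hK
    · field_simp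
      refine mul_right_cancel₀ hs.ne' ?_
      linear_combination (-2) * o1 + c.l1 * M.σ1 ^ 2 * i2 + c.δ * M.σ1 ^ 2 * i3
        + 2 * M.σ1 ^ 2 * (c.δ + M.θε) * hK
    · rw [← add_div, ← sub_div]
      exact div_pos (by linarith) hl
  exact ⟨hd, by rw [ed2]; linarith⟩

end Reduction

end AnticipatoryTrading

open MeasureTheory ProbabilityTheory
open scoped ENNReal NNReal

namespace AnticipatoryTrading

/-- The comparison of a state with a critical one. -/
theorem RState.threshold {θ θ₂ Ξ δ₀ u₀ x₀ C₀ δ u x η C : ℝ} (hθ : 0 ≤ θ) (hθ₂ : 0 < θ₂)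
    (h₀ : RState θ θ₂ δ₀ u₀ x₀ 1 C₀) (hs₀ : invSize θ δ₀ u₀ x₀ 1 * (2 * (2 - C₀) / (C₀ - 1)) ^ 2 = Ξ)
    (h : RState θ θ₂ δ u x η C) (hs : invSize θ δ u x η * (2 * (2 - C) / (C - 1)) ^ 2 = Ξ) :
    (invAversion θ θ₂ δ₀ u₀ x₀ 1 < invAversion θ θ₂ δ u x η → η < 1) ∧
    (invAversion θ θ₂ δ u x η = invAversion θ θ₂ δ₀ u₀ x₀ 1 → 1 ≤ η) ∧
    (invAversion θ θ₂ δ u x η < invAversion θ θ₂ δ₀ u₀ x₀ 1 → 1 < η) := by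
  have e : invSize θ δ u x η * ((2 - C) / (C - 1)) ^ 2
      = invSize θ δ₀ u₀ x₀ 1 * ((2 - C₀) / (C₀ - 1)) ^ 2 := by
    rw [← hs₀, mul_div_assoc, mul_div_assoc] at hs
    linarith
  refine ⟨fun h' => ?_, fun h' => ?_, fun h' => ?_⟩
  · by_contra! hη
    exact (h₀.invAversion_mono hθ hθ₂ h le_rfl hη (Or.inr rfl) e).1.not_gt h'
  · by_contra! hη
    exact ((h.invAversion_mono hθ hθ₂ h₀ hη.le le_rfl (Or.inl rfl) e.symm).2 hη).ne' h'
  · by_contra! hη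
    exact (h.invAversion_mono hθ hθ₂ h₀ hη le_rfl (Or.inl rfl) e.symm).1.not_gt h'

theorem RState.invAversion_pos {θ θ₂ δ u x η C : ℝ} (hθ : 0 ≤ θ) (hθ₂ : 0 < θ₂)
    (h : RState θ θ₂ δ u x η C) : 0 < invAversion θ θ₂ δ u x η := by
  have h1 := h.δ_pos
  have h2 : 0 < 1 - δ := by linarith [h.δ_lt]
  have h3 : 0 < 1 - u := by linarith [h.u_lt]
  have h4 := h.cell.x_pos
  have h5 := h.cell.η_pos
  unfold invAversion
  positivity

theorem Market.Γ_toReal (M : Market) : M.Γ.toReal = M.γ.toReal * (M.σ1 / M.σv) := by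
  rw [Market.Γ, ENNReal.toReal_div, ENNReal.toReal_ofReal (div_pos M.σv_pos M.σ1_pos).le]
  have h1 := M.σv_pos.ne'
  have h2 := M.σ1_pos.ne'
  field_simp

theorem Market.Γ_ne_top {M : Market} (h : M.γ ≠ ∞) : M.Γ ≠ ∞ :=
  ENNReal.div_ne_top h (by simpa using div_pos M.σv_pos M.σ1_pos)

theorem Market.Γ_eq_top {M : Market} (h : M.γ = ∞) : M.Γ = ∞ := by
  rw [Market.Γ, h, ENNReal.top_div_of_ne_top ENNReal.ofReal_ne_top]

end AnticipatoryTrading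


theorem mainTheorem1 (θ1p θ2 θε : ℝ) (h1p : 0 < θ1p) (h2 : 0 < θ2) (hε : 0 ≤ θε) :
    ∃ Γbar : ℝ≥0∞, 0 < Γbar ∧ Γbar < ∞ ∧
      ∀ M : AnticipatoryTrading.Market, M.θ1p = θ1p → M.θ2 = θ2 → M.θε = θε →
      ∀ (Ω : Type*) [MeasurableSpace Ω] (P : Measure Ω) [IsProbabilityMeasure P]
        (S : AnticipatoryTrading.Shocks Ω) (c : AnticipatoryTrading.Coeffs),
        c.IsLinearEquilibrium M S P →
          (M.Γ < Γbar → c.IsSmallIT) ∧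
          (M.Γ = Γbar → 0 < c.direction1 ∧ c.direction2 ≤ 0) ∧
          (Γbar < M.Γ → c.IsRoundTripper) := by

  open AnticipatoryTrading in
  obtain ⟨δ₀, u₀, x₀, C₀, h₀, hs₀⟩ := exists_critical hε h2 (one_div_pos.2 h1p)
  have hΦ := h₀.invAversion_pos hε h2
  set Φ := invAversion θε θ2 δ₀ u₀ x₀ 1
  have hB : 0 < √(1 / (16 * θ1p * Φ)) := by positivity
  refine ⟨ENNReal.ofReal √(1 / (16 * θ1p * Φ)), ENNReal.ofReal_pos.2 hB, ENNReal.ofReal_lt_top, ?_⟩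
  intro M hM1 hM2 hM3 Ω _ P _ S c h
  by_cases hγ : M.γ = ∞
  · have hΓ := AnticipatoryTrading.Market.Γ_eq_top hγ
    rw [hΓ]
    exact ⟨fun h' => absurd h' not_top_lt, fun h' => absurd h'.symm ENNReal.ofReal_ne_top,
      fun _ => h.isRoundTripper hγ⟩
  have hΓ := AnticipatoryTrading.Market.Γ_ne_top hγ
  have hN := h.normEq hγ
  obtain ⟨hl, -⟩ := h.moments
  rw [hM1, hM2, hM3] at hN
  have hd := hN.d₁_pos hε h1p
  have hsq : √(1 / (16 * θ1p * Φ)) ^ 2 = 1 / (16 * θ1p * Φ) := Real.sq_sqrt (by positivity)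
  rw [← ENNReal.ofReal_toReal hΓ]
  have hΓ0 : 0 ≤ M.Γ.toReal := ENNReal.toReal_nonneg
  rw [ENNReal.ofReal_lt_ofReal_iff hB, ENNReal.ofReal_lt_ofReal_iff_of_nonneg hB.le,
    ENNReal.ofReal_eq_ofReal_iff hΓ0 hB.le]
  rcases (ENNReal.toReal_nonneg (a := M.γ)).eq_or_lt with hg | hg
  · rw [← hg, zero_div] at hN
    have hd2 := hN.small_of_g_eq_zero hε h1p
    have : M.Γ.toReal = 0 := by rw [M.Γ_toReal, ← hg, zero_mul]
    rw [this]
    exact ⟨fun _ => ⟨hd, hd2⟩, fun h' => absurd h' hB.ne, fun h' => absurd h' hB.not_gt⟩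
  obtain ⟨u, x, η, C, hR, hs, ha, i1, i2⟩ := hN.exists_state hε h1p (div_pos hg hl)
  have hΓ1 : 0 < M.Γ.toReal := by
    rw [M.Γ_toReal]
    exact mul_pos hg (div_pos M.σ1_pos M.σv_pos)
  have ha' : AnticipatoryTrading.invAversion θε θ2 c.δ u x η
      = 1 / (16 * θ1p * M.Γ.toReal ^ 2) := by
    rw [ha, M.Γ_toReal]
    have := M.σv_pos.ne'
    congr 2
    field_simp
  obtain ⟨t1, t2, t3⟩ := h₀.threshold hε h2 hs₀ hR hs
  have hΦe : Φ = 1 / (16 * θ1p * √(1 / (16 * θ1p * Φ)) ^ 2) := by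
    rw [hsq]
    field_simp
  refine ⟨fun h' => ⟨hd, i1.1 (t1 ?_)⟩, fun h' => ⟨hd, ?_⟩, fun h' => ⟨hd, i2.1 (t3 ?_)⟩⟩
  · rw [ha']
    refine hΦe.trans_lt (one_div_lt_one_div_of_lt (by positivity) ?_)
    exact mul_lt_mul_of_pos_left (pow_lt_pow_left₀ h' hΓ0 two_ne_zero) (by positivity)
  · have := t2 (by rw [ha', h']; exact hΦe.symm)
    by_contra! hd2
    exact (i1.2 hd2).not_ge this
  · rw [ha']
    refine lt_of_lt_of_eq (one_div_lt_one_div_of_lt (by positivity) ?_) hΦe.symm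
    exact mul_lt_mul_of_pos_left (pow_lt_pow_left₀ h' hB.le two_ne_zero) (by positivity)
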